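/- **Signatures and string graphs.** A *(strict) monoidal signature* $T$ consists of a set $O$ of object symbols, a set $M$ of morphism symbols, and words $\mathrm{dom}(f),\mathrm{cod}(f)\in O^*$ for every $f\in M$. Its *derived typegraph* $G_T$ is the directed multigraph with vertex set $O\sqcup M$, with a self-loop at every $A\in O$, and, for every $f\in M$, one edge from the $i$-th letter of $\mathrm{dom}(f)$ to $f$ for each position $i$ and one edge from $f$ to the $j$-th letter of $\mathrm{cod}(f)$ for each position $j$. A *string graph* is a finite directed multigraph $G$ with a graph homomorphism $\tau: G\to G_T$ such that (i) at every *box-vertex* (a vertex sent to $M$), $\tau$ is a bijection from the adjacent edges to the edges adjacent to the type of that vertex, and (ii) every *wire-vertex* (a vertex sent to $O$) has at most one in-edge and at most one out-edge. A wire-vertex is an *input* if it has no in-edge and an *output* if it has no out-edge; the inputs and outputs form the *boundary* of $G$. **Framed cospans.** A *framed point graph* $X$ is a finite set of vertices, each typed by an element of $O$ and carrying a sign $+$ or $-$, together with a total order on it. A *framed cospan* $X\xrightarrow{d}G\xleftarrow{c}Y$ consists of a string graph $G$ without isolated wire-vertices and type-preserving maps $d,c$ such that $[d,c]$ is a bijection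 from $X\sqcup Y$ onto the boundary of $G$, $d(x)$ is an input iff $x$ is positive, and $c(y)$ is an output iff $y$ is positive. *Wire-homeomorphism* is the equivalence relation on framed cospans from $X$ to $Y$ that is generated by isomorphisms of framed cospans and by contraction of a single edge between two distinct wire-vertices (merging these two vertices, whenever the result is again a framed cospan). **The category.** $\mathrm{FCsp}(\mathbb H,T)$ has the framed point graphs as objects and the framed cospans modulo wire-homeomorphism as morphisms. Composition is by pushout over the common framed point graph; identities are the cospans that consist of one edge for each vertex of $X$, running from $x\in X$ on the left to $x\in X$ on the right if $x$ is positive and backwards if $x$ is negative. The tensor product is disjoint union, where the vertices of the second framed point graph are placed after those of the first; the unit $I$ is the empty framed point graph. More generally, every bijection $X\to Y$ that preserves types and signs gives a framed cospan of single edges (a *permutation*); the associators, unitors and symmetries are the classes of the evident permutations. A *reframing* is a permutation given by an order-preserving bijection. $X^*$ is $X$ with all signs reversed, and $\cup_X: X\otimes X^*\to I$ and $\cap_X: I\to X^*\otimes X$ are the classes of the cospans that consist of one edge for each $x\in X$, joining the two copies of $x$. **Valuations.** A *valuation* of $T$ in a monoidal category $\mathcal V$ assigns an object of $\mathcal V$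 to every element of $O$ and a morphism of $\mathcal V$ to every $f\in M$, from the tensor product of the objects assigned to $\mathrm{dom}(f)$ to that of the objects assigned to $\mathrm{cod}(f)$. The generators are the valuation of $T$ in $\mathrm{FCsp}(\mathbb H,T)$ that sends $A\in O$ to the single positive vertex of type $A$ and $f\in M$ to the class of the string graph with a single box-vertex, of type $f$, and one wire-vertex for each of its inputs and outputs. A compact closed category is a symmetric monoidal category with a dual $A^*$ and a compact structure $A\otimes A^*\to I$, $I\to A^*\otimes A$ (satisfying the two triangle identities) for every object $A$. **Corollary ($\mathrm{FCsp}(\mathbb H,T)$ is the free compact closed category).** Let $T$ be a monoidal signature. Composition and tensor product of framed cospans are well defined modulo wire-homeomorphism and make $\mathrm{FCsp}(\mathbb H,T)$ a symmetric monoidal category. It is compact closed: for every $X$, $(X^*,\cup_X,\cap_X)$ satisfies the triangle identities. It is the free compact closed category on $T$: 1. For every compact closed category $\mathcal V$ and every valuation $x$ of $T$ in $\mathcal V$, there is a symmetric strong monoidal functor $F:\mathrm{FCsp}(\mathbb H,T)\to\mathcal V$ whose restriction to the generators is isomorphic to $x$, as a valuation. If $(F,\varphi)$ and $(G,\psi)$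 are two such functors with chosen isomorphisms of valuations, then there is a unique monoidal natural isomorphism $\theta: F\cong G$ with $\psi\circ\theta=\varphi$ on the generating objects. 2. For every compact closed category $\mathcal V$ that is strict as a monoidal category, with a chosen dual and compact structure for every object, and every valuation $x$ of $T$ in $\mathcal V$, there is a unique strict symmetric monoidal functor $F:\mathrm{FCsp}(\mathbb H,T)\to\mathcal V$ that sends reframings to identities, restricts to $x$ on the generators (on the nose), and sends the dual and the compact structure of every generating object to the chosen ones. (A strict symmetric monoidal functor here preserves $\otimes$, $I$ and the symmetries on the nose.) -/

import Mathlib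

open CategoryTheory MonoidalCategory

universe u v w₁ w₂ a b c d

/-! ## Monoidal signatures, typed graphs, string graphs -/

/-- A (strict) monoidal signature: object symbols, morphism symbols, and for each morphism symbol
the word of its inputs and the word of its outputs. -/
structure MonoidalSignature where
  O : Type u
  M : Type v
  dom : M → List O
  cod : M → List O

/-- Directed multigraphs. -/
structure DirGraph where
  V : Type a
  E : Type b
  src : E → V
  tgt : E → V

namespace DirGraph

/-- Graph homomorphisms. -/
structure Hom (G : DirGraph.{a, b}) (H : DirGraph.{c, d}) where
  onV : G.V → H.V
  onE : G.E → H.E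
  src_comm : ∀ e, onV (G.src e) = H.src (onE e)
  tgt_comm : ∀ e, onV (G.tgt e) = H.tgt (onE e)

/-- The edge neighbourhood of a vertex. -/
def nbhd (G : DirGraph.{a, b}) (x : G.V) : Set G.E := {e | G.src e = x ∨ G.tgt e = x}

end DirGraph

namespace MonoidalSignature

/-- The edges of the derived typegraph. -/
inductive TypeEdge (T : MonoidalSignature.{u, v}) : Type (max u v)
  | mid (X : T.O)
  | inp (f : T.M) (i : Fin (T.dom f).length)
  | out (f : T.M) (j : Fin (T.cod f).length)

/-- The derived typegraph of a signature: its vertices are the object and morphism symbols, with a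
self-loop on every object symbol, an edge from the `i`-th input object to `f`, and an edge from `f`
to the `j`-th output object. -/
def typegraph (T : MonoidalSignature.{u, v}) : DirGraph.{max u v, max u v} where
  V := T.O ⊕ T.M
  E := T.TypeEdge
  src
    | .mid X => .inl X
    | .inp f i => .inl ((T.dom f).get i)
    | .out f _ => .inr f
  tgt
    | .mid X => .inl X
    | .inp f _ => .inr f
    | .out f j => .inl ((T.cod f).get j)

end MonoidalSignature

/-- A graph over the derived typegraph of `T`. -/
structure TypedGraph (T : MonoidalSignature.{u, v}) extends DirGraph.{0, 0} where
  τ : toDirGraph.Hom T.typegraph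

namespace TypedGraph

variable {T : MonoidalSignature.{u, v}} (G : TypedGraph T)

/-- Wire-vertices are the vertices typed by an object symbol. -/
def IsWire (x : G.V) : Prop := ∃ X : T.O, G.τ.onV x = .inl X

/-- Box-vertices are the vertices typed by a morphism symbol. -/
def IsBox (x : G.V) : Prop := ∃ f : T.M, G.τ.onV x = .inr f

/-- The inputs: wire-vertices without in-edges. -/
def IsInput (x : G.V) : Prop := G.IsWire x ∧ ∀ e, G.tgt e ≠ x

/-- The outputs: wire-vertices without out-edges. -/
def IsOutput (x : G.V) : Prop := G.IsWire x ∧ ∀ e, G.src e ≠ x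

/-- A (finite) string graph: the typing map is a local isomorphism, i.e. a bijection from the
neighbourhood of every box-vertex to the neighbourhood of its type, and every wire-vertex has at
most one in-edge and at most one out-edge. -/
structure IsStringGraph : Prop where
  finite_V : Finite G.V
  finite_E : Finite G.E
  local_iso : ∀ x, G.IsBox x →
    Set.BijOn G.τ.onE (G.nbhd x) (T.typegraph.nbhd (G.τ.onV x))
  in_unique : ∀ e e', G.IsWire (G.tgt e) → G.tgt e = G.tgt e' → e = e'
  out_unique : ∀ e e', G.IsWire (G.src e) → G.src e = G.src e' → e = e'

end TypedGraph

/-! ## Framed point graphs and framed cospans -/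

/-- A framed point graph: a finite string graph that consists of isolated wire-vertices only (so it
is nothing but a finite set of vertices typed by object symbols), with a total order on its vertices
and a signing map (`true` is the sign `+`, `false` is the sign `-`). -/
structure FramedPointGraph (T : MonoidalSignature.{u, v}) where
  V : Type
  finite : Finite V
  ord : LinearOrder V
  ty : V → T.O
  sgn : V → Bool

/-- A framed cospan `X ⟶ G ⟵ Y` of string graphs: `G` has no isolated wire-vertices, `[d, c]` is a
bijection from the vertices of `X + Y` to the boundary of `G`, the positive vertices of `X` are sent
to inputs and the positive vertices of `Y` are sent to outputs (hence the negative ones to outputs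
and to inputs, respectively). -/
structure FramedCospan {T : MonoidalSignature.{u, v}} (X Y : FramedPointGraph T) where
  G : TypedGraph T
  string : G.IsStringGraph
  d : X.V → G.V
  c : Y.V → G.V
  d_ty : ∀ x, G.τ.onV (d x) = .inl (X.ty x)
  c_ty : ∀ y, G.τ.onV (c y) = .inl (Y.ty y)
  no_isolated : ∀ x, ¬ (G.IsInput x ∧ G.IsOutput x)
  injective : Function.Injective (Sum.elim d c)
  range : Set.range (Sum.elim d c) = {x | G.IsInput x ∨ G.IsOutput x}
  d_sgn : ∀ x, G.IsInput (d x) ↔ X.sgn x = true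
  c_sgn : ∀ y, G.IsOutput (c y) ↔ Y.sgn y = true

namespace FramedCospan

variable {T : MonoidalSignature.{u, v}}

/-- Isomorphisms of framed cospans. -/
structure Iso {X Y : FramedPointGraph T} (K L : FramedCospan X Y) where
  onV : K.G.V ≃ L.G.V
  onE : K.G.E ≃ L.G.E
  src_comm : ∀ e, onV (K.G.src e) = L.G.src (onE e)
  tgt_comm : ∀ e, onV (K.G.tgt e) = L.G.tgt (onE e)
  tyV_comm : ∀ x, L.G.τ.onV (onV x) = K.G.τ.onV x
  tyE_comm : ∀ e, L.G.τ.onE (onE e) = K.G.τ.onE e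
  d_comm : ∀ x, onV (K.d x) = L.d x
  c_comm : ∀ y, onV (K.c y) = L.c y

/-- An elementary shortening of a wire. `L` arises from `K` by contracting an edge `e` between two
different wire-vertices `p → q`, i.e. by merging `p` and `q` and removing `e`, everything else being
unchanged. (As `L` is a framed cospan again, `p` and `q` are not both on the boundary.) If `q` has
an edge back to `p`, this is an application of the loop contraction rule; if one of the
chains `p → q → r`, `r → p → q` has a third wire-vertex `r`, it is an application of the wire
contraction rule; if `q` is connected to the `i`-th input of a box, of an input contraction rule;
if `p` is connected to the `j`-th output of a box, of an output contraction rule. -/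
structure Contraction {X Y : FramedPointGraph T} (K L : FramedCospan X Y) where
  e : K.G.E
  ne : K.G.src e ≠ K.G.tgt e
  src_wire : K.G.IsWire (K.G.src e)
  tgt_wire : K.G.IsWire (K.G.tgt e)
  onV : K.G.V → L.G.V
  onV_surjective : Function.Surjective onV
  onV_eq_iff : ∀ x y, onV x = onV y ↔ x = y ∨ (x = K.G.src e ∧ y = K.G.tgt e) ∨
    (x = K.G.tgt e ∧ y = K.G.src e)
  onE : {e' : K.G.E // e' ≠ e} ≃ L.G.E
  src_comm : ∀ e', onV (K.G.src e'.1) = L.G.src (onE e')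
  tgt_comm : ∀ e', onV (K.G.tgt e'.1) = L.G.tgt (onE e')
  tyV_comm : ∀ x, L.G.τ.onV (onV x) = K.G.τ.onV x
  tyE_comm : ∀ e', L.G.τ.onE (onE e') = K.G.τ.onE e'.1
  d_comm : ∀ x, onV (K.d x) = L.d x
  c_comm : ∀ y, onV (K.c y) = L.c y

/-- Wire-homeomorphism of framed cospans: the equivalence relation generated by isomorphisms and
elementary contractions of wires. -/
def wireHomeo (X Y : FramedPointGraph T) : Setoid (FramedCospan X Y) :=
  Relation.EqvGen.setoid fun K L => Nonempty (Iso K L) ∨ Nonempty (Contraction K L)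

theorem bijOn_transfer {E E' S : Type*} {N : Set E} {N' : Set E'} {U : Set S} {t : E → S}
    {t' : E' → S} {i : E → E'} (hN : N' = i '' N)
    (ht : ∀ e, t' (i e) = t e) (h : Set.BijOn t N U) : Set.BijOn t' N' U := by
  subst hN
  refine ⟨?_, ?_, ?_⟩
  · rintro _ ⟨e, he, rfl⟩
    rw [ht]; exact h.mapsTo he
  · rintro _ ⟨e, he, rfl⟩ _ ⟨e', he', rfl⟩ hee
    rw [ht, ht] at hee
    rw [h.injOn he he' hee]
  · intro s hs
    obtain ⟨e, he, rfl⟩ := h.surjOn hs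
    exact ⟨i e, ⟨e, he, rfl⟩, ht e⟩

theorem nbhd_image {P Q : DirGraph.{a, b}} (iV : Q.V → P.V) (iE : Q.E → P.E)
    (hs : ∀ e, P.src (iE e) = iV (Q.src e)) (ht : ∀ e, P.tgt (iE e) = iV (Q.tgt e)) (q : Q.V)
    (hq : ∀ x, iV x = iV q ↔ x = q)
    (ho : ∀ e, e ∉ Set.range iE → P.src e ≠ iV q ∧ P.tgt e ≠ iV q) :
    P.nbhd (iV q) = iE '' Q.nbhd q := by
  have key : ∀ e, iE e ∈ P.nbhd (iV q) ↔ e ∈ Q.nbhd q := fun e => by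
    change (_ ∨ _) ↔ (_ ∨ _)
    rw [hs, ht, hq, hq]
  ext e
  constructor
  · intro he
    by_cases h : e ∈ Set.range iE
    · obtain ⟨e, rfl⟩ := h
      exact ⟨e, (key e).1 he, rfl⟩
    · exact he.elim (fun h' => absurd h' (ho e h).1) (fun h' => absurd h' (ho e h).2)
  · rintro ⟨e, he, rfl⟩
    exact (key e).2 he

section comp

variable {X Y Z : FramedPointGraph T} (K : FramedCospan X Y) (L : FramedCospan Y Z)

theorem d_injective : Function.Injective K.d := fun x y h => by
  have := @K.injective (.inl x) (.inl y) h
  simpa using this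

theorem c_injective : Function.Injective K.c := fun x y h => by
  have := @K.injective (.inr x) (.inr y) h
  simpa using this

theorem d_ne_c (x : X.V) (y : Y.V) : K.d x ≠ K.c y := fun h => by
  have := @K.injective (.inl x) (.inr y) h
  simp at this

theorem d_bound (x : X.V) : K.G.IsInput (K.d x) ∨ K.G.IsOutput (K.d x) := by
  have : K.d x ∈ Set.range (Sum.elim K.d K.c) := ⟨.inl x, rfl⟩
  rw [K.range] at this; exact this

theorem c_bound (y : Y.V) : K.G.IsInput (K.c y) ∨ K.G.IsOutput (K.c y) := by
  have : K.c y ∈ Set.range (Sum.elim K.d K.c) := ⟨.inr y, rfl⟩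
  rw [K.range] at this; exact this

theorem bound_cases {p : K.G.V} (h : K.G.IsInput p ∨ K.G.IsOutput p) :
    (∃ x, K.d x = p) ∨ ∃ y, K.c y = p := by
  have : p ∈ Set.range (Sum.elim K.d K.c) := by rw [K.range]; exact h
  obtain ⟨x | y, rfl⟩ := this
  · exact .inl ⟨x, rfl⟩
  · exact .inr ⟨y, rfl⟩

theorem d_out (x : X.V) : K.G.IsOutput (K.d x) ↔ X.sgn x = false := by
  have h1 := K.d_sgn x
  have h2 := K.d_bound x
  have h3 := K.no_isolated (K.d x)
  cases h : X.sgn x <;> simp_all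

theorem c_in (y : Y.V) : K.G.IsInput (K.c y) ↔ Y.sgn y = false := by
  have h1 := K.c_sgn y
  have h2 := K.c_bound y
  have h3 := K.no_isolated (K.c y)
  cases h : Y.sgn y <;> simp_all

/-- The gluing relation on the disjoint union of the vertices of `K` and `L`: for every vertex `y`
of `Y`, the vertices `K.c y` and `L.d y` are identified. -/
def glueRel : K.G.V ⊕ L.G.V → K.G.V ⊕ L.G.V → Prop
  | .inl p, .inl q => p = q
  | .inr p, .inr q => p = q
  | .inl p, .inr q => ∃ y, K.c y = p ∧ L.d y = q
  | .inr q, .inl p => ∃ y, K.c y = p ∧ L.d y = q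

def glue : Setoid (K.G.V ⊕ L.G.V) where
  r := K.glueRel L
  iseqv := by
    refine ⟨?_, ?_, ?_⟩
    · rintro (p | p) <;> rfl
    · rintro (p | p) (q | q) h
      · exact Eq.symm h
      · exact h
      · exact h
      · exact Eq.symm h
    · rintro (p | p) (q | q) (r | r) h h'
      · exact Eq.trans h h'
      · cases (h : p = q); exact h'
      · obtain ⟨y, rfl, rfl⟩ := h
        obtain ⟨y', rfl, hy⟩ := h'
        exact congrArg K.c (L.d_injective hy).symm
      · cases (h' : q = r); exact h
      · cases (h' : q = r); exact h
      · obtain ⟨y, rfl, rfl⟩ := h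
        obtain ⟨y', hy, rfl⟩ := h'
        exact congrArg L.d (K.c_injective hy).symm
      · cases (h : p = q); exact h'
      · exact Eq.trans h h'

/-- The pushout of the graphs of `K` and `L` along `Y`. -/
def compGraph : TypedGraph T where
  V := Quotient (K.glue L)
  E := K.G.E ⊕ L.G.E
  src := Sum.elim (fun e => Quotient.mk _ (.inl (K.G.src e)))
    (fun e => Quotient.mk _ (.inr (L.G.src e)))
  tgt := Sum.elim (fun e => Quotient.mk _ (.inl (K.G.tgt e)))
    (fun e => Quotient.mk _ (.inr (L.G.tgt e)))
  τ :=
    { onV := Quotient.lift (Sum.elim K.G.τ.onV L.G.τ.onV) (by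
        rintro (p | p) (q | q) h
        · exact congrArg K.G.τ.onV h
        · obtain ⟨y, rfl, rfl⟩ := h
          exact (K.c_ty y).trans (L.d_ty y).symm
        · obtain ⟨y, rfl, rfl⟩ := h
          exact (L.d_ty y).trans (K.c_ty y).symm
        · exact congrArg L.G.τ.onV h)
      onE := Sum.elim K.G.τ.onE L.G.τ.onE
      src_comm := by
        rintro (e | e)
        · exact K.G.τ.src_comm e
        · exact L.G.τ.src_comm e
      tgt_comm := by
        rintro (e | e)
        · exact K.G.τ.tgt_comm e
        · exact L.G.τ.tgt_comm e }

/-- The first pushout injection on vertices. -/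
def compInl (p : K.G.V) : (K.compGraph L).V := Quotient.mk _ (.inl p)

/-- The second pushout injection on vertices. -/
def compInr (p : L.G.V) : (K.compGraph L).V := Quotient.mk _ (.inr p)

variable {K L}

theorem compInl_eq_inl {p q : K.G.V} : K.compInl L p = K.compInl L q ↔ p = q :=
  ⟨fun h => Quotient.exact h, fun h => h ▸ rfl⟩

theorem compInr_eq_inr {p q : L.G.V} : K.compInr L p = K.compInr L q ↔ p = q :=
  ⟨fun h => Quotient.exact h, fun h => h ▸ rfl⟩

theorem compInl_eq_inr {p : K.G.V} {q : L.G.V} :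
    K.compInl L p = K.compInr L q ↔ ∃ y, K.c y = p ∧ L.d y = q :=
  ⟨fun h => Quotient.exact h, fun h => Quotient.sound h⟩

theorem compInr_eq_inl {p : K.G.V} {q : L.G.V} :
    K.compInr L q = K.compInl L p ↔ ∃ y, K.c y = p ∧ L.d y = q :=
  eq_comm.trans compInl_eq_inr

theorem comp_cases (p : (K.compGraph L).V) :
    (∃ q, p = K.compInl L q) ∨ ∃ q, p = K.compInr L q := by
  induction p using Quotient.inductionOn with
  | h p =>
    rcases p with p | p
    · exact .inl ⟨p, rfl⟩
    · exact .inr ⟨p, rfl⟩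

theorem comp_isWire_inl {p : K.G.V} : (K.compGraph L).IsWire (K.compInl L p) ↔ K.G.IsWire p :=
  Iff.rfl

theorem comp_isWire_inr {p : L.G.V} : (K.compGraph L).IsWire (K.compInr L p) ↔ L.G.IsWire p :=
  Iff.rfl

theorem c_wire (y : Y.V) : K.G.IsWire (K.c y) := ⟨_, K.c_ty y⟩

theorem d_wire (x : X.V) : K.G.IsWire (K.d x) := ⟨_, K.d_ty x⟩

theorem not_wire_of_box {G : TypedGraph T} {p : G.V} (h : G.IsBox p) : ¬ G.IsWire p := by
  obtain ⟨f, hf⟩ := h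
  rintro ⟨Z, hZ⟩
  rw [hf] at hZ
  cases hZ

theorem comp_isInput_inl {p : K.G.V} : (K.compGraph L).IsInput (K.compInl L p) ↔
    K.G.IsInput p ∧ ∀ y, K.c y = p → L.G.IsInput (L.d y) := by
  constructor
  · rintro ⟨h, h'⟩
    refine ⟨⟨h, fun e he => h' (.inl e) (congrArg (K.compInl L) he)⟩, fun y hy => ⟨d_wire y, fun e he => ?_⟩⟩
    exact h' (.inr e) (compInr_eq_inl.2 ⟨y, hy, he.symm⟩)
  · rintro ⟨⟨h, h'⟩, h''⟩
    refine ⟨h, ?_⟩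
    rintro (e | e) he
    · exact h' e (compInl_eq_inl.1 he)
    · obtain ⟨y, hy, hy'⟩ := compInr_eq_inl.1 he
      exact (h'' y hy).2 e hy'.symm

theorem comp_isOutput_inl {p : K.G.V} : (K.compGraph L).IsOutput (K.compInl L p) ↔
    K.G.IsOutput p ∧ ∀ y, K.c y = p → L.G.IsOutput (L.d y) := by
  constructor
  · rintro ⟨h, h'⟩
    refine ⟨⟨h, fun e he => h' (.inl e) (congrArg (K.compInl L) he)⟩, fun y hy => ⟨d_wire y, fun e he => ?_⟩⟩
    exact h' (.inr e) (compInr_eq_inl.2 ⟨y, hy, he.symm⟩)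
  · rintro ⟨⟨h, h'⟩, h''⟩
    refine ⟨h, ?_⟩
    rintro (e | e) he
    · exact h' e (compInl_eq_inl.1 he)
    · obtain ⟨y, hy, hy'⟩ := compInr_eq_inl.1 he
      exact (h'' y hy).2 e hy'.symm

theorem comp_isInput_inr {p : L.G.V} : (K.compGraph L).IsInput (K.compInr L p) ↔
    L.G.IsInput p ∧ ∀ y, L.d y = p → K.G.IsInput (K.c y) := by
  constructor
  · rintro ⟨h, h'⟩
    refine ⟨⟨h, fun e he => h' (.inr e) (congrArg (K.compInr L) he)⟩, fun y hy => ⟨c_wire y, fun e he => ?_⟩⟩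
    exact h' (.inl e) (compInl_eq_inr.2 ⟨y, he.symm, hy⟩)
  · rintro ⟨⟨h, h'⟩, h''⟩
    refine ⟨h, ?_⟩
    rintro (e | e) he
    · obtain ⟨y, hy, hy'⟩ := compInl_eq_inr.1 he
      exact (h'' y hy').2 e hy.symm
    · exact h' e (compInr_eq_inr.1 he)

theorem comp_isOutput_inr {p : L.G.V} : (K.compGraph L).IsOutput (K.compInr L p) ↔
    L.G.IsOutput p ∧ ∀ y, L.d y = p → K.G.IsOutput (K.c y) := by
  constructor
  · rintro ⟨h, h'⟩
    refine ⟨⟨h, fun e he => h' (.inr e) (congrArg (K.compInr L) he)⟩, fun y hy => ⟨c_wire y, fun e he => ?_⟩⟩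
    exact h' (.inl e) (compInl_eq_inr.2 ⟨y, he.symm, hy⟩)
  · rintro ⟨⟨h, h'⟩, h''⟩
    refine ⟨h, ?_⟩
    rintro (e | e) he
    · obtain ⟨y, hy, hy'⟩ := compInl_eq_inr.1 he
      exact (h'' y hy').2 e hy.symm
    · exact h' e (compInr_eq_inr.1 he)

/-- A glued vertex is neither an input nor an output any more. -/
theorem comp_glued (y : Y.V) : ¬ ((K.compGraph L).IsInput (K.compInl L (K.c y)) ∨
    (K.compGraph L).IsOutput (K.compInl L (K.c y))) := by
  rw [comp_isInput_inl, comp_isOutput_inl, K.c_in, K.c_sgn]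
  have h1 := L.d_sgn y
  have h2 := L.d_out y
  rintro (⟨h, h'⟩ | ⟨h, h'⟩)
  · have := h1.1 (h' y rfl)
    simp_all
  · have := h2.1 (h' y rfl)
    simp_all

variable (K L)

theorem compGraph_isString : (K.compGraph L).IsStringGraph where
  finite_V := by
    have := K.string.finite_V
    have := L.string.finite_V
    exact Quotient.finite _
  finite_E := by
    have := K.string.finite_E
    have := L.string.finite_E
    exact inferInstanceAs (Finite (K.G.E ⊕ L.G.E))
  local_iso := by
    intro p hp
    rcases comp_cases p with ⟨q, rfl⟩ | ⟨q, rfl⟩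
    · have hq : K.G.IsBox q := hp
      have key : ∀ r : L.G.V, K.compInr L r ≠ K.compInl L q := fun r h => by
        obtain ⟨y, rfl, -⟩ := compInr_eq_inl.1 h
        exact not_wire_of_box hq (c_wire y)
      refine bijOn_transfer (i := Sum.inl) ?_ (fun _ => rfl)
        (K.string.local_iso q hq)
      refine nbhd_image (P := (K.compGraph L).toDirGraph) (Q := K.G.toDirGraph) (K.compInl L)
        Sum.inl (fun _ => rfl) (fun _ => rfl) q (fun x => compInl_eq_inl) ?_
      rintro (e | e) he
      · exact absurd ⟨e, rfl⟩ he
      · exact ⟨key _, key _⟩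
    · have hq : L.G.IsBox q := hp
      have key : ∀ r : K.G.V, K.compInl L r ≠ K.compInr L q := fun r h => by
        obtain ⟨y, -, rfl⟩ := compInl_eq_inr.1 h
        exact not_wire_of_box hq (d_wire y)
      refine bijOn_transfer (i := Sum.inr) ?_ (fun _ => rfl)
        (L.string.local_iso q hq)
      refine nbhd_image (P := (K.compGraph L).toDirGraph) (Q := L.G.toDirGraph) (K.compInr L)
        Sum.inr (fun _ => rfl) (fun _ => rfl) q (fun x => compInr_eq_inr) ?_
      rintro (e | e) he
      · exact ⟨key _, key _⟩
      · exact absurd ⟨e, rfl⟩ he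
  in_unique := by
    have key : ∀ (e : K.G.E) (e' : L.G.E), K.compInl L (K.G.tgt e) ≠ K.compInr L (L.G.tgt e') := by
      intro e e' h
      obtain ⟨y, hy, hy'⟩ := compInl_eq_inr.1 h
      have h1 := K.c_in y
      have h2 := L.d_sgn y
      have h3 : ¬ K.G.IsInput (K.c y) := fun h => h.2 e hy.symm
      have h4 : ¬ L.G.IsInput (L.d y) := fun h => h.2 e' hy'.symm
      simp_all
    rintro (e | e) (e' | e') hw h
    · exact congrArg _ (K.string.in_unique e e' hw (compInl_eq_inl.1 h))
    · exact absurd h (key e e')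
    · exact absurd h.symm (key e' e)
    · exact congrArg _ (L.string.in_unique e e' hw (compInr_eq_inr.1 h))
  out_unique := by
    have key : ∀ (e : K.G.E) (e' : L.G.E), K.compInl L (K.G.src e) ≠ K.compInr L (L.G.src e') := by
      intro e e' h
      obtain ⟨y, hy, hy'⟩ := compInl_eq_inr.1 h
      have h1 := K.c_sgn y
      have h2 := L.d_out y
      have h3 : ¬ K.G.IsOutput (K.c y) := fun h => h.2 e hy.symm
      have h4 : ¬ L.G.IsOutput (L.d y) := fun h => h.2 e' hy'.symm
      simp_all
    rintro (e | e) (e' | e') hw h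
    · exact congrArg _ (K.string.out_unique e e' hw (compInl_eq_inl.1 h))
    · exact absurd h (key e e')
    · exact absurd h.symm (key e' e)
    · exact congrArg _ (L.string.out_unique e e' hw (compInr_eq_inr.1 h))

theorem comp_d_isInput (x : X.V) :
    (K.compGraph L).IsInput (K.compInl L (K.d x)) ↔ K.G.IsInput (K.d x) := by
  rw [comp_isInput_inl, and_iff_left]
  exact fun y h => absurd h.symm (K.d_ne_c x y)

theorem comp_d_isOutput (x : X.V) :
    (K.compGraph L).IsOutput (K.compInl L (K.d x)) ↔ K.G.IsOutput (K.d x) := by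
  rw [comp_isOutput_inl, and_iff_left]
  exact fun y h => absurd h.symm (K.d_ne_c x y)

theorem comp_c_isInput (z : Z.V) :
    (K.compGraph L).IsInput (K.compInr L (L.c z)) ↔ L.G.IsInput (L.c z) := by
  rw [comp_isInput_inr, and_iff_left]
  exact fun y h => absurd h (L.d_ne_c y z)

theorem comp_c_isOutput (z : Z.V) :
    (K.compGraph L).IsOutput (K.compInr L (L.c z)) ↔ L.G.IsOutput (L.c z) := by
  rw [comp_isOutput_inr, and_iff_left]
  exact fun y h => absurd h (L.d_ne_c y z)

/-- Composition of framed cospans (`K` first), by pushout. -/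
def comp : FramedCospan X Z where
  G := K.compGraph L
  string := K.compGraph_isString L
  d x := K.compInl L (K.d x)
  c z := K.compInr L (L.c z)
  d_ty := K.d_ty
  c_ty := L.c_ty
  no_isolated := by
    intro p h
    rcases comp_cases p with ⟨q, rfl⟩ | ⟨q, rfl⟩
    · exact K.no_isolated q ⟨(comp_isInput_inl.1 h.1).1, (comp_isOutput_inl.1 h.2).1⟩
    · exact L.no_isolated q ⟨(comp_isInput_inr.1 h.1).1, (comp_isOutput_inr.1 h.2).1⟩
  injective := by
    rintro (x | x) (y | y) h
    · exact congrArg _ (K.d_injective (compInl_eq_inl.1 h))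
    · obtain ⟨z, hz, -⟩ := compInl_eq_inr.1 h
      exact absurd hz.symm (K.d_ne_c x z)
    · obtain ⟨z, hz, -⟩ := compInr_eq_inl.1 h
      exact absurd hz.symm (K.d_ne_c y z)
    · exact congrArg _ (L.c_injective (compInr_eq_inr.1 h))
  range := by
    ext p
    constructor
    · rintro ⟨x | z, rfl⟩
      · exact (K.d_bound x).imp (K.comp_d_isInput L x).2 (K.comp_d_isOutput L x).2
      · exact (L.c_bound z).imp (K.comp_c_isInput L z).2 (K.comp_c_isOutput L z).2
    · intro h
      rcases comp_cases p with ⟨q, rfl⟩ | ⟨q, rfl⟩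
      · have hq : K.G.IsInput q ∨ K.G.IsOutput q :=
          h.imp (fun h => (comp_isInput_inl.1 h).1) (fun h => (comp_isOutput_inl.1 h).1)
        rcases K.bound_cases hq with ⟨x, rfl⟩ | ⟨y, rfl⟩
        · exact ⟨.inl x, rfl⟩
        · exact absurd h (comp_glued y)
      · have hq : L.G.IsInput q ∨ L.G.IsOutput q :=
          h.imp (fun h => (comp_isInput_inr.1 h).1) (fun h => (comp_isOutput_inr.1 h).1)
        rcases L.bound_cases hq with ⟨y, rfl⟩ | ⟨z, rfl⟩
        · have hy : K.compInl L (K.c y) = K.compInr L (L.d y) :=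
            compInl_eq_inr.2 ⟨y, rfl, rfl⟩
          exact absurd (hy.symm ▸ h) (comp_glued y)
        · exact ⟨.inr z, rfl⟩
  d_sgn x := (K.comp_d_isInput L x).trans (K.d_sgn x)
  c_sgn z := (K.comp_c_isOutput L z).trans (L.c_sgn z)

end comp

end FramedCospan

namespace FramedPointGraph

variable {T : MonoidalSignature.{u, v}}

/-- The tensor product: disjoint union, with the vertices of `Y` placed above those of `X`. -/
def tensor (X Y : FramedPointGraph T) : FramedPointGraph T where
  V := X.V ⊕ Y.V
  finite := by
    have := X.finite
    have := Y.finite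
    infer_instance
  ord :=
    letI := X.ord
    letI := Y.ord
    LinearOrder.lift' (toLex : X.V ⊕ Y.V → X.V ⊕ₗ Y.V) toLex.injective
  ty := Sum.elim X.ty Y.ty
  sgn := Sum.elim X.sgn Y.sgn

/-- The tensor unit: the empty framed point graph. -/
def unit : FramedPointGraph T where
  V := Empty
  finite := inferInstance
  ord := inferInstance
  ty := Empty.elim
  sgn := Empty.elim

/-- The framed point graph `X*`: all signs are reversed. -/
def dual (X : FramedPointGraph T) : FramedPointGraph T where
  V := X.V
  finite := X.finite
  ord := X.ord
  ty := X.ty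
  sgn x := !X.sgn x

/-- A single positive vertex of type `Z`. -/
def point (Z : T.O) : FramedPointGraph T where
  V := Unit
  finite := inferInstance
  ord := inferInstance
  ty _ := Z
  sgn _ := true

/-- The positive framed point graph given by a word of object symbols. -/
def word (l : List T.O) : FramedPointGraph T := (l.map point).foldr tensor unit

/-- The position of a vertex of `word l`. -/
def wordIdx : (l : List T.O) → (word l).V → Fin l.length
  | [], x => Empty.elim x
  | _ :: l, .inl _ => ⟨0, Nat.succ_pos l.length⟩
  | _ :: l, .inr x => (wordIdx l x).succ

theorem wordIdx_bijective : ∀ l : List T.O, Function.Bijective (wordIdx l)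
  | [] => ⟨fun x => Empty.elim x, fun i => i.elim0⟩
  | Z :: l => by
    have ih := wordIdx_bijective l
    constructor
    · rintro (x | x) (y | y) h
      · rfl
      · exact absurd h.symm (Fin.succ_ne_zero (wordIdx l y))
      · exact absurd h (Fin.succ_ne_zero (wordIdx l x))
      · exact congrArg _ (ih.1 (Fin.succ_injective _ h))
    · intro i
      induction i using Fin.cases with
      | zero => exact ⟨.inl (), rfl⟩
      | succ i =>
        obtain ⟨x, hx⟩ := ih.2 i
        exact ⟨.inr x, congrArg Fin.succ hx⟩

theorem word_ty : ∀ (l : List T.O) (x : (word l).V), (word l).ty x = l.get (wordIdx l x)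
  | [], x => Empty.elim x
  | _ :: _, .inl _ => rfl
  | _ :: l, .inr x => word_ty l x

theorem word_sgn : ∀ (l : List T.O) (x : (word l).V), (word l).sgn x = true
  | [], x => Empty.elim x
  | _ :: _, .inl _ => rfl
  | _ :: l, .inr x => word_sgn l x

/-- A bijection between framed point graphs that preserves types and signs (but not necessarily the
order). -/
structure Perm (X Y : FramedPointGraph T) where
  equiv : X.V ≃ Y.V
  ty_comm : ∀ x, Y.ty (equiv x) = X.ty x
  sgn_comm : ∀ x, Y.sgn (equiv x) = X.sgn x

namespace Perm

/-- A permutation is a reframing, i.e. an isomorphism of framed point graphs, if it preserves the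
order as well. -/
def IsReframing {X Y : FramedPointGraph T} (φ : Perm X Y) : Prop :=
  ∀ x x', Y.ord.le (φ.equiv x) (φ.equiv x') ↔ X.ord.le x x'

def refl (X : FramedPointGraph T) : Perm X X := ⟨.refl _, fun _ => rfl, fun _ => rfl⟩

def symm {X Y : FramedPointGraph T} (φ : Perm X Y) : Perm Y X :=
  ⟨φ.equiv.symm, fun y => by rw [← φ.ty_comm, Equiv.apply_symm_apply],
    fun y => by rw [← φ.sgn_comm, Equiv.apply_symm_apply]⟩

def assoc (X Y Z : FramedPointGraph T) :
    Perm ((X.tensor Y).tensor Z) (X.tensor (Y.tensor Z)) :=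
  ⟨Equiv.sumAssoc _ _ _, by rintro ((x | x) | x) <;> rfl, by rintro ((x | x) | x) <;> rfl⟩

def leftUnit (X : FramedPointGraph T) : Perm (unit.tensor X) X :=
  ⟨Equiv.emptySum Empty X.V, by rintro (x | x); exacts [x.elim, rfl],
    by rintro (x | x); exacts [x.elim, rfl]⟩

def rightUnit (X : FramedPointGraph T) : Perm (X.tensor unit) X :=
  ⟨Equiv.sumEmpty X.V Empty, by rintro (x | x); exacts [rfl, x.elim],
    by rintro (x | x); exacts [rfl, x.elim]⟩

def swap (X Y : FramedPointGraph T) : Perm (X.tensor Y) (Y.tensor X) :=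
  ⟨Equiv.sumComm _ _, by rintro (x | x) <;> rfl, by rintro (x | x) <;> rfl⟩

end Perm

end FramedPointGraph

namespace FramedCospan

open FramedPointGraph

variable {T : MonoidalSignature.{u, v}}

section tensor

variable {X Y X' Y' : FramedPointGraph T} (K : FramedCospan X Y) (L : FramedCospan X' Y')

/-- The disjoint union of the graphs of `K` and `L`. -/
def sumGraph : TypedGraph T where
  V := K.G.V ⊕ L.G.V
  E := K.G.E ⊕ L.G.E
  src := Sum.map K.G.src L.G.src
  tgt := Sum.map K.G.tgt L.G.tgt
  τ :=
    { onV := Sum.elim K.G.τ.onV L.G.τ.onV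
      onE := Sum.elim K.G.τ.onE L.G.τ.onE
      src_comm := by
        rintro (e | e)
        · exact K.G.τ.src_comm e
        · exact L.G.τ.src_comm e
      tgt_comm := by
        rintro (e | e)
        · exact K.G.τ.tgt_comm e
        · exact L.G.τ.tgt_comm e }

variable {K L}

theorem sum_isInput_inl {p : K.G.V} : (K.sumGraph L).IsInput (.inl p) ↔ K.G.IsInput p := by
  refine and_congr Iff.rfl ⟨fun h e he => h (.inl e) (congrArg Sum.inl he), fun h => ?_⟩
  rintro (e | e) he
  · exact h e (Sum.inl_injective he)
  · cases he

theorem sum_isInput_inr {p : L.G.V} : (K.sumGraph L).IsInput (.inr p) ↔ L.G.IsInput p := by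
  refine and_congr Iff.rfl ⟨fun h e he => h (.inr e) (congrArg Sum.inr he), fun h => ?_⟩
  rintro (e | e) he
  · cases he
  · exact h e (Sum.inr_injective he)

theorem sum_isOutput_inl {p : K.G.V} : (K.sumGraph L).IsOutput (.inl p) ↔ K.G.IsOutput p := by
  refine and_congr Iff.rfl ⟨fun h e he => h (.inl e) (congrArg Sum.inl he), fun h => ?_⟩
  rintro (e | e) he
  · exact h e (Sum.inl_injective he)
  · cases he

theorem sum_isOutput_inr {p : L.G.V} : (K.sumGraph L).IsOutput (.inr p) ↔ L.G.IsOutput p := by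
  refine and_congr Iff.rfl ⟨fun h e he => h (.inr e) (congrArg Sum.inr he), fun h => ?_⟩
  rintro (e | e) he
  · cases he
  · exact h e (Sum.inr_injective he)

variable (K L)

theorem sumGraph_isString : (K.sumGraph L).IsStringGraph where
  finite_V := by
    have := K.string.finite_V
    have := L.string.finite_V
    exact inferInstanceAs (Finite (K.G.V ⊕ L.G.V))
  finite_E := by
    have := K.string.finite_E
    have := L.string.finite_E
    exact inferInstanceAs (Finite (K.G.E ⊕ L.G.E))
  local_iso := by
    rintro (q | q) hp
    · refine bijOn_transfer (i := Sum.inl) ?_ (fun _ => rfl) (K.string.local_iso q hp)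
      refine nbhd_image (P := (K.sumGraph L).toDirGraph) (Q := K.G.toDirGraph) Sum.inl
        Sum.inl (fun _ => rfl) (fun _ => rfl) q (fun x => Sum.inl_injective.eq_iff) ?_
      rintro (e | e) he
      · exact absurd ⟨e, rfl⟩ he
      · exact ⟨Sum.inr_ne_inl, Sum.inr_ne_inl⟩
    · refine bijOn_transfer (i := Sum.inr) ?_ (fun _ => rfl) (L.string.local_iso q hp)
      refine nbhd_image (P := (K.sumGraph L).toDirGraph) (Q := L.G.toDirGraph) Sum.inr
        Sum.inr (fun _ => rfl) (fun _ => rfl) q (fun x => Sum.inr_injective.eq_iff) ?_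
      rintro (e | e) he
      · exact ⟨Sum.inl_ne_inr, Sum.inl_ne_inr⟩
      · exact absurd ⟨e, rfl⟩ he
  in_unique := by
    rintro (e | e) (e' | e') hw h
    · exact congrArg _ (K.string.in_unique e e' hw (Sum.inl_injective h))
    · cases h
    · cases h
    · exact congrArg _ (L.string.in_unique e e' hw (Sum.inr_injective h))
  out_unique := by
    rintro (e | e) (e' | e') hw h
    · exact congrArg _ (K.string.out_unique e e' hw (Sum.inl_injective h))
    · cases h
    · cases h
    · exact congrArg _ (L.string.out_unique e e' hw (Sum.inr_injective h))

/-- The tensor product of framed cospans, by coproduct. -/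
def tensor : FramedCospan (X.tensor X') (Y.tensor Y') where
  G := K.sumGraph L
  string := K.sumGraph_isString L
  d := Sum.map K.d L.d
  c := Sum.map K.c L.c
  d_ty := by
    rintro (x | x)
    · exact K.d_ty x
    · exact L.d_ty x
  c_ty := by
    rintro (x | x)
    · exact K.c_ty x
    · exact L.c_ty x
  no_isolated := by
    rintro (p | p) ⟨h, h'⟩
    · exact K.no_isolated p ⟨sum_isInput_inl.1 h, sum_isOutput_inl.1 h'⟩
    · exact L.no_isolated p ⟨sum_isInput_inr.1 h, sum_isOutput_inr.1 h'⟩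
  injective := by
    rintro ((x | x) | (x | x)) ((y | y) | (y | y)) h <;>
      first
      | exact absurd h Sum.inl_ne_inr
      | exact absurd h Sum.inr_ne_inl
      | exact congrArg _ (congrArg _ (K.d_injective (Sum.inl_injective h)))
      | exact congrArg _ (congrArg _ (L.d_injective (Sum.inr_injective h)))
      | exact congrArg _ (congrArg _ (K.c_injective (Sum.inl_injective h)))
      | exact congrArg _ (congrArg _ (L.c_injective (Sum.inr_injective h)))
      | exact absurd (Sum.inl_injective h) (K.d_ne_c _ _)
      | exact absurd (Sum.inr_injective h) (L.d_ne_c _ _)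
      | exact absurd (Sum.inl_injective h).symm (K.d_ne_c _ _)
      | exact absurd (Sum.inr_injective h).symm (L.d_ne_c _ _)
  range := by
    ext p
    constructor
    · rintro ⟨(x | x) | (x | x), rfl⟩
      · exact (K.d_bound x).imp sum_isInput_inl.2 sum_isOutput_inl.2
      · exact (L.d_bound x).imp sum_isInput_inr.2 sum_isOutput_inr.2
      · exact (K.c_bound x).imp sum_isInput_inl.2 sum_isOutput_inl.2
      · exact (L.c_bound x).imp sum_isInput_inr.2 sum_isOutput_inr.2
    · intro h
      rcases p with p | p
      · rcases K.bound_cases (h.imp sum_isInput_inl.1 sum_isOutput_inl.1) with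
          ⟨x, rfl⟩ | ⟨x, rfl⟩
        · exact ⟨.inl (.inl x), rfl⟩
        · exact ⟨.inr (.inl x), rfl⟩
      · rcases L.bound_cases (h.imp sum_isInput_inr.1 sum_isOutput_inr.1) with
          ⟨x, rfl⟩ | ⟨x, rfl⟩
        · exact ⟨.inl (.inr x), rfl⟩
        · exact ⟨.inr (.inr x), rfl⟩
  d_sgn := by
    rintro (x | x)
    · exact sum_isInput_inl.trans (K.d_sgn x)
    · exact sum_isInput_inr.trans (L.d_sgn x)
  c_sgn := by
    rintro (x | x)
    · exact sum_isOutput_inl.trans (K.c_sgn x)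
    · exact sum_isOutput_inr.trans (L.c_sgn x)

end tensor

section wires

variable {X Y : FramedPointGraph T}

/-- The framed cospan `X ⟶ G ⟵ Y` without boxes, whose vertices are those of `X + Y` and whose
edges are indexed by `W`; the edge `w` runs from `s w` to `t w`. Every vertex has to be the start
of precisely one edge or the end of precisely one edge, as its sign and its side prescribe. -/
def wires (W : Type) (s t : W → X.V ⊕ Y.V) (bij : Function.Bijective (Sum.elim s t))
    (hty : ∀ w, Sum.elim X.ty Y.ty (s w) = Sum.elim X.ty Y.ty (t w))
    (hs : ∀ w, Sum.elim X.sgn (fun y => !Y.sgn y) (s w) = true)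
    (ht : ∀ w, Sum.elim X.sgn (fun y => !Y.sgn y) (t w) = false) : FramedCospan X Y :=
  let G : TypedGraph T :=
    { V := X.V ⊕ Y.V
      E := W
      src := s
      tgt := t
      τ :=
        { onV := fun p => .inl (Sum.elim X.ty Y.ty p)
          onE := fun w => .mid (Sum.elim X.ty Y.ty (s w))
          src_comm := fun _ => rfl
          tgt_comm := fun w => congrArg Sum.inl (hty w).symm } }
  have hst : ∀ w w', s w ≠ t w' := fun w w' h => by
    have := @bij.1 (.inl w) (.inr w') h
    cases this
  have hin : ∀ p, G.IsInput p ↔ Sum.elim X.sgn (fun y => !Y.sgn y) p = true := fun p => by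
    obtain ⟨w | w, rfl⟩ := bij.2 p
    · exact ⟨fun _ => hs w, fun _ => ⟨⟨_, rfl⟩, fun e h => hst w e h.symm⟩⟩
    · refine ⟨fun h => absurd rfl (h.2 w), fun h => ?_⟩
      exact absurd ((ht w).symm.trans h) Bool.false_ne_true
  have hout : ∀ p, G.IsOutput p ↔ Sum.elim X.sgn (fun y => !Y.sgn y) p = false := fun p => by
    obtain ⟨w | w, rfl⟩ := bij.2 p
    · refine ⟨fun h => absurd rfl (h.2 w), fun h => ?_⟩
      exact absurd (h.symm.trans (hs w)) Bool.false_ne_true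
    · exact ⟨fun _ => ht w, fun _ => ⟨⟨_, rfl⟩, fun e h => hst e w h⟩⟩
  { G := G
    string :=
      { finite_V := by
          have := X.finite
          have := Y.finite
          exact inferInstanceAs (Finite (X.V ⊕ Y.V))
        finite_E := by
          have := X.finite
          have := Y.finite
          exact Finite.of_injective s fun w w' h =>
            Sum.inl_injective (@bij.1 (.inl w) (.inl w') h)
        local_iso := fun p ⟨f, hf⟩ => by cases hf
        in_unique := fun w w' _ h => Sum.inr_injective (@bij.1 (.inr w) (.inr w') h)
        out_unique := fun w w' _ h => Sum.inl_injective (@bij.1 (.inl w) (.inl w') h) }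
    d := Sum.inl
    c := Sum.inr
    d_ty := fun _ => rfl
    c_ty := fun _ => rfl
    no_isolated := fun p h => by
      have := ((hin p).1 h.1).symm.trans ((hout p).1 h.2)
      cases this
    injective := by
      rintro (x | x) (y | y) h
      · exact h
      · cases h
      · cases h
      · exact h
    range := by
      ext p
      constructor
      · intro _
        cases h : Sum.elim X.sgn (fun y => !Y.sgn y) p
        · exact .inr ((hout p).2 h)
        · exact .inl ((hin p).2 h)
      · intro _
        rcases p with x | y
        · exact ⟨.inl x, rfl⟩
        · exact ⟨.inr y, rfl⟩
    d_sgn := fun x => hin (.inl x)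
    c_sgn := fun y => by
      refine (hout (.inr y)).trans ?_
      cases h : Y.sgn y <;> simp [h] }

/-- The framed cospan with one wire from `x` to `φ x` for every positive vertex `x` of `X` and one
wire from `φ x` to `x` for every negative one. For the identity permutation this is the
pseudo-identity. -/
def perm (φ : Perm X Y) : FramedCospan X Y :=
  wires X.V (fun x => if X.sgn x then .inl x else .inr (φ.equiv x))
    (fun x => if X.sgn x then .inr (φ.equiv x) else .inl x)
    (by
      constructor
      · rintro (x | x) (y | y) h <;> cases hx : X.sgn x <;> cases hy : X.sgn y <;>
          simp_all
      · rintro (x | y)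
        · cases hx : X.sgn x
          · exact ⟨.inr x, by simp [hx]⟩
          · exact ⟨.inl x, by simp [hx]⟩
        · obtain ⟨x, rfl⟩ := φ.equiv.surjective y
          cases hx : X.sgn x
          · exact ⟨.inl x, by simp [hx]⟩
          · exact ⟨.inr x, by simp [hx]⟩)
    (fun x => by cases hx : X.sgn x <;> simp [φ.ty_comm])
    (fun x => by cases hx : X.sgn x <;> simp [hx, φ.sgn_comm])
    (fun x => by cases hx : X.sgn x <;> simp [hx, φ.sgn_comm])

/-- The start of the wire through the vertex `x` of `X`, among the vertices of `X` and `X*`. -/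
def bendStart (X : FramedPointGraph T) (x : X.V) : X.V ⊕ X.V :=
  if X.sgn x then .inl x else .inr x

/-- The end of the wire through the vertex `x` of `X`, among the vertices of `X` and `X*`. -/
def bendEnd (X : FramedPointGraph T) (x : X.V) : X.V ⊕ X.V :=
  if X.sgn x then .inr x else .inl x

theorem bend_bijective (X : FramedPointGraph T) :
    Function.Bijective (Sum.elim (bendStart X) (bendEnd X)) := by
  constructor
  · rintro (x | x) (y | y) h <;> cases hx : X.sgn x <;> cases hy : X.sgn y <;>
      simp_all [bendStart, bendEnd]
  · rintro (x | x) <;> cases hx : X.sgn x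
    · exact ⟨.inr x, by simp [hx, bendEnd]⟩
    · exact ⟨.inl x, by simp [hx, bendStart]⟩
    · exact ⟨.inl x, by simp [hx, bendStart]⟩
    · exact ⟨.inr x, by simp [hx, bendEnd]⟩

/-- The cup `X ⊗ X* ⟶ I`: from every positive vertex of `X` a wire runs to its copy in `X*`, and to
every negative one a wire runs from its copy. -/
def cup (X : FramedPointGraph T) : FramedCospan (X.tensor X.dual) unit :=
  wires (X := X.tensor X.dual) (Y := unit) X.V (fun x => .inl (bendStart X x))
    (fun x => .inl (bendEnd X x))
    (by
      have h : Function.Bijective (Sum.inl : X.V ⊕ X.V → (X.V ⊕ X.V) ⊕ Empty) :=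
        (Equiv.sumEmpty (X.V ⊕ X.V) Empty).symm.bijective
      have h' := h.comp (bend_bijective X)
      rw [Sum.comp_elim] at h'
      exact h')
    (fun x => by
      change Sum.elim X.ty X.ty _ = Sum.elim X.ty X.ty _
      cases hx : X.sgn x <;> simp [hx, bendStart, bendEnd])
    (fun x => by
      change Sum.elim X.sgn (fun x => !X.sgn x) _ = _
      cases hx : X.sgn x <;> simp [hx, bendStart])
    (fun x => by
      change Sum.elim X.sgn (fun x => !X.sgn x) _ = _
      cases hx : X.sgn x <;> simp [hx, bendEnd])

/-- The cap `I ⟶ X* ⊗ X`: to every positive vertex of `X` a wire runs from its copy in `X*`, and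
from every negative one a wire runs to its copy. -/
def cap (X : FramedPointGraph T) : FramedCospan unit (X.dual.tensor X) :=
  wires (X := unit) (Y := X.dual.tensor X) X.V (fun x => .inr (bendStart X x))
    (fun x => .inr (bendEnd X x))
    (by
      have h : Function.Bijective (Sum.inr : X.V ⊕ X.V → Empty ⊕ (X.V ⊕ X.V)) :=
        (Equiv.emptySum Empty (X.V ⊕ X.V)).symm.bijective
      have h' := h.comp (bend_bijective X)
      rw [Sum.comp_elim] at h'
      exact h')
    (fun x => by
      change Sum.elim X.ty X.ty _ = Sum.elim X.ty X.ty _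
      cases hx : X.sgn x <;> simp [hx, bendStart, bendEnd])
    (fun x => by
      change (!(Sum.elim (fun x => !X.sgn x) X.sgn _)) = _
      cases hx : X.sgn x <;> simp [hx, bendStart])
    (fun x => by
      change (!(Sum.elim (fun x => !X.sgn x) X.sgn _)) = _
      cases hx : X.sgn x <;> simp [hx, bendEnd])

end wires

/-- The framed cospan that consists of one box-vertex of type `f`, with a wire-vertex for each of
its inputs and outputs. -/
def box (f : T.M) : FramedCospan (word (T.dom f)) (word (T.cod f)) :=
  let G : TypedGraph T :=
    { V := Unit ⊕ ((word (T.dom f)).V ⊕ (word (T.cod f)).V)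
      E := (word (T.dom f)).V ⊕ (word (T.cod f)).V
      src := Sum.elim (fun x => .inr (.inl x)) (fun _ => .inl ())
      tgt := Sum.elim (fun _ => .inl ()) (fun y => .inr (.inr y))
      τ :=
        { onV := Sum.elim (fun _ => .inr f)
            (fun p => .inl (Sum.elim (word (T.dom f)).ty (word (T.cod f)).ty p))
          onE := Sum.elim (fun x => .inp f (wordIdx _ x)) (fun y => .out f (wordIdx _ y))
          src_comm := by
            rintro (x | y)
            · exact congrArg Sum.inl (word_ty _ x)
            · rfl
          tgt_comm := by
            rintro (x | y)
            · rfl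
            · exact congrArg Sum.inl (word_ty _ y) } }
  have hin : ∀ p, G.IsInput p ↔ ∃ x, p = .inr (.inl x) := fun p => by
    rcases p with _ | x | y
    · refine ⟨fun h => ?_, fun ⟨_, h⟩ => by cases h⟩
      obtain ⟨_, h⟩ := h.1
      cases h
    · refine ⟨fun _ => ⟨x, rfl⟩, fun _ => ⟨⟨_, rfl⟩, ?_⟩⟩
      rintro (e | e) h <;> cases h
    · exact ⟨fun h => absurd rfl (h.2 (.inr y)), fun ⟨_, h⟩ => by cases h⟩
  have hout : ∀ p, G.IsOutput p ↔ ∃ y, p = .inr (.inr y) := fun p => by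
    rcases p with _ | x | y
    · refine ⟨fun h => ?_, fun ⟨_, h⟩ => by cases h⟩
      obtain ⟨_, h⟩ := h.1
      cases h
    · exact ⟨fun h => absurd rfl (h.2 (.inl x)), fun ⟨_, h⟩ => by cases h⟩
    · refine ⟨fun _ => ⟨y, rfl⟩, fun _ => ⟨⟨_, rfl⟩, ?_⟩⟩
      rintro (e | e) h <;> cases h
  { G := G
    string :=
      { finite_V := by
          have := (word (T.dom f)).finite
          have := (word (T.cod f)).finite
          exact inferInstanceAs (Finite (Unit ⊕ ((word (T.dom f)).V ⊕ (word (T.cod f)).V)))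
        finite_E := by
          have := (word (T.dom f)).finite
          have := (word (T.cod f)).finite
          exact inferInstanceAs (Finite ((word (T.dom f)).V ⊕ (word (T.cod f)).V))
        local_iso := by
          rintro (p | p) ⟨g, hg⟩
          · refine ⟨?_, ?_, ?_⟩
            · rintro (x | y) _
              · exact .inr rfl
              · exact .inl rfl
            · rintro (x | y) _ (x' | y') _ h
              · exact congrArg _ ((wordIdx_bijective _).1 (eq_of_heq (MonoidalSignature.TypeEdge.inp.inj h).2))
              · cases h
              · cases h
              · exact congrArg _ ((wordIdx_bijective _).1 (eq_of_heq (MonoidalSignature.TypeEdge.out.inj h).2))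
            · rintro (X | ⟨g, i⟩ | ⟨g, j⟩) h
              · rcases h with h | h <;> cases h
              · rcases h with h | h
                · cases h
                · cases h
                  obtain ⟨x, rfl⟩ := (wordIdx_bijective _).2 i
                  exact ⟨.inl x, .inr rfl, rfl⟩
              · rcases h with h | h
                · cases h
                  obtain ⟨y, rfl⟩ := (wordIdx_bijective _).2 j
                  exact ⟨.inr y, .inl rfl, rfl⟩
                · cases h
          · cases hg
        in_unique := by
          rintro (x | y) (x' | y') ⟨Z, hZ⟩ h
          · cases hZ
          · cases hZ
          · cases h
          · exact congrArg _ (Sum.inr_injective (Sum.inr_injective h))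
        out_unique := by
          rintro (x | y) (x' | y') ⟨Z, hZ⟩ h
          · exact congrArg _ (Sum.inl_injective (Sum.inr_injective h))
          · cases h
          · cases hZ
          · cases hZ }
    d := fun x => .inr (.inl x)
    c := fun y => .inr (.inr y)
    d_ty := fun _ => rfl
    c_ty := fun _ => rfl
    no_isolated := fun p h => by
      obtain ⟨x, rfl⟩ := (hin p).1 h.1
      obtain ⟨y, hy⟩ := (hout _).1 h.2
      cases hy
    injective := by
      rintro (x | x) (y | y) h <;> cases h <;> rfl
    range := by
      ext p
      constructor
      · rintro ⟨x | y, rfl⟩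
        · exact .inl ((hin _).2 ⟨x, rfl⟩)
        · exact .inr ((hout _).2 ⟨y, rfl⟩)
      · rintro (h | h)
        · obtain ⟨x, rfl⟩ := (hin p).1 h
          exact ⟨.inl x, rfl⟩
        · obtain ⟨y, rfl⟩ := (hout p).1 h
          exact ⟨.inr y, rfl⟩
    d_sgn := fun x => ⟨fun _ => word_sgn _ x, fun _ => (hin _).2 ⟨x, rfl⟩⟩
    c_sgn := fun y => ⟨fun _ => word_sgn _ y, fun _ => (hout _).2 ⟨y, rfl⟩⟩ }

end FramedCospan

/-! ## The category of framed cospans modulo wire-homeomorphism -/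

/-- The objects of the category of framed cospans: the framed point graphs. -/
def FCsp (T : MonoidalSignature.{u, v}) : Type (max u 1) := FramedPointGraph T

namespace FCsp

open FramedPointGraph

variable {T : MonoidalSignature.{u, v}}

/-- The morphisms are the framed cospans up to wire-homeomorphism, the identities are the classes of
the pseudo-identities, and the composite of two classes is the class of the composite of
representatives. -/
noncomputable instance : CategoryStruct.{max u v 1} (FCsp T) where
  Hom X Y := Quotient (FramedCospan.wireHomeo X Y)
  id X := Quotient.mk _ (FramedCospan.perm (Perm.refl X))
  comp f g := Quotient.mk _ ((Quotient.out f).comp (Quotient.out g))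

/-- The class of a framed cospan. -/
def mk {X Y : FCsp T} (K : FramedCospan X Y) : X ⟶ Y := Quotient.mk (FramedCospan.wireHomeo X Y) K

/-- The tensor product of objects. -/
def tensorObj (X Y : FCsp T) : FCsp T := FramedPointGraph.tensor X Y

/-- The tensor unit. -/
def unit : FCsp T := FramedPointGraph.unit

/-- The tensor product of morphisms, by means of representatives. -/
noncomputable def tensorHom {X Y X' Y' : FCsp T} (f : X ⟶ Y) (g : X' ⟶ Y') :
    tensorObj X X' ⟶ tensorObj Y Y' :=
  mk ((Quotient.out f).tensor (Quotient.out g))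

/-- The morphism given by a permutation of vertices. -/
def ofPerm {X Y : FCsp T} (φ : Perm X Y) : X ⟶ Y := mk (FramedCospan.perm φ)

/-- The associator. -/
def assocHom (X Y Z : FCsp T) :
    tensorObj (tensorObj X Y) Z ⟶ tensorObj X (tensorObj Y Z) := ofPerm (Perm.assoc X Y Z)

/-- The left unitor. -/
def leftUnitHom (X : FCsp T) : tensorObj unit X ⟶ X := ofPerm (Perm.leftUnit X)

/-- The right unitor. -/
def rightUnitHom (X : FCsp T) : tensorObj X unit ⟶ X := ofPerm (Perm.rightUnit X)

/-- The symmetry. -/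
def swapHom (X Y : FCsp T) : tensorObj X Y ⟶ tensorObj Y X := ofPerm (Perm.swap X Y)

/-- The statement that composition and tensor product of framed cospans are well defined modulo
wire-homeomorphism, and that with them the framed cospans modulo wire-homeomorphism obey the laws of
a symmetric monoidal category. -/
class SymmetricMonoidalLaws (T : MonoidalSignature.{u, v}) : Prop where
  mk_comp {X Y Z : FCsp T} (K : FramedCospan X Y) (L : FramedCospan Y Z) :
    mk K ≫ mk L = mk (K.comp L)
  mk_tensor {X Y X' Y' : FCsp T} (K : FramedCospan X Y) (L : FramedCospan X' Y') :
    tensorHom (mk K) (mk L) = mk (K.tensor L)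
  id_comp {X Y : FCsp T} (f : X ⟶ Y) : 𝟙 X ≫ f = f
  comp_id {X Y : FCsp T} (f : X ⟶ Y) : f ≫ 𝟙 Y = f
  assoc {W X Y Z : FCsp T} (f : W ⟶ X) (g : X ⟶ Y) (h : Y ⟶ Z) : (f ≫ g) ≫ h = f ≫ g ≫ h
  perm_inverse {X Y : FCsp T} (φ : Perm X Y) :
    ofPerm φ ≫ ofPerm φ.symm = 𝟙 X ∧ ofPerm φ.symm ≫ ofPerm φ = 𝟙 Y
  id_tensor_id (X Y : FCsp T) : tensorHom (𝟙 X) (𝟙 Y) = 𝟙 (tensorObj X Y)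
  tensor_comp_tensor {X Y Z X' Y' Z' : FCsp T} (f : X ⟶ Y) (f' : X' ⟶ Y') (g : Y ⟶ Z)
    (g' : Y' ⟶ Z') : tensorHom f f' ≫ tensorHom g g' = tensorHom (f ≫ g) (f' ≫ g')
  assoc_naturality {X Y X' Y' X'' Y'' : FCsp T} (f : X ⟶ Y) (f' : X' ⟶ Y') (f'' : X'' ⟶ Y'') :
    tensorHom (tensorHom f f') f'' ≫ assocHom Y Y' Y'' =
      assocHom X X' X'' ≫ tensorHom f (tensorHom f' f'')
  leftUnit_naturality {X Y : FCsp T} (f : X ⟶ Y) :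
    tensorHom (𝟙 unit) f ≫ leftUnitHom Y = leftUnitHom X ≫ f
  rightUnit_naturality {X Y : FCsp T} (f : X ⟶ Y) :
    tensorHom f (𝟙 unit) ≫ rightUnitHom Y = rightUnitHom X ≫ f
  swap_naturality {X Y X' Y' : FCsp T} (f : X ⟶ Y) (f' : X' ⟶ Y') :
    tensorHom f f' ≫ swapHom Y Y' = swapHom X X' ≫ tensorHom f' f
  pentagon (W X Y Z : FCsp T) :
    tensorHom (assocHom W X Y) (𝟙 Z) ≫ assocHom W (tensorObj X Y) Z ≫
        tensorHom (𝟙 W) (assocHom X Y Z) =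
      assocHom (tensorObj W X) Y Z ≫ assocHom W X (tensorObj Y Z)
  triangle (X Y : FCsp T) :
    assocHom X unit Y ≫ tensorHom (𝟙 X) (leftUnitHom Y) = tensorHom (rightUnitHom X) (𝟙 Y)
  hexagon (X Y Z : FCsp T) :
    assocHom X Y Z ≫ swapHom X (tensorObj Y Z) ≫ assocHom Y Z X =
      tensorHom (swapHom X Y) (𝟙 Z) ≫ assocHom Y X Z ≫ tensorHom (𝟙 Y) (swapHom X Z)

section laws

variable [SymmetricMonoidalLaws T]

noncomputable instance : Category (FCsp T) where
  id_comp := SymmetricMonoidalLaws.id_comp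
  comp_id := SymmetricMonoidalLaws.comp_id
  assoc := SymmetricMonoidalLaws.assoc

/-- Permutations of vertices as isomorphisms. -/
noncomputable def permIso {X Y : FCsp T} (φ : Perm X Y) : X ≅ Y where
  hom := ofPerm φ
  inv := ofPerm φ.symm
  hom_inv_id := (SymmetricMonoidalLaws.perm_inverse φ).1
  inv_hom_id := (SymmetricMonoidalLaws.perm_inverse φ).2

noncomputable instance : MonoidalCategoryStruct (FCsp T) where
  tensorObj X Y := tensorObj X Y
  whiskerLeft X _ _ f := tensorHom (𝟙 X) f
  whiskerRight f Y := tensorHom f (𝟙 Y)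
  tensorHom f g := tensorHom f g
  tensorUnit := unit
  associator X Y Z := permIso (Perm.assoc X Y Z)
  leftUnitor X := permIso (Perm.leftUnit X)
  rightUnitor X := permIso (Perm.rightUnit X)

noncomputable instance : MonoidalCategory (FCsp T) :=
  MonoidalCategory.ofTensorHom
    (id_tensorHom_id := SymmetricMonoidalLaws.id_tensor_id)
    (id_tensorHom := fun _ _ _ _ => rfl)
    (tensorHom_id := fun _ _ => rfl)
    (tensorHom_comp_tensorHom := SymmetricMonoidalLaws.tensor_comp_tensor)
    (associator_naturality := SymmetricMonoidalLaws.assoc_naturality)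
    (leftUnitor_naturality := SymmetricMonoidalLaws.leftUnit_naturality)
    (rightUnitor_naturality := SymmetricMonoidalLaws.rightUnit_naturality)
    (pentagon := SymmetricMonoidalLaws.pentagon)
    (triangle := SymmetricMonoidalLaws.triangle)

noncomputable instance : SymmetricCategory (FCsp T) where
  braiding X Y := permIso (Perm.swap X Y)
  braiding_naturality_right X _ _ f := SymmetricMonoidalLaws.swap_naturality (𝟙 X) f
  braiding_naturality_left f Z := SymmetricMonoidalLaws.swap_naturality f (𝟙 Z)
  hexagon_forward X Y Z := SymmetricMonoidalLaws.hexagon X Y Z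
  hexagon_reverse X Y Z := by
    have h : α_ Z X Y ≪≫ permIso (Perm.swap Z (tensorObj X Y)) ≪≫ α_ X Y Z =
        whiskerRightIso (permIso (Perm.swap Z X)) Y ≪≫ α_ X Z Y ≪≫
          whiskerLeftIso X (permIso (Perm.swap Z Y)) :=
      Iso.ext (SymmetricMonoidalLaws.hexagon Z X Y)
    exact (Category.assoc _ _ _).symm.trans ((congrArg Iso.inv h).trans (Category.assoc _ _ _))
  symmetry X Y := (SymmetricMonoidalLaws.perm_inverse (Perm.swap X Y)).1

end laws

/-- The dual object `X*`. -/
def dual (X : FCsp T) : FCsp T := FramedPointGraph.dual X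

/-- The morphism `X ⊗ X* ⟶ I` of the compact structure of `X`. -/
def cup (X : FCsp T) : tensorObj X (dual X) ⟶ unit := mk (FramedCospan.cup X)

/-- The morphism `I ⟶ X* ⊗ X` of the compact structure of `X`. -/
def cap (X : FCsp T) : unit ⟶ tensorObj (dual X) X := mk (FramedCospan.cap X)

end FCsp

/-! ## Valuations and freeness -/

section free

variable {C : Type c} [Category.{d} C] [MonoidalCategory C]

/-- The tensor product of a list of objects, bracketed to the right. -/
def tensorList (l : List C) : C := l.foldr (fun A B => A ⊗ B) (𝟙_ C)

/-- A valuation of a signature `T` in a monoidal category, i.e. a homomorphism from `T` to the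
signature underlying the category. -/
structure SigValuation (T : MonoidalSignature.{u, v}) (C : Type c) [Category.{d} C]
    [MonoidalCategory C] where
  obj : T.O → C
  map (f : T.M) : tensorList ((T.dom f).map obj) ⟶ tensorList ((T.cod f).map obj)

/-- The tensor product of a list of morphisms. -/
def tensorListMap {O : Type u} {A B : O → C} (φ : ∀ Z, A Z ⟶ B Z) :
    (l : List O) → (tensorList (l.map A) ⟶ tensorList (l.map B))
  | [] => 𝟙 (𝟙_ C)
  | Z :: l => φ Z ⊗ₘ tensorListMap φ l

/-- A strong monoidal functor commutes with tensor products of lists. -/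
def tensorListComparison {V : Type w₁} [Category.{w₂} V] [MonoidalCategory V] (F : C ⥤ V)
    [F.Monoidal] {O : Type u} (A : O → C) :
    (l : List O) → (tensorList (l.map fun Z => F.obj (A Z)) ≅ F.obj (tensorList (l.map A)))
  | [] => Functor.Monoidal.εIso F
  | Z :: l => whiskerLeftIso (F.obj (A Z)) (tensorListComparison F A l) ≪≫
      Functor.Monoidal.μIso F (A Z) (tensorList (l.map A))

namespace SigValuation

variable {T : MonoidalSignature.{u, v}}

/-- The image of a valuation under a strong monoidal functor. -/
def along {V : Type w₁} [Category.{w₂} V] [MonoidalCategory V] (E : SigValuation T C) (F : C ⥤ V)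
    [F.Monoidal] : SigValuation T V where
  obj Z := F.obj (E.obj Z)
  map f := (tensorListComparison F E.obj (T.dom f)).hom ≫ F.map (E.map f) ≫
    (tensorListComparison F E.obj (T.cod f)).inv

/-- Isomorphisms of valuations. -/
structure Iso (x y : SigValuation T C) where
  app (Z : T.O) : x.obj Z ≅ y.obj Z
  comm (f : T.M) : x.map f ≫ tensorListMap (fun Z => (app Z).hom) (T.cod f) =
    tensorListMap (fun Z => (app Z).hom) (T.dom f) ≫ y.map f

/-- The universal property of the free compact closed category on a signature, for a valuation `E`
in a symmetric monoidal category `C`: every valuation `x` in a compact closed category `V` extends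
along `E` to a symmetric (strong) monoidal functor from `C` to `V`, and this functor is unique up to
a unique monoidal natural isomorphism that is compatible with `x`.
(A right dual of `A` in the sense of maps `A ⊗ A* ⟶ I` and `I ⟶ A* ⊗ A` is called a left dual in
Mathlib, so that a compact closed category is a symmetric left rigid category.) -/
def IsFreeCompactClosed [SymmetricCategory C] (E : SigValuation T C) : Prop :=
  ∀ (V : Type w₁) [Category.{w₂} V] [MonoidalCategory V] [SymmetricCategory V]
    [LeftRigidCategory V] (x : SigValuation T V),
    (∃ (F : C ⥤ V) (_ : F.Braided), Nonempty (Iso (E.along F) x)) ∧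
    ∀ (F G : C ⥤ V) [F.Braided] [G.Braided] (φ : Iso (E.along F) x) (ψ : Iso (E.along G) x),
      ∃! θ : F ≅ G, NatTrans.IsMonoidal θ.hom ∧
        ∀ Z, θ.hom.app (E.obj Z) ≫ (ψ.app Z).hom = (φ.app Z).hom

end SigValuation

/-- Strict monoidal categories: associators and unitors are identities. -/
structure IsStrictMonoidal (V : Type w₁) [Category.{w₂} V] [MonoidalCategory V] : Prop where
  associator (A B C : V) : Arrow.mk (α_ A B C).hom = Arrow.mk (𝟙 (A ⊗ B ⊗ C))
  leftUnitor (A : V) : Arrow.mk (λ_ A).hom = Arrow.mk (𝟙 A)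
  rightUnitor (A : V) : Arrow.mk (ρ_ A).hom = Arrow.mk (𝟙 A)

end free

namespace FCsp

variable {T : MonoidalSignature.{u, v}} [SymmetricMonoidalLaws T]

/-- The embedding of the signature: an object symbol is sent to a single positive wire-vertex of
that type, and a morphism symbol to a single box-vertex with its inputs and outputs. -/
noncomputable def generators (T : MonoidalSignature.{u, v}) [SymmetricMonoidalLaws T] :
    SigValuation T (FCsp T) where
  obj Z := FramedPointGraph.point Z
  map f := mk (X := FramedPointGraph.word (T.dom f)) (Y := FramedPointGraph.word (T.cod f))
    (FramedCospan.box f)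

/-- A functor to a strict symmetric monoidal category is a strict symmetric monoidal functor if it
preserves the tensor product, its unit and the symmetry on the nose; as framed point graphs are to
be considered up to isomorphism of framed point graphs here, it also has to send reframings to
identities. -/
structure IsStrictFunctor {V : Type w₁} [Category.{w₂} V] [MonoidalCategory V] [SymmetricCategory V]
    (F : FCsp T ⥤ V) : Prop where
  obj_unit : F.obj (𝟙_ (FCsp T)) = 𝟙_ V
  obj_tensor (X Y : FCsp T) : F.obj (X ⊗ Y) = F.obj X ⊗ F.obj Y
  map_tensor {X Y X' Y' : FCsp T} (f : X ⟶ Y) (f' : X' ⟶ Y') :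
    Arrow.mk (F.map (f ⊗ₘ f')) = Arrow.mk (F.map f ⊗ₘ F.map f')
  map_braiding (X Y : FCsp T) :
    Arrow.mk (F.map (β_ X Y).hom) = Arrow.mk (β_ (F.obj X) (F.obj Y)).hom
  map_reframing {X Y : FCsp T} (φ : FramedPointGraph.Perm X Y) :
    φ.IsReframing → Arrow.mk (F.map (ofPerm φ)) = Arrow.mk (𝟙 (F.obj X))

/-- The strict universal property: every valuation `x` in a strict compact closed category `V` (with
a chosen compact structure on every object) extends to a unique strict symmetric monoidal functor
that preserves the compact structure of the generating objects. -/
def IsStrictlyFree (T : MonoidalSignature.{u, v}) [SymmetricMonoidalLaws T] : Prop :=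
  ∀ (V : Type w₁) [Category.{w₂} V] [MonoidalCategory V] [SymmetricCategory V]
    [LeftRigidCategory V] (_ : IsStrictMonoidal V) (x : SigValuation T V),
    ∃! F : FCsp T ⥤ V, IsStrictFunctor F ∧
      (∀ Z, F.obj ((generators T).obj Z) = x.obj Z) ∧
      (∀ f, Arrow.mk (F.map ((generators T).map f)) = Arrow.mk (x.map f)) ∧
      ∀ Z, F.obj (dual ((generators T).obj Z)) = (ᘁ(x.obj Z) : V) ∧
        Arrow.mk (F.map (cup ((generators T).obj Z))) = Arrow.mk (ε_ (ᘁ(x.obj Z)) (x.obj Z)) ∧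
        Arrow.mk (F.map (cap ((generators T).obj Z))) = Arrow.mk (η_ (ᘁ(x.obj Z)) (x.obj Z))

end FCsp

attribute [reducible] FramedCospan.compGraph FramedCospan.comp FramedCospan.sumGraph
  FramedCospan.tensor FramedCospan.wires FramedCospan.perm FramedPointGraph.tensor
  FramedPointGraph.dual FramedPointGraph.unit FramedPointGraph.point FramedCospan.cup
  FramedCospan.cap FramedPointGraph.Perm.refl FramedPointGraph.Perm.symm
  FramedPointGraph.Perm.assoc FramedPointGraph.Perm.leftUnit FramedPointGraph.Perm.rightUnit
  FramedPointGraph.Perm.swap FramedCospan.box FCsp.tensorObj FCsp.unit FCsp.dual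

/-! ## Fusing two wire-vertices -/

namespace TypedGraph

variable {T : MonoidalSignature.{u, v}} (G : TypedGraph T)

/-- `p` and `q` are different wire-vertices of the same type, and every edge out of `p` as well as
every edge into `q` runs from `p` to `q`. -/
structure Fusable (p q : G.V) : Prop where
  ne : p ≠ q
  ty : G.τ.onV p = G.τ.onV q
  wire : G.IsWire p
  out : ∀ e, G.src e = p → G.tgt e = q
  inn : ∀ e, G.tgt e = q → G.src e = p

variable {G} {p q : G.V}

open Classical in
/-- The retraction of the vertices of `G` that sends `q` to `p`. -/
noncomputable def fuseMap (h : G.Fusable p q) (x : G.V) : {x // x ≠ q} :=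
  if hx : x = q then ⟨p, h.ne⟩ else ⟨x, hx⟩

theorem fuseMap_self (h : G.Fusable p q) : fuseMap h q = ⟨p, h.ne⟩ := dif_pos rfl

theorem fuseMap_of_ne (h : G.Fusable p q) {x : G.V} (hx : x ≠ q) : fuseMap h x = ⟨x, hx⟩ :=
  dif_neg hx

theorem fuseMap_lift {S : Type*} (h : G.Fusable p q) (f : G.V → S) (hf : f p = f q) (x : G.V) :
    f (fuseMap h x).1 = f x := by
  by_cases hx : x = q
  · subst hx; rw [fuseMap_self]; exact hf
  · rw [fuseMap_of_ne h hx]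

/-- The graph in which `p` and `q` are merged and the edges from `p` to `q` are removed. -/
noncomputable abbrev fuse (h : G.Fusable p q) : TypedGraph T where
  V := {x // x ≠ q}
  E := {e // ¬ (G.src e = p ∧ G.tgt e = q)}
  src e := fuseMap h (G.src e.1)
  tgt e := fuseMap h (G.tgt e.1)
  τ :=
    { onV := fun x => G.τ.onV x.1
      onE := fun e => G.τ.onE e.1
      src_comm := fun e => (fuseMap_lift h G.τ.onV h.ty _).trans (G.τ.src_comm e.1)
      tgt_comm := fun e => (fuseMap_lift h G.τ.onV h.ty _).trans (G.τ.tgt_comm e.1) }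

variable (h : G.Fusable p q)
include h

theorem fuse_tgt_ne (e : (fuse h).E) : G.tgt e.1 ≠ q := fun he => e.2 ⟨h.inn _ he, he⟩

theorem fuse_src_ne (e : (fuse h).E) : G.src e.1 ≠ p := fun he => e.2 ⟨he, h.out _ he⟩

theorem fuse_tgt (e : (fuse h).E) : ((fuse h).tgt e).1 = G.tgt e.1 :=
  congrArg Subtype.val (fuseMap_of_ne h (fuse_tgt_ne h e))

theorem fuse_src_eq_iff (e : (fuse h).E) (x : (fuse h).V) :
    (fuse h).src e = x ↔ (x.1 ≠ p ∧ G.src e.1 = x.1) ∨ (x.1 = p ∧ G.src e.1 = q) := by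
  change fuseMap h (G.src e.1) = x ↔ _
  have := fuse_src_ne h e
  obtain ⟨x, hx⟩ := x
  by_cases he : G.src e.1 = q
  · rw [he, fuseMap_self, Subtype.mk.injEq]
    constructor
    · rintro rfl; exact .inr ⟨rfl, rfl⟩
    · rintro (⟨-, h'⟩ | ⟨h', -⟩)
      · exact absurd h'.symm hx
      · exact h'.symm
  · rw [fuseMap_of_ne h he, Subtype.mk.injEq]
    constructor
    · rintro rfl; exact .inl ⟨this, rfl⟩
    · rintro (⟨-, h'⟩ | ⟨-, h'⟩)
      · exact h'
      · exact absurd h' he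

theorem fuse_isInput (x : (fuse h).V) : (fuse h).IsInput x ↔ G.IsInput x.1 := by
  refine and_congr Iff.rfl ⟨fun hx e he => ?_, fun hx e he => ?_⟩
  · refine hx ⟨e, fun h' => x.2 (he.symm.trans h'.2)⟩ (Subtype.ext ?_)
    rw [fuse_tgt]; exact he
  · exact hx e.1 (by rw [← fuse_tgt h, he])

theorem fuse_isOutput (x : (fuse h).V) :
    (fuse h).IsOutput x ↔ (x.1 ≠ p ∧ G.IsOutput x.1) ∨ (x.1 = p ∧ G.IsOutput q) := by
  have hw : (fuse h).IsWire x ↔ G.IsWire x.1 := Iff.rfl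
  have hq : G.IsWire q := by obtain ⟨Z, hZ⟩ := h.wire; exact ⟨Z, h.ty ▸ hZ⟩
  by_cases hx : x.1 = p
  · simp only [hx, ne_eq, not_true_eq_false, false_and, true_and, false_or]
    refine ⟨fun h' => ⟨hq, fun e he => h'.2 ⟨e, fun h'' => h.ne ?_⟩ ?_⟩, fun h' => ⟨hw.2 (hx ▸ h.wire), fun e he => ?_⟩⟩
    · rw [← he, h''.1]
    · rw [fuse_src_eq_iff]; exact .inr ⟨hx, he⟩
    · rw [fuse_src_eq_iff] at he
      rcases he with he | he
      · exact he.1 hx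
      · exact h'.2 _ he.2
  · simp only [hx, ne_eq, not_false_eq_true, true_and, false_and, or_false]
    refine and_congr hw ⟨fun h' e he => h' ⟨e, fun h'' => hx (he ▸ h''.1)⟩ ?_, fun h' e he => ?_⟩
    · rw [fuse_src_eq_iff]; exact .inl ⟨hx, he⟩
    · rw [fuse_src_eq_iff] at he
      rcases he with he | he
      · exact h' _ he.2
      · exact hx he.1

theorem fuse_isString (hG : G.IsStringGraph) : (fuse h).IsStringGraph where
  finite_V := by have := hG.finite_V; exact Subtype.finite
  finite_E := by have := hG.finite_E; exact Subtype.finite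
  local_iso := by
    intro x hx
    have hxp : x.1 ≠ p := by
      intro h'
      exact FramedCospan.not_wire_of_box (G := G) (p := x.1) hx (h' ▸ h.wire)
    have key : ∀ e : (fuse h).E, e ∈ (fuse h).nbhd x ↔ e.1 ∈ G.nbhd x.1 := by
      intro e
      change (_ ∨ _) ↔ (_ ∨ _)
      rw [fuse_src_eq_iff, ← fuse_tgt h]
      simp [hxp, Subtype.ext_iff]
    have hb := hG.local_iso x.1 hx
    refine ⟨fun e he => hb.mapsTo ((key e).1 he), fun e he e' he' hee => Subtype.ext
      (hb.injOn ((key e).1 he) ((key e').1 he') hee), fun s hs => ?_⟩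
    obtain ⟨e, he, rfl⟩ := hb.surjOn hs
    have : ¬ (G.src e = p ∧ G.tgt e = q) := by
      rintro ⟨h1, h2⟩
      rcases he with he | he
      · exact hxp (he.symm.trans h1)
      · exact x.2 (he.symm.trans h2)
    exact ⟨⟨e, this⟩, (key _).2 he, rfl⟩
  in_unique := by
    intro e e' hw he
    have h1 := fuse_tgt h e
    refine Subtype.ext (hG.in_unique _ _ ?_ ?_)
    · rw [← h1]; exact hw
    · rw [← h1, he, fuse_tgt]
  out_unique := by
    intro e e' hw he
    have h1 := (fuse_src_eq_iff h e' _).1 he.symm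
    have h2 := (fuse_src_eq_iff h e _).1 rfl
    have hq : G.IsWire q := by obtain ⟨Z, hZ⟩ := h.wire; exact ⟨Z, h.ty ▸ hZ⟩
    refine Subtype.ext ?_
    rcases h1 with h1 | h1 <;> rcases h2 with h2 | h2
    · exact hG.out_unique _ _ (by rw [h2.2]; exact hw) (h2.2.trans h1.2.symm)
    · exact absurd h2.1 h1.1
    · exact absurd h1.1 h2.1
    · exact hG.out_unique _ _ (by rw [h2.2]; exact hq) (h2.2.trans h1.2.symm)

end TypedGraph

namespace FramedCospan

variable {T : MonoidalSignature.{u, v}} {X Y : FramedPointGraph T}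

theorem isWire_congr {G H : TypedGraph T} {x : G.V} {y : H.V} (h : H.τ.onV y = G.τ.onV x) :
    H.IsWire y ↔ G.IsWire x := by
  unfold TypedGraph.IsWire; rw [h]

/-- An edge between two wire-vertices with a free end can be contracted. -/
noncomputable abbrev contract (K : FramedCospan X Y) {p q : K.G.V} (h : K.G.Fusable p q) (e : K.G.E)
    (hp : K.G.src e = p) (hq : K.G.tgt e = q)
    (hb : ∀ z z', Sum.elim K.d K.c z = p → Sum.elim K.d K.c z' = q → z = z') :
    FramedCospan X Y :=
  have hpo : ¬ K.G.IsOutput p := fun h => h.2 e hp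
  have hqi : ¬ K.G.IsInput q := fun h => h.2 e hq
  have hnb : ¬ (K.G.IsInput p ∧ K.G.IsOutput q) := by
    rintro ⟨h1, h2⟩
    have h1' : p ∈ Set.range (Sum.elim K.d K.c) := by rw [K.range]; exact .inl h1
    have h2' : q ∈ Set.range (Sum.elim K.d K.c) := by rw [K.range]; exact .inr h2
    obtain ⟨z, hz⟩ := h1'
    obtain ⟨z', hz'⟩ := h2'
    have := hb z z' hz hz'
    subst this
    exact h.ne (hz.symm.trans hz')
  have hin : ∀ z, (K.G.IsInput z ∨ K.G.IsOutput z) →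
      ((TypedGraph.fuse h).IsInput (TypedGraph.fuseMap h z) ↔ K.G.IsInput z) := by
    intro z hz
    rw [TypedGraph.fuse_isInput]
    by_cases hzq : z = q
    · subst hzq
      rw [TypedGraph.fuseMap_self]
      exact ⟨fun h' => absurd ⟨h', hz.resolve_left hqi⟩ hnb, fun h' => absurd h' hqi⟩
    · rw [TypedGraph.fuseMap_of_ne h hzq]
  have hout : ∀ z, (K.G.IsInput z ∨ K.G.IsOutput z) →
      ((TypedGraph.fuse h).IsOutput (TypedGraph.fuseMap h z) ↔ K.G.IsOutput z) := by
    intro z hz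
    rw [TypedGraph.fuse_isOutput]
    by_cases hzq : z = q
    · subst hzq
      rw [TypedGraph.fuseMap_self]
      simp
    · rw [TypedGraph.fuseMap_of_ne h hzq]
      by_cases hzp : z = p
      · subst hzp
        simp only [ne_eq, not_true_eq_false, false_and, true_and, false_or]
        exact ⟨fun h' => absurd ⟨hz.resolve_right hpo, h'⟩ hnb, fun h' => absurd h' hpo⟩
      · simp [hzp]
  have hbd : ∀ z, K.G.IsInput (Sum.elim K.d K.c z) ∨ K.G.IsOutput (Sum.elim K.d K.c z) := by
    intro z
    have : Sum.elim K.d K.c z ∈ Set.range (Sum.elim K.d K.c) := ⟨z, rfl⟩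
    rw [K.range] at this; exact this
  have hel : Sum.elim (fun x => TypedGraph.fuseMap h (K.d x)) (fun y => TypedGraph.fuseMap h (K.c y)) =
      fun z => TypedGraph.fuseMap h (Sum.elim K.d K.c z) := by
    funext z; rcases z with z | z <;> rfl
  { G := TypedGraph.fuse h
    string := TypedGraph.fuse_isString h K.string
    d := fun x => TypedGraph.fuseMap h (K.d x)
    c := fun y => TypedGraph.fuseMap h (K.c y)
    d_ty := fun x => (TypedGraph.fuseMap_lift h K.G.τ.onV h.ty _).trans (K.d_ty x)
    c_ty := fun x => (TypedGraph.fuseMap_lift h K.G.τ.onV h.ty _).trans (K.c_ty x)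
    no_isolated := by
      rintro x ⟨h1, h2⟩
      rw [TypedGraph.fuse_isInput] at h1
      rw [TypedGraph.fuse_isOutput] at h2
      rcases h2 with h2 | h2
      · exact K.no_isolated _ ⟨h1, h2.2⟩
      · exact hnb ⟨h2.1 ▸ h1, h2.2⟩
    injective := by
      rw [hel]
      intro z z' hz
      by_cases h1 : Sum.elim K.d K.c z = q <;> by_cases h2 : Sum.elim K.d K.c z' = q
      · exact K.injective (h1.trans h2.symm)
      · simp only [h1, TypedGraph.fuseMap_self, TypedGraph.fuseMap_of_ne h h2,
          Subtype.mk.injEq] at hz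
        exact (hb z' z hz.symm h1).symm
      · simp only [h2, TypedGraph.fuseMap_self, TypedGraph.fuseMap_of_ne h h1,
          Subtype.mk.injEq] at hz
        exact hb z z' hz h2
      · simp only [TypedGraph.fuseMap_of_ne h h1, TypedGraph.fuseMap_of_ne h h2,
          Subtype.mk.injEq] at hz
        exact K.injective hz
    range := by
      rw [hel]
      ext x
      constructor
      · rintro ⟨z, rfl⟩
        exact (hbd z).imp (hin _ (hbd z)).2 (hout _ (hbd z)).2
      · intro hx
        have hx' : (K.G.IsInput x.1 ∨ K.G.IsOutput x.1) ∨ (x.1 = p ∧ K.G.IsOutput q) := by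
          rcases hx with hx | hx
          · exact .inl (.inl ((TypedGraph.fuse_isInput h x).1 hx))
          · rcases (TypedGraph.fuse_isOutput h x).1 hx with hx | hx
            · exact .inl (.inr hx.2)
            · exact .inr hx
        rcases hx' with hx' | ⟨h1, h2⟩
        · have : x.1 ∈ Set.range (Sum.elim K.d K.c) := by rw [K.range]; exact hx'
          obtain ⟨z, hz⟩ := this
          refine ⟨z, ?_⟩
          simp only [hz]
          exact TypedGraph.fuseMap_of_ne h x.2
        · have : q ∈ Set.range (Sum.elim K.d K.c) := by rw [K.range]; exact .inr h2
          obtain ⟨z, hz⟩ := this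
          refine ⟨z, ?_⟩
          simp only [hz]
          rw [TypedGraph.fuseMap_self]
          exact Subtype.ext h1.symm
    d_sgn := fun x => (hin _ (K.d_bound x)).trans (K.d_sgn x)
    c_sgn := fun y => (hout _ (K.c_bound y)).trans (K.c_sgn y) }

/-! ## Collapsing forests of wires -/

/-- A map of framed cospans that collapses a set of edges between wire-vertices (those that are not
in the range of `inE`): every fibre is a directed tree of collapsed edges. -/
structure Collapse (K L : FramedCospan X Y) where
  onV : K.G.V → L.G.V
  surj : Function.Surjective onV
  inE : L.G.E → K.G.E
  inj : Function.Injective inE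
  src_comm : ∀ e, onV (K.G.src (inE e)) = L.G.src e
  tgt_comm : ∀ e, onV (K.G.tgt (inE e)) = L.G.tgt e
  tyV_comm : ∀ x, L.G.τ.onV (onV x) = K.G.τ.onV x
  tyE_comm : ∀ e, L.G.τ.onE e = K.G.τ.onE (inE e)
  d_comm : ∀ x, onV (K.d x) = L.d x
  c_comm : ∀ y, onV (K.c y) = L.c y
  wire : ∀ e, e ∉ Set.range inE → K.G.IsWire (K.G.src e)
  fib : ∀ e, e ∉ Set.range inE → onV (K.G.src e) = onV (K.G.tgt e)
  root : ∀ x x', onV x = onV x' → (∀ e, e ∉ Set.range inE → K.G.tgt e ≠ x) →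
    (∀ e, e ∉ Set.range inE → K.G.tgt e ≠ x') → x = x'
  rank : K.G.V → ℕ
  rank_lt : ∀ e, e ∉ Set.range inE → rank (K.G.src e) < rank (K.G.tgt e)

theorem wireHomeo_of_iso {K L : FramedCospan X Y} (i : Iso K L) : wireHomeo X Y K L :=
  .rel _ _ (.inl ⟨i⟩)

theorem wireHomeo_of_contraction {K L : FramedCospan X Y} (i : Contraction K L) :
    wireHomeo X Y K L :=
  .rel _ _ (.inr ⟨i⟩)

theorem Collapse.bound_inj {K L : FramedCospan X Y} (i : Collapse K L) (z z')
    (h : i.onV (Sum.elim K.d K.c z) = i.onV (Sum.elim K.d K.c z')) : z = z' := by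
  apply L.injective
  have : ∀ z, i.onV (Sum.elim K.d K.c z) = Sum.elim L.d L.c z := by
    rintro (z | z)
    · exact i.d_comm z
    · exact i.c_comm z
  rw [← this, ← this, h]

theorem Collapse.fusable {K L : FramedCospan X Y} (i : Collapse K L) {e : K.G.E}
    (he : e ∉ Set.range i.inE) : K.G.Fusable (K.G.src e) (K.G.tgt e) where
  ne h := absurd (i.rank_lt e he) (by rw [h]; exact lt_irrefl _)
  ty := by rw [← i.tyV_comm, ← i.tyV_comm, i.fib e he]
  wire := i.wire e he
  out e' he' := by rw [K.string.out_unique e' e (he' ▸ i.wire e he) he']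
  inn e' he' := by
    have : K.G.IsWire (K.G.tgt e) :=
      (isWire_congr (by rw [← i.tyV_comm, ← i.tyV_comm, i.fib e he])).1 (i.wire e he)
    rw [K.string.in_unique e' e (he' ▸ this) he']

theorem Collapse.homeo_aux (n : ℕ) : ∀ {K L : FramedCospan X Y} (_ : Collapse K L),
    Nat.card K.G.E = n → wireHomeo X Y K L := by
  induction n using Nat.strong_induction_on with
  | _ n ih =>
  intro K L i hn
  by_cases hr : ∀ e, e ∈ Set.range i.inE
  · have hV : Function.Injective i.onV := fun x x' h =>
      i.root x x' h (fun e he => absurd (hr e) he) (fun e he => absurd (hr e) he)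
    let eE : L.G.E ≃ K.G.E := Equiv.ofBijective i.inE ⟨i.inj, hr⟩
    have hE : ∀ e, i.inE (eE.symm e) = e := eE.apply_symm_apply
    refine wireHomeo_of_iso
      { onV := Equiv.ofBijective i.onV ⟨hV, i.surj⟩
        onE := eE.symm
        src_comm := fun e => ?_
        tgt_comm := fun e => ?_
        tyV_comm := i.tyV_comm
        tyE_comm := fun e => ?_
        d_comm := i.d_comm
        c_comm := i.c_comm }
    · change i.onV _ = _
      rw [← i.src_comm, hE]
    · change i.onV _ = _
      rw [← i.tgt_comm, hE]
    · rw [i.tyE_comm, hE]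
  · push Not at hr
    obtain ⟨e, he⟩ := hr
    have hf := i.fusable he
    have heq : ∀ e', (K.G.src e' = K.G.src e ∧ K.G.tgt e' = K.G.tgt e) ↔ e' = e := fun e' =>
      ⟨fun h => K.string.out_unique _ _ (h.1 ▸ i.wire e he) h.1, fun h => h ▸ ⟨rfl, rfl⟩⟩
    let K' := K.contract hf e rfl rfl (fun z z' h h' => i.bound_inj z z' (by
      rw [h, h', i.fib e he]))
    have hl : ∀ x, i.onV (TypedGraph.fuseMap hf x).1 = i.onV x :=
      TypedGraph.fuseMap_lift hf i.onV (i.fib e he)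
    have htw : K.G.IsWire (K.G.tgt e) := (isWire_congr hf.ty).1 hf.wire
    let cn : Contraction K K' :=
      { e := e
        ne := hf.ne
        src_wire := hf.wire
        tgt_wire := htw
        onV := TypedGraph.fuseMap hf
        onV_surjective := fun x => ⟨x.1, TypedGraph.fuseMap_of_ne hf x.2⟩
        onV_eq_iff := by
          intro x y
          by_cases hx : x = K.G.tgt e <;> by_cases hy : y = K.G.tgt e
          · simp [hx, hy]
          · rw [hx, TypedGraph.fuseMap_self, TypedGraph.fuseMap_of_ne hf hy]
            have := hf.ne
            simp only
            grind
          · rw [hy, TypedGraph.fuseMap_self, TypedGraph.fuseMap_of_ne hf hx]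
            have := hf.ne
            simp only
            grind
          · rw [TypedGraph.fuseMap_of_ne hf hx, TypedGraph.fuseMap_of_ne hf hy]
            exact Subtype.ext_iff.trans (by simp [hx, hy])
        onE := Equiv.subtypeEquivRight fun e' => not_congr (heq e').symm
        src_comm := fun _ => rfl
        tgt_comm := fun _ => rfl
        tyV_comm := TypedGraph.fuseMap_lift hf K.G.τ.onV hf.ty
        tyE_comm := fun _ => rfl
        d_comm := fun _ => rfl
        c_comm := fun _ => rfl }
    have hS : ∀ e' : K'.G.E, (∀ e'' : L.G.E, i.inE e'' ≠ e'.1) → e'.1 ∉ Set.range i.inE := by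
      rintro e' h ⟨e'', h''⟩
      exact h e'' h''
    let inE' : L.G.E → K'.G.E := fun e' => ⟨i.inE e', fun h => he ⟨e', (heq _).1 h⟩⟩
    have hS' : ∀ e' : K'.G.E, e' ∉ Set.range inE' → e'.1 ∉ Set.range i.inE := by
      rintro e' h ⟨e'', h''⟩
      exact h ⟨e'', Subtype.ext h''⟩
    have hS'' : ∀ x : K'.G.V, (∀ e', e' ∉ Set.range inE' → K'.G.tgt e' ≠ x) →
        ∀ e', e' ∉ Set.range i.inE → K.G.tgt e' ≠ x.1 := by
      rintro x h e' he' hx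
      have h1 : ¬ (K.G.src e' = K.G.src e ∧ K.G.tgt e' = K.G.tgt e) := fun h' =>
        x.2 (hx.symm.trans h'.2)
      refine h ⟨e', h1⟩ ?_ (Subtype.ext ?_)
      · rintro ⟨e'', h''⟩
        exact he' ⟨e'', congrArg Subtype.val h''⟩
      · exact (TypedGraph.fuse_tgt hf _).trans hx
    let i' : Collapse K' L :=
      { onV := fun x => i.onV x.1
        surj := fun y => by
          obtain ⟨x, rfl⟩ := i.surj y
          exact ⟨TypedGraph.fuseMap hf x, hl x⟩
        inE := inE'
        inj := fun e e' h => i.inj (congrArg Subtype.val h)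
        src_comm := fun e => (hl _).trans (i.src_comm e)
        tgt_comm := fun e => (hl _).trans (i.tgt_comm e)
        tyV_comm := fun x => i.tyV_comm x.1
        tyE_comm := fun e => i.tyE_comm e
        d_comm := fun x => (hl _).trans (i.d_comm x)
        c_comm := fun x => (hl _).trans (i.c_comm x)
        wire := fun e' h' => by
          refine (isWire_congr (TypedGraph.fuseMap_lift hf K.G.τ.onV hf.ty _)).2
            (i.wire e'.1 (hS' e' h'))
        fib := fun e' h' => by
          refine (hl _).trans ((i.fib e'.1 (hS' e' h')).trans (hl _).symm)
        root := fun x x' h h1 h2 => Subtype.ext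
          (i.root x.1 x'.1 h (hS'' x h1) (hS'' x' h2))
        rank := fun x => i.rank x.1
        rank_lt := fun e' h' => by
          have h1 := i.rank_lt e'.1 (hS' e' h')
          have h2 : (K'.G.tgt e').1 = K.G.tgt e'.1 := TypedGraph.fuse_tgt hf e'
          rw [h2]
          refine lt_of_le_of_lt ?_ h1
          change i.rank (TypedGraph.fuseMap hf _).1 ≤ _
          by_cases h3 : K.G.src e'.1 = K.G.tgt e
          · rw [h3, TypedGraph.fuseMap_self]
            exact (i.rank_lt e he).le
          · rw [TypedGraph.fuseMap_of_ne hf h3] }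
    refine Setoid.trans' _ (wireHomeo_of_contraction cn) (ih _ ?_ i' rfl)
    rw [← hn]
    have := K.string.finite_E
    have := Fintype.ofFinite K.G.E
    change Nat.card {e' // ¬ (K.G.src e' = K.G.src e ∧ K.G.tgt e' = K.G.tgt e)} < _
    exact Finite.card_subtype_lt (x := e) (by simp)

theorem Collapse.homeo {K L : FramedCospan X Y} (i : Collapse K L) : wireHomeo X Y K L :=
  i.homeo_aux _ rfl

/-- An isomorphism is a collapse of no edges. -/
def Collapse.ofIso {K L : FramedCospan X Y} (i : Iso K L) : Collapse K L :=
  have h : ∀ e, e ∈ Set.range i.onE.symm := i.onE.symm.surjective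
  { onV := i.onV
    surj := i.onV.surjective
    inE := i.onE.symm
    inj := i.onE.symm.injective
    src_comm := fun e => by rw [i.src_comm, Equiv.apply_symm_apply]
    tgt_comm := fun e => by rw [i.tgt_comm, Equiv.apply_symm_apply]
    tyV_comm := i.tyV_comm
    tyE_comm := fun e => by rw [← i.tyE_comm, Equiv.apply_symm_apply]
    d_comm := i.d_comm
    c_comm := i.c_comm
    wire := fun e he => absurd (h e) he
    fib := fun e he => absurd (h e) he
    root := fun x x' h _ _ => i.onV.injective h
    rank := fun _ => 0
    rank_lt := fun e he => absurd (h e) he }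

open Classical in
/-- A contraction is a collapse of one edge. -/
noncomputable def Collapse.ofContraction {K L : FramedCospan X Y} (i : Contraction K L) :
    Collapse K L :=
  have h : ∀ e, e ∉ Set.range (fun e' => (i.onE.symm e').1) → e = i.e := fun e he => by
    by_contra hne
    exact he ⟨i.onE ⟨e, hne⟩, by simp⟩
  have h' : i.e ∉ Set.range (fun e' => (i.onE.symm e').1) := by
    rintro ⟨e', he'⟩
    exact (i.onE.symm e').2 he'
  { onV := i.onV
    surj := i.onV_surjective
    inE := fun e => (i.onE.symm e).1
    inj := Subtype.val_injective.comp i.onE.symm.injective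
    src_comm := fun e => by rw [i.src_comm, Equiv.apply_symm_apply]
    tgt_comm := fun e => by rw [i.tgt_comm, Equiv.apply_symm_apply]
    tyV_comm := i.tyV_comm
    tyE_comm := fun e => by rw [← i.tyE_comm, Equiv.apply_symm_apply]
    d_comm := i.d_comm
    c_comm := i.c_comm
    wire := fun e he => by rw [h e he]; exact i.src_wire
    fib := fun e he => by rw [h e he, i.onV_eq_iff]; exact .inr (.inl ⟨rfl, rfl⟩)
    root := fun x x' hx h1 h2 => by
      rcases (i.onV_eq_iff x x').1 hx with h3 | ⟨-, h3⟩ | ⟨h3, -⟩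
      · exact h3
      · exact absurd h3.symm (h2 _ h')
      · exact absurd h3.symm (h1 _ h')
    rank := fun x => if x = K.G.tgt i.e then 1 else 0
    rank_lt := fun e he => by rw [h e he]; simp [i.ne] }

theorem wireHomeo_lift {S : Type*} (f : FramedCospan X Y → S)
    (hf : ∀ K L, Collapse K L → f K = f L) {K L : FramedCospan X Y} (h : wireHomeo X Y K L) :
    f K = f L := by
  induction h with
  | rel K L h =>
    rcases h with ⟨⟨i⟩⟩ | ⟨⟨i⟩⟩
    · exact hf _ _ (.ofIso i)
    · exact hf _ _ (.ofContraction i)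
  | refl => rfl
  | symm _ _ _ ih => exact ih.symm
  | trans _ _ _ _ _ ih ih' => exact ih.trans ih'

end FramedCospan

/-! ## Composition and tensor product modulo wire-homeomorphism -/

namespace FramedCospan

variable {T : MonoidalSignature.{u, v}} {X Y Z X' Y' Z' : FramedPointGraph T}

section lift

variable {K : FramedCospan X Y} {L : FramedCospan Y Z} {S : Type*}

/-- The universal property of the pushout, on vertices. -/
def compLift (f : K.G.V → S) (g : L.G.V → S) (h : ∀ y, f (K.c y) = g (L.d y)) :
    (K.compGraph L).V → S :=
  Quotient.lift (Sum.elim f g) (by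
    rintro (p | p) (q | q) hpq
    · exact congrArg f hpq
    · obtain ⟨y, rfl, rfl⟩ := hpq
      exact h y
    · obtain ⟨y, rfl, rfl⟩ := hpq
      exact (h y).symm
    · exact congrArg g hpq)

theorem comp_glue (y : Y.V) : K.compInl L (K.c y) = K.compInr L (L.d y) :=
  compInl_eq_inr.2 ⟨y, rfl, rfl⟩

theorem comp_ind {P : (K.compGraph L).V → Prop} (h1 : ∀ p, P (K.compInl L p))
    (h2 : ∀ p, P (K.compInr L p)) (z) : P z := by
  rcases comp_cases z with ⟨q, rfl⟩ | ⟨q, rfl⟩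
  · exact h1 q
  · exact h2 q

end lift

/-- A collapse of the first factor of a composite. -/
noncomputable def Collapse.compLeft {K K' : FramedCospan X Y} (i : Collapse K K')
    (L : FramedCospan Y Z) : Collapse (K.comp L) (K'.comp L) :=
  have hr : ∀ e, e ∉ Set.range (Sum.map i.inE (id : L.G.E → L.G.E)) →
      ∃ e', e' ∉ Set.range i.inE ∧ e = .inl e' := by
    rintro (e | e) he
    · exact ⟨e, fun ⟨e', h'⟩ => he ⟨.inl e', congrArg _ h'⟩, rfl⟩
    · exact absurd ⟨.inr e, rfl⟩ he
  have hr' : ∀ e', e' ∉ Set.range i.inE →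
      Sum.inl e' ∉ Set.range (Sum.map i.inE (id : L.G.E → L.G.E)) := by
    rintro e' he ⟨e | e, h⟩
    · exact he ⟨e, Sum.inl_injective h⟩
    · cases h
  have hinj : Function.Injective (K.compInl L) := fun _ _ h => compInl_eq_inl.1 h
  { onV := compLift (fun p => K'.compInl L (i.onV p)) (K'.compInr L)
      (fun y => by rw [i.c_comm]; exact comp_glue y)
    surj := comp_ind (fun p => by
      obtain ⟨p, rfl⟩ := i.surj p
      exact ⟨K.compInl L p, rfl⟩) (fun p => ⟨K.compInr L p, rfl⟩)
    inE := Sum.map i.inE id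
    inj := i.inj.sumMap Function.injective_id
    src_comm := by
      rintro (e | e)
      · exact congrArg (K'.compInl L) (i.src_comm e)
      · rfl
    tgt_comm := by
      rintro (e | e)
      · exact congrArg (K'.compInl L) (i.tgt_comm e)
      · rfl
    tyV_comm := comp_ind (fun p => i.tyV_comm p) (fun p => rfl)
    tyE_comm := by
      rintro (e | e)
      · exact i.tyE_comm e
      · rfl
    d_comm := fun x => congrArg (K'.compInl L) (i.d_comm x)
    c_comm := fun _ => rfl
    wire := fun e he => by
      obtain ⟨e', h', rfl⟩ := hr e he
      exact i.wire e' h'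
    fib := fun e he => by
      obtain ⟨e', h', rfl⟩ := hr e he
      exact congrArg (K'.compInl L) (i.fib e' h')
    root := by
      have key : ∀ p p', K'.compInl L (i.onV p) = K'.compInl L (i.onV p') →
        (∀ e, e ∉ Set.range (Sum.map i.inE (id : L.G.E → L.G.E)) →
          (K.compGraph L).tgt e ≠ K.compInl L p) →
        (∀ e, e ∉ Set.range (Sum.map i.inE (id : L.G.E → L.G.E)) →
          (K.compGraph L).tgt e ≠ K.compInl L p') → K.compInl L p = K.compInl L p' := by
        intro p p' h h1 h2
        refine congrArg _ (i.root p p' (compInl_eq_inl.1 h) (fun e he h3 => ?_) (fun e he h3 => ?_))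
        · exact h1 (.inl e) (hr' e he) (congrArg (K.compInl L) h3)
        · exact h2 (.inl e) (hr' e he) (congrArg (K.compInl L) h3)
      refine comp_ind (fun p => comp_ind (fun p' => key p p') fun p' h => ?_)
        (fun p => comp_ind (fun p' h => ?_) fun p' h => ?_)
      · obtain ⟨y, hy, rfl⟩ := compInl_eq_inr.1 h
        rw [← comp_glue y]
        exact key p (K.c y) (by rw [i.c_comm, hy])
      · obtain ⟨y, hy, rfl⟩ := compInr_eq_inl.1 h
        rw [← comp_glue y]
        exact key (K.c y) p' (by rw [i.c_comm, hy])
      · intro _ _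
        exact congrArg _ (compInr_eq_inr.1 h)
    rank := Function.extend (K.compInl L) i.rank 0
    rank_lt := fun e he => by
      obtain ⟨e', h', rfl⟩ := hr e he
      change Function.extend (K.compInl L) i.rank 0 (K.compInl L _) <
        Function.extend (K.compInl L) i.rank 0 (K.compInl L _)
      rw [hinj.extend_apply, hinj.extend_apply]
      exact i.rank_lt e' h' }

/-- A collapse of the first factor of a tensor product. -/
noncomputable def Collapse.tensorLeft {K K' : FramedCospan X Y} (i : Collapse K K')
    (L : FramedCospan X' Y') : Collapse (K.tensor L) (K'.tensor L) :=
  have hr : ∀ e, e ∉ Set.range (Sum.map i.inE (id : L.G.E → L.G.E)) →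
      ∃ e', e' ∉ Set.range i.inE ∧ e = .inl e' := by
    rintro (e | e) he
    · exact ⟨e, fun ⟨e', h'⟩ => he ⟨.inl e', congrArg _ h'⟩, rfl⟩
    · exact absurd ⟨.inr e, rfl⟩ he
  have hr' : ∀ e', e' ∉ Set.range i.inE →
      Sum.inl e' ∉ Set.range (Sum.map i.inE (id : L.G.E → L.G.E)) := by
    rintro e' he ⟨e | e, h⟩
    · exact he ⟨e, Sum.inl_injective h⟩
    · cases h
  { onV := Sum.map i.onV id
    surj := i.surj.sumMap Function.surjective_id
    inE := Sum.map i.inE id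
    inj := i.inj.sumMap Function.injective_id
    src_comm := by
      rintro (e | e)
      · exact congrArg Sum.inl (i.src_comm e)
      · rfl
    tgt_comm := by
      rintro (e | e)
      · exact congrArg Sum.inl (i.tgt_comm e)
      · rfl
    tyV_comm := by
      rintro (p | p)
      · exact i.tyV_comm p
      · rfl
    tyE_comm := by
      rintro (e | e)
      · exact i.tyE_comm e
      · rfl
    d_comm := by
      rintro (x | x)
      · exact congrArg Sum.inl (i.d_comm x)
      · rfl
    c_comm := by
      rintro (x | x)
      · exact congrArg Sum.inl (i.c_comm x)
      · rfl
    wire := fun e he => by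
      obtain ⟨e', h', rfl⟩ := hr e he
      exact i.wire e' h'
    fib := fun e he => by
      obtain ⟨e', h', rfl⟩ := hr e he
      exact congrArg Sum.inl (i.fib e' h')
    root := by
      rintro (p | p) (p' | p') h h1 h2
      · refine congrArg Sum.inl (i.root p p' (Sum.inl_injective h) (fun e he h3 => ?_)
          (fun e he h3 => ?_))
        · exact h1 (.inl e) (hr' e he) (congrArg Sum.inl h3)
        · exact h2 (.inl e) (hr' e he) (congrArg Sum.inl h3)
      · cases h
      · cases h
      · exact congrArg Sum.inr (show p = p' from Sum.inr_injective h)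
    rank := Sum.elim i.rank fun _ => 0
    rank_lt := fun e he => by
      obtain ⟨e', h', rfl⟩ := hr e he
      exact i.rank_lt e' h' }

/-- The same graph, read as a framed cospan from `Y*` to `X*`. -/
@[reducible] def flip (K : FramedCospan X Y) : FramedCospan Y.dual X.dual where
  G := K.G
  string := K.string
  d := K.c
  c := K.d
  d_ty := K.c_ty
  c_ty := K.d_ty
  no_isolated := K.no_isolated
  injective := by
    rintro (x | x) (y | y) h
    · exact congrArg _ (K.c_injective h)
    · exact absurd h.symm (K.d_ne_c _ _)
    · exact absurd h (K.d_ne_c _ _)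
    · exact congrArg _ (K.d_injective h)
  range := by
    rw [← K.range]
    ext p
    simp [or_comm]
  d_sgn y := (K.c_in y).trans (by simp)
  c_sgn x := (K.d_out x).trans (by simp)

def Collapse.flip {K L : FramedCospan X Y} (i : Collapse K L) : Collapse K.flip L.flip :=
  { i with d_comm := i.c_comm, c_comm := i.d_comm }

theorem homeo_flip {K L : FramedCospan X Y} (h : wireHomeo X Y K L) :
    wireHomeo _ _ K.flip L.flip :=
  Quotient.exact (wireHomeo_lift (fun K => Quotient.mk (wireHomeo _ _) K.flip)
    (fun _ _ i => Quotient.sound i.flip.homeo) h)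

theorem homeo_unflip {K L : FramedCospan X Y} (h : wireHomeo _ _ K.flip L.flip) :
    wireHomeo X Y K L := by
  have key : ∀ M N : FramedCospan Y.dual X.dual, wireHomeo _ _ M N →
      ∀ K L : FramedCospan X Y, K.flip = M → L.flip = N → wireHomeo X Y K L := by
    intro M N h
    let g : FramedCospan Y.dual X.dual → FramedCospan X Y := fun M =>
      { M with
        d := M.c
        c := M.d
        d_ty := M.c_ty
        c_ty := M.d_ty
        injective := M.flip.injective
        range := M.flip.range
        d_sgn := fun x => (M.c_in x).trans (by simp)
        c_sgn := fun y => (M.d_out y).trans (by simp) }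
    have hg : wireHomeo _ _ (g M) (g N) := Quotient.exact
      (wireHomeo_lift (fun K => Quotient.mk (wireHomeo _ _) (g K))
        (fun _ _ i => Quotient.sound (Collapse.homeo
          { i with d_comm := i.c_comm, c_comm := i.d_comm })) h)
    rintro K L rfl rfl
    exact hg
  exact key _ _ h K L rfl rfl

/-- Flipping reverses composition. -/
def flipComp (K : FramedCospan X Y) (L : FramedCospan Y Z) :
    Iso (K.comp L).flip (L.flip.comp K.flip) where
  onV :=
    { toFun := compLift (K := K) (L := L) (L.flip.compInr K.flip) (L.flip.compInl K.flip)
        (fun y => (comp_glue (K := L.flip) (L := K.flip) y).symm)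
      invFun := compLift (K := L.flip) (L := K.flip) (K.compInr L) (K.compInl L)
        (fun y => (comp_glue (K := K) (L := L) y).symm)
      left_inv := comp_ind (fun _ => rfl) (fun _ => rfl)
      right_inv := comp_ind (fun _ => rfl) (fun _ => rfl) }
  onE := Equiv.sumComm _ _
  src_comm := by rintro (e | e) <;> rfl
  tgt_comm := by rintro (e | e) <;> rfl
  tyV_comm := comp_ind (fun _ => rfl) (fun _ => rfl)
  tyE_comm := by rintro (e | e) <;> rfl
  d_comm _ := rfl
  c_comm _ := rfl

theorem homeo_comp_left {K K' : FramedCospan X Y} (h : wireHomeo X Y K K')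
    (L : FramedCospan Y Z) : wireHomeo X Z (K.comp L) (K'.comp L) :=
  Quotient.exact (wireHomeo_lift (fun K => Quotient.mk (wireHomeo _ _) (K.comp L))
    (fun _ _ i => Quotient.sound (i.compLeft L).homeo) h)

theorem homeo_comp {K K' : FramedCospan X Y} (h : wireHomeo X Y K K')
    {L L' : FramedCospan Y Z} (h' : wireHomeo Y Z L L') :
    wireHomeo X Z (K.comp L) (K'.comp L') := by
  refine Setoid.trans' _ (homeo_comp_left h L) (homeo_unflip ?_)
  exact Setoid.trans' _ (wireHomeo_of_iso (flipComp _ _)) (Setoid.trans' _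
    (homeo_comp_left (homeo_flip h') _) (Setoid.symm' _ (wireHomeo_of_iso (flipComp _ _))))

theorem homeo_tensor_left {K K' : FramedCospan X Y} (h : wireHomeo X Y K K')
    (L : FramedCospan X' Y') : wireHomeo _ _ (K.tensor L) (K'.tensor L) :=
  Quotient.exact (wireHomeo_lift (fun K => Quotient.mk (wireHomeo _ _) (K.tensor L))
    (fun _ _ i => Quotient.sound (i.tensorLeft L).homeo) h)

/-! ## Reindexing -/

open FramedPointGraph

/-- Relabelling of the boundary. -/
@[reducible] def reindex (K : FramedCospan X Y) (φ : Perm X' X) (ψ : Perm Y Y') : FramedCospan X' Y' where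
  G := K.G
  string := K.string
  d x := K.d (φ.equiv x)
  c y := K.c (ψ.equiv.symm y)
  d_ty x := (K.d_ty _).trans (congrArg _ (φ.ty_comm x))
  c_ty y := (K.c_ty _).trans (congrArg _ (ψ.symm.ty_comm y))
  no_isolated := K.no_isolated
  injective := by
    rintro (x | x) (y | y) h
    · exact congrArg _ (φ.equiv.injective (K.d_injective h))
    · exact absurd h (K.d_ne_c _ _)
    · exact absurd h.symm (K.d_ne_c _ _)
    · exact congrArg _ (ψ.equiv.symm.injective (K.c_injective h))
  range := by
    rw [← K.range]
    ext p
    simp [φ.equiv.surjective.exists, ψ.equiv.symm.surjective.exists]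
  d_sgn x := (K.d_sgn _).trans (by rw [φ.sgn_comm])
  c_sgn y := (K.c_sgn _).trans (by rw [show Y.sgn (ψ.equiv.symm y) = _ from ψ.symm.sgn_comm y])

def Collapse.reindex {K L : FramedCospan X Y} (i : Collapse K L) (φ : Perm X' X) (ψ : Perm Y Y') :
    Collapse (K.reindex φ ψ) (L.reindex φ ψ) :=
  { i with d_comm := fun _ => i.d_comm _, c_comm := fun _ => i.c_comm _ }

theorem homeo_reindex {K L : FramedCospan X Y} (h : wireHomeo X Y K L) (φ : Perm X' X)
    (ψ : Perm Y Y') : wireHomeo _ _ (K.reindex φ ψ) (L.reindex φ ψ) :=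
  Quotient.exact (wireHomeo_lift (fun K => Quotient.mk (wireHomeo _ _) (K.reindex φ ψ))
    (fun _ _ i => Quotient.sound (i.reindex φ ψ).homeo) h)

/-- Composition with a permutation is relabelling. -/
def compPerm (K : FramedCospan X Y) (φ : Perm Y Y') :
    Collapse (K.comp (perm φ)) (K.reindex (Perm.refl X) φ) :=
  have hr : ∀ e : K.G.E ⊕ Y.V, e ∉ Set.range (Sum.inl : K.G.E → K.G.E ⊕ Y.V) → ∃ y, e = .inr y := by
    rintro (e | e) he
    · exact absurd ⟨e, rfl⟩ he
    · exact ⟨e, rfl⟩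
  have hr' : ∀ y : Y.V, Sum.inr y ∉ Set.range (Sum.inl : K.G.E → K.G.E ⊕ Y.V) := by
    rintro y ⟨e, he⟩
    cases he
  { onV := compLift (K := K) (L := perm φ) id
      (Sum.elim K.c fun y => K.c (φ.equiv.symm y)) (fun _ => rfl)
    surj := fun p => ⟨K.compInl _ p, rfl⟩
    inE := Sum.inl
    inj := Sum.inl_injective
    src_comm := fun _ => rfl
    tgt_comm := fun _ => rfl
    tyV_comm := comp_ind (fun _ => rfl) (by
      rintro (y | y)
      · exact K.c_ty y
      · exact (K.c_ty _).trans (congrArg _ (φ.symm.ty_comm y)))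
    tyE_comm := fun _ => rfl
    d_comm := fun _ => rfl
    c_comm := fun _ => rfl
    wire := fun e he => by
      obtain ⟨y, rfl⟩ := hr e he
      exact ⟨_, rfl⟩
    fib := fun e he => by
      obtain ⟨y, rfl⟩ := hr e he
      change Sum.elim K.c (fun y => K.c (φ.equiv.symm y)) (if Y.sgn y then .inl y else .inr (φ.equiv y)) =
        Sum.elim K.c (fun y => K.c (φ.equiv.symm y)) (if Y.sgn y then .inr (φ.equiv y) else .inl y)
      cases Y.sgn y <;> simp
    root := by
      have key : ∀ z : (K.compGraph (perm φ)).V,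
          (∀ e, e ∉ Set.range (Sum.inl : K.G.E → K.G.E ⊕ Y.V) →
            (K.compGraph (perm φ)).tgt e ≠ z) →
          (∃ p, z = K.compInl _ p ∧ ∀ y, K.c y = p → Y.sgn y = true) ∨
            ∃ y, z = K.compInr (perm φ) (.inr (φ.equiv y)) ∧ Y.sgn y = false := by
        have h1 : ∀ y, Y.sgn y = false →
            (K.compGraph (perm φ)).tgt (.inr y) = K.compInr (perm φ) (.inl y) := by
          intro y hy
          change K.compInr (perm φ) (if Y.sgn y then .inr (φ.equiv y) else .inl y) = _
          rw [hy]; rfl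
        have h2 : ∀ y, Y.sgn y = true →
            (K.compGraph (perm φ)).tgt (.inr y) = K.compInr (perm φ) (.inr (φ.equiv y)) := by
          intro y hy
          change K.compInr (perm φ) (if Y.sgn y then .inr (φ.equiv y) else .inl y) = _
          rw [hy]; rfl
        have h3 : ∀ p, (∀ e, e ∉ Set.range (Sum.inl : K.G.E → K.G.E ⊕ Y.V) →
            (K.compGraph (perm φ)).tgt e ≠ K.compInl _ p) → ∀ y, K.c y = p → Y.sgn y = true := by
          rintro p h y rfl
          cases hy : Y.sgn y
          · exact absurd ((h1 y hy).trans (comp_glue y).symm) (h _ (hr' y))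
          · rfl
        refine comp_ind (fun p h => .inl ⟨p, rfl, h3 p h⟩) ?_
        rintro (y | y) h
        · have hg : K.compInl (perm φ) (K.c y) = K.compInr (perm φ) (.inl y) := comp_glue y
          rw [← hg] at h ⊢
          exact .inl ⟨_, rfl, h3 _ h⟩
        · obtain ⟨y, rfl⟩ := φ.equiv.surjective y
          cases hy : Y.sgn y
          · exact .inr ⟨y, rfl, hy⟩
          · exact absurd (h2 y hy) (h _ (hr' y))
      intro z z' h h1 h2
      rcases key z h1 with ⟨p, rfl, hp⟩ | ⟨y, rfl, hy⟩ <;>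
      rcases key z' h2 with ⟨p', rfl, hp'⟩ | ⟨y', rfl, hy'⟩
      · exact congrArg _ h
      · have h3 : p = K.c (φ.equiv.symm (φ.equiv y')) := h
        rw [Equiv.symm_apply_apply] at h3
        rw [hp y' h3.symm] at hy'
        cases hy'
      · have h3 : K.c (φ.equiv.symm (φ.equiv y)) = p' := h
        rw [Equiv.symm_apply_apply] at h3
        rw [hp' y h3] at hy
        cases hy
      · have h3 : K.c (φ.equiv.symm (φ.equiv y)) = K.c (φ.equiv.symm (φ.equiv y')) := h
        rw [Equiv.symm_apply_apply, Equiv.symm_apply_apply] at h3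
        rw [K.c_injective h3]
    rank := compLift (K := K) (L := perm φ) (fun _ => 1)
      (Sum.elim (fun _ => 1) fun y => if Y'.sgn y then 2 else 0) (fun _ => rfl)
    rank_lt := fun e he => by
      obtain ⟨y, rfl⟩ := hr e he
      change Sum.elim (fun _ => 1) (fun y => if Y'.sgn y then 2 else 0)
          (if Y.sgn y then .inl y else .inr (φ.equiv y)) <
        Sum.elim (fun _ => 1) (fun y => if Y'.sgn y then 2 else 0)
          (if Y.sgn y then .inr (φ.equiv y) else .inl y)
      have := φ.sgn_comm y
      cases h : Y.sgn y <;> simp_all }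

end FramedCospan

/-! ## The laws of a symmetric monoidal category -/

namespace FramedPointGraph.Perm

variable {T : MonoidalSignature.{u, v}} {X Y Z X' Y' Z' : FramedPointGraph T}

@[ext] theorem ext {φ ψ : Perm X Y} (h : ∀ x, φ.equiv x = ψ.equiv x) : φ = ψ := by
  obtain ⟨φ, _, _⟩ := φ
  obtain ⟨ψ, _, _⟩ := ψ
  obtain rfl : φ = ψ := Equiv.ext h
  rfl

/-- Composition of permutations. -/
@[reducible] def trans (φ : Perm X Y) (ψ : Perm Y Z) : Perm X Z :=
  ⟨φ.equiv.trans ψ.equiv, fun x => (ψ.ty_comm _).trans (φ.ty_comm x),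
    fun x => (ψ.sgn_comm _).trans (φ.sgn_comm x)⟩

/-- The tensor product of permutations. -/
@[reducible] def tensor (φ : Perm X Y) (ψ : Perm X' Y') : Perm (X.tensor X') (Y.tensor Y') :=
  ⟨Equiv.sumCongr φ.equiv ψ.equiv, by
    rintro (x | x)
    exacts [φ.ty_comm x, ψ.ty_comm x], by
    rintro (x | x)
    exacts [φ.sgn_comm x, ψ.sgn_comm x]⟩

/-- The inverse permutation of the duals. -/
@[reducible] def dualSymm (φ : Perm X Y) : Perm Y.dual X.dual :=
  ⟨φ.equiv.symm, φ.symm.ty_comm, fun y => congrArg (fun b => !b) (φ.symm.sgn_comm y)⟩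

end FramedPointGraph.Perm

namespace FramedCospan

open FramedPointGraph

variable {T : MonoidalSignature.{u, v}} {W X Y Z X' Y' Z' X'' Y'' : FramedPointGraph T}


def reindexRefl (K : FramedCospan X Y) : Iso (K.reindex (Perm.refl X) (Perm.refl Y)) K :=
  ⟨.refl _, .refl _, fun _ => rfl, fun _ => rfl, fun _ => rfl, fun _ => rfl, fun _ => rfl,
    fun _ => rfl⟩

theorem perm_onE (φ : Perm X Y) (x : X.V) : (perm φ).G.τ.onE x = .mid (X.ty x) := by
  change MonoidalSignature.TypeEdge.mid (Sum.elim X.ty Y.ty (if X.sgn x then .inl x else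
    .inr (φ.equiv x))) = _
  cases X.sgn x
  · exact congrArg _ (φ.ty_comm x)
  · rfl

theorem perm_src (φ : Perm X Y) (x : X.V) :
    (perm φ).G.src x = if X.sgn x then .inl x else .inr (φ.equiv x) := rfl

theorem perm_tgt (φ : Perm X Y) (x : X.V) :
    (perm φ).G.tgt x = if X.sgn x then .inr (φ.equiv x) else .inl x := rfl

/-- Flipping a permutation. -/
def flipPerm (φ : Perm X Y) : Iso (perm φ).flip (perm φ.dualSymm) where
  onV := Equiv.sumComm _ _
  onE := φ.equiv
  src_comm x := by
    refine (congrArg (Equiv.sumComm _ _) (perm_src φ x)).trans (Eq.trans ?_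
      (perm_src φ.dualSymm (φ.equiv x)).symm)
    rw [show Y.dual.sgn (φ.equiv x) = !X.sgn x from congrArg (fun b => !b) (φ.sgn_comm x),
      show φ.dualSymm.equiv (φ.equiv x) = x from φ.equiv.symm_apply_apply x]
    cases X.sgn x <;> rfl
  tgt_comm x := by
    refine (congrArg (Equiv.sumComm _ _) (perm_tgt φ x)).trans (Eq.trans ?_
      (perm_tgt φ.dualSymm (φ.equiv x)).symm)
    rw [show Y.dual.sgn (φ.equiv x) = !X.sgn x from congrArg (fun b => !b) (φ.sgn_comm x),
      show φ.dualSymm.equiv (φ.equiv x) = x from φ.equiv.symm_apply_apply x]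
    cases X.sgn x <;> rfl
  tyV_comm := by rintro (x | y) <;> rfl
  tyE_comm x := (perm_onE _ _).trans ((congrArg _ (φ.ty_comm x)).trans (perm_onE φ x).symm)
  d_comm _ := rfl
  c_comm _ := rfl

theorem homeo_permComp (φ : Perm X X') (K : FramedCospan X' Y) :
    wireHomeo _ _ ((perm φ).comp K) (K.reindex φ (Perm.refl Y)) := by
  apply homeo_unflip
  exact Setoid.trans' _ (wireHomeo_of_iso (flipComp _ _)) (Setoid.trans' _
    (homeo_comp (Setoid.refl' _ _) (wireHomeo_of_iso (flipPerm φ)))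
    (show wireHomeo _ _ _ (K.reindex φ (Perm.refl Y)).flip from
      (compPerm K.flip φ.dualSymm).homeo))

def permReindex (φ : Perm X X') (ψ : Perm X' Y') (χ : Perm Y' Y) :
    Iso ((perm ψ).reindex φ χ) (perm ((φ.trans ψ).trans χ)) where
  onV := Equiv.sumCongr φ.equiv.symm χ.equiv
  onE := φ.equiv.symm
  src_comm x := by
    obtain ⟨x, rfl⟩ := φ.equiv.surjective x
    have := φ.sgn_comm x
    cases h : X.sgn x <;> simp_all
  tgt_comm x := by
    obtain ⟨x, rfl⟩ := φ.equiv.surjective x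
    have := φ.sgn_comm x
    cases h : X.sgn x <;> simp_all
  tyV_comm := by
    rintro (x | y)
    · exact congrArg Sum.inl (φ.symm.ty_comm x)
    · exact congrArg Sum.inl (χ.ty_comm y)
  tyE_comm x := by
    refine (perm_onE _ _).trans ((congrArg _ ?_).trans (perm_onE ψ x).symm)
    exact φ.symm.ty_comm x
  d_comm x := congrArg Sum.inl (φ.equiv.symm_apply_apply x)
  c_comm y := congrArg Sum.inr (χ.equiv.apply_symm_apply y)

def permTensor (φ : Perm X Y) (ψ : Perm X' Y') :
    Iso ((perm φ).tensor (perm ψ)) (perm (φ.tensor ψ)) where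
  onV := Equiv.sumSumSumComm _ _ _ _
  onE := .refl _
  src_comm := by
    rintro (x | x)
    · cases h : X.sgn x <;> simp [h]
    · cases h : X'.sgn x <;> simp [h]
  tgt_comm := by
    rintro (x | x)
    · cases h : X.sgn x <;> simp [h]
    · cases h : X'.sgn x <;> simp [h]
  tyV_comm := by rintro ((x | x) | (x | x)) <;> rfl
  tyE_comm := by
    rintro (x | x)
    · exact (perm_onE _ _).trans (perm_onE φ x).symm
    · exact (perm_onE _ _).trans (perm_onE ψ x).symm
  d_comm := by rintro (x | x) <;> rfl
  c_comm := by rintro (x | x) <;> rfl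

/-- Associativity of composition. -/
def compAssoc (K : FramedCospan W X) (L : FramedCospan X Y) (M : FramedCospan Y Z) :
    Iso ((K.comp L).comp M) (K.comp (L.comp M)) where
  onV :=
    { toFun := compLift (K := K.comp L) (L := M)
        (compLift (K.compInl (L.comp M)) (fun p => K.compInr (L.comp M) (L.compInl M p))
          (fun _ => comp_glue (K := K) (L := L.comp M) _))
        (fun p => K.compInr (L.comp M) (L.compInr M p))
        (fun y => congrArg (K.compInr (L.comp M)) (comp_glue (K := L) (L := M) y))
      invFun := compLift (K := K) (L := L.comp M)
        (fun p => (K.comp L).compInl M (K.compInl L p))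
        (compLift (fun p => (K.comp L).compInl M (K.compInr L p)) ((K.comp L).compInr M)
          (fun y => comp_glue (K := K.comp L) (L := M) y))
        (fun y => congrArg ((K.comp L).compInl M) (comp_glue (K := K) (L := L) y))
      left_inv := comp_ind (comp_ind (fun _ => rfl) fun _ => rfl) (fun _ => rfl)
      right_inv := comp_ind (fun _ => rfl) (comp_ind (fun _ => rfl) fun _ => rfl) }
  onE := Equiv.sumAssoc _ _ _
  src_comm := by rintro ((e | e) | e) <;> rfl
  tgt_comm := by rintro ((e | e) | e) <;> rfl
  tyV_comm := comp_ind (comp_ind (fun _ => rfl) fun _ => rfl) (fun _ => rfl)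
  tyE_comm := by rintro ((e | e) | e) <;> rfl
  d_comm _ := rfl
  c_comm _ := rfl

/-- The interchange law. -/
def tensorComp (K : FramedCospan X Y) (K' : FramedCospan X' Y') (L : FramedCospan Y Z)
    (L' : FramedCospan Y' Z') :
    Iso ((K.tensor K').comp (L.tensor L')) ((K.comp L).tensor (K'.comp L')) where
  onV :=
    { toFun := compLift (K := K.tensor K') (L := L.tensor L')
        (Sum.map (K.compInl L) (K'.compInl L')) (Sum.map (K.compInr L) (K'.compInr L'))
        (by
          rintro (y | y)
          · exact congrArg Sum.inl (comp_glue (K := K) (L := L) y)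
          · exact congrArg Sum.inr (comp_glue (K := K') (L := L') y))
      invFun := Sum.elim
        (compLift (K := K) (L := L) (fun p => (K.tensor K').compInl (L.tensor L') (.inl p))
          (fun p => (K.tensor K').compInr (L.tensor L') (.inl p))
          (fun y => comp_glue (K := K.tensor K') (L := L.tensor L') (.inl y)))
        (compLift (K := K') (L := L') (fun p => (K.tensor K').compInl (L.tensor L') (.inr p))
          (fun p => (K.tensor K').compInr (L.tensor L') (.inr p))
          (fun y => comp_glue (K := K.tensor K') (L := L.tensor L') (.inr y)))
      left_inv := comp_ind (by rintro (p | p) <;> rfl) (by rintro (p | p) <;> rfl)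
      right_inv := by
        rintro (p | p)
        · rcases comp_cases p with ⟨q, rfl⟩ | ⟨q, rfl⟩ <;> rfl
        · rcases comp_cases p with ⟨q, rfl⟩ | ⟨q, rfl⟩ <;> rfl }
  onE := Equiv.sumSumSumComm _ _ _ _
  src_comm := by rintro ((e | e) | (e | e)) <;> rfl
  tgt_comm := by rintro ((e | e) | (e | e)) <;> rfl
  tyV_comm := comp_ind (by rintro (p | p) <;> rfl) (by rintro (p | p) <;> rfl)
  tyE_comm := by rintro ((e | e) | (e | e)) <;> rfl
  d_comm := by rintro (x | x) <;> rfl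
  c_comm := by rintro (x | x) <;> rfl

def tensorAssoc (K : FramedCospan X Y) (K' : FramedCospan X' Y') (K'' : FramedCospan X'' Y'') :
    Iso (((K.tensor K').tensor K'').reindex (Perm.refl _) (Perm.assoc _ _ _))
      ((K.tensor (K'.tensor K'')).reindex (Perm.assoc _ _ _) (Perm.refl _)) where
  onV := Equiv.sumAssoc _ _ _
  onE := Equiv.sumAssoc _ _ _
  src_comm := by rintro ((e | e) | e) <;> rfl
  tgt_comm := by rintro ((e | e) | e) <;> rfl
  tyV_comm := by rintro ((e | e) | e) <;> rfl
  tyE_comm := by rintro ((e | e) | e) <;> rfl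
  d_comm := by rintro ((e | e) | e) <;> rfl
  c_comm := by rintro (e | (e | e)) <;> rfl

def tensorSwap (K : FramedCospan X Y) (K' : FramedCospan X' Y') :
    Iso ((K.tensor K').reindex (Perm.refl _) (Perm.swap _ _))
      ((K'.tensor K).reindex (Perm.swap _ _) (Perm.refl _)) where
  onV := Equiv.sumComm _ _
  onE := Equiv.sumComm _ _
  src_comm := by rintro (e | e) <;> rfl
  tgt_comm := by rintro (e | e) <;> rfl
  tyV_comm := by rintro (e | e) <;> rfl
  tyE_comm := by rintro (e | e) <;> rfl
  d_comm := by rintro (e | e) <;> rfl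
  c_comm := by rintro (e | e) <;> rfl

instance : IsEmpty (FramedPointGraph.unit (T := T)).V := inferInstanceAs (IsEmpty Empty)

instance : IsEmpty (perm (Perm.refl (FramedPointGraph.unit (T := T)))).G.V :=
  inferInstanceAs (IsEmpty (Empty ⊕ Empty))

instance : IsEmpty (perm (Perm.refl (FramedPointGraph.unit (T := T)))).G.E :=
  inferInstanceAs (IsEmpty Empty)

def tensorLeftUnit (K : FramedCospan X Y) :
    Iso (((perm (Perm.refl FramedPointGraph.unit)).tensor K).reindex (Perm.refl _) (Perm.leftUnit _))
      (K.reindex (Perm.leftUnit _) (Perm.refl _)) where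
  onV := Equiv.emptySum (perm (Perm.refl (FramedPointGraph.unit (T := T)))).G.V K.G.V
  onE := Equiv.emptySum (perm (Perm.refl (FramedPointGraph.unit (T := T)))).G.E K.G.E
  src_comm := by rintro (e | e); exacts [isEmptyElim e, rfl]
  tgt_comm := by rintro (e | e); exacts [isEmptyElim e, rfl]
  tyV_comm := by rintro (e | e); exacts [isEmptyElim e, rfl]
  tyE_comm := by rintro (e | e); exacts [isEmptyElim e, rfl]
  d_comm := by rintro (e | e); exacts [isEmptyElim e, rfl]
  c_comm _ := rfl

def tensorRightUnit (K : FramedCospan X Y) :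
    Iso ((K.tensor (perm (Perm.refl FramedPointGraph.unit))).reindex (Perm.refl _) (Perm.rightUnit _))
      (K.reindex (Perm.rightUnit _) (Perm.refl _)) where
  onV := Equiv.sumEmpty K.G.V (perm (Perm.refl (FramedPointGraph.unit (T := T)))).G.V
  onE := Equiv.sumEmpty K.G.E (perm (Perm.refl (FramedPointGraph.unit (T := T)))).G.E
  src_comm := by rintro (e | e); exacts [rfl, isEmptyElim e]
  tgt_comm := by rintro (e | e); exacts [rfl, isEmptyElim e]
  tyV_comm := by rintro (e | e); exacts [rfl, isEmptyElim e]
  tyE_comm := by rintro (e | e); exacts [rfl, isEmptyElim e]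
  d_comm := by rintro (e | e); exacts [rfl, isEmptyElim e]
  c_comm _ := rfl

end FramedCospan

namespace FCsp

open FramedPointGraph FramedCospan

variable {T : MonoidalSignature.{u, v}} {W X Y Z X' Y' Z' X'' Y'' : FCsp T}

theorem mk_eq {K L : FramedCospan X Y} (h : wireHomeo X Y K L) : mk K = mk L := Quotient.sound h

theorem mk_iso {K L : FramedCospan X Y} (h : FramedCospan.Iso K L) : mk K = mk L :=
  Quotient.sound (wireHomeo_of_iso h)

theorem mk_surj (f : X ⟶ Y) : ∃ K, mk K = f := Quotient.exists_rep f

theorem mk_comp_mk (K : FramedCospan X Y) (L : FramedCospan Y Z) : mk K ≫ mk L = mk (K.comp L) :=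
  Quotient.sound (homeo_comp (Quotient.mk_out K) (Quotient.mk_out L))

theorem tensorHom_mk (K : FramedCospan X Y) (L : FramedCospan X' Y') :
    tensorHom (mk K) (mk L) = mk (K.tensor L) := by
  refine Quotient.sound (Setoid.trans' _ (homeo_tensor_left (Quotient.mk_out K) _) ?_)
  have key : ∀ L : FramedCospan X' Y', mk (K.tensor L) =
      mk (((L.tensor K).reindex (Perm.swap _ _) (Perm.swap _ _))) := fun L => mk_iso
    { onV := Equiv.sumComm _ _
      onE := Equiv.sumComm _ _
      src_comm := by rintro (e | e) <;> rfl
      tgt_comm := by rintro (e | e) <;> rfl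
      tyV_comm := by rintro (e | e) <;> rfl
      tyE_comm := by rintro (e | e) <;> rfl
      d_comm := by rintro (e | e) <;> rfl
      c_comm := by rintro (e | e) <;> rfl }
  refine Quotient.exact ((key _).trans (Eq.trans ?_ (key _).symm))
  exact Quotient.sound (homeo_reindex (homeo_tensor_left (Quotient.mk_out L) K) _ _)

theorem id_eq (X : FCsp T) : 𝟙 X = ofPerm (Perm.refl X) := rfl

theorem mk_comp_ofPerm (K : FramedCospan X Y) (φ : Perm Y Y') :
    mk K ≫ ofPerm φ = mk (K.reindex (Perm.refl X) φ) :=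
  (mk_comp_mk _ _).trans (mk_eq (compPerm K φ).homeo)

theorem ofPerm_comp_mk (φ : Perm X X') (K : FramedCospan X' Y) :
    ofPerm φ ≫ mk K = mk (K.reindex φ (Perm.refl Y)) :=
  (mk_comp_mk _ _).trans (mk_eq (homeo_permComp φ K))

theorem ofPerm_comp (φ : Perm X Y) (ψ : Perm Y Z) :
    (ofPerm φ ≫ ofPerm ψ : X ⟶ Z) = ofPerm (φ.trans ψ) :=
  (mk_comp_ofPerm _ _).trans (mk_iso (permReindex (Perm.refl X) φ ψ))

theorem ofPerm_tensor (φ : Perm X Y) (ψ : Perm X' Y') :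
    tensorHom (ofPerm φ) (ofPerm ψ) = ofPerm (φ.tensor ψ) :=
  (tensorHom_mk _ _).trans (mk_iso (permTensor φ ψ))

instance : SymmetricMonoidalLaws T where
  mk_comp := mk_comp_mk
  mk_tensor := tensorHom_mk
  id_comp f := by
    obtain ⟨K, rfl⟩ := mk_surj f
    exact (ofPerm_comp_mk _ _).trans (mk_iso (reindexRefl K))
  comp_id f := by
    obtain ⟨K, rfl⟩ := mk_surj f
    exact (mk_comp_ofPerm _ _).trans (mk_iso (reindexRefl K))
  assoc f g h := by
    obtain ⟨K, rfl⟩ := mk_surj f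
    obtain ⟨L, rfl⟩ := mk_surj g
    obtain ⟨M, rfl⟩ := mk_surj h
    simp only [mk_comp_mk]
    exact mk_iso (compAssoc K L M)
  perm_inverse φ := by
    rw [ofPerm_comp, ofPerm_comp, id_eq, id_eq]
    exact ⟨congrArg ofPerm (Perm.ext fun x => φ.equiv.symm_apply_apply x),
      congrArg ofPerm (Perm.ext fun x => φ.equiv.apply_symm_apply x)⟩
  id_tensor_id X Y := by
    rw [id_eq, id_eq, ofPerm_tensor]
    exact congrArg ofPerm (Perm.ext (by rintro (x | x) <;> rfl))
  tensor_comp_tensor f f' g g' := by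
    obtain ⟨K, rfl⟩ := mk_surj f
    obtain ⟨K', rfl⟩ := mk_surj f'
    obtain ⟨L, rfl⟩ := mk_surj g
    obtain ⟨L', rfl⟩ := mk_surj g'
    simp only [mk_comp_mk, tensorHom_mk]
    exact mk_iso (tensorComp K K' L L')
  assoc_naturality f f' f'' := by
    obtain ⟨K, rfl⟩ := mk_surj f
    obtain ⟨K', rfl⟩ := mk_surj f'
    obtain ⟨K'', rfl⟩ := mk_surj f''
    rw [tensorHom_mk, tensorHom_mk, tensorHom_mk, tensorHom_mk]
    exact (mk_comp_ofPerm _ _).trans ((mk_iso (tensorAssoc K K' K'')).trans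
      (ofPerm_comp_mk _ _).symm)
  leftUnit_naturality f := by
    obtain ⟨K, rfl⟩ := mk_surj f
    rw [id_eq, ofPerm, tensorHom_mk]
    exact (mk_comp_ofPerm _ _).trans ((mk_iso (tensorLeftUnit K)).trans
      (ofPerm_comp_mk _ _).symm)
  rightUnit_naturality f := by
    obtain ⟨K, rfl⟩ := mk_surj f
    rw [id_eq, ofPerm, tensorHom_mk]
    exact (mk_comp_ofPerm _ _).trans ((mk_iso (tensorRightUnit K)).trans
      (ofPerm_comp_mk _ _).symm)
  swap_naturality f f' := by
    obtain ⟨K, rfl⟩ := mk_surj f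
    obtain ⟨K', rfl⟩ := mk_surj f'
    rw [tensorHom_mk, tensorHom_mk]
    exact (mk_comp_ofPerm _ _).trans ((mk_iso (tensorSwap K K')).trans
      (ofPerm_comp_mk _ _).symm)
  pentagon W X Y Z := by
    simp only [assocHom, id_eq, ofPerm_tensor, ofPerm_comp]
    exact congrArg ofPerm (Perm.ext (by rintro (((x | x) | x) | x) <;> rfl))
  triangle X Y := by
    simp only [assocHom, rightUnitHom, leftUnitHom, id_eq, ofPerm_tensor, ofPerm_comp]
    exact congrArg ofPerm (Perm.ext (by rintro ((x | x) | x); exacts [rfl, x.elim, rfl]))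
  hexagon X Y Z := by
    simp only [assocHom, swapHom, id_eq, ofPerm_tensor, ofPerm_comp]
    exact congrArg ofPerm (Perm.ext (by rintro ((x | x) | x) <;> rfl))

end FCsp

/-! ## Bending wires -/

namespace FramedCospan

open FramedPointGraph

variable {T : MonoidalSignature.{u, v}} {X Y W P : FramedPointGraph T}

/-- All of the boundary is moved to the right. -/
@[reducible] def bend (K : FramedCospan X Y) : FramedCospan unit (X.dual.tensor Y) where
  G := K.G
  string := K.string
  d := Empty.elim
  c := Sum.elim K.d K.c
  d_ty x := x.elim
  c_ty := by rintro (x | x); exacts [K.d_ty x, K.c_ty x]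
  no_isolated := K.no_isolated
  injective := by
    rintro (x | x) (y | y) h
    exacts [x.elim, x.elim, y.elim, congrArg _ (K.injective h)]
  range := by
    rw [← K.range]
    ext p
    simp
  d_sgn x := x.elim
  c_sgn := by
    rintro (x | x)
    · exact (K.d_out x).trans (by simp)
    · exact K.c_sgn x

/-- A part of the boundary on the right is moved to the left. -/
@[reducible] def unbend (K : FramedCospan unit (X.dual.tensor Y)) : FramedCospan X Y where
  G := K.G
  string := K.string
  d x := K.c (.inl x)
  c y := K.c (.inr y)
  d_ty x := K.c_ty (.inl x)
  c_ty y := K.c_ty (.inr y)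
  no_isolated := K.no_isolated
  injective := by
    rintro (x | x) (y | y) h
    exacts [K.c_injective h, K.c_injective h, K.c_injective h, K.c_injective h]
  range := by
    rw [← K.range]
    ext p
    simp
  d_sgn x := (K.c_in (.inl x)).trans (by simp)
  c_sgn y := K.c_sgn (.inr y)

def unbendBend (K : FramedCospan X Y) : Iso K.bend.unbend K :=
  ⟨.refl _, .refl _, fun _ => rfl, fun _ => rfl, fun _ => rfl, fun _ => rfl, fun _ => rfl,
    fun _ => rfl⟩

/-- Bending by means of cups. -/
def unbendCollapse (K : FramedCospan unit (X.dual.tensor Y)) :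
    Collapse ((((perm (Perm.refl X)).tensor K).reindex (Perm.refl _)
        (Perm.assoc X X.dual Y).symm).comp ((cup X).tensor (perm (Perm.refl Y))))
      (K.unbend.reindex (Perm.rightUnit X) (Perm.leftUnit Y).symm) :=
  let A := ((perm (Perm.refl X)).tensor K).reindex (Perm.refl _) (Perm.assoc X X.dual Y).symm
  let B := (cup X).tensor (perm (Perm.refl Y))
  let inE : K.G.E → (X.V ⊕ K.G.E) ⊕ (X.V ⊕ Y.V) := fun e => .inl (.inr e)
  have hr : ∀ e : (X.V ⊕ K.G.E) ⊕ (X.V ⊕ Y.V), e ∉ Set.range inE →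
      (∃ x, e = .inl (.inl x)) ∨ (∃ x, e = .inr (.inl x)) ∨ ∃ y, e = .inr (.inr y) := by
    rintro ((x | e) | (x | y)) he
    · exact .inl ⟨x, rfl⟩
    · exact absurd ⟨e, rfl⟩ he
    · exact .inr (.inl ⟨x, rfl⟩)
    · exact .inr (.inr ⟨y, rfl⟩)
  have h1 : ∀ x, Sum.inl (.inl x) ∉ Set.range inE := by rintro x ⟨e, he⟩; cases he
  have h2 : ∀ x, Sum.inr (.inl x) ∉ Set.range inE := by rintro x ⟨e, he⟩; cases he
  have h3 : ∀ y, Sum.inr (.inr y) ∉ Set.range inE := by rintro x ⟨e, he⟩; cases he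
  { onV := compLift (K := A) (L := B)
      (Sum.elim (Sum.elim (fun x => K.c (.inl x)) (fun x => K.c (.inl x))) id)
      (Sum.elim (Sum.elim (Sum.elim (fun x => K.c (.inl x)) (fun x => K.c (.inl x))) Empty.elim)
        (Sum.elim (fun y => K.c (.inr y)) (fun y => K.c (.inr y))))
      (by rintro ((x | x) | y) <;> rfl)
    surj := fun p => ⟨A.compInl B (.inr p), rfl⟩
    inE := inE
    inj := fun e e' h => Sum.inr_injective (Sum.inl_injective h)
    src_comm := fun _ => rfl
    tgt_comm := fun _ => rfl
    tyV_comm := comp_ind (K := A) (L := B)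
      (by
        rintro ((x | x) | p)
        exacts [K.c_ty (.inl x), K.c_ty (.inl x), rfl])
      (by
        rintro (((x | x) | x) | (y | y))
        exacts [K.c_ty (.inl x), K.c_ty (.inl x), x.elim, K.c_ty (.inr y), K.c_ty (.inr y)])
    tyE_comm := fun _ => rfl
    d_comm := by rintro (x | x); exacts [rfl, x.elim]
    c_comm := by rintro (y | y); exacts [y.elim, rfl]
    wire := fun e he => by
      rcases hr e he with ⟨x, rfl⟩ | ⟨x, rfl⟩ | ⟨x, rfl⟩ <;> exact ⟨_, rfl⟩
    fib := fun e he => by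
      rcases hr e he with ⟨x, rfl⟩ | ⟨x, rfl⟩ | ⟨y, rfl⟩
      · change Sum.elim (fun x => K.c (.inl x)) (fun x => K.c (.inl x))
            (if X.sgn x then .inl x else .inr x) =
          Sum.elim (fun x => K.c (.inl x)) (fun x => K.c (.inl x))
            (if X.sgn x then .inr x else .inl x)
        cases X.sgn x <;> rfl
      · change Sum.elim (fun x => K.c (.inl x)) (fun x => K.c (.inl x))
            (if X.sgn x then .inl x else .inr x) =
          Sum.elim (fun x => K.c (.inl x)) (fun x => K.c (.inl x))
            (if X.sgn x then .inr x else .inl x)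
        cases X.sgn x <;> rfl
      · change Sum.elim (fun y => K.c (.inr y)) (fun y => K.c (.inr y))
            (if Y.sgn y then .inl y else .inr y) =
          Sum.elim (fun y => K.c (.inr y)) (fun y => K.c (.inr y))
            (if Y.sgn y then .inr y else .inl y)
        cases Y.sgn y <;> rfl
    root := by
      have t1 : ∀ x, (A.compGraph B).tgt (.inl (.inl x)) =
          A.compInl B (.inl (if X.sgn x then .inr x else .inl x)) := fun _ => rfl
      have t2 : ∀ x, (A.compGraph B).tgt (.inr (.inl x)) =
          A.compInr B (.inl (.inl (if X.sgn x then .inr x else .inl x))) := fun _ => rfl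
      have t3 : ∀ y, (A.compGraph B).tgt (.inr (.inr y)) =
          A.compInr B (.inr (if Y.sgn y then .inr y else .inl y)) := fun _ => rfl
      have g1 : ∀ x, A.compInl B (.inl (.inr x)) = A.compInr B (.inl (.inl (.inl x))) :=
        fun x => comp_glue (K := A) (L := B) (.inl (.inl x))
      have g2 : ∀ x, A.compInl B (.inr (K.c (.inl x))) = A.compInr B (.inl (.inl (.inr x))) :=
        fun x => comp_glue (K := A) (L := B) (.inl (.inr x))
      have g3 : ∀ y, A.compInl B (.inr (K.c (.inr y))) = A.compInr B (.inr (.inl y)) :=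
        fun y => comp_glue (K := A) (L := B) (.inr y)
      let N (z : (A.compGraph B).V) : Prop := ∀ e, e ∉ Set.range inE → (A.compGraph B).tgt e ≠ z
      have n2 : ∀ x, ¬ N (A.compInl B (.inl (.inr x))) := by
        intro x h
        cases hx : X.sgn x
        · refine h _ (h2 x) ((t2 x).trans ?_)
          rw [hx]; exact (g1 x).symm
        · refine h _ (h1 x) ((t1 x).trans ?_)
          rw [hx]; rfl
      have n1 : ∀ x, N (A.compInl B (.inl (.inl x))) → X.sgn x = true := by
        intro x h
        cases hx : X.sgn x
        · refine absurd ((t1 x).trans ?_) (h _ (h1 x))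
          rw [hx]; rfl
        · rfl
      have n3 : ∀ p, N (A.compInl B (.inr p)) →
          (∀ x, K.c (.inl x) = p → X.sgn x = false) ∧ ∀ y, K.c (.inr y) = p → Y.sgn y = true := by
        refine fun p h => ⟨?_, ?_⟩
        · rintro x rfl
          cases hx : X.sgn x
          · rfl
          · refine absurd ((t2 x).trans ?_) (h _ (h2 x))
            rw [hx]; exact (g2 x).symm
        · rintro y rfl
          cases hy : Y.sgn y
          · refine absurd ((t3 y).trans ?_) (h _ (h3 y))
            rw [hy]; exact (g3 y).symm
          · rfl
      have n4 : ∀ y, N (A.compInr B (.inr (.inr y))) → Y.sgn y = false := by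
        intro y h
        cases hy : Y.sgn y
        · rfl
        · refine absurd ((t3 y).trans ?_) (h _ (h3 y))
          rw [hy]; rfl
      have key : ∀ z, N z → (∃ x, z = A.compInl B (.inl (.inl x)) ∧ X.sgn x = true) ∨
          (∃ p, z = A.compInl B (.inr p) ∧ (∀ x, K.c (.inl x) = p → X.sgn x = false) ∧
            ∀ y, K.c (.inr y) = p → Y.sgn y = true) ∨
          ∃ y, z = A.compInr B (.inr (.inr y)) ∧ Y.sgn y = false := by
        refine comp_ind (K := A) (L := B) ?_ ?_
        · rintro ((x | x) | p) h
          · exact .inl ⟨x, rfl, n1 x h⟩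
          · exact absurd h (n2 x)
          · exact .inr (.inl ⟨p, rfl, n3 p h⟩)
        · rintro (((x | x) | x) | (y | y)) h
          · rw [← g1] at h
            exact absurd h (n2 x)
          · rw [← g2] at h ⊢
            exact .inr (.inl ⟨_, rfl, n3 _ h⟩)
          · exact x.elim
          · rw [← g3] at h ⊢
            exact .inr (.inl ⟨_, rfl, n3 _ h⟩)
          · exact .inr (.inr ⟨y, rfl, n4 y h⟩)
      intro z z' h hz hz'
      rcases key z hz with ⟨x, rfl, hx⟩ | ⟨p, rfl, hp, hp'⟩ | ⟨y, rfl, hy⟩ <;>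
      rcases key z' hz' with ⟨x', rfl, hx'⟩ | ⟨q, rfl, hq, hq'⟩ | ⟨y', rfl, hy'⟩
      · rw [Sum.inl_injective (K.c_injective h)]
      · rw [hq x h] at hx; cases hx
      · cases K.c_injective h
      · rw [hp x' (Eq.symm h)] at hx'; cases hx'
      · exact congrArg (fun p => A.compInl B (.inr p)) h
      · rw [hp' y' (Eq.symm h)] at hy'; cases hy'
      · cases K.c_injective h
      · rw [hq' y h] at hy; cases hy
      · rw [Sum.inr_injective (K.c_injective h)]
    rank := compLift (K := A) (L := B)
      (Sum.elim (Sum.elim (fun x => if X.sgn x then 0 else 4) (fun x => if X.sgn x then 1 else 3))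
        fun _ => 2)
      (Sum.elim (Sum.elim (Sum.elim (fun x => if X.sgn x then 1 else 3) fun _ => 2) Empty.elim)
        (Sum.elim (fun _ => 2) fun y => if Y.sgn y then 3 else 1))
      (by rintro ((x | x) | y) <;> rfl)
    rank_lt := fun e he => by
      rcases hr e he with ⟨x, rfl⟩ | ⟨x, rfl⟩ | ⟨y, rfl⟩
      · change Sum.elim (fun x => if X.sgn x then 0 else 4) (fun x => if X.sgn x then 1 else 3)
            (if X.sgn x then .inl x else .inr x) <
          Sum.elim (fun x => if X.sgn x then 0 else 4) (fun x => if X.sgn x then 1 else 3)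
            (if X.sgn x then .inr x else .inl x)
        cases h : X.sgn x <;> simp [h]
      · change Sum.elim (fun x => if X.sgn x then 1 else 3) (fun _ => 2)
            (if X.sgn x then .inl x else .inr x) <
          Sum.elim (fun x => if X.sgn x then 1 else 3) (fun _ => 2)
            (if X.sgn x then .inr x else .inl x)
        cases h : X.sgn x <;> simp [h]
      · change Sum.elim (fun _ => 2) (fun y => if Y.sgn y then 3 else 1)
            (if Y.sgn y then .inl y else .inr y) <
          Sum.elim (fun _ => 2) (fun y => if Y.sgn y then 3 else 1)
            (if Y.sgn y then .inr y else .inl y)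
        cases h : Y.sgn y <;> simp [h] }

/-- Composition with cups: every pair of vertices that is joined by a cup is merged. -/
noncomputable def cupCollapse (K : FramedCospan X (W.tensor (P.tensor P.dual))) (K' : FramedCospan X W)
    (onV : K.G.V → K'.G.V) (surj : Function.Surjective onV) (onE : K'.G.E ≃ K.G.E)
    (src_comm : ∀ e, onV (K.G.src (onE e)) = K'.G.src e)
    (tgt_comm : ∀ e, onV (K.G.tgt (onE e)) = K'.G.tgt e)
    (tyV_comm : ∀ x, K'.G.τ.onV (onV x) = K.G.τ.onV x)
    (tyE_comm : ∀ e, K'.G.τ.onE e = K.G.τ.onE (onE e))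
    (d_comm : ∀ x, onV (K.d x) = K'.d x) (c_comm : ∀ y, onV (K.c (.inl y)) = K'.c y)
    (glue : ∀ p, onV (K.c (.inr (.inl p))) = onV (K.c (.inr (.inr p))))
    (eq_of : ∀ x x', onV x = onV x' → x = x' ∨
      ∃ p, (x = K.c (.inr (.inl p)) ∧ x' = K.c (.inr (.inr p))) ∨
        (x = K.c (.inr (.inr p)) ∧ x' = K.c (.inr (.inl p)))) :
    Collapse (K.comp ((perm (Perm.refl W)).tensor (cup P)))
      (K'.reindex (Perm.refl X) (Perm.rightUnit W).symm) :=
  let B := (perm (Perm.refl W)).tensor (cup P)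
  let inE : K'.G.E → K.G.E ⊕ (W.V ⊕ P.V) := fun e => .inl (onE e)
  let r : W.V ⊕ (P.V ⊕ P.V) → ℕ := Sum.elim (fun _ => 1)
    (Sum.elim (fun p => if P.sgn p then 1 else 2) (fun p => if P.sgn p then 2 else 1))
  have hr : ∀ e : K.G.E ⊕ (W.V ⊕ P.V), e ∉ Set.range inE →
      (∃ x, e = .inr (.inl x)) ∨ ∃ x, e = .inr (.inr x) := by
    rintro (e | (x | y)) he
    · exact absurd ⟨onE.symm e, congrArg Sum.inl (onE.apply_symm_apply e)⟩ he
    · exact .inl ⟨x, rfl⟩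
    · exact .inr ⟨y, rfl⟩
  have h1 : ∀ x, Sum.inr (.inl x) ∉ Set.range inE := by rintro x ⟨e, he⟩; cases he
  have h2 : ∀ y, Sum.inr (.inr y) ∉ Set.range inE := by rintro x ⟨e, he⟩; cases he
  { onV := compLift (K := K) (L := B) onV
      (Sum.elim (Sum.elim (fun y => K'.c y) (fun y => K'.c y))
        (Sum.elim (fun p => onV (K.c (.inr p))) Empty.elim))
      (by rintro (y | p); exacts [c_comm y, rfl])
    surj := fun p => by
      obtain ⟨p, rfl⟩ := surj p
      exact ⟨K.compInl B p, rfl⟩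
    inE := inE
    inj := fun e e' h => onE.injective (Sum.inl_injective h)
    src_comm := src_comm
    tgt_comm := tgt_comm
    tyV_comm := comp_ind (K := K) (L := B) tyV_comm
      (by
        rintro ((y | y) | ((p | p) | x))
        exacts [K'.c_ty y, K'.c_ty y, (tyV_comm _).trans (K.c_ty (.inr (.inl p))),
          (tyV_comm _).trans (K.c_ty (.inr (.inr p))), x.elim])
    tyE_comm := tyE_comm
    d_comm := d_comm
    c_comm := by rintro (y | y); exacts [rfl, y.elim]
    wire := fun e he => by
      rcases hr e he with ⟨x, rfl⟩ | ⟨x, rfl⟩ <;> exact ⟨_, rfl⟩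
    fib := fun e he => by
      rcases hr e he with ⟨x, rfl⟩ | ⟨x, rfl⟩
      · change Sum.elim (fun y => K'.c y) (fun y => K'.c y)
            (if W.sgn x then .inl x else .inr x) =
          Sum.elim (fun y => K'.c y) (fun y => K'.c y)
            (if W.sgn x then .inr x else .inl x)
        cases W.sgn x <;> rfl
      · change onV (K.c (.inr (if P.sgn x then .inl x else .inr x))) =
          onV (K.c (.inr (if P.sgn x then .inr x else .inl x)))
        cases P.sgn x
        · exact (glue x).symm
        · exact glue x
    root := by
      have t1 : ∀ x, (K.compGraph B).tgt (.inr (.inl x)) =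
          K.compInr B (.inl (if W.sgn x then .inr x else .inl x)) := fun _ => rfl
      have t2 : ∀ x, (K.compGraph B).tgt (.inr (.inr x)) =
          K.compInr B (.inr (.inl (if P.sgn x then .inr x else .inl x))) := fun _ => rfl
      have g1 : ∀ y, K.compInl B (K.c (.inl y)) = K.compInr B (.inl (.inl y)) :=
        fun y => comp_glue (K := K) (L := B) (.inl y)
      have g2 : ∀ p, K.compInl B (K.c (.inr p)) = K.compInr B (.inr (.inl p)) :=
        fun x => comp_glue (K := K) (L := B) (.inr x)
      let N (z : (K.compGraph B).V) : Prop := ∀ e, e ∉ Set.range inE → (K.compGraph B).tgt e ≠ z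
      have n1 : ∀ p, N (K.compInl B p) → (∀ y, K.c (.inl y) = p → W.sgn y = true) ∧
          (∀ q, K.c (.inr (.inl q)) = p → P.sgn q = true) ∧
          ∀ q, K.c (.inr (.inr q)) = p → P.sgn q = false := by
        refine fun p h => ⟨?_, ?_, ?_⟩
        · rintro y rfl
          cases hy : W.sgn y
          · refine absurd ((t1 y).trans ?_) (h _ (h1 y))
            rw [hy]; exact (g1 y).symm
          · rfl
        · rintro q rfl
          cases hq : P.sgn q
          · refine absurd ((t2 q).trans ?_) (h _ (h2 q))
            rw [hq]; exact (g2 _).symm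
          · rfl
        · rintro q rfl
          cases hq : P.sgn q
          · rfl
          · refine absurd ((t2 q).trans ?_) (h _ (h2 q))
            rw [hq]; exact (g2 _).symm
      have n2 : ∀ y, N (K.compInr B (.inl (.inr y))) → W.sgn y = false := by
        intro y h
        cases hy : W.sgn y
        · rfl
        · refine absurd ((t1 y).trans ?_) (h _ (h1 y))
          rw [hy]; rfl
      have key : ∀ z, N z → (∃ p, z = K.compInl B p ∧ (∀ y, K.c (.inl y) = p → W.sgn y = true) ∧
          (∀ q, K.c (.inr (.inl q)) = p → P.sgn q = true) ∧
          ∀ q, K.c (.inr (.inr q)) = p → P.sgn q = false) ∨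
          ∃ y, z = K.compInr B (.inl (.inr y)) ∧ W.sgn y = false := by
        refine comp_ind (K := K) (L := B) (fun p h => .inl ⟨p, rfl, n1 p h⟩) ?_
        rintro ((y | y) | (p | x)) h
        · rw [← g1] at h ⊢
          exact .inl ⟨_, rfl, n1 _ h⟩
        · exact .inr ⟨y, rfl, n2 y h⟩
        · rw [← g2] at h ⊢
          exact .inl ⟨_, rfl, n1 _ h⟩
        · exact x.elim
      have key' : ∀ p y, onV p = K'.c y → p = K.c (.inl y) := by
        intro p y h
        rw [← c_comm] at h
        rcases eq_of _ _ h with h | ⟨q, ⟨-, h⟩ | ⟨-, h⟩⟩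
        · exact h
        · cases K.c_injective h
        · cases K.c_injective h
      intro z z' h hz hz'
      rcases key z hz with ⟨p, rfl, hp, hp', hp''⟩ | ⟨y, rfl, hy⟩ <;>
      rcases key z' hz' with ⟨q, rfl, hq, hq', hq''⟩ | ⟨y', rfl, hy'⟩
      · rcases eq_of _ _ h with rfl | ⟨s, ⟨hs, hs'⟩ | ⟨hs, hs'⟩⟩
        · rfl
        · have := (hp' s hs.symm).symm.trans (hq'' s hs'.symm)
          cases this
        · have := (hq' s hs'.symm).symm.trans (hp'' s hs.symm)
          cases this
      · rw [hp y' (key' _ _ h).symm] at hy'; cases hy'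
      · rw [hq y (key' _ _ (Eq.symm h)).symm] at hy; cases hy
      · rw [K'.c_injective h]
    rank := compLift (K := K) (L := B) (Function.extend K.c r fun _ => 1)
      (Sum.elim (Sum.elim (fun _ => 1) (fun y => if W.sgn y then 2 else 0))
        (Sum.elim (fun p => r (.inr p)) Empty.elim))
      (by
        rintro (y | p)
        · exact K.c_injective.extend_apply _ _ _
        · exact K.c_injective.extend_apply _ _ _)
    rank_lt := fun e he => by
      rcases hr e he with ⟨x, rfl⟩ | ⟨x, rfl⟩
      · change Sum.elim (fun _ => 1) (fun y => if W.sgn y then 2 else 0)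
            (if W.sgn x then .inl x else .inr x) <
          Sum.elim (fun _ => 1) (fun y => if W.sgn y then 2 else 0)
            (if W.sgn x then .inr x else .inl x)
        cases h : W.sgn x <;> simp [h]
      · change r (.inr (if P.sgn x then .inl x else .inr x)) <
          r (.inr (if P.sgn x then .inr x else .inl x))
        cases h : P.sgn x <;> simp [h, r] }

end FramedCospan

/-! ## Compact closure -/

namespace FCsp

open FramedPointGraph FramedCospan

variable {T : MonoidalSignature.{u, v}} {W X Y Z : FCsp T}

theorem unbend_eq (K : FramedCospan FramedPointGraph.unit (FramedPointGraph.tensor X.dual Y)) :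
    X ◁ (mk K : 𝟙_ (FCsp T) ⟶ dual X ⊗ Y) ≫ (α_ X (dual X) Y).inv ≫ cup X ▷ Y =
      (ρ_ X).hom ≫ (mk K.unbend : X ⟶ Y) ≫ (λ_ Y).inv := by
  change tensorHom (mk (perm (Perm.refl X))) (mk K) ≫ ofPerm (Perm.assoc X (dual X) Y).symm ≫
    tensorHom (mk (FramedCospan.cup X)) (mk (perm (Perm.refl Y))) =
    ofPerm (Perm.rightUnit X) ≫ mk K.unbend ≫ ofPerm (Perm.leftUnit Y).symm
  have e1 := tensorHom_mk (X := X) (Y := X) (X' := unit) (Y' := tensorObj (dual X) Y)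
    (perm (Perm.refl X)) K
  have e2 := tensorHom_mk (X := tensorObj X (dual X)) (Y := unit) (X' := Y) (Y' := Y)
    (FramedCospan.cup X) (perm (Perm.refl Y))
  refine (congrArg₂ (fun f g => f ≫ ofPerm (Perm.assoc X (dual X) Y).symm ≫ g) e1 e2).trans ?_
  refine (Category.assoc _ _ _).symm.trans ((congrArg (· ≫ _) (mk_comp_ofPerm _ _)).trans
    ((mk_comp_mk _ _).trans ((mk_eq (unbendCollapse K).homeo).trans ?_)))
  refine Eq.symm ((congrArg (ofPerm (Perm.rightUnit X) ≫ ·) (mk_comp_ofPerm K.unbend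
    (Perm.leftUnit Y).symm)).trans ((ofPerm_comp_mk _ _).trans ?_))
  rfl

/-- The cap is the bent identity. -/
def bendPerm (X : FramedPointGraph T) : FramedCospan.Iso (FramedCospan.cap X) (perm (Perm.refl X)).bend where
  onV := Equiv.emptySum _ _
  onE := .refl _
  src_comm x := by
    change bendStart X x = if X.sgn x then .inl x else .inr x
    rfl
  tgt_comm x := by
    change bendEnd X x = if X.sgn x then .inr x else .inl x
    rfl
  tyV_comm := by rintro (x | (x | x)); exacts [x.elim, rfl, rfl]
  tyE_comm x := by
    refine (perm_onE _ _).trans ?_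
    change _ = MonoidalSignature.TypeEdge.mid (Sum.elim X.ty X.ty (bendStart X x))
    unfold bendStart
    cases X.sgn x <;> rfl
  d_comm x := x.elim
  c_comm := by rintro (x | x) <;> rfl

theorem cap_eq (X : FCsp T) : cap X = mk (perm (Perm.refl X)).bend := mk_iso (bendPerm X)

theorem snake_right (X : FCsp T) :
    X ◁ (cap X : 𝟙_ (FCsp T) ⟶ dual X ⊗ X) ≫ (α_ X (dual X) X).inv ≫ cup X ▷ X =
      (ρ_ X).hom ≫ (λ_ X).inv := by
  rw [cap_eq, unbend_eq]
  refine congrArg (_ ≫ ·) ((congrArg (· ≫ _) (mk_iso (unbendBend _))).trans ?_)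
  exact Category.id_comp _

/-- The canonical permutation to the double dual. -/
noncomputable def dualDual (X : FCsp T) : X ≅ dual (dual X) :=
  permIso ⟨.refl _, fun _ => rfl, fun x => Bool.not_not (X.sgn x)⟩

theorem cup_dual (X : FCsp T) :
    cup X = (β_ X (dual X)).hom ≫ dual X ◁ (dualDual X).hom ≫ cup (dual X) := by
  have h : dual X ◁ (dualDual X).hom ≫ cup (dual X) = mk ((FramedCospan.cup (dual X)).reindex
      ((Perm.refl (dual X)).tensor ⟨.refl X.V, fun _ => rfl, fun x => Bool.not_not (X.sgn x)⟩)
      (Perm.refl _)) := by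
    refine (congrArg (· ≫ cup (dual X)) (ofPerm_tensor _ _)).trans ?_
    exact ofPerm_comp_mk _ _
  rw [h]
  refine Eq.trans ?_ (ofPerm_comp_mk _ _).symm
  refine mk_iso
    { onV := Equiv.sumCongr (Equiv.sumComm _ _) (.refl _)
      onE := .refl _
      src_comm := fun x => ?_
      tgt_comm := fun x => ?_
      tyV_comm := by rintro ((x | x) | x) <;> rfl
      tyE_comm := fun x => ?_
      d_comm := by rintro (x | x) <;> rfl
      c_comm := fun x => x.elim }
  · change Sum.inl (Sum.swap (bendStart X x)) = Sum.inl (bendStart (dual X) x)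
    change Sum.inl (Sum.swap (if X.sgn x then .inl x else .inr x)) =
      Sum.inl (if !X.sgn x then .inl x else .inr x)
    cases X.sgn x <;> rfl
  · change Sum.inl (Sum.swap (if X.sgn x then .inr x else .inl x)) =
      Sum.inl (if !X.sgn x then .inr x else .inl x)
    cases X.sgn x <;> rfl
  · change MonoidalSignature.TypeEdge.mid (Sum.elim X.ty X.ty (if !X.sgn x then .inl x else .inr x))
      = MonoidalSignature.TypeEdge.mid (Sum.elim X.ty X.ty (if X.sgn x then .inl x else .inr x))
    cases X.sgn x <;> rfl

end FCsp

section snake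

variable {C : Type c} [Category.{d} C] [MonoidalCategory C]

theorem snake_absorb {A B : C} {η : 𝟙_ C ⟶ B ⊗ A} {ε : A ⊗ B ⟶ 𝟙_ C}
    (h : A ◁ η ≫ (α_ A B A).inv ≫ ε ▷ A = (ρ_ A).hom ≫ (λ_ A).inv) :
    A ◁ ((λ_ B).inv ≫ η ▷ B ≫ (α_ B A B).hom ≫ B ◁ ε ≫ (ρ_ B).hom) ≫ ε = ε := by
  calc A ◁ ((λ_ B).inv ≫ η ▷ B ≫ (α_ B A B).hom ≫ B ◁ ε ≫ (ρ_ B).hom) ≫ ε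
      = 𝟙 (A ⊗ B) ⊗≫ A ◁ η ▷ B ⊗≫ ((A ⊗ B) ◁ ε ≫ ε ▷ 𝟙_ C) ⊗≫ 𝟙 (𝟙_ C) := by monoidal
    _ = 𝟙 (A ⊗ B) ⊗≫ (A ◁ η ≫ (α_ A B A).inv ≫ ε ▷ A) ▷ B ⊗≫ ε ⊗≫ 𝟙 (𝟙_ C) := by
        rw [whisker_exchange]; monoidal
    _ = ε := by rw [h]; monoidal

theorem snake_unique {A B D : C} {η : 𝟙_ C ⟶ B ⊗ A} {ε : A ⊗ B ⟶ 𝟙_ C}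
    (h : A ◁ η ≫ (α_ A B A).inv ≫ ε ▷ A = (ρ_ A).hom ≫ (λ_ A).inv) {s t : D ⟶ A}
    (hst : s ▷ B ≫ ε = t ▷ B ≫ ε) : s = t := by
  have key : ∀ s : D ⟶ A, s = (ρ_ D).inv ≫ D ◁ η ≫ (α_ D B A).inv ≫ (s ▷ B ≫ ε) ▷ A ≫ (λ_ A).hom := by
    intro s
    calc s = s ≫ (ρ_ A).inv ≫ ((ρ_ A).hom ≫ (λ_ A).inv) ≫ (λ_ A).hom := by simp
      _ = 𝟙 D ⊗≫ (s ▷ 𝟙_ C ≫ A ◁ η) ⊗≫ ε ▷ A ⊗≫ 𝟙 A := by rw [← h]; monoidal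
      _ = _ := by rw [← whisker_exchange]; monoidal
  rw [key s, key t, hst]

end snake

namespace FCsp

variable {T : MonoidalSignature.{u, v}}

theorem snake_left (X : FCsp T) :
    (cap X : 𝟙_ (FCsp T) ⟶ dual X ⊗ X) ▷ dual X ≫ (α_ (dual X) X (dual X)).hom ≫
      dual X ◁ (cup X : X ⊗ dual X ⟶ 𝟙_ (FCsp T)) = (λ_ (dual X)).hom ≫ (ρ_ (dual X)).inv := by
  have h := snake_absorb (snake_right X)
  set t : dual X ⟶ dual X := (λ_ (dual X)).inv ≫ (cap X : 𝟙_ (FCsp T) ⟶ dual X ⊗ X) ▷ dual X ≫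
    (α_ (dual X) X (dual X)).hom ≫ dual X ◁ (cup X : X ⊗ dual X ⟶ 𝟙_ (FCsp T)) ≫
    (ρ_ (dual X)).hom with ht
  have h1 : t = 𝟙 _ := by
    refine snake_unique (snake_right (dual X)) ?_
    have h2 : X ◁ t ≫ (β_ X (dual X)).hom ≫ dual X ◁ (dualDual X).hom ≫ cup (dual X) =
        (β_ X (dual X)).hom ≫ dual X ◁ (dualDual X).hom ≫ cup (dual X) := by
      rw [← cup_dual]; exact h
    rw [BraidedCategory.braiding_naturality_right_assoc, cancel_epi, ← whisker_exchange_assoc,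
      cancel_epi] at h2
    rw [h2, id_whiskerRight]
    exact (Category.id_comp _).symm
  calc _ = (λ_ (dual X)).hom ≫ t ≫ (ρ_ (dual X)).inv := by simp [ht]
    _ = _ := by rw [h1, Category.id_comp]

/-- The compact structure of `X`. -/
@[reducible] noncomputable def exactPairing (X : FCsp T) : ExactPairing (dual X) X where
  coevaluation' := cap X
  evaluation' := cup X
  coevaluation_evaluation' := snake_right X
  evaluation_coevaluation' := snake_left X

end FCsp

/-! ## Tensor products of labelled objects and their permutations -/

section exchange

variable {C : Type c} [Category.{d} C] [MonoidalCategory C] [SymmetricCategory C]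

/-- The exchange of two neighbouring tensor factors. -/
def exch (A B X : C) : A ⊗ (B ⊗ X) ≅ B ⊗ (A ⊗ X) :=
  (α_ A B X).symm ≪≫ whiskerRightIso (β_ A B) X ≪≫ α_ B A X

theorem exch_inv (A B X : C) : (exch A B X).inv = (exch B A X).hom := by
  simp [exch, SymmetricCategory.braiding_swap_eq_inv_braiding]

theorem exch_natural (A B : C) {X Y : C} (f : X ⟶ Y) :
    A ◁ B ◁ f ≫ (exch A B Y).hom = (exch A B X).hom ≫ B ◁ A ◁ f := by
  simp only [exch, Iso.trans_hom, Iso.symm_hom, whiskerRightIso_hom, Category.assoc]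
  rw [associator_inv_naturality_right_assoc, whisker_exchange_assoc, associator_naturality_right]

theorem exch_natural_assoc (A B : C) {X Y Z : C} (f : X ⟶ Y) (h : B ⊗ (A ⊗ Y) ⟶ Z) :
    A ◁ B ◁ f ≫ (exch A B Y).hom ≫ h = (exch A B X).hom ≫ B ◁ A ◁ f ≫ h := by
  rw [← Category.assoc, exch_natural, Category.assoc]

theorem exch_braid (A B D X : C) :
    (exch A B (D ⊗ X)).hom ≫ B ◁ (exch A D X).hom ≫ (exch B D (A ⊗ X)).hom =
      A ◁ (exch B D X).hom ≫ (exch A D (B ⊗ X)).hom ≫ D ◁ (exch A B X).hom := by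
  have h := congrArg (· ▷ X) (BraidedCategory.yang_baxter A B D)
  have h' := congrArg (fun t => (α_ _ _ _).inv ≫ (α_ _ _ _).inv ≫ (α_ A B D).hom ▷ X ≫ t ≫
    (α_ _ _ _).hom ≫ D ◁ (α_ _ _ _).hom) h
  simp only [exch, Iso.trans_hom, Iso.symm_hom, whiskerRightIso_hom]
  calc _ = _ := by monoidal
    _ = _ := h'
    _ = _ := by monoidal

theorem exch_braid_assoc (A B D X : C) {Z : C} (h : D ⊗ (B ⊗ (A ⊗ X)) ⟶ Z) :
    (exch A B (D ⊗ X)).hom ≫ B ◁ (exch A D X).hom ≫ (exch B D (A ⊗ X)).hom ≫ h =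
      A ◁ (exch B D X).hom ≫ (exch A D (B ⊗ X)).hom ≫ D ◁ (exch A B X).hom ≫ h := by
  simpa only [Category.assoc] using congrArg (· ≫ h) (exch_braid A B D X)

theorem exch_of_comp {X Y Z K L M N : C} {u : X ⊗ L ⟶ M} {v : M ⟶ Y ⊗ N} {j : L ⟶ Y ⊗ K}
    {i : X ⊗ K ⟶ N} (h : u ≫ v = X ◁ j ≫ (exch X Y K).hom ≫ Y ◁ i) :
    ((exch X Z L).hom ≫ Z ◁ u) ≫ Z ◁ v ≫ (exch Z Y N).hom =
      X ◁ (Z ◁ j ≫ (exch Z Y K).hom) ≫ (exch X Y (Z ⊗ K)).hom ≫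
        Y ◁ ((exch X Z K).hom ≫ Z ◁ i) := by
  rw [Category.assoc, ← whiskerLeft_comp_assoc, h]
  simp only [MonoidalCategory.whiskerLeft_comp, Category.assoc]
  rw [exch_natural, ← exch_natural_assoc, exch_braid_assoc]

theorem exch_of_whisker {X Y K L M N P : C} {p : L ⟶ M} {j : M ⟶ X ⊗ K} {j' : L ⟶ X ⊗ N}
    {q : N ⟶ K} {i : Y ⊗ K ⟶ P} (h : p ≫ j = j' ≫ X ◁ q) :
    Y ◁ p ≫ Y ◁ j ≫ (exch Y X K).hom ≫ X ◁ i =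
      (Y ◁ j' ≫ (exch Y X N).hom) ≫ X ◁ (Y ◁ q ≫ i) := by
  rw [← whiskerLeft_comp_assoc, h]
  simp only [MonoidalCategory.whiskerLeft_comp, Category.assoc]
  rw [exch_natural_assoc]

end exchange

section labels

variable {C : Type c} [Category.{d} C] [MonoidalCategory C] {ι : Type a} {κ : Type b}

/-- The tensor product of the objects with labels in a list. -/
@[reducible] def labelTensor (D : ι → C) : List ι → C
  | [] => 𝟙_ C
  | a :: l => D a ⊗ labelTensor D l

theorem labelTensor_eq (D : ι → C) : ∀ l, labelTensor D l = tensorList (l.map D)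
  | [] => rfl
  | a :: l => congrArg (D a ⊗ ·) (labelTensor_eq D l)

theorem labelTensor_congr {D : ι → C} {E : κ → C} {l : List ι} {m : List κ}
    (h : l.map D = m.map E) : labelTensor D l = labelTensor E m := by
  rw [labelTensor_eq, labelTensor_eq, h]

/-- The identification of tensor products of equal lists. -/
def labelCast {D : ι → C} {E : κ → C} {l : List ι} {m : List κ}
    (h : l.map D = m.map E) : labelTensor D l ⟶ labelTensor E m :=
  eqToHom (labelTensor_congr h)

theorem labelCast_refl {D : ι → C} {l : List ι} (h : l.map D = l.map D) : labelCast h = 𝟙 _ := rfl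

theorem labelCast_trans {ν : Type*} {D : ι → C} {E : κ → C} {F : ν → C} {l : List ι} {m : List κ}
    {n : List ν} (h : l.map D = m.map E) (h' : m.map E = n.map F) :
    labelCast h ≫ labelCast h' = labelCast (h.trans h') := eqToHom_trans _ _

theorem labelCast_trans_assoc {ν : Type*} {D : ι → C} {E : κ → C} {F : ν → C} {l : List ι}
    {m : List κ} {n : List ν} (h : l.map D = m.map E) (h' : m.map E = n.map F) {Z : C}
    (f : labelTensor F n ⟶ Z) : labelCast h ≫ labelCast h' ≫ f = labelCast (h.trans h') ≫ f := by
  rw [← Category.assoc, labelCast_trans]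

theorem labelCast_cons {D : ι → C} {E : κ → C} {x : ι} {l : List ι} {y : κ} {m : List κ}
    (h : (x :: l).map D = (y :: m).map E) :
    labelCast h = eqToHom (List.cons.inj h).1 ⊗ₘ labelCast (List.cons.inj h).2 := by
  have h1 : D x = E y := (List.cons.inj h).1
  have h2 : labelTensor D l = labelTensor E m := labelTensor_congr (List.cons.inj h).2
  have key : ∀ (A B X Y : C) (p : A = B) (q : X = Y) (r : A ⊗ X = B ⊗ Y),
      eqToHom r = eqToHom p ⊗ₘ eqToHom q := by
    rintro A _ X _ rfl rfl _
    simp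
  exact key _ _ _ _ h1 h2 _

/-- Concatenation of lists. -/
def labelApp (D : ι → C) : (l m : List ι) →
    (labelTensor D l ⊗ labelTensor D m ≅ labelTensor D (l ++ m))
  | [], m => λ_ (labelTensor D m)
  | x :: l, m => α_ (D x) (labelTensor D l) (labelTensor D m) ≪≫
      whiskerLeftIso (D x) (labelApp D l m)

theorem labelApp_nil (D : ι → C) (m : List ι) : labelApp D [] m = λ_ (labelTensor D m) := rfl

theorem labelApp_cons (D : ι → C) (x : ι) (l m : List ι) :
    (labelApp D (x :: l) m).hom = (α_ (D x) (labelTensor D l) (labelTensor D m)).hom ≫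
      D x ◁ (labelApp D l m).hom := rfl

theorem labelApp_cast {D : ι → C} {E : κ → C} {l m : List ι} {l' m' : List κ}
    (h : l.map D = l'.map E) (h' : m.map D = m'.map E)
    (h'' : (l ++ m).map D = (l' ++ m').map E) :
    (labelApp D l m).hom ≫ labelCast h'' = (labelCast h ⊗ₘ labelCast h') ≫ (labelApp E l' m').hom := by
  induction l generalizing l' with
  | nil =>
    obtain rfl : l' = [] := by simpa using h.symm
    have h1 : labelCast h = 𝟙 (𝟙_ C) := rfl
    rw [h1, id_tensorHom]
    exact (leftUnitor_naturality _).symm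
  | cons x l ih =>
    cases l' with
    | nil => simp at h
    | cons y l' =>
      change _ ≫ labelCast (l := x :: (l ++ m)) (m := y :: (l' ++ m')) h'' = _
      rw [labelCast_cons, labelCast_cons, labelApp_cons, labelApp_cons, Category.assoc,
        ← id_tensorHom, tensorHom_comp_tensorHom,
        ih (List.cons.inj h).2 (by simpa using (List.cons.inj h'').2), Category.id_comp]
      simp [← id_tensorHom]

theorem labelApp_assoc (D : ι → C) (l m n : List ι)
    (h : ((l ++ m) ++ n).map D = (l ++ (m ++ n)).map D) :
    (labelApp D l m).hom ▷ labelTensor D n ≫ (labelApp D (l ++ m) n).hom ≫ labelCast h =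
      (α_ _ _ _).hom ≫ labelTensor D l ◁ (labelApp D m n).hom ≫ (labelApp D l (m ++ n)).hom := by
  induction l with
  | nil =>
    change (λ_ _).hom ▷ _ ≫ (labelApp D m n).hom ≫ labelCast (l := m ++ n) (m := m ++ n) h =
      _ ≫ _ ≫ (λ_ _).hom
    rw [labelCast_refl, Category.comp_id]
    simp
  | cons x l ih =>
    change _ ≫ (labelApp D (x :: (l ++ m)) n).hom ≫
      labelCast (l := x :: ((l ++ m) ++ n)) (m := x :: (l ++ (m ++ n))) h = _
    rw [labelCast_cons, labelApp_cons, labelApp_cons, labelApp_cons]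
    have ih' := ih (List.cons.inj h).2
    rw [eqToHom_refl, id_tensorHom]
    have := congrArg (fun t => (α_ _ _ _).hom ▷ _ ≫ (α_ _ _ _).hom ≫ D x ◁ t) ih'
    simp only [MonoidalCategory.whiskerLeft_comp] at this
    simp only [comp_whiskerRight, Category.assoc, associator_naturality_middle_assoc]
    refine this.trans ?_
    simp

theorem labelApp_nil_right (D : ι → C) (l : List ι) (h : l.map D = (l ++ []).map D) :
    (labelApp D l []).hom = (ρ_ _).hom ≫ labelCast h := by
  induction l with
  | nil =>
    rw [labelCast_refl, Category.comp_id]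
    exact unitors_equal
  | cons x l ih =>
    change _ = _ ≫ labelCast (l := x :: l) (m := x :: (l ++ [])) h
    rw [labelCast_cons, labelApp_cons, ih (List.cons.inj h).2, eqToHom_refl, id_tensorHom]
    simp

/-! ### Permutations -/

/-- The ways to obtain the second list by an insertion of `x` into the first one. -/
inductive Ins (x : ι) : List ι → List ι → Type a
  | head (l) : Ins x l (x :: l)
  | tail (y) {l m} : Ins x l m → Ins x (y :: l) (y :: m)

/-- Derivations of permutations by insertion. -/
inductive PermDer : List ι → List ι → Type a
  | nil : PermDer [] []
  | cons (x) {l m n} : PermDer l m → Ins x m n → PermDer (x :: l) n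

theorem Ins.perm {x : ι} {l m : List ι} (i : Ins x l m) : (x :: l).Perm m := by
  induction i with
  | head l => exact .refl _
  | tail y _ ih => exact (List.Perm.swap _ _ _).trans (ih.cons y)

theorem Ins.unique {x : ι} {l m n : List ι} (i : Ins x l n) (j : Ins x m n) (h : n.Nodup) :
    (⟨l, i⟩ : Σ l, Ins x l n) = ⟨m, j⟩ := by
  induction i generalizing m with
  | head l =>
    cases j with
    | head => rfl
    | tail _ j => exact absurd (j.perm.subset (List.mem_cons_self ..)) (List.nodup_cons.1 h).1
  | tail y i ih =>
    cases j with
    | head => exact absurd (i.perm.subset (List.mem_cons_self ..)) (List.nodup_cons.1 h).1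
    | tail _ j =>
      obtain ⟨rfl, h'⟩ := Sigma.mk.inj (ih j (List.nodup_cons.1 h).2)
      rw [eq_of_heq h']

variable [SymmetricCategory C]

/-- The isomorphism that takes an inserted factor to the front. -/
def Ins.iso (D : ι → C) {x : ι} : {l m : List ι} → Ins x l m →
    (labelTensor D m ≅ D x ⊗ labelTensor D l)
  | _, _, .head l => Iso.refl (D x ⊗ labelTensor D l)
  | _, _, .tail y i => whiskerLeftIso (D y) (i.iso D) ≪≫ exch (D y) (D x) _

/-- The morphism of a derivation. -/
def PermDer.hom (D : ι → C) : {l m : List ι} → PermDer l m → (labelTensor D l ⟶ labelTensor D m)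
  | _, _, .nil => 𝟙 (𝟙_ C)
  | _, _, .cons x p i => D x ◁ p.hom D ≫ (i.iso D).inv

theorem Ins.iso_tail_inv (D : ι → C) {x y : ι} {l m : List ι} (i : Ins x l m) :
    ((Ins.tail y i).iso D).inv = (exch (D x) (D y) _).hom ≫ D y ◁ (i.iso D).inv := by
  rw [← exch_inv]; rfl

theorem Ins.exchange (D : ι → C) {x y : ι} {k l m : List ι} (i : Ins x l m) (j : Ins y k l) :
    ∃ (n : List ι) (j' : Ins y n m) (i' : Ins x k n),
      (i.iso D).inv ≫ (j'.iso D).hom =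
        D x ◁ (j.iso D).hom ≫ (exch (D x) (D y) _).hom ≫ D y ◁ (i'.iso D).inv := by
  induction i generalizing k with
  | head l =>
    refine ⟨_, j.tail x, .head _, ?_⟩
    change 𝟙 _ ≫ D x ◁ _ ≫ _ = _ ≫ _ ≫ D y ◁ 𝟙 _
    rw [MonoidalCategory.whiskerLeft_id, Category.comp_id, Category.id_comp]
  | tail z i ih =>
    cases j with
    | head =>
      refine ⟨_, .head _, i, ?_⟩
      rw [Ins.iso_tail_inv]
      change _ ≫ 𝟙 _ = D x ◁ 𝟙 _ ≫ _
      rw [MonoidalCategory.whiskerLeft_id, Category.comp_id, Category.id_comp]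
    | tail _ j =>
      obtain ⟨n, j', i', h⟩ := ih j
      refine ⟨_, j'.tail z, i'.tail z, ?_⟩
      rw [Ins.iso_tail_inv, Ins.iso_tail_inv]
      exact exch_of_comp h

theorem PermDer.extract (D : ι → C) {x : ι} {l m n : List ι} (p : PermDer l m) (j : Ins x n l) :
    ∃ (k : List ι) (j' : Ins x k m) (q : PermDer n k),
      p.hom D ≫ (j'.iso D).hom = (j.iso D).hom ≫ D x ◁ q.hom D := by
  induction p generalizing n with
  | nil => cases j
  | cons y p i ih =>
    cases j with
    | head =>
      refine ⟨_, i, p, ?_⟩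
      change (D x ◁ _ ≫ _) ≫ _ = 𝟙 _ ≫ _
      simp
    | tail _ j =>
      obtain ⟨k, j', q, h⟩ := ih j
      obtain ⟨n, j'', i', h'⟩ := i.exchange D j'
      refine ⟨n, j'', .cons y q i', ?_⟩
      change (D y ◁ _ ≫ _) ≫ _ = _ ≫ D x ◁ (D y ◁ _ ≫ _)
      rw [Category.assoc, h']
      exact exch_of_whisker h

theorem PermDer.exists_trans (D : ι → C) {l m n : List ι} (p : PermDer l m) (q : PermDer m n) :
    ∃ r : PermDer l n, r.hom D = p.hom D ≫ q.hom D := by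
  induction p generalizing n with
  | nil => cases q; exact ⟨.nil, (Category.comp_id (𝟙 (𝟙_ C))).symm⟩
  | cons x p i ih =>
    obtain ⟨k, j, q', h⟩ := q.extract D i
    obtain ⟨r, h'⟩ := ih q'
    refine ⟨.cons x r j, ?_⟩
    change D x ◁ _ ≫ _ = (D x ◁ _ ≫ (i.iso D).inv) ≫ _
    rw [h', Category.assoc, MonoidalCategory.whiskerLeft_comp, Category.assoc]
    congr 1
    rw [Iso.comp_inv_eq, Category.assoc, Iso.eq_inv_comp, h]

/-- The trivial derivation. -/
def PermDer.refl : (l : List ι) → PermDer l l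
  | [] => .nil
  | x :: l => .cons x (.refl l) (.head l)

theorem PermDer.refl_hom (D : ι → C) : (l : List ι) → (PermDer.refl l).hom D = 𝟙 (labelTensor D l)
  | [] => rfl
  | x :: l => by
    change D x ◁ (PermDer.refl l).hom D ≫ 𝟙 _ = _
    rw [PermDer.refl_hom, MonoidalCategory.whiskerLeft_id, Category.comp_id]

theorem PermDer.unique {l m : List ι} (p q : PermDer l m) (h : m.Nodup) : p = q := by
  induction p with
  | nil => cases q; rfl
  | cons x p i ih =>
    cases q with
    | cons _ q j =>
      obtain ⟨rfl, h'⟩ := Sigma.mk.inj (i.unique j h)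
      rw [eq_of_heq h', ih q (List.nodup_cons.1 (i.perm.nodup_iff.2 h)).2]

theorem PermDer.exists_of_perm {l m : List ι} (h : l.Perm m) : Nonempty (PermDer l m) := by
  induction h with
  | nil => exact ⟨.nil⟩
  | cons x _ ih => exact ih.map fun p => .cons x p (.head _)
  | swap x y l => exact ⟨.cons y (.cons x (.refl l) (.head l)) (.tail x (.head l))⟩
  | trans _ _ ih ih' =>
    obtain ⟨p⟩ := ih
    obtain ⟨q⟩ := ih'
    exact (p.exists_trans (fun _ => 𝟙_ (Type)) q).nonempty

/-- The morphism of a permutation of lists. -/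
noncomputable def labelPerm (D : ι → C) {l m : List ι} (h : l.Perm m) :
    labelTensor D l ⟶ labelTensor D m := (Classical.choice (PermDer.exists_of_perm h)).hom D

theorem labelPerm_eq (D : ι → C) {l m : List ι} (h : l.Perm m) (n : m.Nodup) (p : PermDer l m) :
    labelPerm D h = p.hom D := by
  exact congrArg _ (PermDer.unique _ p n)

theorem labelPerm_refl (D : ι → C) {l : List ι} (h : l.Perm l) (n : l.Nodup) :
    labelPerm D h = 𝟙 _ := by
  rw [labelPerm_eq D h n (.refl l), PermDer.refl_hom]

theorem labelPerm_trans (D : ι → C) {l m k : List ι} (h : l.Perm m) (h' : m.Perm k)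
    (n : k.Nodup) : labelPerm D h ≫ labelPerm D h' = labelPerm D (h.trans h') := by
  obtain ⟨p⟩ := PermDer.exists_of_perm h
  obtain ⟨q⟩ := PermDer.exists_of_perm h'
  obtain ⟨r, hr⟩ := p.exists_trans D q
  rw [labelPerm_eq D h (h'.nodup_iff.2 n) p, labelPerm_eq D h' n q, labelPerm_eq D _ n r, hr]

theorem labelPerm_trans_assoc (D : ι → C) {l m k : List ι} (h : l.Perm m) (h' : m.Perm k)
    (n : k.Nodup) {Z : C} (f : labelTensor D k ⟶ Z) :
    labelPerm D h ≫ labelPerm D h' ≫ f = labelPerm D (h.trans h') ≫ f := by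
  rw [← Category.assoc, labelPerm_trans D h h' n]

theorem labelPerm_cons (D : ι → C) {l m : List ι} (h : l.Perm m) {x : ι}
    (h' : (x :: l).Perm (x :: m)) (n : (x :: m).Nodup) :
    labelPerm D h' = D x ◁ labelPerm D h := by
  obtain ⟨p⟩ := PermDer.exists_of_perm h
  rw [labelPerm_eq D h (List.nodup_cons.1 n).2 p, labelPerm_eq D h' n (.cons x p (.head _))]
  exact Category.comp_id _

theorem labelPerm_swap (D : ι → C) {l : List ι} {x y : ι}
    (h : (x :: y :: l).Perm (y :: x :: l)) (n : (y :: x :: l).Nodup) :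
    labelPerm D h = (exch (D x) (D y) (labelTensor D l)).hom := by
  rw [labelPerm_eq D h n (.cons x (.cons y (.refl l) (.head l)) (.tail y (.head l)))]
  change D x ◁ (D y ◁ (PermDer.refl l).hom D ≫ 𝟙 _) ≫ _ = _
  rw [Ins.iso_tail_inv, PermDer.refl_hom, MonoidalCategory.whiskerLeft_id, Category.comp_id,
    MonoidalCategory.whiskerLeft_id, Category.id_comp]
  change _ ≫ D y ◁ 𝟙 _ = _
  rw [MonoidalCategory.whiskerLeft_id, Category.comp_id]

theorem exch_eqToHom {A A' B B' X X' : C} (p : A = A') (q : B = B') (f : X ⟶ X') :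
    (eqToHom p ⊗ₘ eqToHom q ⊗ₘ f) ≫ (exch A' B' X').hom =
      (exch A B X).hom ≫ (eqToHom q ⊗ₘ eqToHom p ⊗ₘ f) := by
  subst p q
  simp only [eqToHom_refl, id_tensorHom, exch_natural]

/-- Relabelling along a map. -/
def Ins.relabel (f : ι → κ) {x : ι} : {l m : List ι} → Ins x l m → Ins (f x) (l.map f) (m.map f)
  | _, _, .head l => .head (l.map f)
  | _, _, .tail y i => .tail (f y) (i.relabel f)

/-- Relabelling along a map. -/
def PermDer.relabel (f : ι → κ) : {l m : List ι} → PermDer l m → PermDer (l.map f) (m.map f)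
  | _, _, .nil => .nil
  | _, _, .cons x p i => .cons (f x) (p.relabel f) (i.relabel f)

theorem map_relabel {D : ι → C} {E : κ → C} {f : ι → κ} (hf : ∀ i, E (f i) = D i) (l : List ι) :
    l.map D = (l.map f).map E := by
  rw [List.map_map]
  exact List.map_congr_left fun i _ => (hf i).symm

theorem Ins.relabel_inv {D : ι → C} {E : κ → C} {f : ι → κ} (hf : ∀ i, E (f i) = D i) {x : ι}
    {l m : List ι} (i : Ins x l m) :
    (i.iso D).inv ≫ labelCast (map_relabel hf m) =
      (eqToHom (hf x).symm ⊗ₘ labelCast (map_relabel hf l)) ≫ ((i.relabel f).iso E).inv := by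
  induction i with
  | head l =>
    change 𝟙 _ ≫ _ = _ ≫ 𝟙 _
    rw [Category.id_comp, Category.comp_id]
    exact labelCast_cons (l := l) (y := f x) (m := l.map f) (map_relabel hf (x :: l))
  | tail y i ih =>
    rename_i l m
    have e1 : labelCast (map_relabel hf (y :: m)) = _ :=
      labelCast_cons (y := f y) (m := m.map f) (map_relabel hf (y :: m))
    have e2 : labelCast (map_relabel hf (y :: l)) = _ :=
      labelCast_cons (y := f y) (m := l.map f) (map_relabel hf (y :: l))
    rw [e1, e2, Ins.iso_tail_inv]
    change _ = _ ≫ ((Ins.tail (f y) (i.relabel f)).iso E).inv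
    rw [Ins.iso_tail_inv, Category.assoc, ← id_tensorHom, tensorHom_comp_tensorHom, ih]
    rw [← Category.assoc, exch_eqToHom, Category.assoc, ← id_tensorHom, tensorHom_comp_tensorHom]
    simp

theorem PermDer.relabel_hom {D : ι → C} {E : κ → C} {f : ι → κ} (hf : ∀ i, E (f i) = D i)
    {l m : List ι} (p : PermDer l m) :
    p.hom D ≫ labelCast (map_relabel hf m) = labelCast (map_relabel hf l) ≫ (p.relabel f).hom E := by
  induction p with
  | nil =>
    exact (Category.id_comp (𝟙 (𝟙_ C))).trans (Category.comp_id (𝟙 (𝟙_ C))).symm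
  | cons x p i ih =>
    rename_i l m n
    change (D x ◁ p.hom D ≫ (i.iso D).inv) ≫ _ =
      _ ≫ E (f x) ◁ (p.relabel f).hom E ≫ ((i.relabel f).iso E).inv
    have e1 : labelCast (map_relabel hf (x :: l)) = _ :=
      labelCast_cons (y := f x) (m := l.map f) (map_relabel hf (x :: l))
    rw [Category.assoc, i.relabel_inv hf, e1, ← id_tensorHom, ← id_tensorHom,
      tensorHom_comp_tensorHom_assoc, tensorHom_comp_tensorHom_assoc, ih, Category.id_comp, Category.comp_id]

theorem labelPerm_relabel {D : ι → C} {E : κ → C} {f : ι → κ} (hf : ∀ i, E (f i) = D i)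
    {l m : List ι} (h : l.Perm m) (h' : (l.map f).Perm (m.map f)) (n : (m.map f).Nodup) :
    labelPerm D h ≫ labelCast (map_relabel hf m) =
      labelCast (map_relabel hf l) ≫ labelPerm E h' := by
  obtain ⟨p⟩ := PermDer.exists_of_perm h
  rw [labelPerm_eq D h n.of_map p, labelPerm_eq E h' n (p.relabel f), p.relabel_hom hf]

/-- Lists can be appended to both sides of a derivation. -/
def Ins.app {x : ι} (n : List ι) : {l m : List ι} → Ins x l m → Ins x (l ++ n) (m ++ n)
  | _, _, .head l => .head (l ++ n)
  | _, _, .tail y i => .tail y (i.app n)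

/-- Lists can be appended to both sides of a derivation. -/
def PermDer.app (n : List ι) : {l m : List ι} → PermDer l m → PermDer (l ++ n) (m ++ n)
  | _, _, .nil => .refl n
  | _, _, .cons x p i => .cons x (p.app n) (i.app n)

theorem exch_whiskerRight (A B X Y : C) :
    (exch A B X).hom ▷ Y ≫ (α_ B (A ⊗ X) Y).hom ≫ B ◁ (α_ A X Y).hom =
      (α_ A (B ⊗ X) Y).hom ≫ A ◁ (α_ B X Y).hom ≫ (exch A B (X ⊗ Y)).hom := by
  simp [exch]

theorem exch_whiskerRight_assoc (A B X Y : C) {Z : C} (h : B ⊗ (A ⊗ (X ⊗ Y)) ⟶ Z) :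
    (exch A B X).hom ▷ Y ≫ (α_ B (A ⊗ X) Y).hom ≫ B ◁ (α_ A X Y).hom ≫ h =
      (α_ A (B ⊗ X) Y).hom ≫ A ◁ (α_ B X Y).hom ≫ (exch A B (X ⊗ Y)).hom ≫ h := by
  simpa only [Category.assoc] using congrArg (· ≫ h) (exch_whiskerRight A B X Y)

theorem Ins.app_inv (D : ι → C) {x : ι} {l m : List ι} (i : Ins x l m) (n : List ι) :
    (i.iso D).inv ▷ labelTensor D n ≫ (labelApp D m n).hom =
      (labelApp D (x :: l) n).hom ≫ ((i.app n).iso D).inv := by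
  induction i with
  | head l =>
    change (𝟙 _) ▷ _ ≫ _ = _ ≫ 𝟙 _
    simp
  | tail y i ih =>
    rename_i l m
    have e : ((Ins.tail y (i.app n)).iso D).inv = _ := Ins.iso_tail_inv D (i.app n)
    have e' : ((Ins.app n (.tail y i)).iso D).inv = _ := e
    rw [e', Ins.iso_tail_inv, labelApp_cons, labelApp_cons]
    have key : ∀ {X Y L M N P Q : C} (u : X ⊗ L ⟶ M) (v : M ⊗ N ⟶ P) (w : L ⊗ N ⟶ Q)
        (z : X ⊗ Q ⟶ P) (_ : u ▷ N ≫ v = ((α_ X L N).hom ≫ X ◁ w) ≫ z),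
        ((exch X Y L).hom ≫ Y ◁ u) ▷ N ≫ (α_ Y M N).hom ≫ Y ◁ v =
          ((α_ X (Y ⊗ L) N).hom ≫ X ◁ ((α_ Y L N).hom ≫ Y ◁ w)) ≫ (exch X Y Q).hom ≫ Y ◁ z := by
      intro X Y L M N P Q u v w z h
      rw [comp_whiskerRight, Category.assoc, associator_naturality_middle_assoc,
        ← MonoidalCategory.whiskerLeft_comp, h]
      simp only [MonoidalCategory.whiskerLeft_comp, Category.assoc]
      rw [exch_natural_assoc, ← exch_whiskerRight_assoc]
    exact key _ _ _ _ ih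

theorem PermDer.app_hom (D : ι → C) {l m : List ι} (p : PermDer l m) (n : List ι) :
    p.hom D ▷ labelTensor D n ≫ (labelApp D m n).hom =
      (labelApp D l n).hom ≫ (p.app n).hom D := by
  induction p with
  | nil =>
    change (𝟙 _) ▷ _ ≫ _ = _ ≫ (PermDer.refl n).hom D
    rw [PermDer.refl_hom]
    simp
  | cons x p i ih =>
    change (D x ◁ _ ≫ _) ▷ _ ≫ _ = _ ≫ D x ◁ _ ≫ _
    rw [comp_whiskerRight, Category.assoc, i.app_inv, labelApp_cons, labelApp_cons]
    have key : ∀ {X L M N P Q R : C} (p : L ⟶ M) (v : M ⊗ N ⟶ P) (w : L ⊗ N ⟶ Q) (z : Q ⟶ P)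
        (t : X ⊗ P ⟶ R) (_ : p ▷ N ≫ v = w ≫ z),
        (X ◁ p) ▷ N ≫ ((α_ X M N).hom ≫ X ◁ v) ≫ t = ((α_ X L N).hom ≫ X ◁ w) ≫ X ◁ z ≫ t := by
      intro X L M N P Q R p v w z t h
      simp only [Category.assoc]
      rw [associator_naturality_middle_assoc, ← whiskerLeft_comp_assoc, h]
      simp
    exact key _ _ _ _ _ ih

theorem labelPerm_append_right (D : ι → C) {l m : List ι} (h : l.Perm m) (n : List ι)
    (h' : (l ++ n).Perm (m ++ n)) (nd : (m ++ n).Nodup) :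
    labelPerm D h ▷ labelTensor D n ≫ (labelApp D m n).hom =
      (labelApp D l n).hom ≫ labelPerm D h' := by
  obtain ⟨p⟩ := PermDer.exists_of_perm h
  rw [labelPerm_eq D h nd.of_append_left p, labelPerm_eq D h' nd (p.app n), p.app_hom]

theorem labelPerm_append_left (D : ι → C) (n : List ι) {l m : List ι} (h : l.Perm m)
    (h' : (n ++ l).Perm (n ++ m)) (nd : (n ++ m).Nodup) :
    labelTensor D n ◁ labelPerm D h ≫ (labelApp D n m).hom =
      (labelApp D n l).hom ≫ labelPerm D h' := by
  induction n with
  | nil =>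
    change _ ≫ (λ_ _).hom = (λ_ _).hom ≫ labelPerm D h
    exact leftUnitor_naturality _
  | cons x n ih =>
    have ih := ih (h.append_left n) (List.nodup_cons.1 nd).2
    have e : labelPerm D h' = _ := labelPerm_cons D (h.append_left n) h' nd
    rw [e, labelApp_cons, labelApp_cons]
    have key : ∀ {X N L M P Q : C} (p : L ⟶ M) (v : N ⊗ M ⟶ P) (w : N ⊗ L ⟶ Q) (z : Q ⟶ P)
        (_ : N ◁ p ≫ v = w ≫ z),
        (X ⊗ N) ◁ p ≫ (α_ X N M).hom ≫ X ◁ v = ((α_ X N L).hom ≫ X ◁ w) ≫ X ◁ z := by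
      intro X N L M P Q p v w z h
      rw [associator_naturality_right_assoc, ← MonoidalCategory.whiskerLeft_comp, h]
      simp
    exact key _ _ _ _ ih

end labels

section exchange

variable {C : Type c} [Category.{d} C] [MonoidalCategory C] [SymmetricCategory C]

theorem exch_unit_right (A X : C) :
    (exch A (𝟙_ C) X).hom = A ◁ (λ_ X).hom ≫ (λ_ (A ⊗ X)).inv := by
  simp only [exch, Iso.trans_hom, Iso.symm_hom, whiskerRightIso_hom, braiding_tensorUnit_right]
  monoidal

theorem exch_unit_left (A X : C) :
    (exch (𝟙_ C) A X).hom = (λ_ (A ⊗ X)).hom ≫ A ◁ (λ_ X).inv := by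
  rw [← exch_inv, ← cancel_epi (exch A (𝟙_ C) X).hom, Iso.hom_inv_id, exch_unit_right]
  simp

theorem exch_tensor_right (A B D X : C) :
    (exch A (B ⊗ D) X).hom ≫ (α_ B D (A ⊗ X)).hom =
      A ◁ (α_ B D X).hom ≫ (exch A B (D ⊗ X)).hom ≫ B ◁ (exch A D X).hom := by
  simp only [exch, Iso.trans_hom, Iso.symm_hom, whiskerRightIso_hom,
    BraidedCategory.braiding_tensor_right_hom]
  monoidal

theorem exch_tensor_right_assoc (A B D X : C) {Z : C} (h : B ⊗ (D ⊗ (A ⊗ X)) ⟶ Z) :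
    (exch A (B ⊗ D) X).hom ≫ (α_ B D (A ⊗ X)).hom ≫ h =
      A ◁ (α_ B D X).hom ≫ (exch A B (D ⊗ X)).hom ≫ B ◁ (exch A D X).hom ≫ h := by
  simpa only [Category.assoc] using congrArg (· ≫ h) (exch_tensor_right A B D X)

theorem exch_tensor_left (A B D X : C) :
    (α_ A B (D ⊗ X)).hom ≫ A ◁ (exch B D X).hom ≫ (exch A D (B ⊗ X)).hom =
      (exch (A ⊗ B) D X).hom ≫ D ◁ (α_ A B X).hom := by
  simp only [exch, Iso.trans_hom, Iso.symm_hom, whiskerRightIso_hom,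
    BraidedCategory.braiding_tensor_left_hom]
  monoidal

theorem exch_tensor_left_assoc (A B D X : C) {Z : C} (h : D ⊗ (A ⊗ (B ⊗ X)) ⟶ Z) :
    (α_ A B (D ⊗ X)).hom ≫ A ◁ (exch B D X).hom ≫ (exch A D (B ⊗ X)).hom ≫ h =
      (exch (A ⊗ B) D X).hom ≫ D ◁ (α_ A B X).hom ≫ h := by
  simpa only [Category.assoc] using congrArg (· ≫ h) (exch_tensor_left A B D X)

theorem exch_whisker_left (A : C) {B D : C} (f : B ⟶ D) (X : C) :
    A ◁ f ▷ X ≫ (exch A D X).hom = (exch A B X).hom ≫ f ▷ (A ⊗ X) := by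
  simp only [exch, Iso.trans_hom, Iso.symm_hom, whiskerRightIso_hom, Category.assoc]
  rw [associator_inv_naturality_middle_assoc, ← comp_whiskerRight_assoc,
    BraidedCategory.braiding_naturality_right]
  simp

theorem exch_whisker_left_assoc (A : C) {B D : C} (f : B ⟶ D) (X : C) {Z : C}
    (h : D ⊗ (A ⊗ X) ⟶ Z) :
    A ◁ f ▷ X ≫ (exch A D X).hom ≫ h = (exch A B X).hom ≫ f ▷ (A ⊗ X) ≫ h := by
  rw [← Category.assoc, exch_whisker_left, Category.assoc]

end exchange

section labels

variable {C : Type c} [Category.{d} C] [MonoidalCategory C] [SymmetricCategory C]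
  {ι : Type a} {κ : Type b} (D : ι → C)

theorem labelPerm_middle (x : ι) (l m : List ι) (h : (x :: (l ++ m)).Perm (l ++ x :: m))
    (n : (l ++ x :: m).Nodup) :
    D x ◁ (labelApp D l m).hom ≫ labelPerm D h =
      (exch (D x) (labelTensor D l) (labelTensor D m)).hom ≫ (labelApp D l (x :: m)).hom := by
  induction l with
  | nil =>
    have e : labelPerm D h = _ := labelPerm_refl D (l := x :: m) h n
    rw [e]
    refine (Category.comp_id (D x ◁ (labelApp D [] m).hom)).trans ?_
    change D x ◁ (λ_ _).hom = (exch (D x) (𝟙_ C) _).hom ≫ (λ_ _).hom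
    rw [exch_unit_right]
    simp
  | cons y l ih =>
    have ih := ih List.perm_middle.symm (List.nodup_cons.1 n).2
    have n' : (y :: x :: (l ++ m)).Nodup :=
      ((List.perm_middle.symm.cons y).nodup_iff (l₁ := y :: x :: (l ++ m))).2 n
    have e : labelPerm D h = (exch (D x) (D y) (labelTensor D (l ++ m))).hom ≫
        D y ◁ labelPerm D List.perm_middle.symm := by
      rw [← labelPerm_swap D (.swap _ _ _) n', ← labelPerm_cons D List.perm_middle.symm
        (List.perm_middle.symm.cons y) n, labelPerm_trans D _ _ n]
    rw [e, labelApp_cons, labelApp_cons]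
    have key : ∀ {X Y L M P R : C} (v : L ⊗ M ⟶ P) (w : X ⊗ P ⟶ R) (z : L ⊗ (X ⊗ M) ⟶ R)
        (_ : X ◁ v ≫ w = (exch X L M).hom ≫ z),
        X ◁ ((α_ Y L M).hom ≫ Y ◁ v) ≫ (exch X Y P).hom ≫ Y ◁ w =
          (exch X (Y ⊗ L) M).hom ≫ (α_ Y L (X ⊗ M)).hom ≫ Y ◁ z := by
      intro X Y L M P R v w z h
      rw [exch_tensor_right_assoc, ← MonoidalCategory.whiskerLeft_comp, ← h]
      simp only [MonoidalCategory.whiskerLeft_comp, Category.assoc]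
      rw [exch_natural_assoc]
    exact key _ _ _ ih

theorem perm_shuffle (k l m : List ι) : (k ++ (l ++ m)).Perm (l ++ (k ++ m)) := by
  rw [← List.append_assoc, ← List.append_assoc]
  exact List.perm_append_comm.append_right m

theorem labelPerm_shuffle (k l m : List ι) (h : (k ++ (l ++ m)).Perm (l ++ (k ++ m)))
    (n : (l ++ (k ++ m)).Nodup) :
    labelTensor D k ◁ (labelApp D l m).hom ≫ (labelApp D k (l ++ m)).hom ≫ labelPerm D h =
      (exch (labelTensor D k) (labelTensor D l) (labelTensor D m)).hom ≫
        labelTensor D l ◁ (labelApp D k m).hom ≫ (labelApp D l (k ++ m)).hom := by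
  induction k with
  | nil =>
    have e : labelPerm D h = _ := labelPerm_refl D (l := l ++ m) h n
    rw [e, labelApp_nil, labelApp_nil, exch_unit_left]
    change _ ≫ _ ≫ 𝟙 _ = _
    simp
  | cons x k ih =>
    have n' : (x :: (l ++ (k ++ m))).Nodup :=
      (List.perm_middle.symm.nodup_iff (l₁ := x :: (l ++ (k ++ m)))).2 n
    have ih := ih (perm_shuffle k l m) (List.nodup_cons.1 n').2
    have e : labelPerm D h = D x ◁ labelPerm D (perm_shuffle k l m) ≫
        labelPerm D (List.perm_middle.symm : (x :: (l ++ (k ++ m))).Perm _) := by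
      rw [← labelPerm_cons D _ ((perm_shuffle k l m).cons x) n', labelPerm_trans D _ _ n]
    have e' := labelPerm_middle D x l (k ++ m) List.perm_middle.symm n
    have key : ∀ {X K L M P Q R S U W : C} (v : L ⊗ M ⟶ P) (w : K ⊗ P ⟶ Q) (t : K ⊗ M ⟶ U)
        (s : L ⊗ U ⟶ S) (p : Q ⟶ S) (z : L ⊗ (X ⊗ U) ⟶ R) (q : X ⊗ S ⟶ R)
        (_ : K ◁ v ≫ w ≫ p = (exch K L M).hom ≫ L ◁ t ≫ s)
        (_ : X ◁ s ≫ q = (exch X L U).hom ≫ z),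
        (X ⊗ K) ◁ v ≫ ((α_ X K P).hom ≫ X ◁ w) ≫ X ◁ p ≫ q =
          (exch (X ⊗ K) L M).hom ≫ L ◁ ((α_ X K M).hom ≫ X ◁ t) ≫ z := by
      intro X K L M P Q R S U W v w t s p z q h h'
      rw [Category.assoc, associator_naturality_right_assoc]
      simp only [MonoidalCategory.whiskerLeft_comp, Category.assoc]
      rw [← exch_tensor_left_assoc, ← exch_natural_assoc, ← h']
      have := congrArg (fun t => (α_ X K (L ⊗ M)).hom ≫ X ◁ t ≫ q) h
      simpa using this
    rw [e, labelApp_cons, labelApp_cons]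
    exact key (W := 𝟙_ C) _ _ _ _ _ _ _ ih e'

/-! ### Operators -/

variable {D} {k l m : List ι}

/-- The operator that applies a morphism to the first tensor factors. -/
def labelOp (f : labelTensor D k ⟶ labelTensor D l) (m : List ι) :
    labelTensor D (k ++ m) ⟶ labelTensor D (l ++ m) :=
  (labelApp D k m).inv ≫ f ▷ labelTensor D m ≫ (labelApp D l m).hom

/-- The operator that applies a morphism to the last tensor factors. -/
def labelLeft (k : List ι) (f : labelTensor D l ⟶ labelTensor D m) :
    labelTensor D (k ++ l) ⟶ labelTensor D (k ++ m) :=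
  (labelApp D k l).inv ≫ labelTensor D k ◁ f ≫ (labelApp D k m).hom

theorem labelLeft_comp (k : List ι) {l m n : List ι} (f : labelTensor D l ⟶ labelTensor D m)
    (g : labelTensor D m ⟶ labelTensor D n) :
    labelLeft k (f ≫ g) = labelLeft k f ≫ labelLeft k g := by
  simp [labelLeft]

theorem labelLeft_id (k l : List ι) : labelLeft k (𝟙 (labelTensor D l)) = 𝟙 _ := by
  simp [labelLeft]

theorem labelLeft_cons (x : ι) (f : labelTensor D l ⟶ labelTensor D m) :
    labelLeft [x] f = D x ◁ f := by
  simp [labelLeft, labelApp]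

theorem labelOp_comp {k l m : List ι} (f : labelTensor D k ⟶ labelTensor D l)
    (g : labelTensor D l ⟶ labelTensor D m) (n : List ι) :
    labelOp (f ≫ g) n = labelOp f n ≫ labelOp g n := by
  simp [labelOp]

theorem labelOp_interchange {k l m n : List ι} (f : labelTensor D k ⟶ labelTensor D l)
    (g : labelTensor D m ⟶ labelTensor D n) :
    labelOp f m ≫ labelLeft l g = labelLeft k g ≫ labelOp f n := by
  simp only [labelOp, labelLeft, Category.assoc, Iso.hom_inv_id_assoc]
  rw [whisker_exchange_assoc]

theorem labelPerm_left (k : List ι) (h : l.Perm m) (n : (k ++ m).Nodup) :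
    labelLeft k (labelPerm D h) = labelPerm D (h.append_left k) := by
  rw [labelLeft, labelPerm_append_left D k h (h.append_left k) n, Iso.inv_hom_id_assoc]

theorem labelPerm_op (h : k.Perm l) (m : List ι) (n : (l ++ m).Nodup) :
    labelOp (labelPerm D h) m = labelPerm D (h.append_right m) := by
  rw [labelOp, labelPerm_append_right D h m (h.append_right m) n, Iso.inv_hom_id_assoc]

theorem labelOp_shuffle {k l : List ι} (f : labelTensor D k ⟶ labelTensor D l) (m n : List ι)
    (h : (m ++ (k ++ n)).Perm (k ++ (m ++ n))) (h' : (m ++ (l ++ n)).Perm (l ++ (m ++ n)))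
    (nd : (k ++ (m ++ n)).Nodup) (nd' : (l ++ (m ++ n)).Nodup) :
    labelLeft m (labelOp f n) ≫ labelPerm D h' = labelPerm D h ≫ labelOp f (m ++ n) := by
  have e := labelPerm_shuffle D m k n h nd
  have e' := labelPerm_shuffle D m l n h' nd'
  have key : ∀ {M K L N P Q R S U W : C} (a : K ⊗ N ≅ P) (b : M ⊗ P ≅ Q) (s : Q ⟶ R)
      (t : M ⊗ N ≅ S) (u : K ⊗ S ≅ R) (a' : L ⊗ N ≅ U) (b' : M ⊗ U ⟶ W) {Z : C} (s' : W ⟶ Z)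
      (u' : L ⊗ S ⟶ Z) (f : K ⟶ L)
      (_ : M ◁ a.hom ≫ b.hom ≫ s = (exch M K N).hom ≫ K ◁ t.hom ≫ u.hom)
      (_ : M ◁ a'.hom ≫ b' ≫ s' = (exch M L N).hom ≫ L ◁ t.hom ≫ u'),
      (b.inv ≫ M ◁ (a.inv ≫ f ▷ N ≫ a'.hom) ≫ b') ≫ s' = s ≫ u.inv ≫ f ▷ S ≫ u' := by
    intro M K L N P Q R S U W a b s t u a' b' Z s' u' f h h'
    have hs : s = b.inv ≫ M ◁ a.inv ≫ (exch M K N).hom ≫ K ◁ t.hom ≫ u.hom := by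
      rw [← h]; simp
    rw [hs]
    simp only [MonoidalCategory.whiskerLeft_comp, Category.assoc, Iso.hom_inv_id_assoc]
    rw [h', exch_whisker_left_assoc, whisker_exchange_assoc]
  exact key _ _ _ (labelApp D m n) _ _ _ _ _ _ e e'

/-! ### Change of labels -/

theorem labelOp_cast {E : κ → C} {k l : List ι} {k' l' m' : List κ}
    (f : labelTensor D k ⟶ labelTensor D l) (f' : labelTensor E k' ⟶ labelTensor E l')
    (hk : k.map D = k'.map E) (hl : l.map D = l'.map E) (hm : m.map D = m'.map E)
    (hkm : (k ++ m).map D = (k' ++ m').map E) (hlm : (l ++ m).map D = (l' ++ m').map E)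
    (h : f ≫ labelCast hl = labelCast hk ≫ f') :
    labelOp f m ≫ labelCast hlm = labelCast hkm ≫ labelOp f' m' := by
  rw [labelOp, labelOp, Category.assoc, Category.assoc, labelApp_cast hl hm hlm,
    Iso.inv_comp_eq, ← Category.assoc (labelApp D k m).hom, labelApp_cast hk hm hkm,
    Category.assoc, Iso.hom_inv_id_assoc, ← tensorHom_id, ← tensorHom_id,
    tensorHom_comp_tensorHom_assoc, tensorHom_comp_tensorHom_assoc, h, Category.id_comp,
    Category.comp_id]

end labels

/-! ## Networks of states and costates -/

section networks

variable {C : Type c} [Category.{d} C] [MonoidalCategory C] {ι : Type a} {κ : Type b}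
  {D : ι → C} {k l m : List ι}

/-- The labels of a list of states. -/
@[reducible] def joins : List (Σ l, labelTensor D [] ⟶ labelTensor D l) → List ι
  | [] => []
  | s :: A => s.1 ++ joins A

/-- The labels of a list of costates, followed by those of a list. -/
@[reducible] def fullList : List (Σ l, labelTensor D l ⟶ labelTensor D []) → List ι → List ι
  | [], o => o
  | k :: P, o => k.1 ++ fullList P o

/-- The product of a list of states. -/
def stateProd : (A : List (Σ l, labelTensor D [] ⟶ labelTensor D l)) →
    (labelTensor D [] ⟶ labelTensor D (joins A))
  | [] => 𝟙 _
  | s :: A => stateProd A ≫ labelOp s.2 (joins A)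

/-- The successive application of costates. -/
def contractions : (P : List (Σ l, labelTensor D l ⟶ labelTensor D [])) → (o : List ι) →
    (labelTensor D (fullList P o) ⟶ labelTensor D o)
  | [], o => 𝟙 (labelTensor D o)
  | k :: P, o => labelOp k.2 (fullList P o) ≫ contractions P o

theorem joins_perm {A A' : List (Σ l, labelTensor D [] ⟶ labelTensor D l)} (h : A.Perm A') :
    (joins A).Perm (joins A') := by
  induction h with
  | nil => exact .refl _
  | cons s _ ih => exact ih.append_left s.1
  | swap s t A => exact perm_shuffle t.1 s.1 (joins A)
  | trans _ _ ih ih' => exact ih.trans ih'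

theorem fullList_perm {P P' : List (Σ l, labelTensor D l ⟶ labelTensor D [])} (h : P.Perm P')
    (o : List ι) : (fullList P o).Perm (fullList P' o) := by
  induction h with
  | nil => exact .refl _
  | cons s _ ih => exact ih.append_left s.1
  | swap s t A => exact perm_shuffle t.1 s.1 (fullList A o)
  | trans _ _ ih ih' => exact ih.trans ih'

theorem fullList_perm_out (P : List (Σ l, labelTensor D l ⟶ labelTensor D [])) {o o' : List ι}
    (h : o.Perm o') : (fullList P o).Perm (fullList P o') := by
  induction P with
  | nil => exact h
  | cons k P ih => exact ih.append_left k.1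

theorem fullList_append (P : List (Σ l, labelTensor D l ⟶ labelTensor D [])) (l o : List ι) :
    (l ++ fullList P o).Perm (fullList P (l ++ o)) := by
  induction P with
  | nil => exact .refl _
  | cons k P ih => exact (perm_shuffle l k.1 _).trans (ih.append_left k.1)

theorem labelLeft_nil (f : labelTensor D l ⟶ labelTensor D m) :
    labelLeft (D := D) [] f = f := by
  change (λ_ _).inv ≫ 𝟙_ C ◁ f ≫ (λ_ _).hom = f
  simp

variable [SymmetricCategory C]

theorem labelOp_perm_right (f : labelTensor D k ⟶ labelTensor D l) {m n : List ι} (h : m.Perm n)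
    (hk : (k ++ m).Perm (k ++ n)) (hl : (l ++ m).Perm (l ++ n)) (nk : (k ++ n).Nodup)
    (nl : (l ++ n).Nodup) :
    labelOp f m ≫ labelPerm D hl = labelPerm D hk ≫ labelOp f n := by
  have e := labelPerm_left (D := D) k h nk
  have e' := labelPerm_left (D := D) l h nl
  rw [← e, ← e', labelOp_interchange]

theorem state_perm_right (s : labelTensor D [] ⟶ labelTensor D l) {m n : List ι} (h : m.Perm n)
    (hl : (l ++ m).Perm (l ++ n)) (nl : (l ++ n).Nodup) :
    labelOp s m ≫ labelPerm D hl = labelPerm D h ≫ labelOp s n :=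
  labelOp_perm_right s h h hl nl.of_append_right nl

theorem costate_perm_right (k : labelTensor D l ⟶ labelTensor D []) {m n : List ι} (h : m.Perm n)
    (hl : (l ++ m).Perm (l ++ n)) (nl : (l ++ n).Nodup) :
    labelOp k m ≫ labelPerm D h = labelPerm D hl ≫ labelOp k n :=
  labelOp_perm_right k h hl h nl nl.of_append_right

theorem state_shuffle (s : labelTensor D [] ⟶ labelTensor D l) (m n : List ι)
    (h : (m ++ (l ++ n)).Perm (l ++ (m ++ n))) (nd : (l ++ (m ++ n)).Nodup) :
    labelLeft m (labelOp s n) ≫ labelPerm D h = labelOp s (m ++ n) := by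
  have e := labelOp_shuffle s m n (.refl _) h nd.of_append_right nd
  have e' : labelPerm D (.refl (m ++ ([] ++ n))) = 𝟙 _ := labelPerm_refl D _ nd.of_append_right
  rw [e'] at e
  exact e.trans (Category.id_comp _)

theorem costate_shuffle (k : labelTensor D l ⟶ labelTensor D []) (m n : List ι)
    (h : (m ++ (l ++ n)).Perm (l ++ (m ++ n))) (nd : (l ++ (m ++ n)).Nodup) :
    labelLeft m (labelOp k n) = labelPerm D h ≫ labelOp k (m ++ n) := by
  have e := labelOp_shuffle k m n h (.refl _) nd nd.of_append_right
  have e' : labelPerm D (.refl (m ++ ([] ++ n))) = 𝟙 _ := labelPerm_refl D _ nd.of_append_right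
  rw [e'] at e
  exact (Category.comp_id _).symm.trans e

theorem stateProd_perm {A A' : List (Σ l, labelTensor D [] ⟶ labelTensor D l)} (hA : A.Perm A')
    (h : (joins A).Perm (joins A')) (n : (joins A').Nodup) :
    stateProd A ≫ labelPerm D h = stateProd A' := by
  induction hA with
  | nil => exact (congrArg _ (labelPerm_refl D h n)).trans (Category.comp_id _)
  | cons s hA ih =>
    refine (Category.assoc _ _ _).trans ?_
    refine (congrArg (_ ≫ ·) (state_perm_right s.2 (joins_perm hA) h n)).trans ?_
    rw [← Category.assoc, ih (joins_perm hA) n.of_append_right]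
    rfl
  | swap s t A =>
    refine (Category.assoc _ _ _).trans ?_
    have e : labelOp s.2 (joins A) ≫ labelOp t.2 (s.1 ++ joins A) =
        labelOp t.2 (joins A) ≫ labelLeft t.1 (labelOp s.2 (joins A)) := by
      refine Eq.trans ?_ (labelOp_interchange t.2 (labelOp s.2 (joins A))).symm
      rw [labelLeft_nil]
    have e' := state_shuffle s.2 t.1 (joins A) h n
    change (stateProd A ≫ labelOp s.2 (joins A)) ≫ labelOp t.2 (s.1 ++ joins A) ≫ _ =
      (stateProd A ≫ labelOp t.2 (joins A)) ≫ labelOp s.2 (t.1 ++ joins A)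
    rw [← e', Category.assoc, Category.assoc, ← Category.assoc (labelOp s.2 (joins A)), e,
      Category.assoc]
  | trans h1 h2 ih1 ih2 =>
    rw [← ih2 (joins_perm h2) n, ← ih1 (joins_perm h1) ((joins_perm h2).nodup_iff.2 n),
      Category.assoc, labelPerm_trans D _ _ n]

theorem contractions_perm {P P' : List (Σ l, labelTensor D l ⟶ labelTensor D [])}
    (hP : P.Perm P') (o : List ι) (h : (fullList P o).Perm (fullList P' o))
    (n : (fullList P' o).Nodup) : labelPerm D h ≫ contractions P' o = contractions P o := by
  induction hP with
  | nil => exact (congrArg (· ≫ _) (labelPerm_refl D h n)).trans (Category.id_comp _)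
  | cons s hP ih =>
    refine (Category.assoc _ _ _).symm.trans ?_
    refine (congrArg (· ≫ _) (costate_perm_right s.2 (fullList_perm hP o) h n).symm).trans ?_
    rw [Category.assoc, ih (fullList_perm hP o) n.of_append_right]
    rfl
  | swap s t P =>
    have e : labelLeft t.1 (labelOp s.2 (fullList P o)) ≫ labelOp t.2 (fullList P o) =
        labelOp t.2 (s.1 ++ fullList P o) ≫ labelOp s.2 (fullList P o) := by
      refine (labelOp_interchange t.2 (labelOp s.2 (fullList P o))).symm.trans ?_
      rw [labelLeft_nil]
    have e' := costate_shuffle s.2 t.1 (fullList P o) h n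
    change _ ≫ labelOp s.2 (t.1 ++ fullList P o) ≫ labelOp t.2 (fullList P o) ≫ _ =
      labelOp t.2 (s.1 ++ fullList P o) ≫ labelOp s.2 (fullList P o) ≫ _
    rw [← Category.assoc (labelOp t.2 _), ← e, e', Category.assoc, Category.assoc]
  | trans h1 h2 ih1 ih2 =>
    rw [← ih1 (fullList_perm h1 o) ((fullList_perm h2 o).nodup_iff.2 n),
      ← ih2 (fullList_perm h2 o) n, ← Category.assoc, labelPerm_trans D _ _ n]

theorem contractions_out (P : List (Σ l, labelTensor D l ⟶ labelTensor D [])) {o o' : List ι}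
    (h : o.Perm o') (h' : (fullList P o).Perm (fullList P o')) (n : (fullList P o').Nodup) :
    contractions P o ≫ labelPerm D h = labelPerm D h' ≫ contractions P o' := by
  induction P with
  | nil => exact (Category.id_comp _).trans (Category.comp_id _).symm
  | cons k P ih =>
    refine (Category.assoc _ _ _).trans ?_
    refine (congrArg (_ ≫ ·) (ih (fullList_perm_out P h) n.of_append_right)).trans ?_
    refine (Category.assoc _ _ _).symm.trans ?_
    refine (congrArg (· ≫ _) (costate_perm_right k.2 (fullList_perm_out P h) h' n)).trans ?_
    exact Category.assoc _ _ _

theorem contractions_left (P : List (Σ l, labelTensor D l ⟶ labelTensor D [])) (l o : List ι)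
    (h : (l ++ fullList P o).Perm (fullList P (l ++ o))) (n : (fullList P (l ++ o)).Nodup) :
    labelLeft l (contractions P o) = labelPerm D h ≫ contractions P (l ++ o) := by
  induction P with
  | nil =>
    have e : labelPerm D h = _ := labelPerm_refl D (l := l ++ o) h n
    rw [e]
    exact (labelLeft_id l o).trans (Category.comp_id _).symm
  | cons k P ih =>
    have e := ih (fullList_append P l o) n.of_append_right
    have n' : (k.1 ++ (l ++ fullList P o)).Nodup :=
      ((fullList_append P l o).append_left k.1).nodup_iff.2 n
    have e' := costate_shuffle k.2 l (fullList P o) (perm_shuffle _ _ _) n'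
    have e'' := costate_perm_right k.2 (fullList_append P l o)
      ((fullList_append P l o).append_left k.1) n
    change labelLeft l (labelOp k.2 (fullList P o) ≫ contractions P o) =
      labelPerm D h ≫ labelOp k.2 (fullList P (l ++ o)) ≫ contractions P (l ++ o)
    rw [labelLeft_comp, e, e', Category.assoc, ← Category.assoc (labelOp k.2 _), e'',
      Category.assoc, labelPerm_trans_assoc D _ _ n]

/-- The value of a network. -/
noncomputable def netValue (A : List (Σ l, labelTensor D [] ⟶ labelTensor D l))
    (P : List (Σ l, labelTensor D l ⟶ labelTensor D [])) (o : List ι)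
    (h : (joins A).Perm (fullList P o)) : labelTensor D [] ⟶ labelTensor D o :=
  stateProd A ≫ labelPerm D h ≫ contractions P o

variable {A A' : List (Σ l, labelTensor D [] ⟶ labelTensor D l)}
  {P P' : List (Σ l, labelTensor D l ⟶ labelTensor D [])} {o o' : List ι}

theorem netValue_perm (hA : A.Perm A') (hP : P.Perm P') (h : (joins A).Perm (fullList P o))
    (h' : (joins A').Perm (fullList P' o)) (n : (fullList P o).Nodup) :
    netValue A P o h = netValue A' P' o h' := by
  have n' : (fullList P' o).Nodup := (fullList_perm hP o).nodup_iff.1 n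
  rw [netValue, netValue, ← stateProd_perm hA (joins_perm hA) (h'.nodup_iff.2 n'),
    ← contractions_perm hP o (fullList_perm hP o) n', Category.assoc,
    labelPerm_trans_assoc D _ _ n', labelPerm_trans_assoc D _ _ n']

theorem netValue_out (ho : o.Perm o') (h : (joins A).Perm (fullList P o))
    (h' : (joins A).Perm (fullList P o')) (n : (fullList P o').Nodup) :
    netValue A P o h ≫ labelPerm D ho = netValue A P o' h' := by
  rw [netValue, netValue, Category.assoc, Category.assoc,
    contractions_out P ho (fullList_perm_out P ho) n, labelPerm_trans_assoc D _ _ n]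

theorem netValue_state_cons (s : labelTensor D [] ⟶ labelTensor D l)
    (h : (joins A).Perm (fullList P o)) (h' : (l ++ joins A).Perm (fullList P (l ++ o)))
    (n : (fullList P (l ++ o)).Nodup) :
    netValue (⟨l, s⟩ :: A) P (l ++ o) h' = netValue A P o h ≫ labelOp s o := by
  have n' := (fullList_append P l o).nodup_iff.2 n
  have e := contractions_left P l o (fullList_append P l o) n
  have e' := state_perm_right s h (h.append_left l) n'
  have e'' : labelOp s (fullList P o) ≫ labelLeft l (contractions P o) = contractions P o ≫
      labelOp s o := by
    refine (labelOp_interchange s (contractions P o)).trans ?_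
    rw [labelLeft_nil]
  change (stateProd A ≫ labelOp s (joins A)) ≫ labelPerm D h' ≫ contractions P (l ++ o) =
    (stateProd A ≫ labelPerm D h ≫ contractions P o) ≫ labelOp s o
  rw [← labelPerm_trans D (h.append_left l) (fullList_append P l o) n]
  simp only [Category.assoc]
  rw [← e, ← Category.assoc (labelOp s _), e', Category.assoc, e'']

theorem netValue_costate_cons (k : labelTensor D l ⟶ labelTensor D [])
    (h : (joins A).Perm (fullList P (l ++ o))) (h' : (joins A).Perm (l ++ fullList P o))
    (n : (fullList P (l ++ o)).Nodup) :
    netValue A (⟨l, k⟩ :: P) o h' = netValue A P (l ++ o) h ≫ labelOp k o := by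
  have e := contractions_left P l o (fullList_append P l o) n
  have e' : labelLeft l (contractions P o) ≫ labelOp k o =
      labelOp k (fullList P o) ≫ contractions P o := by
    refine (labelOp_interchange k (contractions P o)).symm.trans ?_
    rw [labelLeft_nil]
  change stateProd A ≫ labelPerm D h' ≫ labelOp k (fullList P o) ≫ contractions P o =
    (stateProd A ≫ labelPerm D h ≫ contractions P (l ++ o)) ≫ labelOp k o
  rw [← e', e]
  simp only [Category.assoc]
  rw [labelPerm_trans_assoc D _ _ n]

theorem netValue_state_perm (s : labelTensor D [] ⟶ labelTensor D l) (hl : l.Perm m)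
    (h : (l ++ joins A).Perm (fullList P o)) (h' : (m ++ joins A).Perm (fullList P o))
    (n : (fullList P o).Nodup) :
    netValue (⟨m, s ≫ labelPerm D hl⟩ :: A) P o h' = netValue (⟨l, s⟩ :: A) P o h := by
  have e := labelPerm_op (D := D) hl (joins A) (h'.nodup_iff.2 n)
  change (stateProd A ≫ labelOp (s ≫ labelPerm D hl) (joins A)) ≫ labelPerm D h' ≫ _ =
    (stateProd A ≫ labelOp s (joins A)) ≫ labelPerm D h ≫ _
  rw [labelOp_comp, e]
  simp only [Category.assoc]
  rw [labelPerm_trans_assoc D _ _ n]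

theorem netValue_costate_perm (k : labelTensor D m ⟶ labelTensor D []) (hl : l.Perm m)
    (h : (joins A).Perm (m ++ fullList P o)) (h' : (joins A).Perm (l ++ fullList P o))
    (n : (m ++ fullList P o).Nodup) :
    netValue A (⟨l, labelPerm D hl ≫ k⟩ :: P) o h' = netValue A (⟨m, k⟩ :: P) o h := by
  have e := labelPerm_op (D := D) hl (fullList P o) n
  change stateProd A ≫ labelPerm D h' ≫ labelOp (labelPerm D hl ≫ k) (fullList P o) ≫ _ =
    stateProd A ≫ labelPerm D h ≫ labelOp k (fullList P o) ≫ _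
  rw [labelOp_comp, e]
  simp only [Category.assoc]
  rw [labelPerm_trans_assoc D _ _ n]

/-! ### Relabelling -/

variable {E : κ → C} {f : ι → κ} (hf : ∀ i, E (f i) = D i)

/-- The relabelling of a state. -/
@[reducible] def relabelState (s : Σ l, labelTensor D [] ⟶ labelTensor D l) :
    Σ l, labelTensor E [] ⟶ labelTensor E l :=
  ⟨s.1.map f, s.2 ≫ labelCast (map_relabel hf s.1)⟩

/-- The relabelling of a costate. -/
@[reducible] def relabelCostate (k : Σ l, labelTensor D l ⟶ labelTensor D []) :
    Σ l, labelTensor E l ⟶ labelTensor E [] :=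
  ⟨k.1.map f, labelCast (map_relabel hf k.1).symm ≫ k.2⟩

theorem joins_relabel : ∀ A : List (Σ l, labelTensor D [] ⟶ labelTensor D l),
    joins (A.map (relabelState hf)) = (joins A).map f
  | [] => rfl
  | s :: A => (congrArg (s.1.map f ++ ·) (joins_relabel A)).trans (List.map_append ..).symm

theorem fullList_relabel : ∀ (P : List (Σ l, labelTensor D l ⟶ labelTensor D [])) (o : List ι),
    fullList (P.map (relabelCostate hf)) (o.map f) = (fullList P o).map f
  | [], _ => rfl
  | k :: P, o => (congrArg (k.1.map f ++ ·) (fullList_relabel P o)).trans (List.map_append ..).symm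

theorem stateProd_relabel (A : List (Σ l, labelTensor D [] ⟶ labelTensor D l))
    (h : (joins A).map D = (joins (A.map (relabelState hf))).map E) :
    stateProd A ≫ labelCast h = stateProd (A.map (relabelState hf)) := by
  induction A with
  | nil => exact Category.id_comp _
  | cons s A ih =>
    have hA : (joins A).map D = (joins (A.map (relabelState hf))).map E := by
      rw [joins_relabel, ← map_relabel hf]
    have e := labelOp_cast (D := D) (E := E) (k' := []) (m := joins A) s.2
      (relabelState hf s).2 rfl (map_relabel hf s.1) hA hA h (Category.id_comp _).symm
    refine (Category.assoc _ _ _).trans ((congrArg (_ ≫ ·) e).trans ?_)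
    refine (Category.assoc _ _ _).symm.trans (congrArg (· ≫ _) (ih hA))

theorem contractions_relabel (P : List (Σ l, labelTensor D l ⟶ labelTensor D [])) (o : List ι)
    (h : (fullList P o).map D = (fullList (P.map (relabelCostate hf)) (o.map f)).map E)
    (ho : o.map D = (o.map f).map E) :
    contractions P o ≫ labelCast ho =
      labelCast h ≫ contractions (P.map (relabelCostate hf)) (o.map f) := by
  induction P with
  | nil => exact (Category.id_comp _).trans (Category.comp_id _).symm
  | cons k P ih =>
    have hP : (fullList P o).map D =
        (fullList (P.map (relabelCostate hf)) (o.map f)).map E := by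
      rw [fullList_relabel, ← map_relabel hf]
    have e := labelOp_cast (D := D) (E := E) (l' := []) (m := fullList P o) k.2
      (relabelCostate hf k).2 (map_relabel hf k.1) rfl hP h hP (by
        change k.2 ≫ 𝟙 _ = labelCast _ ≫ labelCast _ ≫ k.2
        rw [labelCast_trans_assoc, labelCast_refl, Category.id_comp, Category.comp_id])
    refine (Category.assoc _ _ _).trans ((congrArg (_ ≫ ·) (ih hP)).trans ?_)
    refine (Category.assoc _ _ _).symm.trans ((congrArg (· ≫ _) e).trans (Category.assoc _ _ _))

theorem labelPerm_relabel_of_eq (hf : ∀ i, E (f i) = D i) {l m : List ι} {l' m' : List κ} (h : l.Perm m)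
    (h' : l'.Perm m') (n : m'.Nodup) (hl : l' = l.map f) (hm : m' = m.map f)
    (cl : l.map D = l'.map E) (cm : m.map D = m'.map E) :
    labelPerm D h ≫ labelCast cm = labelCast cl ≫ labelPerm E h' := by
  subst hl hm
  exact labelPerm_relabel hf h h' n

theorem netValue_relabel (h : (joins A).Perm (fullList P o))
    (h' : (joins (A.map (relabelState hf))).Perm
      (fullList (P.map (relabelCostate hf)) (o.map f)))
    (n : ((fullList P o).map f).Nodup) (ho : o.map D = (o.map f).map E) :
    netValue (A.map (relabelState hf)) (P.map (relabelCostate hf)) (o.map f) h' =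
      netValue A P o h ≫ labelCast ho := by
  have hA : (joins A).map D = (joins (A.map (relabelState hf))).map E := by
    rw [joins_relabel, ← map_relabel hf]
  have hP : (fullList P o).map D = (fullList (P.map (relabelCostate hf)) (o.map f)).map E := by
    rw [fullList_relabel, ← map_relabel hf]
  have e := labelPerm_relabel_of_eq hf h h' (fullList_relabel hf P o ▸ n) (joins_relabel hf A)
    (fullList_relabel hf P o) hA hP
  rw [netValue, netValue, ← stateProd_relabel hf A hA, Category.assoc, Category.assoc,
    Category.assoc, contractions_relabel hf P o hP ho, ← Category.assoc (labelPerm D h), e,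
    Category.assoc]

/-! ### Straightening of wires -/

theorem whisker_triangle {S X Y : C} {c : 𝟙_ C ⟶ S ⊗ Y} {e : X ⊗ S ⟶ 𝟙_ C} {i : X ⟶ Y}
    (h : X ◁ c ≫ (α_ X S Y).inv ≫ e ▷ Y = (ρ_ X).hom ≫ i ≫ (λ_ Y).inv) (R : C) :
    X ◁ ((λ_ R).inv ≫ c ▷ R ≫ (α_ S Y R).hom) ≫ (α_ X S (Y ⊗ R)).inv ≫ e ▷ (Y ⊗ R) ≫
      (λ_ (Y ⊗ R)).hom = i ▷ R := by
  have e1 : X ◁ ((λ_ R).inv ≫ c ▷ R ≫ (α_ S Y R).hom) ≫ (α_ X S (Y ⊗ R)).inv ≫ e ▷ (Y ⊗ R) ≫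
      (λ_ (Y ⊗ R)).hom = (ρ_ X).inv ▷ R ≫ (X ◁ c ≫ (α_ X S Y).inv ≫ e ▷ Y) ▷ R ≫
        (λ_ Y).hom ▷ R := by
    monoidal
  rw [e1, h, ← comp_whiskerRight, ← comp_whiskerRight]
  simp

theorem labelOp_triangle {a s t : ι} {c : 𝟙_ C ⟶ D s ⊗ D t} {e : D a ⊗ D s ⟶ 𝟙_ C}
    {i : D a ⟶ D t}
    (h : D a ◁ c ≫ (α_ (D a) (D s) (D t)).inv ≫ e ▷ D t = (ρ_ (D a)).hom ≫ i ≫ (λ_ (D t)).inv)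
    (R : List ι) :
    labelLeft [a] (labelOp (k := []) (l := [s, t]) (c ≫ D s ◁ (ρ_ (D t)).inv) R) ≫
      labelOp (k := [a, s]) (l := []) (D a ◁ (ρ_ (D s)).hom ≫ e) (t :: R) =
        i ▷ labelTensor D R := by
  rw [← whisker_triangle h (labelTensor D R)]
  refine (congrArg (· ≫ _) (labelLeft_cons a _)).trans ?_
  simp only [labelOp, labelApp, Iso.trans_inv, Iso.trans_hom, whiskerLeftIso_inv,
    whiskerLeftIso_hom]
  change D a ◁ ((λ_ (labelTensor D R)).inv ≫ (c ≫ D s ◁ (ρ_ (D t)).inv) ▷ labelTensor D R ≫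
      (α_ (D s) (D t ⊗ 𝟙_ C) (labelTensor D R)).hom ≫
        D s ◁ ((α_ (D t) (𝟙_ C) (labelTensor D R)).hom ≫ D t ◁ (λ_ (labelTensor D R)).hom)) ≫
    ((D a ◁ (D s ◁ (λ_ (D t ⊗ labelTensor D R)).inv ≫
      (α_ (D s) (𝟙_ C) (D t ⊗ labelTensor D R)).inv) ≫
      (α_ (D a) (D s ⊗ 𝟙_ C) (D t ⊗ labelTensor D R)).inv) ≫
      (D a ◁ (ρ_ (D s)).hom ≫ e) ▷ (D t ⊗ labelTensor D R) ≫
        (λ_ (D t ⊗ labelTensor D R)).hom) = _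
  monoidal

theorem netValue_zigzag {a s t : ι} {c : 𝟙_ C ⟶ D s ⊗ D t} {e : D a ⊗ D s ⟶ 𝟙_ C}
    (hat : D a = D t)
    (htri : D a ◁ c ≫ (α_ (D a) (D s) (D t)).inv ≫ e ▷ D t =
      (ρ_ (D a)).hom ≫ eqToHom hat ≫ (λ_ (D t)).inv) (ne : a ≠ t)
    {r : ι → ι} (hr : ∀ i, D (r i) = D i) (ra : r a = t)
    (r_of_ne : ∀ i ∈ joins A, i ≠ a → r i = i)
    (h : ([s, t] ++ joins A).Perm ([a, s] ++ fullList P o))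
    (h' : (joins (A.map (relabelState hr))).Perm (fullList P o))
    (n : ([a, s] ++ fullList P o).Nodup) :
    netValue (⟨[s, t], c ≫ D s ◁ (ρ_ (D t)).inv⟩ :: A) (⟨[a, s], D a ◁ (ρ_ (D s)).hom ≫ e⟩ :: P)
      o h = netValue (A.map (relabelState hr)) P o h' := by
  classical
  have nl : ([s, t] ++ joins A).Nodup := h.nodup_iff.2 n
  have hs : (t :: joins A).Perm (a :: fullList P o) := by
    have : (s :: t :: joins A).Perm (s :: a :: fullList P o) := h.trans (.swap _ _ _)
    exact this.cons_inv
  have ns : (a :: fullList P o).Nodup :=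
    (hs.nodup_iff).1 (List.nodup_cons.1 nl).2
  have ht : t ∈ fullList P o := by
    have := hs.subset (List.mem_cons_self ..)
    exact (List.mem_cons.1 this).resolve_left (Ne.symm ne)
  have ha : a ∈ joins A := by
    have := hs.symm.subset (List.mem_cons_self ..)
    exact (List.mem_cons.1 this).resolve_left ne
  obtain ⟨R, hR⟩ : ∃ R, (joins A).Perm (a :: R) := ⟨_, List.perm_cons_erase ha⟩
  have hF : (t :: R).Perm (fullList P o) := by
    have : (a :: t :: R).Perm (a :: fullList P o) :=
      (List.Perm.swap _ _ _).trans ((hR.symm.cons t).trans hs)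
    exact this.cons_inv
  have nR : (a :: R).Nodup := hR.nodup_iff.1 nl.of_append_right
  have nF : (fullList P o).Nodup := (List.nodup_cons.1 ns).2
  have ntR : (t :: R).Nodup := hF.nodup_iff.2 nF
  have q1 : ([s, t] ++ joins A).Perm ([s, t] ++ a :: R) := hR.append_left _
  have n1 : ([s, t] ++ a :: R).Nodup := q1.nodup_iff.1 nl
  have q2 : ([a] ++ ([s, t] ++ R)).Perm ([s, t] ++ ([a] ++ R)) := perm_shuffle _ _ _
  have q3 : ([a, s] ++ (t :: R)).Perm ([a, s] ++ fullList P o) := hF.append_left _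
  have n3 : ([a, s] ++ (t :: R)).Nodup := q3.nodup_iff.2 n
  set c' : labelTensor D [] ⟶ labelTensor D [s, t] := c ≫ D s ◁ (ρ_ (D t)).inv with hc'
  set e' : labelTensor D [a, s] ⟶ labelTensor D [] := D a ◁ (ρ_ (D s)).hom ≫ e with he'
  have e1 := state_perm_right c' hR q1 n1
  have e2 := state_shuffle c' [a] R q2 n1
  have e3 := costate_perm_right e' hF q3 n
  have e4 : labelLeft [a] (labelOp c' R) ≫ labelOp e' (t :: R) = _ := labelOp_triangle htri R
  -- the relabelled side
  have rR : (a :: R).map r = t :: R := by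
    rw [List.map_cons, ra]
    congr 1
    refine (List.map_congr_left fun i hi => ?_).trans (List.map_id R)
    exact r_of_ne i (hR.symm.subset (List.mem_cons_of_mem _ hi))
      fun h => (List.nodup_cons.1 nR).1 (h ▸ hi)
  have cJ : (joins A).map D = (joins (A.map (relabelState hr))).map D := by
    rw [joins_relabel, ← map_relabel hr]
  have pJ : (joins (A.map (relabelState hr))).Perm (t :: R) := h'.trans hF.symm
  have cR : (a :: R).map D = (t :: R).map D := by rw [List.map_cons, List.map_cons, hat]
  have e5 := labelPerm_relabel_of_eq hr hR pJ ntR (joins_relabel hr A) rR.symm cJ cR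
  have e6 : labelCast cR = eqToHom hat ▷ labelTensor D R := by
    have : labelCast cR = eqToHom hat ⊗ₘ labelCast (D := D) (E := D) rfl := labelCast_cons cR
    rw [this, labelCast_refl, tensorHom_id]
  rw [netValue, netValue, ← stateProd_relabel hr A cJ, ← labelPerm_trans D pJ hF nF]
  change (stateProd A ≫ labelOp c' (joins A)) ≫ labelPerm D h ≫ labelOp e' (fullList P o) ≫
    contractions P o = _
  have e7 : labelPerm D h = labelPerm D q1 ≫ labelPerm D q2.symm ≫ labelPerm D q3 := by
    rw [labelPerm_trans D _ _ n, labelPerm_trans D _ _ n]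
  have e8 : labelOp c' (a :: R) ≫ labelPerm D q2.symm = labelLeft [a] (labelOp c' R) := by
    refine (congrArg (· ≫ _) e2.symm).trans ?_
    rw [Category.assoc, labelPerm_trans D _ _ n3, labelPerm_refl D _ n3]
    exact Category.comp_id _
  rw [e7]
  simp only [Category.assoc]
  rw [← Category.assoc (labelPerm D q3), ← e3, ← Category.assoc (labelOp c' (joins A)), e1]
  simp only [Category.assoc]
  rw [← Category.assoc (labelCast cJ), ← e5, e6, ← e4, ← e8]
  simp only [Category.assoc]

end networks

/-! ## The object of a framed point graph -/

section labels

variable {C : Type c} [Category.{d} C] [MonoidalCategory C] [SymmetricCategory C]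
  {ι : Type a} {κ : Type b} (D : ι → C)

theorem labelPerm_of_eq {l m : List ι} (h : l = m) (h' : l.Perm m) (n : m.Nodup)
    (e : l.map D = m.map D) : labelPerm D h' = labelCast e := by
  subst h
  exact labelPerm_refl D h' n

theorem labelPerm_comm (l m : List ι) (h : (l ++ m).Perm (m ++ l)) (n : (m ++ l).Nodup) :
    (labelApp D l m).hom ≫ labelPerm D h =
      (β_ (labelTensor D l) (labelTensor D m)).hom ≫ (labelApp D m l).hom := by
  induction l with
  | nil =>
    have e : labelPerm D h = _ := labelPerm_of_eq D (List.append_nil m).symm h n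
      (by rw [List.append_nil])
    change _ = (β_ (𝟙_ C) (labelTensor D m)).hom ≫ _
    rw [e, labelApp_nil_right D m (by rw [List.append_nil]), braiding_tensorUnit_left, labelApp_nil]
    simp
  | cons x l ih =>
    have n' : (x :: (m ++ l)).Nodup := (List.perm_middle.symm.nodup_iff (l₁ := x :: (m ++ l))).2 n
    have ih := ih List.perm_append_comm (List.nodup_cons.1 n').2
    have e : labelPerm D h = D x ◁ labelPerm D List.perm_append_comm ≫
        labelPerm D (List.perm_middle.symm : (x :: (m ++ l)).Perm _) := by
      rw [← labelPerm_cons D _ (List.perm_append_comm.cons x) n', labelPerm_trans D _ _ n]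
    have e' := labelPerm_middle D x m l List.perm_middle.symm n
    have key : ∀ {X L M P Q R : C} (u : L ⊗ M ⟶ P) (p : P ⟶ Q) (v : M ⊗ L ⟶ Q) (q : X ⊗ Q ⟶ R)
        (w : M ⊗ (X ⊗ L) ⟶ R) (_ : u ≫ p = (β_ L M).hom ≫ v)
        (_ : X ◁ v ≫ q = (exch X M L).hom ≫ w),
        ((α_ X L M).hom ≫ X ◁ u) ≫ X ◁ p ≫ q = (β_ (X ⊗ L) M).hom ≫ w := by
      intro X L M P Q R u p v q w h h'
      rw [Category.assoc, ← whiskerLeft_comp_assoc, h, MonoidalCategory.whiskerLeft_comp,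
        Category.assoc, h', BraidedCategory.braiding_tensor_left_hom]
      simp [exch]
    rw [e, labelApp_cons]
    exact key _ _ _ _ _ ih e'

end labels

namespace FramedPointGraph

variable {T : MonoidalSignature.{u, v}} {X Y Z X' Y' : FramedPointGraph T}

/-- The vertices in their order. -/
noncomputable def lst (X : FramedPointGraph T) : List X.V :=
  letI := X.ord
  letI := X.finite
  letI := Fintype.ofFinite X.V
  (Finset.univ : Finset X.V).sort (· ≤ ·)

theorem lst_nodup (X : FramedPointGraph T) : X.lst.Nodup := by
  letI := X.ord
  exact Finset.sort_nodup _ _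

theorem mem_lst (x : X.V) : x ∈ X.lst := by
  letI := X.ord
  letI := X.finite
  letI := Fintype.ofFinite X.V
  exact (Finset.mem_sort _).2 (Finset.mem_univ x)

theorem lst_pairwise (X : FramedPointGraph T) : X.lst.Pairwise X.ord.le := by
  letI := X.ord
  exact Finset.pairwise_sort _ _

theorem lst_unique {l : List X.V} (hn : l.Nodup) (hm : ∀ x, x ∈ l) (hp : l.Pairwise X.ord.le) :
    X.lst = l := by
  letI := X.ord
  refine List.Perm.eq_of_pairwise (le := X.ord.le) (fun a b _ _ => X.ord.le_antisymm a b)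
    X.lst_pairwise hp ?_
  exact (List.perm_ext_iff_of_nodup X.lst_nodup hn).2 fun x => ⟨fun _ => hm x, fun _ => mem_lst x⟩

theorem lst_tensor (X Y : FramedPointGraph T) :
    (X.tensor Y).lst = X.lst.map Sum.inl ++ Y.lst.map Sum.inr := by
  refine lst_unique ?_ ?_ ?_
  · refine List.nodup_append.2 ⟨X.lst_nodup.map Sum.inl_injective,
      Y.lst_nodup.map Sum.inr_injective, ?_⟩
    intro p hp q hq
    obtain ⟨x, _, rfl⟩ := List.mem_map.1 hp
    obtain ⟨y, _, rfl⟩ := List.mem_map.1 hq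
    exact Sum.inl_ne_inr
  · rintro (x | y)
    · exact List.mem_append_left _ (List.mem_map_of_mem (mem_lst x))
    · exact List.mem_append_right _ (List.mem_map_of_mem (mem_lst y))
  · refine List.pairwise_append.2 ⟨?_, ?_, ?_⟩
    · exact List.pairwise_map.2 (X.lst_pairwise.imp fun h => Sum.Lex.inl h)
    · exact List.pairwise_map.2 (Y.lst_pairwise.imp fun h => Sum.Lex.inr h)
    · intro p hp q hq
      obtain ⟨x, _, rfl⟩ := List.mem_map.1 hp
      obtain ⟨y, _, rfl⟩ := List.mem_map.1 hq
      exact Sum.Lex.sep x y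

theorem lst_unit : (unit : FramedPointGraph T).lst = [] :=
  lst_unique .nil (fun x => Empty.elim x) .nil

theorem lst_point (Z : T.O) : (point Z : FramedPointGraph T).lst = [()] :=
  lst_unique (List.nodup_singleton _) (fun _ => List.mem_singleton.2 rfl)
    (List.pairwise_singleton _ _)

theorem lst_reframing {φ : Perm X Y} (h : φ.IsReframing) : Y.lst = X.lst.map φ.equiv := by
  refine lst_unique (X.lst_nodup.map φ.equiv.injective) (fun y => ?_) ?_
  · exact List.mem_map.2 ⟨φ.equiv.symm y, mem_lst _, φ.equiv.apply_symm_apply y⟩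
  · exact List.pairwise_map.2 (X.lst_pairwise.imp fun h' => (h _ _).2 h')

theorem lst_perm (φ : Perm X Y) : (X.lst.map φ.equiv).Perm Y.lst :=
  (List.perm_ext_iff_of_nodup (X.lst_nodup.map φ.equiv.injective) Y.lst_nodup).2 fun y =>
    ⟨fun _ => mem_lst y, fun _ =>
      List.mem_map.2 ⟨φ.equiv.symm y, mem_lst _, φ.equiv.apply_symm_apply y⟩⟩

/-- The signed type of a vertex. -/
def letter (X : FramedPointGraph T) (x : X.V) : T.O × Bool := (X.ty x, X.sgn x)

theorem letter_perm (φ : Perm X Y) (x : X.V) : Y.letter (φ.equiv x) = X.letter x :=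
  Prod.ext (φ.ty_comm x) (φ.sgn_comm x)

/-- The word of the signed types of the vertices. -/
noncomputable def letters (X : FramedPointGraph T) : List (T.O × Bool) := X.lst.map X.letter

theorem letters_tensor (X Y : FramedPointGraph T) :
    (X.tensor Y).letters = X.letters ++ Y.letters := by
  simp only [letters, lst_tensor, List.map_append, List.map_map]
  rfl

theorem letters_unit : (unit : FramedPointGraph T).letters = [] := by
  simp only [letters, lst_unit]
  rfl

theorem letters_point (Z : T.O) : (point Z : FramedPointGraph T).letters = [(Z, true)] := by
  simp only [letters, lst_point]
  rfl

theorem letters_dual_point (Z : T.O) :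
    (point Z : FramedPointGraph T).dual.letters = [(Z, false)] := by
  have : (point Z : FramedPointGraph T).dual.lst = [()] := lst_point Z
  simp only [letters, this]
  rfl

theorem letters_reframing {φ : Perm X Y} (h : φ.IsReframing) : Y.letters = X.letters := by
  simp only [letters, lst_reframing h, List.map_map]
  exact List.map_congr_left fun x _ => letter_perm φ x

section ob

variable {V : Type w₁} [Category.{w₂} V] [MonoidalCategory V] (D : T.O × Bool → V)

/-- The object that a choice of objects for the signed types assigns to a framed point graph. -/
@[reducible] noncomputable def ob (X : FramedPointGraph T) : V := labelTensor D X.letters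

/-- The comparison of tensor products. -/
noncomputable def obTensor (X Y : FramedPointGraph T) :
    ob D X ⊗ ob D Y ≅ ob D (X.tensor Y) :=
  labelApp D X.letters Y.letters ≪≫ eqToIso (congrArg (labelTensor D) (letters_tensor X Y).symm)

theorem obTensor_hom (X Y : FramedPointGraph T) : (obTensor D X Y).hom =
    (labelApp D X.letters Y.letters).hom ≫ labelCast (by rw [letters_tensor]) := rfl

theorem obTensor_cast {ι κ : Type} (lt : ι → T.O × Bool) {l m : List ι}
    (hl : l.map (fun i => D (lt i)) = X.letters.map D)
    (hm : m.map (fun i => D (lt i)) = Y.letters.map D)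
    (h : (l ++ m).map (fun i => D (lt i)) = (X.tensor Y).letters.map D) :
    (labelApp (fun i => D (lt i)) l m).hom ≫ labelCast h =
      (labelCast hl ⊗ₘ labelCast hm) ≫ (obTensor D X Y).hom := by
  have h' : (l ++ m).map (fun i => D (lt i)) = (X.letters ++ Y.letters).map D := by
    rw [h, letters_tensor]
  rw [obTensor_hom, ← Category.assoc, ← labelApp_cast hl hm h', Category.assoc, labelCast_trans]

variable [SymmetricCategory V]

theorem map_letters (X : FramedPointGraph T) :
    X.letters.map D = X.lst.map fun x => D (X.letter x) := by
  rw [letters, List.map_map]; rfl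

theorem map_letters_perm (φ : Perm X Y) :
    X.letters.map D = (X.lst.map φ.equiv).map fun y => D (Y.letter y) := by
  rw [map_letters, List.map_map]
  exact List.map_congr_left fun x _ => congrArg D (letter_perm φ x).symm

/-- The morphism of a permutation. -/
noncomputable def obPerm (φ : Perm X Y) : ob D X ⟶ ob D Y :=
  labelCast (map_letters_perm D φ) ≫ labelPerm (fun y => D (Y.letter y)) (lst_perm φ) ≫
    labelCast (map_letters D Y).symm

/-- The morphism of a permutation in terms of other labels. -/
theorem obPerm_eq {ι : Type*} (φ : Perm X Y) (E : ι → V) (f : Y.V → ι)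
    (hf : Function.Injective f) (hE : ∀ y, E (f y) = D (Y.letter y)) {l m : List ι}
    (hl : l = X.lst.map fun x => f (φ.equiv x)) (hm : m = Y.lst.map f) (h : l.Perm m)
    (cl : X.letters.map D = l.map E) (cm : m.map E = Y.letters.map D) :
    obPerm D φ = labelCast cl ≫ labelPerm E h ≫ labelCast cm := by
  have hl' : l = (X.lst.map φ.equiv).map f := by rw [hl, List.map_map]; rfl
  have n : m.Nodup := by rw [hm]; exact Y.lst_nodup.map hf
  have e := labelPerm_relabel_of_eq hE (lst_perm φ) h n hl' hm
    (by rw [hl']; exact map_relabel hE _) (by rw [hm]; exact map_relabel hE _)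
  rw [obPerm, ← labelCast_trans (m := m) (E := E) (by rw [hm]; exact map_relabel hE _) cm,
    ← Category.assoc (labelPerm _ _), e]
  simp only [Category.assoc]
  rw [labelCast_trans_assoc]

theorem obPerm_refl (X : FramedPointGraph T) : obPerm D (Perm.refl X) = 𝟙 _ := by
  have h : X.lst.map (Perm.refl X).equiv = X.lst := List.map_id _
  have e := labelPerm_of_eq (fun y => D (X.letter y)) h (lst_perm (Perm.refl X))
    X.lst_nodup (congrArg _ h)
  refine (congrArg (fun t => labelCast _ ≫ t ≫ labelCast _) e).trans ?_
  rw [labelCast_trans, labelCast_trans, labelCast_refl]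

theorem obPerm_trans (φ : Perm X Y) (ψ : Perm Y Z) :
    obPerm D (φ.trans ψ) = obPerm D φ ≫ obPerm D ψ := by
  have h1 : (X.lst.map fun x => ψ.equiv (φ.equiv x)).Perm (Y.lst.map ψ.equiv) := by
    have := (lst_perm φ).map ψ.equiv
    rwa [List.map_map] at this
  have hE : ∀ y, D (Z.letter (ψ.equiv y)) = D (Y.letter y) := fun y =>
    congrArg D (letter_perm ψ y)
  have c : X.letters.map D =
      (X.lst.map fun x => ψ.equiv (φ.equiv x)).map fun z => D (Z.letter z) :=
    map_letters_perm D (φ.trans ψ)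
  have hL : obPerm D (φ.trans ψ) = labelCast c ≫ labelPerm _ (h1.trans (lst_perm ψ)) ≫
    labelCast (map_letters D Z).symm := rfl
  have e := obPerm_eq D φ (fun z => D (Z.letter z)) ψ.equiv ψ.equiv.injective hE rfl rfl h1
    c (map_letters_perm D ψ).symm
  rw [hL, e, obPerm]
  simp only [Category.assoc]
  rw [labelCast_trans_assoc, labelCast_refl, Category.id_comp,
    labelPerm_trans_assoc _ _ _ Z.lst_nodup]

theorem obPerm_reframing {φ : Perm X Y} (h : φ.IsReframing) :
    obPerm D φ = labelCast (by rw [letters_reframing h]) := by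
  have e := labelPerm_of_eq (fun y => D (Y.letter y)) (lst_reframing h).symm (lst_perm φ)
    Y.lst_nodup (by rw [lst_reframing h])
  rw [obPerm, e, labelCast_trans, labelCast_trans]

theorem obPerm_tensor (φ : Perm X Y) (ψ : Perm X' Y') :
    (obTensor D X X').hom ≫ obPerm D (φ.tensor ψ) =
      (obPerm D φ ⊗ₘ obPerm D ψ) ≫ (obTensor D Y Y').hom := by
  let E := fun z => D ((Y.tensor Y').letter z)
  have hl : ((X.tensor X').lst.map (φ.tensor ψ).equiv) =
      (X.lst.map fun x => Sum.inl (φ.equiv x)) ++ (X'.lst.map fun x => Sum.inr (ψ.equiv x)) := by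
    rw [lst_tensor, List.map_append, List.map_map, List.map_map]
    rfl
  have p1 : (X.lst.map fun x => (Sum.inl (φ.equiv x) : Y.V ⊕ Y'.V)).Perm (Y.lst.map Sum.inl) := by
    have := (lst_perm φ).map (Sum.inl : Y.V → Y.V ⊕ Y'.V)
    rwa [List.map_map] at this
  have p2 : (X'.lst.map fun x => (Sum.inr (ψ.equiv x) : Y.V ⊕ Y'.V)).Perm (Y'.lst.map Sum.inr) := by
    have := (lst_perm ψ).map (Sum.inr : Y'.V → Y.V ⊕ Y'.V)
    rwa [List.map_map] at this
  have c1 : X.letters.map D = (X.lst.map fun x => (Sum.inl (φ.equiv x) : Y.V ⊕ Y'.V)).map E := by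
    rw [map_letters_perm D φ, List.map_map, List.map_map]; rfl
  have c2 : X'.letters.map D =
      (X'.lst.map fun x => (Sum.inr (ψ.equiv x) : Y.V ⊕ Y'.V)).map E := by
    rw [map_letters_perm D ψ, List.map_map, List.map_map]; rfl
  have c3 : (Y.lst.map (Sum.inl : Y.V → Y.V ⊕ Y'.V)).map E = Y.letters.map D := by
    rw [map_letters D Y, List.map_map]; rfl
  have c4 : (Y'.lst.map (Sum.inr : Y'.V → Y.V ⊕ Y'.V)).map E = Y'.letters.map D := by
    rw [map_letters D Y', List.map_map]; rfl
  have e1 := obPerm_eq D φ E Sum.inl Sum.inl_injective (fun _ => rfl) rfl rfl p1 c1 c3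
  have e2 := obPerm_eq D ψ E Sum.inr Sum.inr_injective (fun _ => rfl) rfl rfl p2 c2 c4
  have nd : (Y.lst.map (Sum.inl : Y.V → Y.V ⊕ Y'.V) ++ Y'.lst.map Sum.inr).Nodup := by
    rw [← lst_tensor]; exact (Y.tensor Y').lst_nodup
  have p3 := p1.append p2
  have c5 : (X.tensor X').letters.map D = ((X.lst.map fun x =>
      (Sum.inl (φ.equiv x) : Y.V ⊕ Y'.V)) ++ (X'.lst.map fun x => Sum.inr (ψ.equiv x))).map E := by
    rw [letters_tensor, List.map_append, List.map_append, c1, c2]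
  have c6 : (Y.lst.map (Sum.inl : Y.V → Y.V ⊕ Y'.V) ++ Y'.lst.map Sum.inr).map E =
      (Y.tensor Y').letters.map D := by
    rw [letters_tensor, List.map_append, List.map_append, c3, c4]
  have e3 := obPerm_eq D (φ.tensor ψ) E id Function.injective_id (fun _ => rfl)
    (l := (X.lst.map fun x => Sum.inl (φ.equiv x)) ++ (X'.lst.map fun x => Sum.inr (ψ.equiv x)))
    (m := Y.lst.map Sum.inl ++ Y'.lst.map Sum.inr) hl.symm
    (by rw [List.map_id]; exact (lst_tensor _ _).symm) p3 c5 c6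
  have c7 : (X.letters ++ X'.letters).map D = ((X.lst.map fun x =>
      (Sum.inl (φ.equiv x) : Y.V ⊕ Y'.V)) ++ (X'.lst.map fun x => Sum.inr (ψ.equiv x))).map E := by
    rw [← letters_tensor]; exact c5
  have q : labelPerm E p1 ▷ _ ≫ (labelApp E _ _).hom = _ :=
    labelPerm_append_right E p1 _ (p1.append_right _)
    ((p2.append_left _).nodup_iff.2 nd)
  have q' := labelPerm_append_left E _ p2 (p2.append_left _) nd
  have c6' : (Y.lst.map (Sum.inl : Y.V → Y.V ⊕ Y'.V) ++ Y'.lst.map Sum.inr).map E =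
      (Y.letters ++ Y'.letters).map D := by
    rw [c6, letters_tensor]
  have r1 := labelApp_cast c1 c2 c7
  have r2 := labelApp_cast c3 c4 c6'
  rw [e1, e2, e3, obTensor_hom, obTensor_hom, Category.assoc, labelCast_trans_assoc,
    ← Category.assoc, r1, ← tensorHom_comp_tensorHom, ← tensorHom_comp_tensorHom]
  simp only [Category.assoc]
  rw [← Category.assoc (labelCast c3 ⊗ₘ _), ← r2]
  simp only [Category.assoc]
  rw [labelCast_trans]
  have q'' : (labelApp E _ _).hom ≫ labelPerm E p3 =
      (labelPerm E p1 ⊗ₘ labelPerm E p2) ≫ (labelApp E _ _).hom := by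
    rw [MonoidalCategory.tensorHom_def, Category.assoc, q', ← Category.assoc, q, Category.assoc,
      labelPerm_trans E _ _ nd]
  rw [← Category.assoc (labelPerm E p1 ⊗ₘ labelPerm E p2), ← q'']
  simp only [Category.assoc]

theorem obPerm_swap (X Y : FramedPointGraph T) :
    (obTensor D X Y).hom ≫ obPerm D (Perm.swap X Y) =
      (β_ (ob D X) (ob D Y)).hom ≫ (obTensor D Y X).hom := by
  let E := fun z => D ((Y.tensor X).letter z)
  let lx : List (Y.V ⊕ X.V) := X.lst.map Sum.inr
  let ly : List (Y.V ⊕ X.V) := Y.lst.map Sum.inl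
  have hl : ((X.tensor Y).lst.map (Perm.swap X Y).equiv) = lx ++ ly := by
    rw [lst_tensor, List.map_append, List.map_map, List.map_map]
    rfl
  have hm : (Y.tensor X).lst = ly ++ lx := lst_tensor Y X
  have nd : (ly ++ lx).Nodup := hm ▸ (Y.tensor X).lst_nodup
  have c1 : X.letters.map D = lx.map E := by rw [map_letters, List.map_map]; rfl
  have c2 : Y.letters.map D = ly.map E := by rw [map_letters, List.map_map]; rfl
  have c5 : (X.letters ++ Y.letters).map D = (lx ++ ly).map E := by
    rw [List.map_append, List.map_append, c1, c2]
  have c6 : (ly ++ lx).map E = (Y.letters ++ X.letters).map D := by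
    rw [List.map_append, List.map_append, c1, c2]
  have e := obPerm_eq D (Perm.swap X Y) E id Function.injective_id (fun _ => rfl) hl.symm
    ((List.map_id _).symm ▸ hm.symm) (List.perm_append_comm (l₁ := lx) (l₂ := ly))
    (by rw [letters_tensor, c5]) (by rw [letters_tensor, c6])
  have r1 := labelApp_cast c1 c2 c5
  have r2 := labelApp_cast c2.symm c1.symm c6
  have q := labelPerm_comm E lx ly List.perm_append_comm nd
  rw [e, obTensor_hom, obTensor_hom, Category.assoc, labelCast_trans_assoc, ← Category.assoc, r1,
    Category.assoc, ← Category.assoc (labelApp E lx ly).hom, q, Category.assoc,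
    ← labelCast_trans c6, ← Category.assoc (labelApp E ly lx).hom, r2, Category.assoc,
    BraidedCategory.braiding_naturality_assoc, tensorHom_comp_tensorHom_assoc, labelCast_trans,
    labelCast_trans, labelCast_refl, labelCast_refl, id_tensorHom_id, Category.id_comp]

theorem assoc_isReframing (X Y Z : FramedPointGraph T) : (Perm.assoc X Y Z).IsReframing := by
  rintro ((x | x) | x) ((y | y) | y)
  · exact ⟨fun h => by cases h with | inl h => exact .inl (.inl h), fun h => by
      cases h with | inl h => cases h with | inl h => exact .inl h⟩
  · exact iff_of_true (.sep _ _) (.inl (.sep _ _))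
  · exact iff_of_true (.sep _ _) (.sep _ _)
  · exact iff_of_false (fun h => by cases h) (fun h => by cases h with | inl h => cases h)
  · exact ⟨fun h => by cases h with | inr h => cases h with | inl h => exact .inl (.inr h),
      fun h => by cases h with | inl h => cases h with | inr h => exact .inr (.inl h)⟩
  · exact iff_of_true (.inr (.sep _ _)) (.sep _ _)
  · exact iff_of_false (fun h => by cases h) (fun h => by cases h)
  · exact iff_of_false (fun h => by cases h with | inr h => cases h) (fun h => by cases h)
  · exact ⟨fun h => by cases h with | inr h => cases h with | inr h => exact .inr h,
      fun h => by cases h with | inr h => exact .inr (.inr h)⟩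

theorem leftUnit_isReframing (X : FramedPointGraph T) : (Perm.leftUnit X).IsReframing := by
  rintro (x | x) (y | y)
  · exact x.elim
  · exact x.elim
  · exact y.elim
  · exact ⟨fun h => .inr h, fun h => by cases h with | inr h => exact h⟩

theorem rightUnit_isReframing (X : FramedPointGraph T) : (Perm.rightUnit X).IsReframing := by
  rintro (x | x) (y | y)
  · exact ⟨fun h => .inl h, fun h => by cases h with | inl h => exact h⟩
  · exact y.elim
  · exact x.elim
  · exact x.elim

theorem obPerm_assoc (X Y Z : FramedPointGraph T) :
    (obTensor D X Y).hom ▷ ob D Z ≫ (obTensor D (X.tensor Y) Z).hom ≫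
        obPerm D (Perm.assoc X Y Z) =
      (α_ _ _ _).hom ≫ ob D X ◁ (obTensor D Y Z).hom ≫ (obTensor D X (Y.tensor Z)).hom := by
  have r1 := labelApp_assoc D X.letters Y.letters Z.letters (by rw [List.append_assoc])
  have c1 : (X.letters ++ Y.letters).map D = (X.tensor Y).letters.map D := by rw [letters_tensor]
  have c2 : (Y.letters ++ Z.letters).map D = (Y.tensor Z).letters.map D := by rw [letters_tensor]
  have r2 := labelApp_cast c1 (m := Z.letters) rfl
    (show (X.letters ++ Y.letters ++ Z.letters).map D = _ by rw [letters_tensor])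
  have r3 := labelApp_cast (l := X.letters) rfl c2
    (show (X.letters ++ (Y.letters ++ Z.letters)).map D = _ by rw [letters_tensor Y Z])
  rw [labelCast_refl, tensorHom_id] at r2
  rw [labelCast_refl, id_tensorHom] at r3
  rw [obPerm_reframing D (assoc_isReframing X Y Z), obTensor_hom, obTensor_hom, obTensor_hom,
    obTensor_hom, comp_whiskerRight, MonoidalCategory.whiskerLeft_comp]
  simp only [Category.assoc]
  rw [← Category.assoc (labelCast _ ▷ _), ← r2, ← Category.assoc (_ ◁ labelCast _), ← r3]
  simp only [Category.assoc]
  rw [labelCast_trans, labelCast_trans, labelCast_trans,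
    ← labelCast_trans (m := X.letters ++ (Y.letters ++ Z.letters)) (E := D)
      (by rw [List.append_assoc]) (by rw [letters_tensor X (Y.tensor Z), letters_tensor Y Z]),
    ← Category.assoc (labelApp D (X.letters ++ Y.letters) _).hom,
    ← Category.assoc (_ ▷ _), r1]
  simp only [Category.assoc]

end ob

end FramedPointGraph

/-! ## Evaluation of string graphs -/

/-- Objects for the signed types, dual to each other for opposite signs. -/
structure DualLetters (T : MonoidalSignature.{u, v}) (V : Type w₁) [Category.{w₂} V]
    [MonoidalCategory V] where
  obj : T.O × Bool → V
  cap (Z : T.O) : 𝟙_ V ⟶ obj (Z, false) ⊗ obj (Z, true)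
  cup (Z : T.O) : obj (Z, true) ⊗ obj (Z, false) ⟶ 𝟙_ V
  triangle_pos (Z : T.O) : obj (Z, true) ◁ cap Z ≫ (α_ _ _ _).inv ≫ cup Z ▷ obj (Z, true) =
    (ρ_ _).hom ≫ (λ_ _).inv
  triangle_neg (Z : T.O) : cap Z ▷ obj (Z, false) ≫ (α_ _ _ _).hom ≫ obj (Z, false) ◁ cup Z =
    (λ_ _).hom ≫ (ρ_ _).inv

namespace DualLetters

variable {T : MonoidalSignature.{u, v}} {V : Type w₁} [Category.{w₂} V] [MonoidalCategory V]
  (D : DualLetters T V) {ι : Type a} {κ : Type b} (lt : ι → T.O × Bool) (lt' : κ → T.O × Bool)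

/-- The objects of signed labels. -/
@[reducible] def lab (i : ι) : V := D.obj (lt i)

/-- The state that joins two opposite labels. -/
def capState (Z : T.O) (s t : ι) (hs : lt s = (Z, false)) (ht : lt t = (Z, true)) :
    Σ l, labelTensor (D.lab lt) [] ⟶ labelTensor (D.lab lt) l :=
  ⟨[s, t], (D.cap Z ≫ (eqToHom (congrArg D.obj hs.symm) ⊗ₘ eqToHom (congrArg D.obj ht.symm))) ≫
    D.lab lt s ◁ (ρ_ (D.lab lt t)).inv⟩

/-- The costate that joins two opposite labels. -/
def cupCostate (Z : T.O) (s t : ι) (hs : lt s = (Z, true)) (ht : lt t = (Z, false)) :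
    Σ l, labelTensor (D.lab lt) l ⟶ labelTensor (D.lab lt) [] :=
  ⟨[s, t], D.lab lt s ◁ (ρ_ (D.lab lt t)).hom ≫
    (eqToHom (congrArg D.obj hs) ⊗ₘ eqToHom (congrArg D.obj ht)) ≫ D.cup Z⟩

theorem map_lab {X : FramedPointGraph T} {f : X.V → ι} (h : ∀ p, lt (f p) = X.letter p) :
    X.letters.map D.obj = (X.lst.map f).map (D.lab lt) := by
  rw [FramedPointGraph.letters, List.map_map, List.map_map]
  exact List.map_congr_left fun p _ => congrArg D.obj (h p).symm

/-- A state with labels on the vertices of a framed point graph. -/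
noncomputable def boxState {X : FramedPointGraph T} (s : 𝟙_ V ⟶ X.ob D.obj) (f : X.V → ι)
    (h : ∀ p, lt (f p) = X.letter p) :
    Σ l, labelTensor (D.lab lt) [] ⟶ labelTensor (D.lab lt) l :=
  ⟨X.lst.map f, s ≫ labelCast (D.map_lab lt h)⟩

variable {lt lt'}

theorem lab_comm {f : ι → κ} (hf : ∀ i, lt' (f i) = lt i) (i : ι) :
    D.lab lt' (f i) = D.lab lt i := congrArg D.obj (hf i)

theorem labelCast_two {D : ι → V} {E : κ → V} {s t : ι} {s' t' : κ} (hs : D s = E s')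
    (ht : D t = E t') (h : [s, t].map D = [s', t'].map E) :
    labelCast h = eqToHom hs ⊗ₘ (eqToHom ht ▷ 𝟙_ V) := by
  have e : labelCast h = eqToHom hs ⊗ₘ labelCast (List.cons.inj h).2 := labelCast_cons h
  have e' : labelCast (List.cons.inj h).2 = eqToHom ht ⊗ₘ 𝟙 (𝟙_ V) :=
    labelCast_cons (List.cons.inj h).2
  rw [e, e', tensorHom_id]

variable [SymmetricCategory V]

theorem relabel_capState {f : ι → κ} (hf : ∀ i, lt' (f i) = lt i) {Z : T.O} {s t : ι}
    (hs : lt s = (Z, false)) (ht : lt t = (Z, true)) (hs' : lt' (f s) = (Z, false))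
    (ht' : lt' (f t) = (Z, true)) :
    relabelState (D.lab_comm hf) (D.capState lt Z s t hs ht) =
      D.capState lt' Z (f s) (f t) hs' ht' := by
  refine congrArg (Sigma.mk [f s, f t]) ?_
  have e := labelCast_two (D := D.lab lt) (E := D.lab lt') (D.lab_comm hf s).symm
    (D.lab_comm hf t).symm (map_relabel (D.lab_comm hf) [s, t])
  refine (congrArg (_ ≫ ·) e).trans ?_
  change ((D.cap Z ≫ _) ≫ _) ≫ _ = (D.cap Z ≫ _) ≫ _
  simp only [Category.assoc, ← id_tensorHom, ← tensorHom_id, tensorHom_comp_tensorHom,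
    Category.comp_id, Category.id_comp]
  congr 2
  · simp
  · rw [tensorHom_id, ← rightUnitor_inv_naturality]; simp

theorem relabel_cupCostate {f : ι → κ} (hf : ∀ i, lt' (f i) = lt i) {Z : T.O} {s t : ι}
    (hs : lt s = (Z, true)) (ht : lt t = (Z, false)) (hs' : lt' (f s) = (Z, true))
    (ht' : lt' (f t) = (Z, false)) :
    relabelCostate (D.lab_comm hf) (D.cupCostate lt Z s t hs ht) =
      D.cupCostate lt' Z (f s) (f t) hs' ht' := by
  refine congrArg (Sigma.mk [f s, f t]) ?_
  have e := labelCast_two (D := D.lab lt') (E := D.lab lt) (D.lab_comm hf s)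
    (D.lab_comm hf t) (map_relabel (D.lab_comm hf) [s, t]).symm
  refine (congrArg (· ≫ _) e).trans ?_
  change _ ≫ _ ≫ _ ≫ D.cup Z = _ ≫ _ ≫ D.cup Z
  simp only [← id_tensorHom, ← tensorHom_id, tensorHom_comp_tensorHom_assoc,
    Category.comp_id, Category.id_comp]
  congr 2
  · simp
  · rw [tensorHom_id, rightUnitor_naturality_assoc]; simp

theorem relabel_boxState {f : ι → κ} (hf : ∀ i, lt' (f i) = lt i) {X : FramedPointGraph T}
    (s : 𝟙_ V ⟶ X.ob D.obj) (g : X.V → ι) (h : ∀ p, lt (g p) = X.letter p)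
    (g' : X.V → κ) (h' : ∀ p, lt' (g' p) = X.letter p) (hg : ∀ p, g' p = f (g p)) :
    relabelState (D.lab_comm hf) (D.boxState lt s g h) = D.boxState lt' s g' h' := by
  obtain rfl : g' = fun p => f (g p) := funext hg
  have key : ∀ (l : List κ) (_ : l = X.lst.map fun p => f (g p))
      (c : X.letters.map D.obj = l.map (D.lab lt')),
      (⟨l, s ≫ labelCast c⟩ : Σ l, labelTensor (D.lab lt') [] ⟶ labelTensor (D.lab lt') l) =
        D.boxState lt' s (fun p => f (g p)) h' := by
    rintro _ rfl c
    rfl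
  refine Eq.trans ?_ (key ((X.lst.map g).map f) (by rw [List.map_map]; rfl)
    ((D.map_lab lt h).trans (map_relabel (D.lab_comm hf) _)))
  refine congrArg (Sigma.mk ((X.lst.map g).map f)) ?_
  exact (Category.assoc _ _ _).trans (congrArg (s ≫ ·)
    (labelCast_trans (D.map_lab lt h) (map_relabel (D.lab_comm hf) _)))

end DualLetters

/-- The type of a wire. -/
def MonoidalSignature.TypeEdge.letter {T : MonoidalSignature.{u, v}} : T.TypeEdge → T.O
  | .mid Z => Z
  | .inp f i => (T.dom f).get i
  | .out f j => (T.cod f).get j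

/-- The boundary of a box in a state. -/
@[reducible] def FramedPointGraph.boxBoundary {T : MonoidalSignature.{u, v}} (f : T.M) : FramedPointGraph T :=
  (word (T.dom f)).dual.tensor (word (T.cod f))

namespace TypedGraph

variable {T : MonoidalSignature.{u, v}} (G : TypedGraph T)

/-- The signed type of an end of an edge. -/
def flagLetter (p : G.E × Bool) : T.O × Bool := ((G.τ.onE p.1).letter, p.2)

/-- The vertex at an end of an edge. -/
def flagEnd : G.E × Bool → G.V
  | (e, true) => G.tgt e
  | (e, false) => G.src e

/-- The elementary parts of a string graph: the edges between wire-vertices, and the boxes. -/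
def IsElem : G.E ⊕ G.V → Prop
  | .inl e => ∃ Z, G.τ.onE e = .mid Z
  | .inr x => G.IsBox x

/-- The wire-vertices that are not on the boundary. -/
def IsInner (x : G.V) : Prop := G.IsWire x ∧ (∃ e, G.tgt e = x) ∧ ∃ e, G.src e = x

variable {G}

theorem letter_tgt {e : G.E} {Z : T.O} (h : G.τ.onV (G.tgt e) = .inl Z) :
    G.flagLetter (e, true) = (Z, true) := by
  rw [G.τ.tgt_comm] at h
  refine congrArg (·, true) ?_
  change (G.τ.onE e).letter = Z
  cases he : G.τ.onE e <;> rw [he] at h <;> first | exact Sum.inl_injective h | cases h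

theorem letter_src {e : G.E} {Z : T.O} (h : G.τ.onV (G.src e) = .inl Z) :
    G.flagLetter (e, false) = (Z, false) := by
  rw [G.τ.src_comm] at h
  refine congrArg (·, false) ?_
  change (G.τ.onE e).letter = Z
  cases he : G.τ.onE e <;> rw [he] at h <;> first | exact Sum.inl_injective h | cases h

theorem letter_flag {p : G.E × Bool} {Z : T.O} (h : G.τ.onV (G.flagEnd p) = .inl Z) :
    G.flagLetter p = (Z, p.2) := by
  obtain ⟨e, _ | _⟩ := p
  · exact letter_src h
  · exact letter_tgt h

theorem mid_src {e : G.E} {Z : T.O} (h : G.τ.onE e = .mid Z) : G.τ.onV (G.src e) = .inl Z := by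
  rw [G.τ.src_comm, h]; rfl

theorem mid_tgt {e : G.E} {Z : T.O} (h : G.τ.onE e = .mid Z) : G.τ.onV (G.tgt e) = .inl Z := by
  rw [G.τ.tgt_comm, h]; rfl

/-- The ends at wire-vertices of the edges at a box, in terms of the boundary of the box. -/
structure IsBoxLab (x : G.V) (f : T.M) (l : (FramedPointGraph.boxBoundary f).V → G.E × Bool) :
    Prop where
  ty : G.τ.onV x = .inr f
  inp (y : (FramedPointGraph.word (T.dom f)).V) : (l (.inl y)).2 = false ∧
    G.tgt (l (.inl y)).1 = x ∧ G.τ.onE (l (.inl y)).1 = .inp f (FramedPointGraph.wordIdx _ y)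
  out (z : (FramedPointGraph.word (T.cod f)).V) : (l (.inr z)).2 = true ∧
    G.src (l (.inr z)).1 = x ∧ G.τ.onE (l (.inr z)).1 = .out f (FramedPointGraph.wordIdx _ z)

theorem IsBoxLab.letter {x : G.V} {f : T.M} {l : (FramedPointGraph.boxBoundary f).V → G.E × Bool}
    (h : IsBoxLab x f l) (p) : G.flagLetter (l p) = (FramedPointGraph.boxBoundary f).letter p := by
  rcases p with y | z
  · refine Prod.ext ?_ ?_
    · change (G.τ.onE (l (.inl y)).1).letter = (FramedPointGraph.word (T.dom f)).ty y
      rw [(h.inp y).2.2, FramedPointGraph.word_ty]; rfl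
    · change (l (.inl y)).2 = !(FramedPointGraph.word (T.dom f)).sgn y
      rw [(h.inp y).1, FramedPointGraph.word_sgn]; rfl
  · refine Prod.ext ?_ ?_
    · change (G.τ.onE (l (.inr z)).1).letter = (FramedPointGraph.word (T.cod f)).ty z
      rw [(h.out z).2.2, FramedPointGraph.word_ty]; rfl
    · change (l (.inr z)).2 = (FramedPointGraph.word (T.cod f)).sgn z
      rw [(h.out z).1, FramedPointGraph.word_sgn]

theorem IsBoxLab.unique (hG : G.IsStringGraph) {x : G.V} {f : T.M}
    {l l' : (FramedPointGraph.boxBoundary f).V → G.E × Bool}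
    (h : IsBoxLab x f l) (h' : IsBoxLab x f l') : l = l' := by
  have inj := (hG.local_iso x ⟨f, h.ty⟩).injOn
  funext p
  rcases p with y | z
  · refine Prod.ext (inj (.inr (h.inp y).2.1) (.inr (h'.inp y).2.1) ?_) ?_
    · rw [(h.inp y).2.2, (h'.inp y).2.2]
    · rw [(h.inp y).1, (h'.inp y).1]
  · refine Prod.ext (inj (.inl (h.out z).2.1) (.inl (h'.out z).2.1) ?_) ?_
    · rw [(h.out z).2.2, (h'.out z).2.2]
    · rw [(h.out z).1, (h'.out z).1]

theorem exists_boxLab (hG : G.IsStringGraph) {x : G.V} {f : T.M} (h : G.τ.onV x = .inr f) :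
    ∃ l, IsBoxLab x f l := by
  have surj := (hG.local_iso x ⟨f, h⟩).surjOn
  rw [h] at surj
  have h1 : ∀ y : (FramedPointGraph.word (T.dom f)).V, ∃ e, G.tgt e = x ∧
      G.τ.onE e = .inp f (FramedPointGraph.wordIdx _ y) := fun y => by
    obtain ⟨e, he, he'⟩ := surj (show MonoidalSignature.TypeEdge.inp f
      (FramedPointGraph.wordIdx _ y) ∈ _ from .inr rfl)
    refine ⟨e, he.resolve_left fun hs => ?_, he'⟩
    have := G.τ.src_comm e
    rw [hs, h, he'] at this
    cases this
  have h2 : ∀ y : (FramedPointGraph.word (T.cod f)).V, ∃ e, G.src e = x ∧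
      G.τ.onE e = .out f (FramedPointGraph.wordIdx _ y) := fun y => by
    obtain ⟨e, he, he'⟩ := surj (show MonoidalSignature.TypeEdge.out f
      (FramedPointGraph.wordIdx _ y) ∈ _ from .inl rfl)
    refine ⟨e, he.resolve_right fun hs => ?_, he'⟩
    have := G.τ.tgt_comm e
    rw [hs, h, he'] at this
    cases this
  choose e1 he1 he1' using h1
  choose e2 he2 he2' using h2
  exact ⟨Sum.elim (fun y => (e1 y, false)) (fun z => (e2 z, true)), h,
    fun y => ⟨rfl, he1 y, he1' y⟩, fun z => ⟨rfl, he2 z, he2' z⟩⟩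

end TypedGraph

namespace TypedGraph

open FramedPointGraph

variable {T : MonoidalSignature.{u, v}} {V : Type w₁} [Category.{w₂} V] [MonoidalCategory V]
  (D : DualLetters T V) (hat : ∀ f : T.M, 𝟙_ V ⟶ (boxBoundary f).ob D.obj) (G : TypedGraph T)

/-- The state of an elementary part. -/
noncomputable def elemState : G.E ⊕ G.V → Σ l, labelTensor (D.lab G.flagLetter) [] ⟶
    labelTensor (D.lab G.flagLetter) l
  | .inl e => open Classical in
    if h : ∃ Z, G.τ.onE e = .mid Z then
      D.capState G.flagLetter h.choose (e, false) (e, true) (letter_src (mid_src h.choose_spec))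
        (letter_tgt (mid_tgt h.choose_spec))
    else ⟨[], 𝟙 _⟩
  | .inr x => open Classical in
    if h : ∃ f l, IsBoxLab (G := G) x f l then
      D.boxState G.flagLetter (hat h.choose) h.choose_spec.choose
        h.choose_spec.choose_spec.letter
    else ⟨[], 𝟙 _⟩

variable {G} in
theorem elemState_mid {e : G.E} {Z : T.O} (h : G.τ.onE e = .mid Z) :
    G.elemState D hat (.inl e) = D.capState G.flagLetter Z (e, false) (e, true)
      (letter_src (mid_src h)) (letter_tgt (mid_tgt h)) := by
  have key : ∀ (Z' : T.O) (h' : G.τ.onE e = .mid Z'),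
      D.capState G.flagLetter Z' (e, false) (e, true) (letter_src (mid_src h'))
        (letter_tgt (mid_tgt h')) = D.capState G.flagLetter Z (e, false) (e, true)
        (letter_src (mid_src h)) (letter_tgt (mid_tgt h)) := fun Z' h' => by
    obtain rfl : Z' = Z := by
      have := h'.symm.trans h
      cases this
      rfl
    rfl
  have hex : ∃ Z, G.τ.onE e = .mid Z := ⟨Z, h⟩
  rw [elemState, dif_pos hex]
  exact key _ hex.choose_spec

variable {G} in
theorem elemState_box (hG : G.IsStringGraph) {x : G.V} {f : T.M} {l} (h : IsBoxLab x f l) :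
    G.elemState D hat (.inr x) = D.boxState G.flagLetter (hat f) l h.letter := by
  have key : ∀ (f' l') (h' : IsBoxLab x f' l'),
      D.boxState G.flagLetter (hat f') l' h'.letter =
        D.boxState G.flagLetter (hat f) l h.letter := fun f' l' h' => by
    obtain rfl : f' = f := Sum.inr_injective (h'.ty.symm.trans h.ty)
    obtain rfl := h'.unique hG h
    rfl
  have hex : ∃ f l, IsBoxLab x f l := ⟨f, l, h⟩
  rw [elemState, dif_pos hex]
  exact key _ _ hex.choose_spec.choose_spec

/-- The costate of an inner wire-vertex. -/
noncomputable def wireCostate (x : G.V) : Σ l, labelTensor (D.lab G.flagLetter) l ⟶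
    labelTensor (D.lab G.flagLetter) [] := open Classical in
  if h : ∃ (Z : T.O) (e e' : G.E), G.τ.onV (G.tgt e) = .inl Z ∧ G.τ.onV (G.src e') = .inl Z ∧
      G.tgt e = x ∧ G.src e' = x then
    D.cupCostate G.flagLetter h.choose (h.choose_spec.choose, true)
      (h.choose_spec.choose_spec.choose, false)
      (letter_tgt h.choose_spec.choose_spec.choose_spec.1)
      (letter_src h.choose_spec.choose_spec.choose_spec.2.1)
  else ⟨[], 𝟙 _⟩

variable {G} in
theorem wireCostate_eq (hG : G.IsStringGraph) {x : G.V} {Z : T.O} {e e' : G.E}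
    (ht : G.τ.onV (G.tgt e) = .inl Z) (hs : G.τ.onV (G.src e') = .inl Z) (h : G.tgt e = x)
    (h' : G.src e' = x) :
    G.wireCostate D x = D.cupCostate G.flagLetter Z (e, true) (e', false) (letter_tgt ht)
      (letter_src hs) := by
  have key : ∀ (Z₁ : T.O) (e₁ e₁' : G.E) (ht₁ : G.τ.onV (G.tgt e₁) = .inl Z₁)
      (hs₁ : G.τ.onV (G.src e₁') = .inl Z₁) (_ : G.tgt e₁ = x) (_ : G.src e₁' = x),
      D.cupCostate G.flagLetter Z₁ (e₁, true) (e₁', false) (letter_tgt ht₁) (letter_src hs₁) =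
        D.cupCostate G.flagLetter Z (e, true) (e', false) (letter_tgt ht)
          (letter_src hs) := fun Z₁ e₁ e₁' ht₁ hs₁ h₁ h₁' => by
    obtain rfl : e = e₁ := hG.in_unique _ _ ⟨_, ht⟩ (h.trans h₁.symm)
    obtain rfl : e' = e₁' := hG.out_unique _ _ ⟨_, hs⟩ (h'.trans h₁'.symm)
    obtain rfl : Z = Z₁ := Sum.inl_injective (ht.symm.trans ht₁)
    rfl
  have hex : ∃ (Z : T.O) (e e' : G.E), G.τ.onV (G.tgt e) = .inl Z ∧ G.τ.onV (G.src e') = .inl Z ∧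
      G.tgt e = x ∧ G.src e' = x := ⟨Z, e, e', ht, hs, h, h'⟩
  rw [wireCostate, dif_pos hex]
  have sp := hex.choose_spec.choose_spec.choose_spec
  exact key _ _ _ sp.1 sp.2.1 sp.2.2.1 sp.2.2.2

variable {G}

theorem isInner_iff (x : G.V) : G.IsInner x ↔ ∃ (Z : T.O) (e e' : G.E),
    G.τ.onV (G.tgt e) = .inl Z ∧ G.τ.onV (G.src e') = .inl Z ∧ G.tgt e = x ∧ G.src e' = x := by
  constructor
  · rintro ⟨⟨Z, hZ⟩, ⟨e, he⟩, ⟨e', he'⟩⟩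
    exact ⟨Z, e, e', he ▸ hZ, he' ▸ hZ, he, he'⟩
  · rintro ⟨Z, e, e', h, _, h2, h3⟩
    exact ⟨⟨Z, h2 ▸ h⟩, ⟨e, h2⟩, ⟨e', h3⟩⟩

theorem mem_wireCostate (hG : G.IsStringGraph) {x : G.V} (hx : G.IsInner x) (p : G.E × Bool) :
    p ∈ (G.wireCostate D x).1 ↔ G.flagEnd p = x := by
  obtain ⟨Z, e, e', ht, hs, h, h'⟩ := (isInner_iff x).1 hx
  rw [wireCostate_eq D hG ht hs h h']
  change p ∈ [(e, true), (e', false)] ↔ _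
  rw [List.mem_pair]
  constructor
  · rintro (rfl | rfl)
    exacts [h, h']
  · obtain ⟨e₁, _ | _⟩ := p
    · intro h₁
      exact .inr (congrArg (·, false) (hG.out_unique _ _ ⟨_, hs⟩ (h'.trans (Eq.symm h₁))).symm)
    · intro h₁
      exact .inl (congrArg (·, true) (hG.in_unique _ _ ⟨_, ht⟩ (h.trans (Eq.symm h₁))).symm)

theorem nodup_wireCostate (hG : G.IsStringGraph) {x : G.V} (hx : G.IsInner x) :
    (G.wireCostate D x).1.Nodup := by
  obtain ⟨Z, e, e', ht, hs, h, h'⟩ := (isInner_iff x).1 hx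
  rw [wireCostate_eq D hG ht hs h h']
  change [(e, true), (e', false)].Nodup
  simp

/-- The elementary part that an end of an edge at a wire-vertex belongs to. -/
def flagOwner (G : TypedGraph T) (p : G.E × Bool) : G.E ⊕ G.V :=
  match G.τ.onE p.1 with
  | .mid _ => .inl p.1
  | .inp _ _ => .inr (G.tgt p.1)
  | .out _ _ => .inr (G.src p.1)

theorem owner_mid {p : G.E × Bool} {Z} (h : G.τ.onE p.1 = .mid Z) : G.flagOwner p = .inl p.1 := by
  rw [flagOwner, h]

theorem owner_inp {p : G.E × Bool} {f i} (h : G.τ.onE p.1 = .inp f i) :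
    G.flagOwner p = .inr (G.tgt p.1) := by
  rw [flagOwner, h]

theorem owner_out {p : G.E × Bool} {f i} (h : G.τ.onE p.1 = .out f i) :
    G.flagOwner p = .inr (G.src p.1) := by
  rw [flagOwner, h]

theorem isWire_src {e : G.E} {f i} (h : G.τ.onE e = .inp f i) : G.IsWire (G.src e) :=
  ⟨_, by rw [G.τ.src_comm, h]; rfl⟩

theorem isWire_tgt {e : G.E} {f i} (h : G.τ.onE e = .out f i) : G.IsWire (G.tgt e) :=
  ⟨_, by rw [G.τ.tgt_comm, h]; rfl⟩

theorem ty_tgt {e : G.E} {f i} (h : G.τ.onE e = .inp f i) : G.τ.onV (G.tgt e) = .inr f := by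
  rw [G.τ.tgt_comm, h]; rfl

theorem ty_src {e : G.E} {f i} (h : G.τ.onE e = .out f i) : G.τ.onV (G.src e) = .inr f := by
  rw [G.τ.src_comm, h]; rfl

theorem not_isWire {x : G.V} {f} (h : G.τ.onV x = .inr f) : ¬ G.IsWire x := by
  rintro ⟨Z, hZ⟩
  rw [h] at hZ
  cases hZ

theorem mem_elemState (hG : G.IsStringGraph) {i : G.E ⊕ G.V} (hi : G.IsElem i) (p : G.E × Bool) :
    p ∈ (G.elemState D hat i).1 ↔ G.flagOwner p = i ∧ G.IsWire (G.flagEnd p) := by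
  rcases i with e | x
  · obtain ⟨Z, hZ⟩ := hi
    rw [elemState_mid D hat hZ]
    change p ∈ [(e, false), (e, true)] ↔ _
    rw [List.mem_pair]
    constructor
    · rintro (rfl | rfl)
      · exact ⟨owner_mid hZ, _, mid_src hZ⟩
      · exact ⟨owner_mid hZ, _, mid_tgt hZ⟩
    · rintro ⟨h, -⟩
      have : p.1 = e := by
        cases he : G.τ.onE p.1 with
        | mid Z => rw [owner_mid he] at h; exact Sum.inl_injective h
        | inp f i => rw [owner_inp he] at h; cases h
        | out f i => rw [owner_out he] at h; cases h
      obtain ⟨e', _ | _⟩ := p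
      · exact .inl (congrArg (·, false) this)
      · exact .inr (congrArg (·, true) this)
  · obtain ⟨f, hf⟩ := hi
    obtain ⟨l, hl⟩ := exists_boxLab hG hf
    rw [elemState_box D hat hG hl]
    change p ∈ (boxBoundary f).lst.map l ↔ _
    rw [List.mem_map]
    constructor
    · rintro ⟨y | z, -, rfl⟩
      · obtain ⟨h1, h2, h3⟩ := hl.inp y
        refine ⟨(owner_inp h3).trans (congrArg _ h2), ?_⟩
        have : l (.inl y) = ((l (.inl y)).1, false) := Prod.ext rfl h1
        rw [this]
        exact isWire_src h3
      · obtain ⟨h1, h2, h3⟩ := hl.out z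
        refine ⟨(owner_out h3).trans (congrArg _ h2), ?_⟩
        have : l (.inr z) = ((l (.inr z)).1, true) := Prod.ext rfl h1
        rw [this]
        exact isWire_tgt h3
    · rintro ⟨h, hw⟩
      have inj := (hG.local_iso x ⟨f, hf⟩).injOn
      cases he : G.τ.onE p.1 with
      | mid Z => rw [owner_mid he] at h; cases h
      | inp f' i =>
        rw [owner_inp he] at h
        have h : G.tgt p.1 = x := Sum.inr_injective h
        obtain rfl : f' = f := Sum.inr_injective ((ty_tgt he).symm.trans (h ▸ hf))
        obtain ⟨y, rfl⟩ := (wordIdx_bijective _).2 i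
        obtain ⟨h1, h2, h3⟩ := hl.inp y
        refine ⟨.inl y, mem_lst _, Prod.ext (inj (.inr h2) (.inr h) (h3.trans he.symm)) ?_⟩
        obtain ⟨e, _ | _⟩ := p
        · exact h1
        · exact absurd hw (not_isWire (ty_tgt he))
      | out f' i =>
        rw [owner_out he] at h
        have h : G.src p.1 = x := Sum.inr_injective h
        obtain rfl : f' = f := Sum.inr_injective ((ty_src he).symm.trans (h ▸ hf))
        obtain ⟨y, rfl⟩ := (wordIdx_bijective _).2 i
        obtain ⟨h1, h2, h3⟩ := hl.out y
        refine ⟨.inr y, mem_lst _, Prod.ext (inj (.inl h2) (.inl h) (h3.trans he.symm)) ?_⟩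
        obtain ⟨e, _ | _⟩ := p
        · exact absurd hw (not_isWire (ty_src he))
        · exact h1

theorem isElem_owner (p : G.E × Bool) : G.IsElem (G.flagOwner p) := by
  cases he : G.τ.onE p.1 with
  | mid Z => rw [owner_mid he]; exact ⟨Z, he⟩
  | inp f i => rw [owner_inp he]; exact ⟨f, ty_tgt he⟩
  | out f i => rw [owner_out he]; exact ⟨f, ty_src he⟩

theorem nodup_elemState (hG : G.IsStringGraph) {i : G.E ⊕ G.V} (hi : G.IsElem i) :
    (G.elemState D hat i).1.Nodup := by
  rcases i with e | x
  · obtain ⟨Z, hZ⟩ := hi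
    rw [elemState_mid D hat hZ]
    change [(e, false), (e, true)].Nodup
    simp
  · obtain ⟨f, hf⟩ := hi
    obtain ⟨l, hl⟩ := exists_boxLab hG hf
    rw [elemState_box D hat hG hl]
    refine (lst_nodup _).map ?_
    rintro (y | z) (y' | z') h
    · have h3 := (hl.inp y).2.2
      rw [h, (hl.inp y').2.2] at h3
      exact congrArg _ ((wordIdx_bijective _).1
        (eq_of_heq (MonoidalSignature.TypeEdge.inp.inj h3).2)).symm
    · have h3 := (hl.inp y).1
      rw [h, (hl.out z').1] at h3
      cases h3
    · have h3 := (hl.out z).1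
      rw [h, (hl.inp y').1] at h3
      cases h3
    · have h3 := (hl.out z).2.2
      rw [h, (hl.out z').2.2] at h3
      exact congrArg _ ((wordIdx_bijective _).1
        (eq_of_heq (MonoidalSignature.TypeEdge.out.inj h3).2)).symm

end TypedGraph

section lists

variable {C : Type c} [Category.{d} C] [MonoidalCategory C] {ι : Type a} {κ : Type b} {D : ι → C}

theorem mem_joins {A : List (Σ l, labelTensor D [] ⟶ labelTensor D l)} {i : ι} :
    i ∈ joins A ↔ ∃ s ∈ A, i ∈ s.1 := by
  induction A with
  | nil => exact ⟨fun h => absurd h List.not_mem_nil, fun ⟨_, h, _⟩ => absurd h List.not_mem_nil⟩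
  | cons s A ih => rw [joins, List.mem_append, ih]; simp

theorem mem_fullList {P : List (Σ l, labelTensor D l ⟶ labelTensor D [])} {o : List ι} {i : ι} :
    i ∈ fullList P o ↔ (∃ k ∈ P, i ∈ k.1) ∨ i ∈ o := by
  induction P with
  | nil => exact ⟨.inr, fun h => h.resolve_left fun ⟨_, h, _⟩ => absurd h List.not_mem_nil⟩
  | cons s A ih => rw [fullList, List.mem_append, ih]; simp [or_assoc]

theorem nodup_joins {N : List κ} (hN : N.Nodup)
    {s : κ → Σ l, labelTensor D [] ⟶ labelTensor D l} (hs : ∀ k ∈ N, (s k).1.Nodup)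
    (hd : ∀ k ∈ N, ∀ k' ∈ N, ∀ i, i ∈ (s k).1 → i ∈ (s k').1 → k = k') :
    (joins (N.map s)).Nodup := by
  induction N with
  | nil => exact .nil
  | cons k N ih =>
    refine List.nodup_append'.2 ⟨hs k (List.mem_cons_self ..), ih (List.nodup_cons.1 hN).2
      (fun k' h => hs k' (List.mem_cons_of_mem _ h)) (fun k₁ h₁ k₂ h₂ => hd k₁
        (List.mem_cons_of_mem _ h₁) k₂ (List.mem_cons_of_mem _ h₂)), fun i hi hi' => ?_⟩
    obtain ⟨_, h, hi'⟩ := mem_joins.1 hi'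
    obtain ⟨k', hk', rfl⟩ := List.mem_map.1 h
    have := hd k (List.mem_cons_self ..) k' (List.mem_cons_of_mem _ hk') i hi hi'
    exact (List.nodup_cons.1 hN).1 (this ▸ hk')

theorem nodup_fullList {N : List κ} (hN : N.Nodup)
    {s : κ → Σ l, labelTensor D l ⟶ labelTensor D []} (hs : ∀ k ∈ N, (s k).1.Nodup)
    (hd : ∀ k ∈ N, ∀ k' ∈ N, ∀ i, i ∈ (s k).1 → i ∈ (s k').1 → k = k') {o : List ι}
    (ho : o.Nodup) (hso : ∀ k ∈ N, ∀ i, i ∈ (s k).1 → i ∉ o) : (fullList (N.map s) o).Nodup := by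
  induction N with
  | nil => exact ho
  | cons k N ih =>
    refine List.nodup_append'.2 ⟨hs k (List.mem_cons_self ..), ih (List.nodup_cons.1 hN).2
      (fun k' h => hs k' (List.mem_cons_of_mem _ h)) (fun k₁ h₁ k₂ h₂ => hd k₁
        (List.mem_cons_of_mem _ h₁) k₂ (List.mem_cons_of_mem _ h₂))
        (fun k' h => hso k' (List.mem_cons_of_mem _ h)), fun i hi hi' => ?_⟩
    rcases mem_fullList.1 hi' with ⟨_, h, hi'⟩ | hi'
    · obtain ⟨k', hk', rfl⟩ := List.mem_map.1 h
      have := hd k (List.mem_cons_self ..) k' (List.mem_cons_of_mem _ hk') i hi hi'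
      exact (List.nodup_cons.1 hN).1 (this ▸ hk')
    · exact hso k (List.mem_cons_self ..) i hi hi'

end lists

/-- The list enumerates the elements with a property. -/
structure Enumerates {α : Type*} (N : List α) (p : α → Prop) : Prop where
  nodup : N.Nodup
  mem_iff : ∀ i, i ∈ N ↔ p i

theorem Enumerates.perm {α : Type*} {N N' : List α} {p : α → Prop} (h : Enumerates N p)
    (h' : Enumerates N' p) : N.Perm N' :=
  (List.perm_ext_iff_of_nodup h.nodup h'.nodup).2 fun i => (h.mem_iff i).trans (h'.mem_iff i).symm

theorem exists_enumerates {α : Type*} [Finite α] (p : α → Prop) : ∃ N, Enumerates N p := by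
  classical
  have := Fintype.ofFinite α
  exact ⟨(Finset.univ.filter p).toList, Finset.nodup_toList _, fun i => by simp⟩

namespace FramedCospan

open FramedPointGraph TypedGraph

variable {T : MonoidalSignature.{u, v}} {V : Type w₁} [Category.{w₂} V] [MonoidalCategory V]
  (D : DualLetters T V) (hat : ∀ f : T.M, 𝟙_ V ⟶ (boxBoundary f).ob D.obj)
  {Y : FramedPointGraph T} (K : FramedCospan unit Y)

/-- The ends of edges on the boundary. -/
structure IsOutLab (o : Y.V → K.G.E × Bool) : Prop where
  flagEnd_eq : ∀ y, K.G.flagEnd (o y) = K.c y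
  sgn_eq : ∀ y, (o y).2 = Y.sgn y

variable {K}

theorem IsOutLab.letter {o} (h : K.IsOutLab o) (y : Y.V) : K.G.flagLetter (o y) = Y.letter y := by
  rw [letter_flag ((congrArg _ (h.flagEnd_eq y)).trans (K.c_ty y)), h.sgn_eq]
  rfl

theorem flag_unique {G : TypedGraph T} (hG : G.IsStringGraph) {p q : G.E × Bool}
    (hw : G.IsWire (G.flagEnd p)) (h : G.flagEnd p = G.flagEnd q) (h' : p.2 = q.2) : p = q := by
  obtain ⟨e, b⟩ := p
  obtain ⟨e', b'⟩ := q
  obtain rfl : b = b' := h'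
  cases b
  · exact congrArg (·, false) (hG.out_unique _ _ hw h)
  · exact congrArg (·, true) (hG.in_unique _ _ hw h)

theorem IsOutLab.unique {o o'} (h : K.IsOutLab o) (h' : K.IsOutLab o') : o = o' :=
  funext fun y => flag_unique K.string (by rw [h.flagEnd_eq]; exact K.c_wire y)
    ((h.flagEnd_eq y).trans (h'.flagEnd_eq y).symm) ((h.sgn_eq y).trans (h'.sgn_eq y).symm)

theorem IsOutLab.injective {o} (h : K.IsOutLab o) : Function.Injective o := fun y y' hy =>
  K.c_injective (by rw [← h.flagEnd_eq, ← h.flagEnd_eq, hy])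

variable (K) in
theorem exists_outLab : ∃ o, K.IsOutLab o := by
  have : ∀ y, ∃ p : K.G.E × Bool, K.G.flagEnd p = K.c y ∧ p.2 = Y.sgn y := fun y => by
    have hb := K.c_bound y
    have hi := K.no_isolated (K.c y)
    cases hs : Y.sgn y with
    | true =>
      have ho : K.G.IsOutput (K.c y) := (K.c_sgn y).2 hs
      have hn : ¬ K.G.IsInput (K.c y) := fun h => hi ⟨h, ho⟩
      have : ∃ e, K.G.tgt e = K.c y := by
        by_contra! h
        exact hn ⟨K.c_wire y, h⟩
      obtain ⟨e, he⟩ := this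
      exact ⟨(e, true), he, rfl⟩
    | false =>
      have ho : K.G.IsInput (K.c y) := (K.c_in y).2 hs
      have hn : ¬ K.G.IsOutput (K.c y) := fun h => hi ⟨ho, h⟩
      have : ∃ e, K.G.src e = K.c y := by
        by_contra! h
        exact hn ⟨K.c_wire y, h⟩
      obtain ⟨e, he⟩ := this
      exact ⟨(e, false), he, rfl⟩
  choose o ho ho' using this
  exact ⟨o, ho, ho'⟩

theorem c_not_inner (y : Y.V) : ¬ K.G.IsInner (K.c y) := by
  rintro ⟨-, ⟨e, he⟩, ⟨e', he'⟩⟩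
  rcases K.c_bound y with h | h
  · exact h.2 e he
  · exact h.2 e' he'

theorem inner_or_boundary {p : K.G.V} (h : K.G.IsWire p) : K.G.IsInner p ∨ ∃ y, K.c y = p := by
  by_cases h1 : ∃ e, K.G.tgt e = p
  · by_cases h2 : ∃ e, K.G.src e = p
    · exact .inl ⟨h, h1, h2⟩
    · push Not at h2
      exact .inr ((K.bound_cases (.inr ⟨h, h2⟩)).resolve_left fun ⟨x, _⟩ => x.elim)
  · push Not at h1
    exact .inr ((K.bound_cases (.inl ⟨h, h1⟩)).resolve_left fun ⟨x, _⟩ => x.elim)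

variable {N : List (K.G.E ⊕ K.G.V)} {M : List K.G.V} {o : Y.V → K.G.E × Bool}

theorem mem_joins_iff (hN : Enumerates N K.G.IsElem) (p : K.G.E × Bool) :
    p ∈ joins (N.map (K.G.elemState D hat)) ↔ K.G.IsWire (K.G.flagEnd p) := by
  rw [mem_joins]
  constructor
  · rintro ⟨_, h, hp⟩
    obtain ⟨i, hi, rfl⟩ := List.mem_map.1 h
    exact ((mem_elemState D hat K.string ((hN.mem_iff i).1 hi) p).1 hp).2
  · intro h
    exact ⟨_, List.mem_map_of_mem ((hN.mem_iff _).2 (isElem_owner p)),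
      (mem_elemState D hat K.string (isElem_owner p) p).2 ⟨rfl, h⟩⟩

theorem joins_nodup (hN : Enumerates N K.G.IsElem) :
    (joins (N.map (K.G.elemState D hat))).Nodup :=
  nodup_joins hN.nodup (fun i hi => nodup_elemState D hat K.string ((hN.mem_iff i).1 hi))
    fun i hi j hj p h h' =>
      ((mem_elemState D hat K.string ((hN.mem_iff i).1 hi) p).1 h).1.symm.trans
        ((mem_elemState D hat K.string ((hN.mem_iff j).1 hj) p).1 h').1

theorem mem_fullList_iff (hM : Enumerates M K.G.IsInner) (ho : K.IsOutLab o) (p : K.G.E × Bool) :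
    p ∈ fullList (M.map (K.G.wireCostate D)) (Y.lst.map o) ↔ K.G.IsWire (K.G.flagEnd p) := by
  rw [mem_fullList]
  constructor
  · rintro (⟨_, h, hp⟩ | h)
    · obtain ⟨x, hx, rfl⟩ := List.mem_map.1 h
      have hx := (hM.mem_iff x).1 hx
      rw [(mem_wireCostate D K.string hx p).1 hp]
      exact hx.1
    · obtain ⟨y, -, rfl⟩ := List.mem_map.1 h
      rw [ho.flagEnd_eq]
      exact K.c_wire y
  · intro h
    rcases inner_or_boundary h with h' | ⟨y, hy⟩
    · exact .inl ⟨_, List.mem_map_of_mem ((hM.mem_iff _).2 h'),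
        (mem_wireCostate D K.string h' p).2 rfl⟩
    · refine .inr (List.mem_map.2 ⟨y, mem_lst y, ?_⟩)
      refine (flag_unique K.string h (hy.symm.trans (ho.flagEnd_eq y).symm) ?_).symm
      rw [ho.sgn_eq]
      have h1 := K.c_sgn y
      have h2 := K.c_in y
      obtain ⟨e, _ | _⟩ := p
      · have : ¬ K.G.IsOutput (K.c y) := fun hh => hh.2 e hy.symm
        rw [h1] at this
        simpa using Eq.symm (Bool.eq_false_of_not_eq_true this)
      · have : ¬ K.G.IsInput (K.c y) := fun hh => hh.2 e hy.symm
        rw [h2] at this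
        simpa using this

theorem fullList_nodup (hM : Enumerates M K.G.IsInner) (ho : K.IsOutLab o) :
    (fullList (M.map (K.G.wireCostate D)) (Y.lst.map o)).Nodup := by
  refine nodup_fullList hM.nodup (fun x hx => nodup_wireCostate D K.string ((hM.mem_iff x).1 hx))
    (fun x hx y hy p h h' =>
      ((mem_wireCostate D K.string ((hM.mem_iff x).1 hx) p).1 h).symm.trans
        ((mem_wireCostate D K.string ((hM.mem_iff y).1 hy) p).1 h'))
    (Y.lst_nodup.map ho.injective) fun x hx p h h' => ?_
  obtain ⟨y, -, rfl⟩ := List.mem_map.1 h'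
  have h1 := (mem_wireCostate D K.string ((hM.mem_iff x).1 hx) _).1 h
  rw [ho.flagEnd_eq] at h1
  exact c_not_inner y (h1 ▸ (hM.mem_iff x).1 hx)

theorem joins_perm_fullList (hN : Enumerates N K.G.IsElem) (hM : Enumerates M K.G.IsInner)
    (ho : K.IsOutLab o) : (joins (N.map (K.G.elemState D hat))).Perm
      (fullList (M.map (K.G.wireCostate D)) (Y.lst.map o)) :=
  (List.perm_ext_iff_of_nodup (joins_nodup D hat hN) (fullList_nodup D hM ho)).2 fun p =>
    (mem_joins_iff D hat hN p).trans (mem_fullList_iff D hM ho p).symm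

variable [SymmetricCategory V]

theorem exists_elems (K : FramedCospan unit Y) : ∃ N, Enumerates N K.G.IsElem := by
  have := K.string.finite_V
  have := K.string.finite_E
  exact exists_enumerates _

theorem exists_inner (K : FramedCospan unit Y) : ∃ N, Enumerates N K.G.IsInner := by
  have := K.string.finite_V
  exact exists_enumerates _

/-- The value of a framed cospan without inputs. -/
noncomputable def value (K : FramedCospan unit Y) : 𝟙_ V ⟶ Y.ob D.obj :=
  netValue _ _ _ (joins_perm_fullList D hat K.exists_elems.choose_spec K.exists_inner.choose_spec
    K.exists_outLab.choose_spec) ≫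
    labelCast (D.map_lab K.G.flagLetter K.exists_outLab.choose_spec.letter).symm

theorem value_eq (hN : Enumerates N K.G.IsElem) (hM : Enumerates M K.G.IsInner)
    (ho : K.IsOutLab o) : K.value D hat =
      netValue _ _ _ (joins_perm_fullList D hat hN hM ho) ≫
        labelCast (D.map_lab K.G.flagLetter ho.letter).symm := by
  obtain rfl : K.exists_outLab.choose = o := K.exists_outLab.choose_spec.unique ho
  exact congrArg (· ≫ _) (netValue_perm ((K.exists_elems.choose_spec.perm hN).map _)
    ((K.exists_inner.choose_spec.perm hM).map _) _ _
    (fullList_nodup D K.exists_inner.choose_spec ho))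

/-- The value in terms of other labels. -/
theorem value_relabel (hN : Enumerates N K.G.IsElem) (hM : Enumerates M K.G.IsInner)
    (ho : K.IsOutLab o) {κ : Type} {lt : κ → T.O × Bool} {m : K.G.E × Bool → κ}
    (hm : ∀ p, lt (m p) = K.G.flagLetter p)
    {A : List (Σ l, labelTensor (D.lab lt) [] ⟶ labelTensor (D.lab lt) l)}
    {P : List (Σ l, labelTensor (D.lab lt) l ⟶ labelTensor (D.lab lt) [])} {r : List κ}
    (hA : A = N.map fun i => relabelState (D.lab_comm hm) (K.G.elemState D hat i))
    (hP : P = M.map fun x => relabelCostate (D.lab_comm hm) (K.G.wireCostate D x))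
    (hr : r = Y.lst.map fun y => m (o y)) (h : (joins A).Perm (fullList P r))
    (n : (fullList P r).Nodup) (c : r.map (D.lab lt) = Y.letters.map D.obj) :
    K.value D hat = netValue A P r h ≫ labelCast c := by
  have hA' : A = (N.map (K.G.elemState D hat)).map (relabelState (D.lab_comm hm)) := by
    rw [hA, List.map_map]; rfl
  have hP' : P = (M.map (K.G.wireCostate D)).map (relabelCostate (D.lab_comm hm)) := by
    rw [hP, List.map_map]; rfl
  have hr' : r = (Y.lst.map o).map m := by rw [hr, List.map_map]; rfl
  clear hA hP hr
  subst hA' hP' hr'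
  rw [value_eq D hat hN hM ho, netValue_relabel (D.lab_comm hm) (joins_perm_fullList D hat hN hM ho)
    h (by rw [← fullList_relabel (D.lab_comm hm)]; exact n) (map_relabel (D.lab_comm hm) _),
    Category.assoc, labelCast_trans]

end FramedCospan

namespace TypedGraph

open FramedPointGraph

variable {T : MonoidalSignature.{u, v}} {V : Type w₁} [Category.{w₂} V] [MonoidalCategory V]
  [SymmetricCategory V]
  (D : DualLetters T V) (hat : ∀ f : T.M, 𝟙_ V ⟶ (boxBoundary f).ob D.obj) {G G' : TypedGraph T}

theorem elemState_transport (hG : G.IsStringGraph) (hG' : G'.IsStringGraph) {ψ : G.V → G'.V}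
    {iE : G.E → G'.E} (hE : ∀ e, G'.τ.onE (iE e) = G.τ.onE e)
    (hV : ∀ x f, G.τ.onV x = .inr f → G'.τ.onV (ψ x) = .inr f)
    (ht : ∀ e f, G.τ.onV (G.tgt e) = .inr f → G'.tgt (iE e) = ψ (G.tgt e))
    (hs : ∀ e f, G.τ.onV (G.src e) = .inr f → G'.src (iE e) = ψ (G.src e))
    {κ : Type} {lt : κ → T.O × Bool} {m : G.E × Bool → κ} {m' : G'.E × Bool → κ}
    (hm : ∀ p, lt (m p) = G.flagLetter p) (hm' : ∀ p, lt (m' p) = G'.flagLetter p)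
    (h : ∀ p, m p = m' (iE p.1, p.2)) {i : G.E ⊕ G.V} (hi : G.IsElem i) :
    relabelState (D.lab_comm hm') (G'.elemState D hat (Sum.map iE ψ i)) =
      relabelState (D.lab_comm hm) (G.elemState D hat i) := by
  rcases i with e | x
  · obtain ⟨Z, hZ⟩ := hi
    have hZ' : G'.τ.onE (iE e) = .mid Z := (hE e).trans hZ
    change relabelState _ (G'.elemState D hat (.inl (iE e))) = _
    have k1 : lt (m (e, false)) = (Z, false) := (hm _).trans (letter_src (mid_src hZ))
    have k2 : lt (m (e, true)) = (Z, true) := (hm _).trans (letter_tgt (mid_tgt hZ))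
    have k1' : lt (m' (iE e, false)) = (Z, false) := (hm' _).trans (letter_src (mid_src hZ'))
    have k2' : lt (m' (iE e, true)) = (Z, true) := (hm' _).trans (letter_tgt (mid_tgt hZ'))
    rw [elemState_mid D hat hZ, elemState_mid D hat hZ',
      D.relabel_capState hm _ _ k1 k2, D.relabel_capState hm' _ _ k1' k2']
    congr 1
    · exact (h (e, false)).symm
    · exact (h (e, true)).symm
  · obtain ⟨f, hf⟩ := hi
    obtain ⟨l, hl⟩ := exists_boxLab hG hf
    have hl' : IsBoxLab (G := G') (ψ x) f fun p => (iE (l p).1, (l p).2) := by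
      refine ⟨hV _ _ hl.ty, fun y => ⟨(hl.inp y).1, ?_, (hE _).trans (hl.inp y).2.2⟩,
        fun z => ⟨(hl.out z).1, ?_, (hE _).trans (hl.out z).2.2⟩⟩
      · have := (hl.inp y).2.1
        exact (ht _ f (this ▸ hl.ty)).trans (congrArg ψ this)
      · have := (hl.out z).2.1
        exact (hs _ f (this ▸ hl.ty)).trans (congrArg ψ this)
    change relabelState _ (G'.elemState D hat (.inr (ψ x))) = _
    rw [elemState_box D hat hG hl, elemState_box D hat hG' hl',
      D.relabel_boxState hm _ _ _ (fun p => m (l p)) (fun p => (hm _).trans (hl.letter p))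
        fun _ => rfl,
      D.relabel_boxState hm' _ _ _ (fun p => m (l p)) (fun p => (hm _).trans (hl.letter p))
        fun p => h (l p)]

theorem wireCostate_transport (hG : G.IsStringGraph) (hG' : G'.IsStringGraph)
    {κ : Type} {lt : κ → T.O × Bool} {m : G.E × Bool → κ} {m' : G'.E × Bool → κ}
    (hm : ∀ p, lt (m p) = G.flagLetter p) (hm' : ∀ p, lt (m' p) = G'.flagLetter p)
    {x : G.V} {x' : G'.V} {e₁ e₂ : G.E} {e₁' e₂' : G'.E} (hx : G.IsWire x) (hx' : G'.IsWire x')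
    (h₁ : G.tgt e₁ = x) (h₂ : G.src e₂ = x)
    (h₁' : G'.tgt e₁' = x') (h₂' : G'.src e₂' = x') (h : m (e₁, true) = m' (e₁', true))
    (h' : m (e₂, false) = m' (e₂', false)) :
    relabelCostate (D.lab_comm hm') (G'.wireCostate D x') =
      relabelCostate (D.lab_comm hm) (G.wireCostate D x) := by
  obtain ⟨Z, hZ⟩ := hx
  obtain ⟨Z', hZ'⟩ := hx'
  have k1 : lt (m (e₁, true)) = (Z, true) := (hm _).trans (letter_tgt (h₁ ▸ hZ))
  have k2 : lt (m (e₂, false)) = (Z, false) := (hm _).trans (letter_src (h₂ ▸ hZ))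
  have k1' : lt (m' (e₁', true)) = (Z', true) := (hm' _).trans (letter_tgt (h₁' ▸ hZ'))
  have k2' : lt (m' (e₂', false)) = (Z', false) := (hm' _).trans (letter_src (h₂' ▸ hZ'))
  rw [wireCostate_eq D hG (h₁ ▸ hZ) (h₂ ▸ hZ) h₁ h₂,
    wireCostate_eq D hG' (h₁' ▸ hZ') (h₂' ▸ hZ') h₁' h₂', D.relabel_cupCostate hm _ _ k1 k2,
    D.relabel_cupCostate hm' _ _ k1' k2']
  have : Z' = Z := by
    rw [← h, k1] at k1'
    exact (congrArg Prod.fst k1').symm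
  congr 1
  · exact h.symm
  · exact h'.symm

end TypedGraph

theorem Enumerates.map {α β : Type*} {N : List α} {p : α → Prop} {p' : β → Prop}
    (hN : Enumerates N p) (f : α → β) (hp : ∀ i, p i → p' (f i))
    (inj : ∀ i j, p i → p j → f i = f j → i = j) (surj : ∀ j, p' j → ∃ i, p i ∧ f i = j) :
    Enumerates (N.map f) p' where
  nodup := hN.nodup.map_on fun i hi j hj h =>
    inj i j ((hN.mem_iff i).1 hi) ((hN.mem_iff j).1 hj) h
  mem_iff j := by
    rw [List.mem_map]
    constructor
    · rintro ⟨i, hi, rfl⟩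
      exact hp i ((hN.mem_iff i).1 hi)
    · intro h
      obtain ⟨i, hi, rfl⟩ := surj j h
      exact ⟨i, (hN.mem_iff i).2 hi, rfl⟩

theorem Enumerates.cons_map {α β : Type*} {N : List α} {p : α → Prop} {p' : β → Prop}
    (hN : Enumerates N p) (f : α → β) (b : β) (hb : p' b) (hp : ∀ i, p i → p' (f i) ∧ f i ≠ b)
    (inj : ∀ i j, p i → p j → f i = f j → i = j)
    (surj : ∀ j, p' j → j ≠ b → ∃ i, p i ∧ f i = j) : Enumerates (b :: N.map f) p' := by
  have h : Enumerates (N.map f) fun j => p' j ∧ j ≠ b :=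
    hN.map f hp inj fun j hj => surj j hj.1 hj.2
  refine ⟨List.nodup_cons.2 ⟨fun hb => ((h.mem_iff _).1 hb).2 rfl, h.nodup⟩, fun j => ?_⟩
  rw [List.mem_cons, h.mem_iff]
  by_cases hj : j = b
  · subst hj; simp [hb]
  · simp [hj]

namespace FramedCospan

open FramedPointGraph TypedGraph

variable {T : MonoidalSignature.{u, v}} {V : Type w₁} [Category.{w₂} V] [MonoidalCategory V]
  [SymmetricCategory V]
  (D : DualLetters T V) (hat : ∀ f : T.M, 𝟙_ V ⟶ (boxBoundary f).ob D.obj)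
  {Y Y' : FramedPointGraph T} {K L : FramedCospan unit Y}

theorem value_of_injective {N : List (K.G.E ⊕ K.G.V)} {M : List K.G.V} {o : Y.V → K.G.E × Bool}
    (hN : Enumerates N K.G.IsElem) (hM : Enumerates M K.G.IsInner)
    (ho : K.IsOutLab o) {κ : Type} {lt : κ → T.O × Bool} {m : K.G.E × Bool → κ}
    (hm : ∀ p, lt (m p) = K.G.flagLetter p) (inj : Function.Injective m)
    {A : List (Σ l, labelTensor (D.lab lt) [] ⟶ labelTensor (D.lab lt) l)}
    {P : List (Σ l, labelTensor (D.lab lt) l ⟶ labelTensor (D.lab lt) [])} {r : List κ}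
    (hA : A = N.map fun i => relabelState (D.lab_comm hm) (K.G.elemState D hat i))
    (hP : P = M.map fun x => relabelCostate (D.lab_comm hm) (K.G.wireCostate D x))
    (hr : r = Y.lst.map fun y => m (o y)) :
    ∃ h : (joins A).Perm (fullList P r), (fullList P r).Nodup ∧
      ∀ c : r.map (D.lab lt) = Y.letters.map D.obj,
        K.value D hat = netValue A P r h ≫ labelCast c := by
  have hA' : A = (N.map (K.G.elemState D hat)).map (relabelState (D.lab_comm hm)) := by
    rw [hA, List.map_map]; rfl
  have hP' : P = (M.map (K.G.wireCostate D)).map (relabelCostate (D.lab_comm hm)) := by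
    rw [hP, List.map_map]; rfl
  have hr' : r = (Y.lst.map o).map m := by rw [hr, List.map_map]; rfl
  have h : (joins A).Perm (fullList P r) := by
    rw [hA', hP', hr', joins_relabel, fullList_relabel]
    exact (joins_perm_fullList D hat hN hM ho).map m
  have n : (fullList P r).Nodup := by
    rw [hP', hr', fullList_relabel]
    exact (fullList_nodup D hM ho).map inj
  exact ⟨h, n, fun c => value_relabel D hat hN hM ho hm hA hP hr h n c⟩

theorem value_iso (i : Iso K L) : K.value D hat = L.value D hat := by
  obtain ⟨N, hN⟩ := K.exists_elems
  obtain ⟨M, hM⟩ := K.exists_inner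
  obtain ⟨o, ho⟩ := K.exists_outLab
  have hN' : Enumerates (N.map (Sum.map i.onE i.onV)) L.G.IsElem := by
    refine hN.map _ ?_ (fun a b _ _ h =>
      Sum.map_injective.2 ⟨i.onE.injective, i.onV.injective⟩ h) ?_
    · rintro (e | x) ⟨Z, hZ⟩
      exacts [⟨Z, (i.tyE_comm e).trans hZ⟩, ⟨Z, (i.tyV_comm x).trans hZ⟩]
    · rintro (e | x) ⟨Z, hZ⟩
      · obtain ⟨e, rfl⟩ := i.onE.surjective e
        exact ⟨.inl e, ⟨Z, (i.tyE_comm e).symm.trans hZ⟩, rfl⟩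
      · obtain ⟨x, rfl⟩ := i.onV.surjective x
        exact ⟨.inr x, ⟨Z, (i.tyV_comm x).symm.trans hZ⟩, rfl⟩
  have hw : ∀ x, L.G.IsWire (i.onV x) ↔ K.G.IsWire x := fun x => isWire_congr (i.tyV_comm x)
  have hin : ∀ x, L.G.IsInner (i.onV x) ↔ K.G.IsInner x := fun x => by
    refine and_congr (hw x) (and_congr ?_ ?_)
    · rw [← i.onE.exists_congr_right]
      exact exists_congr fun e => by rw [← i.tgt_comm, i.onV.injective.eq_iff]
    · rw [← i.onE.exists_congr_right]
      exact exists_congr fun e => by rw [← i.src_comm, i.onV.injective.eq_iff]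
  have hM' : Enumerates (M.map i.onV) L.G.IsInner :=
    hM.map _ (fun x hx => (hin x).2 hx) (fun a b _ _ h => i.onV.injective h) fun x hx => by
      obtain ⟨x, rfl⟩ := i.onV.surjective x
      exact ⟨x, (hin x).1 hx, rfl⟩
  have ho' : L.IsOutLab fun y => (i.onE (o y).1, (o y).2) := by
    refine ⟨fun y => ?_, fun y => ho.sgn_eq y⟩
    rw [← i.c_comm, ← ho.flagEnd_eq]
    rcases o y with ⟨e, _ | _⟩
    · exact (i.src_comm e).symm
    · exact (i.tgt_comm e).symm
  have hm : ∀ p : K.G.E × Bool, L.G.flagLetter (i.onE p.1, p.2) = K.G.flagLetter p := fun p =>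
    congrArg (fun t : T.TypeEdge => (t.letter, p.2)) (i.tyE_comm p.1)
  have hid : ∀ p, L.G.flagLetter (id p) = L.G.flagLetter p := fun _ => rfl
  have hA : (N.map fun j => relabelState (D.lab_comm hm) (K.G.elemState D hat j)) =
      (N.map (Sum.map i.onE i.onV)).map fun j => relabelState (D.lab_comm hid)
        (L.G.elemState D hat j) := by
    rw [List.map_map]
    exact List.map_congr_left fun j hj => (elemState_transport D hat K.string L.string i.tyE_comm
      (fun x f h => (i.tyV_comm x).trans h) (fun e _ _ => (i.tgt_comm e).symm)
      (fun e _ _ => (i.src_comm e).symm) hm hid (fun _ => rfl) ((hN.mem_iff j).1 hj)).symm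
  have hP : (M.map fun j => relabelCostate (D.lab_comm hm) (K.G.wireCostate D j)) =
      (M.map i.onV).map fun j => relabelCostate (D.lab_comm hid) (L.G.wireCostate D j) := by
    rw [List.map_map]
    refine List.map_congr_left fun j hj => ?_
    obtain ⟨h1, ⟨e, he⟩, ⟨e', he'⟩⟩ := (hM.mem_iff j).1 hj
    exact (wireCostate_transport D K.string L.string hm hid h1 ((hw j).2 h1) he he'
      ((i.tgt_comm e).symm.trans (congrArg _ he)) ((i.src_comm e').symm.trans (congrArg _ he'))
      rfl rfl).symm
  obtain ⟨h, n, e⟩ := value_of_injective D hat hN hM ho hm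
    (Function.Injective.prodMap i.onE.injective Function.injective_id) rfl rfl rfl
  obtain ⟨h', n', e'⟩ := value_of_injective D hat hN' hM' ho' hid Function.injective_id hA hP rfl
  have c := (D.map_lab L.G.flagLetter ho'.letter).symm
  exact (e c).trans (e' c).symm

theorem value_reindex (χ : Perm unit unit) (φ : Perm Y Y') :
    (K.reindex χ φ).value D hat = K.value D hat ≫ obPerm D.obj φ := by
  obtain ⟨N, hN⟩ := K.exists_elems
  obtain ⟨M, hM⟩ := K.exists_inner
  obtain ⟨o, ho⟩ := K.exists_outLab
  have ho' : (K.reindex χ φ).IsOutLab fun y => o (φ.equiv.symm y) :=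
    ⟨fun y => ho.flagEnd_eq _, fun y => (ho.sgn_eq _).trans (φ.symm.sgn_comm y)⟩
  have e := value_eq D hat hN hM ho
  have e' := value_eq (K := K.reindex χ φ) D hat hN hM ho'
  have hp : (Y.lst.map o).Perm (Y'.lst.map fun y => o (φ.equiv.symm y)) := by
    have := (lst_perm φ).map fun y => o (φ.equiv.symm y)
    rw [List.map_map] at this
    refine List.Perm.trans (.of_eq (List.map_congr_left fun y _ => ?_)) this
    exact congrArg o (φ.equiv.symm_apply_apply y).symm
  have c1 := D.map_lab K.G.flagLetter ho.letter
  have c2 := D.map_lab K.G.flagLetter ho'.letter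
  have q := obPerm_eq D.obj φ (D.lab K.G.flagLetter) (fun y => o (φ.equiv.symm y))
    (ho.injective.comp φ.equiv.symm.injective)
    (fun y => congrArg D.obj (ho'.letter y))
    (l := Y.lst.map o) (m := Y'.lst.map fun y => o (φ.equiv.symm y))
    (List.map_congr_left fun y _ => congrArg o (φ.equiv.symm_apply_apply y).symm) rfl hp c1 c2.symm
  have n := fullList_nodup (K := K.reindex χ φ) D hM ho'
  refine e'.trans ?_
  rw [e, q, Category.assoc, labelCast_trans_assoc, labelCast_refl, Category.id_comp,
    ← Category.assoc, netValue_out hp _ (joins_perm_fullList (K := K.reindex χ φ) D hat hN hM ho') n]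

end FramedCospan

namespace DualLetters

open FramedPointGraph

variable {T : MonoidalSignature.{u, v}} {V : Type w₁} [Category.{w₂} V] [MonoidalCategory V]
  (D : DualLetters T V) {ι : Type} {lt : ι → T.O × Bool}

theorem labelOp_costate {X Y : FramedPointGraph T} {l m : List ι}
    (hl : l.map (D.lab lt) = X.letters.map D.obj) (hm : m.map (D.lab lt) = Y.letters.map D.obj)
    (h : (l ++ m).map (D.lab lt) = (X.tensor Y).letters.map D.obj) (k : X.ob D.obj ⟶ 𝟙_ V)
    {k' : labelTensor (D.lab lt) l ⟶ labelTensor (D.lab lt) []} (hk : k' = labelCast hl ≫ k) :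
    labelOp k' m ≫ labelCast hm =
      labelCast h ≫ (obTensor D.obj X Y).inv ≫ k ▷ Y.ob D.obj ≫ (λ_ _).hom := by
  subst hk
  have e := obTensor_cast (κ := ι) D.obj lt hl hm h
  have e' : labelCast h ≫ (obTensor D.obj X Y).inv =
      (labelApp (D.lab lt) l m).inv ≫ (labelCast hl ⊗ₘ labelCast hm) := by
    rw [Iso.eq_inv_comp, ← Category.assoc, Iso.comp_inv_eq]
    exact e
  rw [← Category.assoc, e']
  change ((labelApp (D.lab lt) l m).inv ≫ (labelCast hl ≫ k) ▷ labelTensor (D.lab lt) m ≫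
    (λ_ (labelTensor (D.lab lt) m)).hom) ≫ labelCast hm = _
  rw [MonoidalCategory.tensorHom_def]
  simp only [Category.assoc, comp_whiskerRight]
  rw [← leftUnitor_naturality, whisker_exchange_assoc]

theorem labelOp_state {X Y : FramedPointGraph T} {l m : List ι}
    (hl : X.letters.map D.obj = l.map (D.lab lt)) (hm : m.map (D.lab lt) = Y.letters.map D.obj)
    (h : (l ++ m).map (D.lab lt) = (X.tensor Y).letters.map D.obj) (s : 𝟙_ V ⟶ X.ob D.obj)
    {s' : labelTensor (D.lab lt) [] ⟶ labelTensor (D.lab lt) l} (hs : s' = s ≫ labelCast hl) :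
    labelOp s' m ≫ labelCast h =
      labelCast hm ≫ (λ_ _).inv ≫ s ▷ Y.ob D.obj ≫ (obTensor D.obj X Y).hom := by
  subst hs
  have e := obTensor_cast (κ := ι) D.obj lt hl.symm hm h
  change ((λ_ (labelTensor (D.lab lt) m)).inv ≫
    (s ≫ labelCast hl) ▷ labelTensor (D.lab lt) m ≫ (labelApp (D.lab lt) l m).hom) ≫
      labelCast h = _
  simp only [Category.assoc]
  refine (congrArg (fun t => _ ≫ _ ≫ t) e).trans ?_
  rw [MonoidalCategory.tensorHom_def]
  simp only [Category.assoc, comp_whiskerRight]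
  rw [← comp_whiskerRight_assoc (labelCast hl), labelCast_trans, labelCast_refl,
    id_whiskerRight, Category.id_comp, ← whisker_exchange_assoc, leftUnitor_inv_naturality_assoc]

theorem letters_cup (Z : T.O) :
    ((point Z).tensor (point Z).dual).letters = [(Z, true), (Z, false)] := by
  rw [letters_tensor, letters_point, letters_dual_point]; rfl

theorem letters_cap (Z : T.O) :
    ((point Z).dual.tensor (point Z)).letters = [(Z, false), (Z, true)] := by
  rw [letters_tensor, letters_point, letters_dual_point]; rfl

/-- The cup of a generating object. -/
noncomputable def obCup (Z : T.O) : ((point Z).tensor (point Z).dual).ob D.obj ⟶ 𝟙_ V :=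
  labelCast (congrArg (List.map D.obj) (letters_cup Z)) ≫
    D.obj (Z, true) ◁ (ρ_ (D.obj (Z, false))).hom ≫ D.cup Z

/-- The cap of a generating object. -/
noncomputable def obCap (Z : T.O) : 𝟙_ V ⟶ ((point Z).dual.tensor (point Z)).ob D.obj :=
  (D.cap Z ≫ D.obj (Z, false) ◁ (ρ_ (D.obj (Z, true))).inv) ≫
    labelCast (congrArg (List.map D.obj) (letters_cap Z).symm)

theorem cupCostate_eq {Z : T.O} {s t : ι} (hs : lt s = (Z, true)) (ht : lt t = (Z, false))
    (h : [s, t].map (D.lab lt) = ((point Z).tensor (point Z).dual).letters.map D.obj) :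
    (D.cupCostate lt Z s t hs ht).2 = labelCast h ≫ D.obCup Z := by
  have h' : [s, t].map (D.lab lt) = [(Z, true), (Z, false)].map D.obj :=
    h.trans (congrArg (List.map D.obj) (letters_cup Z))
  have e := labelCast_two (D := D.lab lt) (E := D.obj) (congrArg D.obj hs) (congrArg D.obj ht) h'
  rw [obCup, labelCast_trans_assoc]
  refine Eq.trans ?_ (congrArg (· ≫ _) e.symm)
  change _ ≫ _ ≫ D.cup Z = _ ≫ _ ≫ D.cup Z
  simp only [← id_tensorHom, ← tensorHom_id, tensorHom_comp_tensorHom_assoc, Category.comp_id,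
    Category.id_comp]
  rw [tensorHom_id, rightUnitor_naturality]

theorem capState_eq {Z : T.O} {s t : ι} (hs : lt s = (Z, false)) (ht : lt t = (Z, true))
    (h : ((point Z).dual.tensor (point Z)).letters.map D.obj = [s, t].map (D.lab lt)) :
    (D.capState lt Z s t hs ht).2 = D.obCap Z ≫ labelCast h := by
  have h' : [(Z, false), (Z, true)].map D.obj = [s, t].map (D.lab lt) :=
    (congrArg (List.map D.obj) (letters_cap Z).symm).trans h
  have e := labelCast_two (D := D.obj) (E := D.lab lt) (congrArg D.obj hs.symm)
    (congrArg D.obj ht.symm) h'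
  rw [obCap, Category.assoc, labelCast_trans]
  refine Eq.trans ?_ (congrArg (_ ≫ ·) e.symm)
  change (D.cap Z ≫ _) ≫ _ = (D.cap Z ≫ _) ≫ _
  simp only [Category.assoc, ← id_tensorHom, ← tensorHom_id, tensorHom_comp_tensorHom,
    Category.comp_id, Category.id_comp]
  rw [tensorHom_id, ← rightUnitor_inv_naturality]

end DualLetters

namespace FramedCospan

open FramedPointGraph TypedGraph

variable {T : MonoidalSignature.{u, v}} {V : Type w₁} [Category.{w₂} V] [MonoidalCategory V]
  [SymmetricCategory V]
  (D : DualLetters T V) (hat : ∀ f : T.M, 𝟙_ V ⟶ (boxBoundary f).ob D.obj)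
  {X Y Y' W : FramedPointGraph T}

/-- The value of a disjoint union with an elementary string graph. -/
theorem value_tensor (S : FramedCospan unit X) (J : FramedCospan unit Y) {i₀ : S.G.E ⊕ S.G.V}
    (hi : Enumerates [i₀] S.G.IsElem) (hS : ∀ x, ¬ S.G.IsInner x) {oS : X.V → S.G.E × Bool}
    (hoS : S.IsOutLab oS) (s : 𝟙_ V ⟶ X.ob D.obj)
    (hs : S.G.elemState D hat i₀ = D.boxState S.G.flagLetter s oS hoS.letter)
    (χ : Perm unit (unit.tensor unit)) :
    ((S.tensor J).reindex χ (Perm.refl _)).value D hat =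
      J.value D hat ≫ (λ_ _).inv ≫ s ▷ Y.ob D.obj ≫ (obTensor D.obj X Y).hom := by
  let L := (S.tensor J).reindex χ (Perm.refl _)
  obtain ⟨N, hN⟩ := J.exists_elems
  obtain ⟨M, hM⟩ := J.exists_inner
  obtain ⟨o, ho⟩ := J.exists_outLab
  have hi₀ : S.G.IsElem i₀ := (hi.mem_iff i₀).1 (List.mem_singleton.2 rfl)
  have hSi : ∀ i, S.G.IsElem i → i = i₀ := fun i h => List.mem_singleton.1 ((hi.mem_iff i).2 h)
  have hN' : Enumerates (Sum.map Sum.inl Sum.inl i₀ :: N.map (Sum.map Sum.inr Sum.inr))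
      L.G.IsElem := by
    refine hN.cons_map _ _ ?_ ?_ ?_ ?_
    · rcases i₀ with e | x
      · exact hi₀
      · exact hi₀
    · rintro (e | x) h
      · refine ⟨h, ?_⟩
        rcases i₀ with e' | x' <;> intro h' <;> cases h'
      · refine ⟨h, ?_⟩
        rcases i₀ with e' | x' <;> intro h' <;> cases h'
    · exact fun a b _ _ h => Sum.map_injective.2 ⟨Sum.inr_injective, Sum.inr_injective⟩ h
    · rintro ((e | e) | (x | x)) h h'
      · exact absurd (congrArg (Sum.map Sum.inl Sum.inl) (hSi (.inl e) h)) h'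
      · exact ⟨.inl e, h, rfl⟩
      · exact absurd (congrArg (Sum.map Sum.inl Sum.inl) (hSi (.inr x) h)) h'
      · exact ⟨.inr x, h, rfl⟩
  have hM' : Enumerates (M.map Sum.inr) L.G.IsInner := by
    refine hM.map _ ?_ (fun a b _ _ h => Sum.inr_injective h) ?_
    · rintro x ⟨h, ⟨e, he⟩, ⟨e', he'⟩⟩
      exact ⟨h, ⟨.inr e, congrArg Sum.inr he⟩, ⟨.inr e', congrArg Sum.inr he'⟩⟩
    · rintro (x | x) ⟨h, ⟨e | e, he⟩, ⟨e' | e', he'⟩⟩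
      · exact absurd ⟨h, ⟨e, Sum.inl_injective he⟩, ⟨e', Sum.inl_injective he'⟩⟩ (hS x)
      · cases he'
      · cases he
      · cases he
      · cases he
      · cases he
      · cases he'
      · exact ⟨x, ⟨h, ⟨e, Sum.inr_injective he⟩, ⟨e', Sum.inr_injective he'⟩⟩, rfl⟩
  let mS : S.G.E × Bool → L.G.E × Bool := fun p => (.inl p.1, p.2)
  let mJ : J.G.E × Bool → L.G.E × Bool := fun p => (.inr p.1, p.2)
  have hmS : ∀ p, L.G.flagLetter (mS p) = S.G.flagLetter p := fun _ => rfl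
  have hmJ : ∀ p, L.G.flagLetter (mJ p) = J.G.flagLetter p := fun _ => rfl
  have hid : ∀ p, L.G.flagLetter (id p) = L.G.flagLetter p := fun _ => rfl
  have hoL : L.IsOutLab (Sum.elim (fun y => mS (oS y)) fun y => mJ (o y)) := by
    refine ⟨?_, ?_⟩
    · rintro (y | y)
      · have := hoS.flagEnd_eq y
        change L.G.flagEnd (mS (oS y)) = .inl (S.c y)
        rw [← this]
        rcases oS y with ⟨e, _ | _⟩ <;> rfl
      · have := ho.flagEnd_eq y
        change L.G.flagEnd (mJ (o y)) = .inr (J.c y)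
        rw [← this]
        rcases o y with ⟨e, _ | _⟩ <;> rfl
    · rintro (y | y)
      exacts [hoS.sgn_eq y, ho.sgn_eq y]
  have hbox : ∀ p, L.G.flagLetter (mS (oS p)) = X.letter p := fun p => hoS.letter p
  have hA : D.boxState L.G.flagLetter s (fun y => mS (oS y)) hbox ::
      (N.map fun i => relabelState (D.lab_comm hmJ) (J.G.elemState D hat i)) =
      (Sum.map Sum.inl Sum.inl i₀ :: N.map (Sum.map Sum.inr Sum.inr)).map
        fun i => relabelState (D.lab_comm hid) (L.G.elemState D hat i) := by
    rw [List.map_cons, List.map_map]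
    congr 1
    · have := elemState_transport D hat S.string L.string (G' := L.G) (ψ := Sum.inl)
        (iE := Sum.inl) (fun _ => rfl) (fun _ _ h => h) (fun _ _ _ => rfl) (fun _ _ _ => rfl)
        hmS hid (fun _ => rfl) hi₀
      rw [this, hs]
      exact (D.relabel_boxState hmS s oS hoS.letter _ hbox fun _ => rfl).symm
    · exact List.map_congr_left fun i h => (elemState_transport D hat J.string L.string
        (G' := L.G) (ψ := Sum.inr) (iE := Sum.inr) (fun _ => rfl) (fun _ _ h => h)
        (fun _ _ _ => rfl) (fun _ _ _ => rfl) hmJ hid (fun _ => rfl) ((hN.mem_iff i).1 h)).symm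
  have hP : (M.map fun i => relabelCostate (D.lab_comm hmJ) (J.G.wireCostate D i)) =
      (M.map Sum.inr).map fun i => relabelCostate (D.lab_comm hid) (L.G.wireCostate D i) := by
    rw [List.map_map]
    refine List.map_congr_left fun x hx => ?_
    obtain ⟨h1, ⟨e, he⟩, ⟨e', he'⟩⟩ := (hM.mem_iff x).1 hx
    exact (wireCostate_transport D J.string L.string (G' := L.G) (x' := .inr x) (e₁' := .inr e)
      (e₂' := .inr e') hmJ hid h1 h1 he he' (congrArg Sum.inr he) (congrArg Sum.inr he')
      rfl rfl).symm
  have hr : (X.lst.map fun y => mS (oS y)) ++ (Y.lst.map fun y => mJ (o y)) =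
      (X.tensor Y).lst.map fun y => id (Sum.elim (fun y => mS (oS y)) (fun y => mJ (o y)) y) := by
    rw [lst_tensor, List.map_append, List.map_map, List.map_map]
    rfl
  obtain ⟨h, n, e⟩ := value_of_injective D hat hN hM ho hmJ
    (Function.Injective.prodMap Sum.inr_injective Function.injective_id) rfl rfl rfl
  obtain ⟨h', n', e'⟩ := value_of_injective (K := L) D hat hN' hM' hoL hid Function.injective_id
    hA hP hr
  have cY : (Y.lst.map fun y => mJ (o y)).map (D.lab L.G.flagLetter) = Y.letters.map D.obj :=
    (D.map_lab (X := Y) L.G.flagLetter (f := fun y => mJ (o y))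
      fun y => (hmJ _).trans (ho.letter y)).symm
  have cX : X.letters.map D.obj = (X.lst.map fun y => mS (oS y)).map (D.lab L.G.flagLetter) :=
    D.map_lab L.G.flagLetter hbox
  have cXY : ((X.lst.map fun y => mS (oS y)) ++ (Y.lst.map fun y => mJ (o y))).map
      (D.lab L.G.flagLetter) = (X.tensor Y).letters.map D.obj := by
    rw [letters_tensor, List.map_append, List.map_append, cX, cY]
  refine (e' cXY).trans ?_
  rw [e cY]
  refine (congrArg (· ≫ _) (netValue_state_cons _ h h' n')).trans ?_
  exact (Category.assoc _ _ _).trans ((congrArg (_ ≫ ·)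
    (D.labelOp_state cX cY cXY s rfl)).trans (Category.assoc _ _ _).symm)

/-- The value after joining two vertices of the boundary. -/
theorem value_merge {Z : T.O}
    (K : FramedCospan unit (((point Z).tensor (point Z).dual).tensor W)) (K' : FramedCospan unit W)
    (onV : K.G.V → K'.G.V) (surj : Function.Surjective onV) (onE : K.G.E ≃ K'.G.E)
    (src_comm : ∀ e, onV (K.G.src e) = K'.G.src (onE e))
    (tgt_comm : ∀ e, onV (K.G.tgt e) = K'.G.tgt (onE e))
    (tyV_comm : ∀ x, K'.G.τ.onV (onV x) = K.G.τ.onV x)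
    (tyE_comm : ∀ e, K'.G.τ.onE (onE e) = K.G.τ.onE e)
    (c_comm : ∀ y, onV (K.c (.inr y)) = K'.c y)
    (glue : onV (K.c (.inl (.inl ()))) = onV (K.c (.inl (.inr ()))))
    (eq_of : ∀ x x', onV x = onV x' → x = x' ∨
      (x = K.c (.inl (.inl ())) ∧ x' = K.c (.inl (.inr ()))) ∨
        (x = K.c (.inl (.inr ())) ∧ x' = K.c (.inl (.inl ())))) :
    K'.value D hat = K.value D hat ≫ (obTensor D.obj _ W).inv ≫ D.obCup Z ▷ W.ob D.obj ≫
      (λ_ _).hom := by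
  obtain ⟨N, hN⟩ := K.exists_elems
  obtain ⟨M, hM⟩ := K.exists_inner
  obtain ⟨o, ho⟩ := K.exists_outLab
  have hw : ∀ x, K'.G.IsWire (onV x) ↔ K.G.IsWire x := fun x => isWire_congr (tyV_comm x)
  have inj : ∀ x x', onV x = onV x' → (∀ y, K.c y ≠ x) → x = x' := fun x x' h h' =>
    (eq_of x x' h).resolve_right
      (fun h => h.elim (fun h => h' _ h.1.symm) fun h => h' _ h.1.symm)
  have inner_ne : ∀ x, K.G.IsInner x → ∀ y, K.c y ≠ x := fun x hx y h =>
    c_not_inner y (h.symm ▸ hx)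
  have box_ne : ∀ x, K.G.IsBox x → ∀ y, K.c y ≠ x := fun x hx y h =>
    not_wire_of_box hx (h ▸ K.c_wire y)
  have hN' : Enumerates (N.map (Sum.map onE onV)) K'.G.IsElem := by
    refine hN.map _ ?_ ?_ ?_
    · rintro (e | x) ⟨Z, hZ⟩
      exacts [⟨Z, (tyE_comm e).trans hZ⟩, ⟨Z, (tyV_comm x).trans hZ⟩]
    · rintro (e | x) (e' | x') h h' hh
      · exact congrArg _ (onE.injective (Sum.inl_injective hh))
      · cases hh
      · cases hh
      · exact congrArg _ (inj _ _ (Sum.inr_injective hh) (box_ne x h))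
    · rintro (e | x) ⟨Z, hZ⟩
      · obtain ⟨e, rfl⟩ := onE.surjective e
        exact ⟨.inl e, ⟨Z, (tyE_comm e).symm.trans hZ⟩, rfl⟩
      · obtain ⟨x, rfl⟩ := surj x
        exact ⟨.inr x, ⟨Z, (tyV_comm x).symm.trans hZ⟩, rfl⟩
  obtain ⟨ea, hea⟩ : ∃ e, o (.inl (.inl ())) = (e, true) :=
    ⟨_, Prod.ext rfl (ho.sgn_eq (.inl (.inl ())))⟩
  obtain ⟨eb, heb⟩ : ∃ e, o (.inl (.inr ())) = (e, false) :=
    ⟨_, Prod.ext rfl (ho.sgn_eq (.inl (.inr ())))⟩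
  have hta : K.G.tgt ea = K.c (.inl (.inl ())) := by
    have := ho.flagEnd_eq (.inl (.inl ()))
    rw [hea] at this
    exact this
  have htb : K.G.src eb = K.c (.inl (.inr ())) := by
    have := ho.flagEnd_eq (.inl (.inr ()))
    rw [heb] at this
    exact this
  have hinner : ∀ x, K.G.IsInner x → K'.G.IsInner (onV x) := by
    rintro x ⟨h, ⟨e, he⟩, ⟨e', he'⟩⟩
    exact ⟨(hw x).2 h, ⟨onE e, (tgt_comm e).symm.trans (congrArg onV he)⟩,
      ⟨onE e', (src_comm e').symm.trans (congrArg onV he')⟩⟩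
  have hM' : Enumerates (onV (K.c (.inl (.inl ()))) :: M.map onV) K'.G.IsInner := by
    refine hM.cons_map _ _ ?_ ?_ ?_ ?_
    · exact ⟨(hw _).2 (K.c_wire _), ⟨onE ea, (tgt_comm ea).symm.trans (congrArg onV hta)⟩,
        ⟨onE eb, (src_comm eb).symm.trans ((congrArg onV htb).trans glue.symm)⟩⟩
    · exact fun x hx => ⟨hinner x hx, fun h => inner_ne x hx _ (inj _ _ h (inner_ne x hx)).symm⟩
    · exact fun x x' hx _ h => inj _ _ h (inner_ne x hx)
    · intro x' hx' hne
      obtain ⟨x, rfl⟩ := surj x'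
      refine ⟨x, ?_, rfl⟩
      have h1 : ∀ z, onV z = onV x → z = x := fun z hz => by
        rcases eq_of _ _ hz with h | ⟨-, h⟩ | ⟨-, h⟩
        · exact h
        · exact absurd ((congrArg onV h).trans glue.symm) hne
        · exact absurd (congrArg onV h) hne
      obtain ⟨h2, ⟨e, he⟩, ⟨e', he'⟩⟩ := hx'
      obtain ⟨e, rfl⟩ := onE.surjective e
      obtain ⟨e', rfl⟩ := onE.surjective e'
      exact ⟨(hw x).1 h2, ⟨e, h1 _ ((tgt_comm e).trans he)⟩,
        ⟨e', h1 _ ((src_comm e').trans he')⟩⟩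
  let m : K.G.E × Bool → K'.G.E × Bool := fun p => (onE p.1, p.2)
  have hm : ∀ p, K'.G.flagLetter (m p) = K.G.flagLetter p := fun p =>
    congrArg (fun t : T.TypeEdge => (t.letter, p.2)) (tyE_comm p.1)
  have hid : ∀ p, K'.G.flagLetter (id p) = K'.G.flagLetter p := fun _ => rfl
  have ho' : K'.IsOutLab fun y => m (o (.inr y)) := by
    refine ⟨fun y => ?_, fun y => ho.sgn_eq (.inr y)⟩
    rw [← c_comm, ← ho.flagEnd_eq]
    rcases o (.inr y) with ⟨e, _ | _⟩
    · exact (src_comm e).symm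
    · exact (tgt_comm e).symm
  have hA : (N.map fun j => relabelState (D.lab_comm hm) (K.G.elemState D hat j)) =
      (N.map (Sum.map onE onV)).map fun j => relabelState (D.lab_comm hid)
        (K'.G.elemState D hat j) := by
    rw [List.map_map]
    exact List.map_congr_left fun j hj => (elemState_transport D hat K.string K'.string tyE_comm
      (fun x f h => (tyV_comm x).trans h) (fun e _ _ => (tgt_comm e).symm)
      (fun e _ _ => (src_comm e).symm) hm hid (fun _ => rfl) ((hN.mem_iff j).1 hj)).symm
  have la : K'.G.flagLetter (m (ea, true)) = (Z, true) := by
    rw [hm]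
    exact letter_tgt (by rw [hta]; exact K.c_ty (.inl (.inl ())))
  have lb : K'.G.flagLetter (m (eb, false)) = (Z, false) := by
    rw [hm]
    exact letter_src (by rw [htb]; exact K.c_ty (.inl (.inr ())))
  have hP : D.cupCostate K'.G.flagLetter Z (m (ea, true)) (m (eb, false)) la lb ::
      (M.map fun j => relabelCostate (D.lab_comm hm) (K.G.wireCostate D j)) =
      (onV (K.c (.inl (.inl ()))) :: M.map onV).map fun j =>
        relabelCostate (D.lab_comm hid) (K'.G.wireCostate D j) := by
    rw [List.map_cons, List.map_map]
    congr 1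
    · have t1 : K'.G.tgt (onE ea) = onV (K.c (.inl (.inl ()))) :=
        (tgt_comm ea).symm.trans (congrArg onV hta)
      have t2 : K'.G.src (onE eb) = onV (K.c (.inl (.inl ()))) :=
        (src_comm eb).symm.trans ((congrArg onV htb).trans glue.symm)
      have t3 : K'.G.τ.onV (onV (K.c (.inl (.inl ())))) = .inl Z :=
        (tyV_comm _).trans (K.c_ty (.inl (.inl ())))
      rw [wireCostate_eq D K'.string (t1 ▸ t3) (t2 ▸ t3) t1 t2,
        D.relabel_cupCostate hid _ _ la lb]
      rfl
    · refine List.map_congr_left fun j hj => ?_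
      obtain ⟨h1, ⟨e, he⟩, ⟨e', he'⟩⟩ := (hM.mem_iff j).1 hj
      exact (wireCostate_transport D K.string K'.string hm hid h1 ((hw j).2 h1) he he'
        ((tgt_comm e).symm.trans (congrArg _ he)) ((src_comm e').symm.trans (congrArg _ he'))
        rfl rfl).symm
  have hr : [m (ea, true), m (eb, false)] ++ (W.lst.map fun y => m (o (.inr y))) =
      (((point Z).tensor (point Z).dual).tensor W).lst.map fun y => m (o y) := by
    have l1 : (point Z : FramedPointGraph T).dual.lst = [()] := lst_point Z
    rw [lst_tensor, lst_tensor, lst_point, l1, List.map_append, List.map_map, List.map_map,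
      ← hea, ← heb]
    rfl
  obtain ⟨h, n, e⟩ := value_of_injective D hat hN hM ho hm
    (Function.Injective.prodMap onE.injective Function.injective_id) rfl rfl hr
  obtain ⟨h', n', e'⟩ := value_of_injective (K := K') D hat hN' hM' ho' hid Function.injective_id
    hA hP rfl
  have cW : (W.lst.map fun y => m (o (.inr y))).map (D.lab K'.G.flagLetter) =
      W.letters.map D.obj := (D.map_lab K'.G.flagLetter ho'.letter).symm
  have cX : [m (ea, true), m (eb, false)].map (D.lab K'.G.flagLetter) =
      ((point Z).tensor (point Z).dual).letters.map D.obj := by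
    rw [DualLetters.letters_cup]
    change [D.obj _, D.obj _] = [D.obj _, D.obj _]
    rw [la, lb]
  have cXW : ([m (ea, true), m (eb, false)] ++ (W.lst.map fun y => m (o (.inr y)))).map
      (D.lab K'.G.flagLetter) =
      (((point Z).tensor (point Z).dual).tensor W).letters.map D.obj := by
    rw [letters_tensor, List.map_append, List.map_append, cX, cW]
  refine (e' cW).trans ?_
  rw [e cXW]
  refine (congrArg (· ≫ _) (netValue_costate_cons _ h h' n)).trans ?_
  rw [Category.assoc, Category.assoc]
  exact congrArg (_ ≫ ·) (D.labelOp_costate cX cW cXW (D.obCup Z) (D.cupCostate_eq la lb cX))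

end FramedCospan

section triangles

variable {C : Type c} [Category.{d} C] [MonoidalCategory C]

theorem triangle_cast {X Y A S T : C} {η : 𝟙_ C ⟶ Y ⊗ X} {ε : X ⊗ Y ⟶ 𝟙_ C}
    (h : X ◁ η ≫ (α_ X Y X).inv ≫ ε ▷ X = (ρ_ X).hom ≫ (λ_ X).inv)
    (hA : A = X) (hS : S = Y) (hS' : Y = S) (hT : X = T) (hat : A = T) :
    A ◁ (η ≫ (eqToHom hS' ⊗ₘ eqToHom hT)) ≫ (α_ A S T).inv ≫
      ((eqToHom hA ⊗ₘ eqToHom hS) ≫ ε) ▷ T = (ρ_ A).hom ≫ eqToHom hat ≫ (λ_ T).inv := by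
  subst hA hS' hT
  simpa using h

variable [SymmetricCategory C]

theorem triangle_swap {X Y : C} {η : 𝟙_ C ⟶ Y ⊗ X} {ε : X ⊗ Y ⟶ 𝟙_ C}
    (h : X ◁ η ≫ (α_ X Y X).inv ≫ ε ▷ X = (ρ_ X).hom ≫ (λ_ X).inv)
    (h' : η ▷ Y ≫ (α_ Y X Y).hom ≫ Y ◁ ε = (λ_ Y).hom ≫ (ρ_ Y).inv) :
    Y ◁ (η ≫ (β_ Y X).hom) ≫ (α_ Y X Y).inv ≫ ((β_ Y X).hom ≫ ε) ▷ Y =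
      (ρ_ Y).hom ≫ (λ_ Y).inv := by
  let p : ExactPairing Y X :=
    { coevaluation' := η
      evaluation' := ε
      coevaluation_evaluation' := h
      evaluation_coevaluation' := h' }
  have := (BraidedCategory.exactPairing_swap Y X).coevaluation_evaluation'
  refine Eq.trans ?_ this
  have e : (β_ Y X).hom = (β_ X Y).inv := SymmetricCategory.braiding_swap_eq_inv_braiding X Y
  rw [show Y ◁ (η ≫ (β_ Y X).hom) = Y ◁ (η ≫ (β_ X Y).inv) by rw [e]]
  rfl

theorem cap_exch {X Y S T : C} (η : 𝟙_ C ⟶ Y ⊗ X) (f : Y ⟶ S) (g : X ⟶ T) :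
    ((η ≫ (f ⊗ₘ g)) ≫ S ◁ (ρ_ T).inv) ≫ (exch S T (𝟙_ C)).hom =
      ((η ≫ (β_ Y X).hom) ≫ (g ⊗ₘ f)) ≫ T ◁ (ρ_ S).inv := by
  have e : S ◁ (ρ_ T).inv ≫ (exch S T (𝟙_ C)).hom = (β_ S T).hom ≫ T ◁ (ρ_ S).inv := by
    simp [exch]
  simp only [Category.assoc, e]
  rw [BraidedCategory.braiding_naturality_assoc]

theorem exch_cup {X Y S T : C} (ε : X ⊗ Y ⟶ 𝟙_ C) (f : S ⟶ X) (g : T ⟶ Y) :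
    (exch T S (𝟙_ C)).hom ≫ S ◁ (ρ_ T).hom ≫ (f ⊗ₘ g) ≫ ε =
      T ◁ (ρ_ S).hom ≫ (g ⊗ₘ f) ≫ (β_ Y X).hom ≫ ε := by
  have e : (exch T S (𝟙_ C)).hom ≫ S ◁ (ρ_ T).hom = T ◁ (ρ_ S).hom ≫ (β_ T S).hom := by
    simp [exch]
  rw [← Category.assoc, e]
  simp only [Category.assoc]
  rw [BraidedCategory.braiding_naturality_assoc]

end triangles

section relabel

variable {C : Type c} [Category.{d} C] [MonoidalCategory C] [SymmetricCategory C]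
  {ι κ μ : Type a} {D : ι → C} {E : κ → C} {F : μ → C}

theorem relabelState_trans {f : ι → κ} (hf : ∀ i, E (f i) = D i) {g : κ → μ}
    (hg : ∀ i, F (g i) = E i) {k : ι → μ} (hk : ∀ i, F (k i) = D i) (h : ∀ i, k i = g (f i))
    (s : Σ l, labelTensor D [] ⟶ labelTensor D l) :
    relabelState hg (relabelState hf s) = relabelState hk s := by
  obtain rfl : k = g ∘ f := funext h
  obtain ⟨l, s⟩ := s
  have key : ∀ (l' : List μ) (_ : l' = l.map (g ∘ f)) (c : l.map D = l'.map F),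
      (⟨l', s ≫ labelCast c⟩ : Σ l, labelTensor F [] ⟶ labelTensor F l) =
        relabelState hk ⟨l, s⟩ := by
    rintro _ rfl c
    rfl
  refine Eq.trans ?_ (key ((l.map f).map g) (by rw [List.map_map])
    ((map_relabel hf l).trans (map_relabel hg _)))
  refine congrArg (Sigma.mk ((l.map f).map g)) ?_
  exact (Category.assoc _ _ _).trans (congrArg (s ≫ ·)
    (labelCast_trans (map_relabel hf l) (map_relabel hg _)))

theorem relabelState_id (h : ∀ i, D (id i) = D i) (s : Σ l, labelTensor D [] ⟶ labelTensor D l) :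
    relabelState h s = s := by
  obtain ⟨l, s⟩ := s
  have key : ∀ (l' : List ι) (_ : l' = l) (c : l.map D = l'.map D),
      (⟨l', s ≫ labelCast c⟩ : Σ l, labelTensor D [] ⟶ labelTensor D l) = ⟨l, s⟩ := by
    rintro _ rfl c
    rw [labelCast_refl]
    exact congrArg (Sigma.mk _) (Category.comp_id s)
  exact key _ (List.map_id l) (map_relabel h l)

theorem relabelCostate_id (h : ∀ i, D (id i) = D i)
    (s : Σ l, labelTensor D l ⟶ labelTensor D []) : relabelCostate h s = s := by
  obtain ⟨l, s⟩ := s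
  have key : ∀ (l' : List ι) (_ : l' = l) (c : l'.map D = l.map D),
      (⟨l', labelCast c ≫ s⟩ : Σ l, labelTensor D l ⟶ labelTensor D []) = ⟨l, s⟩ := by
    rintro _ rfl c
    rw [labelCast_refl]
    exact congrArg (Sigma.mk _) (Category.id_comp s)
  exact key _ (List.map_id l) (map_relabel h l).symm

end relabel

namespace FramedCospan

open FramedPointGraph TypedGraph

variable {T : MonoidalSignature.{u, v}} {V : Type w₁} [Category.{w₂} V] [MonoidalCategory V]
  [SymmetricCategory V]
  (D : DualLetters T V) (hat : ∀ f : T.M, 𝟙_ V ⟶ (boxBoundary f).ob D.obj)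
  {Y : FramedPointGraph T} {K L : FramedCospan unit Y}

theorem value_contraction_of_inner (C : Contraction K L) {a s t : K.G.E × Bool} {v : K.G.V}
    (hv : K.G.flagEnd s = v) (ha : K.G.flagEnd a = v) (hwire : K.G.IsWire v)
    (ss : s.1 = C.e) (st : t.1 = C.e) (hst : s.2 = !t.2) (hat' : a.2 = t.2)
    {c : 𝟙_ V ⟶ D.lab K.G.flagLetter s ⊗ D.lab K.G.flagLetter t}
    {k : D.lab K.G.flagLetter a ⊗ D.lab K.G.flagLetter s ⟶ 𝟙_ V}
    (hlt : K.G.flagLetter a = K.G.flagLetter t)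
    (htri : D.lab K.G.flagLetter a ◁ c ≫ (α_ _ _ _).inv ≫ k ▷ D.lab K.G.flagLetter t =
      (ρ_ (D.lab K.G.flagLetter a)).hom ≫ eqToHom (congrArg D.obj hlt) ≫
        (λ_ (D.lab K.G.flagLetter t)).inv)
    {l m : List (K.G.E × Bool)} (hl : l.Perm [s, t]) (hm : [a, s].Perm m)
    {sl : labelTensor (D.lab K.G.flagLetter) [] ⟶ labelTensor (D.lab K.G.flagLetter) l}
    {km : labelTensor (D.lab K.G.flagLetter) m ⟶ labelTensor (D.lab K.G.flagLetter) []}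
    (el : K.G.elemState D hat (.inl C.e) = ⟨l, sl⟩) (em : K.G.wireCostate D v = ⟨m, km⟩)
    (hsl : sl ≫ labelPerm _ hl = c ≫ D.lab K.G.flagLetter s ◁ (ρ_ (D.lab K.G.flagLetter t)).inv)
    (hkm : labelPerm _ hm ≫ km =
      D.lab K.G.flagLetter a ◁ (ρ_ (D.lab K.G.flagLetter s)).hom ≫ k) :
    K.value D hat = L.value D hat := by
  classical
  obtain ⟨N, hN⟩ := L.exists_elems
  obtain ⟨M, hM⟩ := L.exists_inner
  obtain ⟨o, ho⟩ := L.exists_outLab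
  -- the vertices of the contracted edge
  have hse : ∀ f : K.G.E × Bool, f.1 = C.e → f = s ∨ f = t := by
    intro f hf
    by_cases h : f.2 = t.2
    · exact .inr (Prod.ext (hf.trans st.symm) h)
    · refine .inl (Prod.ext (hf.trans ss.symm) ?_)
      rw [hst]
      revert h
      cases f.2 <;> cases t.2 <;> simp
  have hends : (K.G.flagEnd s = K.G.src C.e ∧ K.G.flagEnd t = K.G.tgt C.e) ∨
      (K.G.flagEnd s = K.G.tgt C.e ∧ K.G.flagEnd t = K.G.src C.e) := by
    obtain ⟨s1, s2⟩ := s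
    obtain ⟨t1, t2⟩ := t
    cases ss
    cases st
    cases hst
    cases t2
    exacts [.inr ⟨rfl, rfl⟩, .inl ⟨rfl, rfl⟩]
  have hvt : v ≠ K.G.flagEnd t := by
    rw [← hv]
    rcases hends with ⟨h, h'⟩ | ⟨h, h'⟩ <;> rw [h, h']
    exacts [C.ne, C.ne.symm]
  have hfib : ∀ x y, C.onV x = C.onV y → x ≠ v → y ≠ v → x = y := by
    intro x y h hx hy
    rw [← hv] at hx hy
    rcases (C.onV_eq_iff x y).1 h with h | ⟨rfl, rfl⟩ | ⟨rfl, rfl⟩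
    · exact h
    · rcases hends with ⟨h, h'⟩ | ⟨h, h'⟩
      exacts [absurd h.symm hx, absurd h.symm hy]
    · rcases hends with ⟨h, h'⟩ | ⟨h, h'⟩
      exacts [absurd h.symm hy, absurd h.symm hx]
  have hglue : C.onV v = C.onV (K.G.flagEnd t) := by
    rw [← hv]
    refine (C.onV_eq_iff _ _).2 (.inr ?_)
    rcases hends with ⟨h, h'⟩ | ⟨h, h'⟩ <;> rw [h, h']
    exacts [.inl ⟨rfl, rfl⟩, .inr ⟨rfl, rfl⟩]
  have hane : a.1 ≠ C.e := fun h => by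
    rcases hse a h with rfl | rfl
    · rw [hat'] at hst
      revert hst
      cases t.2 <;> simp
    · exact hvt ha.symm
  have hat_ne : a ≠ t := fun h => hvt (by rw [← h, ha])
  have hflag : ∀ f : K.G.E × Bool, K.G.flagEnd f = v → f = a ∨ f = s := by
    intro f hf
    by_cases h : f.2 = a.2
    · exact .inl (flag_unique K.string (hf ▸ hwire) (hf.trans ha.symm) h)
    · refine .inr (flag_unique K.string (hf ▸ hwire) (hf.trans hv.symm) ?_)
      rw [hat'] at h
      rw [hst]
      revert h
      cases f.2 <;> cases t.2 <;> simp
  have hsec : ∀ x : L.G.V, ∃ y, C.onV y = x ∧ y ≠ v := by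
    intro x
    obtain ⟨y, rfl⟩ := C.onV_surjective x
    by_cases h : y = v
    · exact ⟨K.G.flagEnd t, by rw [h, hglue], hvt.symm⟩
    · exact ⟨y, rfl, h⟩
  choose ψ hψ hψv using hsec
  have ψ_onV : ∀ y, y ≠ v → ψ (C.onV y) = y := fun y hy => hfib _ _ (hψ _) (hψv _) hy
  have ψ_v : ψ (C.onV v) = K.G.flagEnd t := by rw [hglue, ψ_onV _ hvt.symm]
  -- the labels
  let iE : L.G.E → K.G.E := fun e => (C.onE.symm e).1
  have iE_ne : ∀ e, iE e ≠ C.e := fun e => (C.onE.symm e).2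
  have iE_inj : Function.Injective iE := fun e e' h => C.onE.symm.injective (Subtype.ext h)
  have iE_surj : ∀ e, e ≠ C.e → ∃ e', iE e' = e := fun e h =>
    ⟨C.onE ⟨e, h⟩, congrArg Subtype.val (C.onE.symm_apply_apply ⟨e, h⟩)⟩
  have iE_ty : ∀ e, K.G.τ.onE (iE e) = L.G.τ.onE e := fun e => by
    rw [← C.tyE_comm, Equiv.apply_symm_apply]
  have iE_src : ∀ e, C.onV (K.G.src (iE e)) = L.G.src e := fun e => by
    rw [C.src_comm, Equiv.apply_symm_apply]
  have iE_tgt : ∀ e, C.onV (K.G.tgt (iE e)) = L.G.tgt e := fun e => by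
    rw [C.tgt_comm, Equiv.apply_symm_apply]
  let m₀ : L.G.E × Bool → K.G.E × Bool := fun f => (iE f.1, f.2)
  have m₀_inj : Function.Injective m₀ := Function.Injective.prodMap iE_inj Function.injective_id
  have hm₀ : ∀ f, K.G.flagLetter (m₀ f) = L.G.flagLetter f := fun f =>
    congrArg (fun t : T.TypeEdge => (t.letter, f.2)) (iE_ty f.1)
  have m₀_end : ∀ f, C.onV (K.G.flagEnd (m₀ f)) = L.G.flagEnd f := by
    rintro ⟨e, _ | _⟩
    exacts [iE_src e, iE_tgt e]
  let r : K.G.E × Bool → K.G.E × Bool := fun f => if f = a then t else f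
  have r_a : r a = t := if_pos rfl
  have r_ne : ∀ f, f ≠ a → r f = f := fun f h => if_neg h
  have hr : ∀ f, K.G.flagLetter (r f) = K.G.flagLetter f := fun f => by
    by_cases h : f = a
    · rw [h, r_a, hlt]
    · rw [r_ne f h]
  have r_sgn : ∀ f, (r f).2 = f.2 := fun f => by
    by_cases h : f = a
    · rw [h, r_a, hat']
    · rw [r_ne f h]
  have m₀_t : ∀ f, m₀ f ≠ t := fun f h => iE_ne f.1 ((congrArg Prod.fst h).trans st)
  have m₀_s : ∀ f, m₀ f ≠ s := fun f h => iE_ne f.1 ((congrArg Prod.fst h).trans ss)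
  let m' : L.G.E × Bool → K.G.E × Bool := fun f => r (m₀ f)
  have hm' : ∀ f, K.G.flagLetter (m' f) = L.G.flagLetter f := fun f => (hr _).trans (hm₀ f)
  have m'_inj : Function.Injective m' := by
    intro f f' h
    change r (m₀ f) = r (m₀ f') at h
    by_cases h1 : m₀ f = a <;> by_cases h2 : m₀ f' = a
    · exact m₀_inj (h1.trans h2.symm)
    · rw [h1, r_a, r_ne _ h2] at h
      exact absurd h.symm (m₀_t _)
    · rw [h2, r_a, r_ne _ h1] at h
      exact absurd h (m₀_t _)
    · rw [r_ne _ h1, r_ne _ h2] at h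
      exact m₀_inj h
  have m'_end : ∀ f, K.G.flagEnd (m' f) = ψ (L.G.flagEnd f) := by
    intro f
    rw [← m₀_end]
    change K.G.flagEnd (r (m₀ f)) = _
    by_cases h : m₀ f = a
    · rw [h, r_a, ha, ψ_v]
    · rw [r_ne _ h, ψ_onV]
      intro h'
      rcases hflag _ h' with h' | h'
      exacts [h h', m₀_s _ h']
  have m'_surj : ∀ f, K.G.flagEnd f ≠ v → ∃ g, m' g = f := by
    intro f hf
    by_cases h : f.1 = C.e
    · rcases hse f h with rfl | rfl
      · exact absurd hv hf
      · obtain ⟨e, he⟩ := iE_surj a.1 hane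
        refine ⟨(e, a.2), ?_⟩
        have : m₀ (e, a.2) = a := Prod.ext he rfl
        change r (m₀ (e, a.2)) = _
        rw [this, r_a]
    · obtain ⟨e, he⟩ := iE_surj f.1 h
      refine ⟨(e, f.2), ?_⟩
      have : m₀ (e, f.2) = f := Prod.ext he rfl
      change r (m₀ (e, f.2)) = _
      rw [this, r_ne]
      exact fun h => hf (h ▸ ha)
  have ψ_wire : ∀ x, K.G.IsWire (ψ x) ↔ L.G.IsWire x := fun x =>
    ((isWire_congr (C.tyV_comm (ψ x))).symm.trans (by rw [hψ]))
  have htgt : ∀ (f : K.G.E × Bool), f.2 = true → ∃ e, K.G.tgt e = K.G.flagEnd f := by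
    rintro ⟨e, _ | _⟩ h
    exacts [absurd h (by simp), ⟨e, rfl⟩]
  have hsrc : ∀ (f : K.G.E × Bool), f.2 = false → ∃ e, K.G.src e = K.G.flagEnd f := by
    rintro ⟨e, _ | _⟩ h
    exacts [⟨e, rfl⟩, absurd h (by simp)]
  have hv_inner : K.G.IsInner v := by
    refine ⟨hwire, ?_⟩
    cases ht : t.2
    · rw [ht] at hst hat'
      exact ⟨hv ▸ htgt s hst, ha ▸ hsrc a hat'⟩
    · rw [ht] at hst hat'
      exact ⟨ha ▸ htgt a hat', hv ▸ hsrc s hst⟩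
  have hinner : ∀ x, L.G.IsInner x → K.G.IsInner (ψ x) := by
    rintro x ⟨h, ⟨e, he⟩, ⟨e', he'⟩⟩
    refine ⟨(ψ_wire x).2 h, ?_, ?_⟩
    · have h1 := m'_end (e, true)
      exact (h1.trans (congrArg ψ he)) ▸ htgt _ (r_sgn _)
    · have h1 := m'_end (e', false)
      exact (h1.trans (congrArg ψ he')) ▸ hsrc _ (r_sgn _)
  have ψ_inj : Function.Injective ψ := fun x y h => by rw [← hψ x, h, hψ]
  have hmid : K.G.IsElem (.inl C.e) := by
    by_contra h
    cases he : K.G.τ.onE C.e with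
    | mid Z => exact h ⟨Z, he⟩
    | inp f i => exact not_isWire (ty_tgt he) C.tgt_wire
    | out f i => exact not_isWire (ty_src he) C.src_wire
  have hbox : ∀ x f, L.G.τ.onV x = .inr f → K.G.τ.onV (ψ x) = .inr f := fun x f h => by
    rw [← C.tyV_comm, hψ, h]
  have box_ne : ∀ y f, K.G.τ.onV y = .inr f → y ≠ v := fun y f h h' =>
    not_isWire h (h' ▸ hwire)
  have hN' : Enumerates (.inl C.e :: N.map (Sum.map iE ψ)) K.G.IsElem := by
    refine hN.cons_map _ _ hmid ?_ ?_ ?_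
    · rintro (e | x) ⟨Z, hZ⟩
      · exact ⟨⟨Z, (iE_ty e).trans hZ⟩, fun h => iE_ne e (Sum.inl_injective h)⟩
      · exact ⟨⟨Z, hbox x Z hZ⟩, fun h => by cases h⟩
    · exact fun a b _ _ h => Sum.map_injective.2 ⟨iE_inj, ψ_inj⟩ h
    · rintro (e | x) ⟨Z, hZ⟩ hne
      · obtain ⟨e', rfl⟩ := iE_surj e fun h => hne (congrArg _ h)
        exact ⟨.inl e', ⟨Z, (iE_ty e').symm.trans hZ⟩, rfl⟩
      · exact ⟨.inr (C.onV x), ⟨Z, (C.tyV_comm x).trans hZ⟩,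
          congrArg Sum.inr (ψ_onV x (box_ne x Z hZ))⟩
  have hM' : Enumerates (v :: M.map ψ) K.G.IsInner := by
    refine hM.cons_map _ _ hv_inner (fun x hx => ⟨hinner x hx, hψv x⟩)
      (fun x y _ _ h => ψ_inj h) ?_
    rintro x ⟨hx, ⟨e, he⟩, ⟨e', he'⟩⟩ hne
    refine ⟨C.onV x, ⟨(isWire_congr (C.tyV_comm x)).2 hx, ?_, ?_⟩, ψ_onV x hne⟩
    · obtain ⟨⟨g, b⟩, hg⟩ := m'_surj (e, true) (fun h => hne (he.symm.trans h))
      have h1 : b = true := (r_sgn _).symm.trans (congrArg Prod.snd hg)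
      subst h1
      refine ⟨g, ψ_inj ((m'_end (g, true)).symm.trans ?_)⟩
      rw [hg, ψ_onV x hne]
      exact he
    · obtain ⟨⟨g, b⟩, hg⟩ := m'_surj (e', false) (fun h => hne (he'.symm.trans h))
      have h1 : b = false := (r_sgn _).symm.trans (congrArg Prod.snd hg)
      subst h1
      refine ⟨g, ψ_inj ((m'_end (g, false)).symm.trans ?_)⟩
      rw [hg, ψ_onV x hne]
      exact he'
  have ho' : K.IsOutLab fun y => m' (o y) := by
    refine ⟨fun y => ?_, fun y => (r_sgn _).trans (ho.sgn_eq y)⟩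
    rw [m'_end, ho.flagEnd_eq, ← C.c_comm, ψ_onV]
    exact fun h => c_not_inner y (h ▸ hv_inner)
  have hid : ∀ p, K.G.flagLetter (id p) = K.G.flagLetter p := fun _ => rfl
  let A := N.map fun i => relabelState (D.lab_comm hm₀) (L.G.elemState D hat i)
  let P := M.map fun x => relabelCostate (D.lab_comm hm') (L.G.wireCostate D x)
  have hA : (⟨l, sl⟩ :: A) =
      (Sum.inl C.e :: N.map (Sum.map iE ψ)).map fun i =>
        relabelState (D.lab_comm hid) (K.G.elemState D hat i) := by
    rw [List.map_cons, List.map_map]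
    congr 1
    · exact el.symm.trans (relabelState_id _ _).symm
    · exact List.map_congr_left fun i hi => (elemState_transport D hat L.string K.string
        (G := L.G) (G' := K.G) (ψ := ψ) (iE := iE) iE_ty hbox
        (fun e f h => by
          have := ψ_onV (K.G.tgt (iE e)) (box_ne _ f (by rw [← C.tyV_comm, iE_tgt, h]))
          rw [← this, iE_tgt])
        (fun e f h => by
          have := ψ_onV (K.G.src (iE e)) (box_ne _ f (by rw [← C.tyV_comm, iE_src, h]))
          rw [← this, iE_src])
        hm₀ hid (fun _ => rfl) ((hN.mem_iff i).1 hi)).symm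
  have hP : (⟨m, km⟩ :: P) =
      (v :: M.map ψ).map fun i => relabelCostate (D.lab_comm hid) (K.G.wireCostate D i) := by
    rw [List.map_cons, List.map_map]
    congr 1
    · exact em.symm.trans (relabelCostate_id _ _).symm
    · refine List.map_congr_left fun x hx => ?_
      obtain ⟨h1, ⟨e, he⟩, ⟨e', he'⟩⟩ := (hM.mem_iff x).1 hx
      have k1 : m' (e, true) = ((m' (e, true)).1, true) := Prod.ext rfl (r_sgn _)
      have k2 : m' (e', false) = ((m' (e', false)).1, false) := Prod.ext rfl (r_sgn _)
      have k3 := m'_end (e, true)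
      have k4 := m'_end (e', false)
      rw [k1] at k3
      rw [k2] at k4
      exact (wireCostate_transport D L.string K.string (G' := K.G) (x' := ψ x)
        (e₁' := (m' (e, true)).1) (e₂' := (m' (e', false)).1) hm' hid h1 ((ψ_wire x).2 h1) he he'
        (k3.trans (congrArg ψ he)) (k4.trans (congrArg ψ he')) k1 k2).symm
  have hA' : A.map (relabelState (D.lab_comm hr)) =
      N.map fun i => relabelState (D.lab_comm hm') (L.G.elemState D hat i) := by
    rw [List.map_map]
    exact List.map_congr_left fun i _ => relabelState_trans (D.lab_comm hm₀) (D.lab_comm hr)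
      (D.lab_comm hm') (fun _ => rfl) _
  obtain ⟨h, n, e⟩ := value_of_injective D hat hN' hM' ho' hid Function.injective_id hA hP rfl
  obtain ⟨h', n', e'⟩ := value_of_injective D hat hN hM ho hm' m'_inj hA' (P := P) rfl rfl
  have cL := (D.map_lab K.G.flagLetter ho'.letter).symm
  refine (e cL).trans (Eq.trans (congrArg (· ≫ labelCast cL) ?_) (e' cL).symm)
  have h1 : ([s, t] ++ joins A).Perm (fullList (⟨m, km⟩ :: P) (Y.lst.map fun y => m' (o y))) :=
    (hl.symm.append_right _).trans h
  have h2 : ([s, t] ++ joins A).Perm ([a, s] ++ fullList P (Y.lst.map fun y => m' (o y))) :=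
    h1.trans (hm.symm.append_right _)
  have n2 : ([a, s] ++ fullList P (Y.lst.map fun y => m' (o y))).Nodup :=
    (hm.append_right _).nodup_iff.2 n
  refine (netValue_state_perm sl hl h h1 n).symm.trans ?_
  refine (netValue_costate_perm (A := ⟨[s, t], sl ≫ labelPerm _ hl⟩ :: A) (P := P) km hm h1 h2 n).symm.trans ?_
  rw [hsl, hkm]
  exact netValue_zigzag (D := D.lab K.G.flagLetter) (congrArg D.obj hlt) htri hat_ne
    (D.lab_comm hr) r_a (fun i _ => r_ne i) h2 h' n2

theorem value_contraction (C : Contraction K L) : K.value D hat = L.value D hat := by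
  obtain ⟨Z, hZ⟩ := C.src_wire
  have hZ' : K.G.τ.onV (K.G.tgt C.e) = .inl Z := by
    have := (C.tyV_comm (K.G.src C.e)).symm.trans ((congrArg L.G.τ.onV ((C.onV_eq_iff _ _).2
      (.inr (.inl ⟨rfl, rfl⟩)))).trans (C.tyV_comm (K.G.tgt C.e)))
    exact this.symm.trans hZ
  have hmid : K.G.τ.onE C.e = .mid Z := by
    have h1 := K.G.τ.src_comm C.e
    have h2 := K.G.τ.tgt_comm C.e
    rw [hZ] at h1
    rw [hZ'] at h2
    cases he : K.G.τ.onE C.e with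
    | mid Z' => rw [he] at h1; cases h1; rfl
    | inp f i => rw [he] at h2; cases h2
    | out f i => rw [he] at h1; cases h1
  have ls := letter_src hZ
  have lt := letter_tgt hZ'
  by_cases hp : ∃ e₀, K.G.tgt e₀ = K.G.src C.e
  · obtain ⟨e₀, he₀⟩ := hp
    have la : K.G.flagLetter (e₀, true) = (Z, true) := letter_tgt (he₀ ▸ hZ)
    refine value_contraction_of_inner D hat C (a := (e₀, true)) (s := (C.e, false))
      (t := (C.e, true)) (v := K.G.src C.e) rfl he₀ C.src_wire rfl rfl rfl rfl
      (la.trans lt.symm)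
      (triangle_cast (D.triangle_pos Z) (congrArg D.obj la) (congrArg D.obj ls)
        (congrArg D.obj ls.symm) (congrArg D.obj lt.symm) _) (.refl _) (.refl _)
      (elemState_mid D hat hmid) (wireCostate_eq D K.string (he₀ ▸ hZ) hZ he₀ rfl) ?_ ?_
    · rw [labelPerm_refl _ _ (by simp)]
      exact Category.comp_id _
    · rw [labelPerm_refl _ _ (by simp)]
      exact Category.id_comp _
  · have hq : ∃ e₂, K.G.src e₂ = K.G.tgt C.e := by
      by_contra hq
      have h1 : K.G.IsInput (K.G.src C.e) := ⟨C.src_wire, fun e he => hp ⟨e, he⟩⟩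
      have h2 : K.G.IsOutput (K.G.tgt C.e) := ⟨C.tgt_wire, fun e he => hq ⟨e, he⟩⟩
      rcases K.bound_cases (.inl h1) with ⟨⟨⟩, -⟩ | ⟨y, hy⟩
      rcases K.bound_cases (.inr h2) with ⟨⟨⟩, -⟩ | ⟨y', hy'⟩
      have h3 : L.c y = L.c y' := by
        rw [← C.c_comm, ← C.c_comm, hy, hy']
        exact (C.onV_eq_iff _ _).2 (.inr (.inl ⟨rfl, rfl⟩))
      rw [L.c_injective h3, hy'] at hy
      exact C.ne hy.symm
    obtain ⟨e₂, he₂⟩ := hq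
    have la : K.G.flagLetter (e₂, false) = (Z, false) := letter_src (he₂ ▸ hZ')
    have tri := triangle_swap (D.triangle_pos Z) (D.triangle_neg Z)
    refine value_contraction_of_inner D hat C (a := (e₂, false)) (s := (C.e, true))
      (t := (C.e, false)) (v := K.G.tgt C.e) rfl he₂ C.tgt_wire rfl rfl rfl rfl
      (la.trans ls.symm)
      (triangle_cast tri (congrArg D.obj la) (congrArg D.obj lt)
        (congrArg D.obj lt.symm) (congrArg D.obj ls.symm) _) (.swap _ _ _) (.swap _ _ _)
      (elemState_mid D hat hmid) (wireCostate_eq D K.string hZ' (he₂ ▸ hZ') rfl he₂) ?_ ?_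
    · rw [labelPerm_swap _ _ (by simp)]
      exact cap_exch _ _ _
    · rw [labelPerm_swap _ _ (by simp)]
      exact exch_cup _ _ _

end FramedCospan

/-! ## Framed point graphs as words -/

namespace FramedPointGraph

variable {T : MonoidalSignature.{u, v}} {X Y Z W X' Y' : FramedPointGraph T}

/-- A single vertex of a given signed type. -/
@[reducible] def single (p : T.O × Bool) : FramedPointGraph T where
  V := Unit
  finite := inferInstance
  ord := inferInstance
  ty _ := p.1
  sgn _ := p.2

/-- The framed point graph of a word of signed types. -/
def ofLetters : List (T.O × Bool) → FramedPointGraph T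
  | [] => unit
  | p :: l => (single p).tensor (ofLetters l)

theorem lst_single (p : T.O × Bool) : (single p : FramedPointGraph T).lst = [()] :=
  lst_unique (List.nodup_singleton _) (fun _ => List.mem_singleton.2 rfl)
    (List.pairwise_singleton _ _)

theorem letters_single (p : T.O × Bool) : (single p : FramedPointGraph T).letters = [p] := by
  rw [letters, lst_single]; rfl

theorem letters_ofLetters : ∀ l : List (T.O × Bool), (ofLetters l).letters = l
  | [] => letters_unit
  | p :: l => by rw [ofLetters, letters_tensor, letters_single, letters_ofLetters l]; rfl

theorem IsReframing.unique {φ ψ : Perm X Y} (h : φ.IsReframing) (h' : ψ.IsReframing) : φ = ψ := by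
  have e := (lst_reframing h).symm.trans (lst_reframing h')
  exact Perm.ext fun x => List.map_inj_left.1 e x (mem_lst x)

theorem exists_reframing (h : X.letters = Y.letters) : ∃ φ : Perm X Y, φ.IsReframing := by
  classical
  have hlen : X.lst.length = Y.lst.length := by
    simpa [letters] using congrArg List.length h
  let eX := List.Nodup.getEquivOfForallMemList X.lst X.lst_nodup mem_lst
  let eY := List.Nodup.getEquivOfForallMemList Y.lst Y.lst_nodup mem_lst
  have le_iff : ∀ (X : FramedPointGraph T) (i j : Fin X.lst.length),
      X.ord.le (X.lst.get i) (X.lst.get j) ↔ i ≤ j := by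
    intro X i j
    have key : ∀ i j : Fin X.lst.length, i ≤ j → X.ord.le (X.lst.get i) (X.lst.get j) := by
      intro i j hij
      rcases hij.eq_or_lt with rfl | hij
      · exact X.ord.le_refl _
      · exact List.pairwise_iff_get.1 X.lst_pairwise i j hij
    refine ⟨fun hle => ?_, key i j⟩
    by_contra hij
    have e := X.ord.le_antisymm _ _ hle (key j i (not_le.1 hij).le)
    exact hij (List.nodup_iff_injective_get.1 X.lst_nodup e).le
  have hlet : ∀ i : Fin X.lst.length,
      Y.letter (Y.lst.get (finCongr hlen i)) = X.letter (X.lst.get i) := by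
    intro i
    have := List.getElem_of_eq h.symm (i := i) (by simp [letters, ← hlen])
    simpa [letters] using this
  let e : X.V ≃ Y.V := eX.symm.trans ((finCongr hlen).trans eY)
  have he : ∀ i, e (X.lst.get i) = Y.lst.get (finCongr hlen i) := fun i =>
    congrArg (fun i => Y.lst.get (finCongr hlen i)) (eX.symm_apply_apply i)
  have hs : ∀ x, ∃ i, X.lst.get i = x := fun x => eX.surjective x
  have hl : ∀ x, Y.letter (e x) = X.letter x := fun x => by
    obtain ⟨i, rfl⟩ := hs x
    rw [he, hlet]
  refine ⟨⟨e, fun x => congrArg Prod.fst (hl x), fun x => congrArg Prod.snd (hl x)⟩, ?_⟩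
  intro x x'
  obtain ⟨i, rfl⟩ := hs x
  obtain ⟨j, rfl⟩ := hs x'
  change Y.ord.le (e _) (e _) ↔ _
  rw [he, he, le_iff, le_iff]
  rfl

theorem isReframing_of_lst {φ : Perm X Y} (h : Y.lst = X.lst.map φ.equiv) : φ.IsReframing := by
  have hl : X.letters = Y.letters := by
    rw [letters, letters, h, List.map_map]
    exact List.map_congr_left fun x _ => (letter_perm φ x).symm
  obtain ⟨ψ, hψ⟩ := exists_reframing hl
  have e := h.symm.trans (lst_reframing hψ)
  have : φ = ψ := Perm.ext fun x => List.map_inj_left.1 e x (mem_lst x)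
  exact this ▸ hψ

/-- The reframing between framed point graphs with the same word. -/
noncomputable def reframe (h : X.letters = Y.letters) : Perm X Y := (exists_reframing h).choose

theorem reframe_isReframing (h : X.letters = Y.letters) : (reframe h).IsReframing :=
  (exists_reframing h).choose_spec

theorem IsReframing.refl (X : FramedPointGraph T) : (Perm.refl X).IsReframing := fun _ _ => Iff.rfl

theorem IsReframing.trans {φ : Perm X Y} {ψ : Perm Y Z} (h : φ.IsReframing) (h' : ψ.IsReframing) :
    (φ.trans ψ).IsReframing := fun _ _ => (h' _ _).trans (h _ _)

theorem IsReframing.symm {φ : Perm X Y} (h : φ.IsReframing) : φ.symm.IsReframing := fun x x' => by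
  rw [← h]
  change Y.ord.le (φ.equiv (φ.equiv.symm x)) (φ.equiv (φ.equiv.symm x')) ↔ _
  rw [Equiv.apply_symm_apply, Equiv.apply_symm_apply]

theorem IsReframing.tensor {φ : Perm X Y} {ψ : Perm X' Y'} (h : φ.IsReframing)
    (h' : ψ.IsReframing) : (φ.tensor ψ).IsReframing := by
  refine isReframing_of_lst ?_
  rw [lst_tensor, lst_tensor, lst_reframing h, lst_reframing h']
  simp only [List.map_append, List.map_map]
  rfl

theorem exists_tensor_of_fix {p : T.O × Bool} (ψ : Perm ((single p).tensor X) ((single p).tensor Y))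
    (h : ψ.equiv (.inl ()) = .inl ()) : ∃ ψ' : Perm X Y, ψ = (Perm.refl (single p)).tensor ψ' := by
  have h1 : ∀ x : X.V, ∃ y : Y.V, ψ.equiv (.inr x) = .inr y := fun x => by
    rcases hx : ψ.equiv (.inr x) with _ | y
    · have := ψ.equiv.injective (hx.trans h.symm)
      cases this
    · exact ⟨y, rfl⟩
  choose f hf using h1
  have hb : Function.Bijective f := by
    refine ⟨fun x x' hx => ?_, fun y => ?_⟩
    · exact Sum.inr_injective (ψ.equiv.injective ((hf x).trans ((congrArg Sum.inr hx).trans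
        (hf x').symm)))
    · obtain ⟨x | x, hx⟩ := ψ.equiv.surjective (.inr y)
      · cases h.symm.trans hx
      · exact ⟨x, Sum.inr_injective ((hf x).symm.trans hx)⟩
  refine ⟨⟨Equiv.ofBijective f hb, fun x => ?_, fun x => ?_⟩, Perm.ext ?_⟩
  · have := ψ.ty_comm (.inr x)
    rw [hf] at this
    exact this
  · have := ψ.sgn_comm (.inr x)
    rw [hf] at this
    exact this
  · rintro (x | x)
    exacts [h, hf x]

theorem reframing_induction {P : FramedPointGraph T → Prop} (h_unit : P unit)
    (h_single : ∀ p, P (single p)) (h_tensor : ∀ X Y, P X → P Y → P (X.tensor Y))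
    (h_reframe : ∀ X Y (φ : Perm X Y), φ.IsReframing → P X → P Y) (X : FramedPointGraph T) : P X := by
  refine h_reframe _ _ (reframe (letters_ofLetters X.letters)) (reframe_isReframing _) ?_
  induction X.letters with
  | nil => exact h_unit
  | cons p l ih => exact h_tensor _ _ (h_single p) ih

end FramedPointGraph

/-! ## Generation -/

namespace FCsp

open FramedPointGraph FramedCospan

variable {T : MonoidalSignature.{u, v}}

/-- The morphisms that are generated by the reframings, the symmetries, the cups and caps of the
generating objects and the boxes from a given set. -/
inductive Gen (B : T.M → Prop) : ∀ {X Y : FCsp T}, (X ⟶ Y) → Prop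
  | reframe {X Y : FCsp T} (φ : Perm X Y) : φ.IsReframing → Gen B (ofPerm φ)
  | braid (X Y : FCsp T) : Gen B (β_ X Y).hom
  | comp {X Y Z : FCsp T} (f : X ⟶ Y) (g : Y ⟶ Z) : Gen B f → Gen B g → Gen B (f ≫ g)
  | tensor {X Y X' Y' : FCsp T} (f : X ⟶ Y) (g : X' ⟶ Y') : Gen B f → Gen B g → Gen B (f ⊗ₘ g)
  | cap (Z : T.O) : Gen B (FCsp.cap (FramedPointGraph.point Z))
  | cup (Z : T.O) : Gen B (FCsp.cup (FramedPointGraph.point Z))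
  | box (f : T.M) : B f → Gen B ((generators T).map f)

namespace Gen

variable {B : T.M → Prop} {X Y Z X' Y' : FCsp T}

theorem id (X : FCsp T) : Gen B (𝟙 X) := .reframe (Perm.refl X) (IsReframing.refl X)

theorem ofPerm_assoc_inv (X Y Z : FCsp T) : Gen B (α_ X Y Z).inv :=
  .reframe _ (IsReframing.symm (assoc_isReframing X Y Z))

theorem whiskerLeft (X : FCsp T) {f : Y ⟶ Z} (h : Gen B f) : Gen B (X ◁ f) := .tensor _ _ (.id X) h

theorem whiskerRight {f : Y ⟶ Z} (h : Gen B f) (X : FCsp T) : Gen B (f ▷ X) := .tensor _ _ h (.id X)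

theorem perm_trans {X Y Z : FramedPointGraph T} {φ : Perm X Y} {ψ : Perm Y Z}
    (h : Gen B (ofPerm (X := X) (Y := Y) φ)) (h' : Gen B (ofPerm (X := Y) (Y := Z) ψ)) :
    Gen B (ofPerm (X := X) (Y := Z) (φ.trans ψ)) :=
  ofPerm_comp (X := X) (Y := Y) (Z := Z) φ ψ ▸ .comp _ _ h h'

theorem perm_tensor {X Y X' Y' : FramedPointGraph T} {φ : Perm X Y} {ψ : Perm X' Y'}
    (h : Gen B (ofPerm (X := X) (Y := Y) φ)) (h' : Gen B (ofPerm (X := X') (Y := Y') ψ)) :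
    Gen B (ofPerm (X := X.tensor X') (Y := Y.tensor Y') (φ.tensor ψ)) :=
  ofPerm_tensor (X := X) (Y := Y) (X' := X') (Y' := Y') φ ψ ▸ .tensor _ _ h h'

theorem perm_aux : ∀ (l m : List (T.O × Bool)) (φ : Perm (ofLetters l) (ofLetters m)),
    Gen B (ofPerm (X := ofLetters l) (Y := ofLetters m) φ)
  | [], m, φ => by
    refine .reframe _ fun x => Empty.elim x
  | p :: l, m, φ => by
    let Y := ofLetters m
    let y : Y.V := φ.equiv (.inl ())
    obtain ⟨u, w, hu⟩ := List.append_of_mem (mem_lst y)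
    let U := ofLetters (u.map Y.letter)
    let W := ofLetters (w.map Y.letter)
    have hy : Y.letter y = p := letter_perm φ _
    have hlet : Y.letters = (U.tensor ((single p).tensor W)).letters := by
      rw [letters_tensor, letters_tensor, letters_ofLetters (u.map _), letters_ofLetters (w.map _),
        letters_single]
      change Y.lst.map Y.letter = _
      rw [hu, List.map_append, List.map_cons, hy]
      rfl
    let ρ := FramedPointGraph.reframe hlet
    have hρ : ρ.IsReframing := reframe_isReframing hlet
    have hρy : ρ.equiv y = .inr (.inl ()) := by
      have e := lst_reframing hρ
      rw [hu, lst_tensor, lst_tensor, lst_single, List.map_append (l₁ := u)] at e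
      have hlen : (U.lst.map (Sum.inl : U.V → U.V ⊕ (Unit ⊕ W.V))).length =
          (u.map ρ.equiv).length := by
        have := congrArg List.length (letters_ofLetters (u.map Y.letter))
        simpa [letters] using this
      have := List.append_inj_right e hlen
      exact (List.cons.inj this).1.symm
    let σ : Perm (U.tensor ((single p).tensor W)) ((single p).tensor (U.tensor W)) :=
      ((Perm.assoc _ _ _).symm.trans ((Perm.swap U (single p)).tensor (Perm.refl W))).trans
        (Perm.assoc _ _ _)
    let ρ' := FramedPointGraph.reframe (letters_ofLetters (U.tensor W).letters).symm
    let ψ : Perm ((single p).tensor (ofLetters l))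
        ((single p).tensor (ofLetters (U.tensor W).letters)) :=
      ((φ.trans ρ).trans σ).trans ((Perm.refl _).tensor ρ')
    have hψ : ψ.equiv (.inl ()) = .inl () := by
      change Sum.map _ _ (σ.equiv (ρ.equiv y)) = _
      rw [hρy]
      rfl
    obtain ⟨ψ', e⟩ := exists_tensor_of_fix ψ hψ
    have e' : φ = ((ψ.trans ((Perm.refl _).tensor ρ'.symm)).trans
        (((Perm.assoc _ _ _).symm.trans ((Perm.swap (single p) U).tensor (Perm.refl W))).trans
          (Perm.assoc _ _ _))).trans ρ.symm := by
      refine Perm.ext fun x => ?_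
      refine (ρ.equiv.symm_apply_apply _).symm.trans (congrArg ρ.equiv.symm ?_)
      change _ = Equiv.sumAssoc _ _ _ (Sum.map Sum.swap _root_.id ((Equiv.sumAssoc _ _ _).symm
        (Sum.map _root_.id ρ'.equiv.symm (Sum.map _root_.id ρ'.equiv (σ.equiv (ρ.equiv (φ.equiv x)))))))
      rw [Sum.map_map]
      have : (⇑ρ'.equiv.symm ∘ ⇑ρ'.equiv) = _root_.id := funext ρ'.equiv.symm_apply_apply
      rw [this]
      rcases ρ.equiv (φ.equiv x) with x | x | x <;> rfl
    rw [e']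
    refine .perm_trans (.perm_trans (.perm_trans ?_ (.perm_tensor (.id _) (.reframe _ ?_)))
      (.perm_trans (.perm_trans (.reframe _ ?_) (.perm_tensor (.braid (single p) U) (.id W)))
        (.reframe _ ?_))) (.reframe _ ?_)
    · rw [e]
      exact .perm_tensor (.id _) (perm_aux l _ ψ')
    · exact IsReframing.symm (reframe_isReframing _)
    · exact IsReframing.symm (assoc_isReframing _ _ _)
    · exact assoc_isReframing _ _ _
    · exact IsReframing.symm hρ

theorem perm {X Y : FramedPointGraph T} (φ : Perm X Y) : Gen B (ofPerm (X := X) (Y := Y) φ) := by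
  let ρ := FramedPointGraph.reframe (letters_ofLetters X.letters)
  let σ := FramedPointGraph.reframe (letters_ofLetters Y.letters)
  have hρ : ρ.IsReframing := reframe_isReframing _
  have hσ : σ.IsReframing := reframe_isReframing _
  have e : φ = (ρ.symm.trans ((ρ.trans φ).trans σ.symm)).trans σ := Perm.ext fun x =>
    ((σ.equiv.apply_symm_apply _).trans (congrArg φ.equiv (ρ.equiv.apply_symm_apply x))).symm
  rw [e]
  exact .perm_trans (.perm_trans (.reframe _ (IsReframing.symm hρ)) (perm_aux _ _ _)) (.reframe _ hσ)

theorem of_reindex {X Y X' Y' : FramedPointGraph T} {K : FramedCospan X Y}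
    (h : Gen B (mk (X := X) (Y := Y) K)) (φ : Perm X' X) (ψ : Perm Y Y') :
    Gen B (mk (X := X') (Y := Y') (K.reindex φ ψ)) := by
  have e := ofPerm_comp_mk (X := X') (X' := X) (Y := Y') φ (K.reindex (Perm.refl X) ψ)
  have e' : mk (X := X) (Y := Y') (K.reindex (Perm.refl X) ψ) =
    mk (X := X) (Y := Y) K ≫ ofPerm ψ := (mk_comp_ofPerm _ _).symm
  have : Gen B (ofPerm (X := X') (Y := X) φ ≫ mk (X := X) (Y := Y') (K.reindex (Perm.refl X) ψ)) :=
    .comp _ _ (.perm φ) (e' ▸ .comp _ _ h (.perm ψ))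
  exact e ▸ this

theorem of_tensor {X Y X' Y' : FramedPointGraph T} {K : FramedCospan X Y} {L : FramedCospan X' Y'}
    (h : Gen B (mk (X := X) (Y := Y) K)) (h' : Gen B (mk (X := X') (Y := Y') L)) :
    Gen B (mk (X := X.tensor X') (Y := Y.tensor Y') (K.tensor L)) :=
  tensorHom_mk (X := X) (Y := Y) (X' := X') (Y' := Y') K L ▸ .tensor _ _ h h'

theorem of_iso {X Y : FramedPointGraph T} {K L : FramedCospan X Y}
    (h : Gen B (mk (X := X) (Y := Y) K)) (i : FramedCospan.Iso K L) :
    Gen B (mk (X := X) (Y := Y) L) := mk_iso i ▸ h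

/-- The framed cospan and its mirror image are generated. -/
def Both (B : T.M → Prop) {X Y : FramedPointGraph T} (K : FramedCospan X Y) : Prop :=
  Gen B (mk (X := X) (Y := Y) K) ∧ Gen B (mk (X := Y.dual) (Y := X.dual) K.flip)

theorem Both.iso {X Y : FramedPointGraph T} {K L : FramedCospan X Y} (h : Both B K)
    (i : FramedCospan.Iso K L) : Both B L :=
  ⟨of_iso h.1 i, of_iso h.2 { i with d_comm := i.c_comm, c_comm := i.d_comm }⟩

theorem Both.perm {X Y : FramedPointGraph T} (φ : Perm X Y) : Both B (FramedCospan.perm φ) :=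
  ⟨Gen.perm φ, of_iso (Gen.perm φ.dualSymm)
    { onV := (flipPerm φ).onV.symm
      onE := (flipPerm φ).onE.symm
      src_comm := fun e => by
        rw [Equiv.symm_apply_eq, (flipPerm φ).src_comm, Equiv.apply_symm_apply]
      tgt_comm := fun e => by
        rw [Equiv.symm_apply_eq, (flipPerm φ).tgt_comm, Equiv.apply_symm_apply]
      tyV_comm := fun x => by rw [← (flipPerm φ).tyV_comm, Equiv.apply_symm_apply]
      tyE_comm := fun x => by rw [← (flipPerm φ).tyE_comm, Equiv.apply_symm_apply]
      d_comm := fun _ => rfl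
      c_comm := fun _ => rfl }⟩

theorem Both.reindex {X Y X' Y' : FramedPointGraph T} {K : FramedCospan X Y} (h : Both B K)
    (φ : Perm X' X) (ψ : Perm Y Y') : Both B (K.reindex φ ψ) :=
  ⟨of_reindex h.1 φ ψ, of_iso (of_reindex h.2 ψ.dualSymm φ.dualSymm)
    ⟨.refl _, .refl _, fun _ => rfl, fun _ => rfl, fun _ => rfl, fun _ => rfl, fun _ => rfl,
      fun _ => rfl⟩⟩

theorem Both.tensor {X Y X' Y' : FramedPointGraph T} {K : FramedCospan X Y}
    {L : FramedCospan X' Y'} (h : Both B K) (h' : Both B L) : Both B (K.tensor L) :=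
  ⟨of_tensor h.1 h'.1, of_iso (of_reindex (of_tensor h.2 h'.2)
    (X' := (Y.tensor Y').dual) (Y' := (X.tensor X').dual) ⟨.refl _, by rintro (x | x) <;> rfl, by rintro (x | x) <;> rfl⟩
    ⟨.refl _, by rintro (x | x) <;> rfl, by rintro (x | x) <;> rfl⟩)
    ⟨.refl _, .refl _, fun _ => rfl, fun _ => rfl, fun _ => rfl, fun _ => rfl,
      by rintro (x | x) <;> rfl, by rintro (x | x) <;> rfl⟩⟩

theorem both_cap_point (Z : T.O) : Both B (FramedCospan.cap (FramedPointGraph.point Z)) := by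
  refine ⟨.cap Z, of_iso (of_reindex (.cup Z)
    (X' := ((FramedPointGraph.point Z).dual.tensor (FramedPointGraph.point Z)).dual)
    (Y' := FramedPointGraph.unit.dual)
    ⟨.refl _, by rintro (x | x) <;> rfl, by rintro (x | x) <;> rfl⟩
    ⟨.refl _, fun x => x.elim, fun x => x.elim⟩)
    ⟨Equiv.sumComm _ _, .refl _, fun _ => rfl, fun _ => rfl, ?_, fun _ => rfl, fun _ => rfl,
      fun x => x.elim⟩⟩
  rintro ((x | x) | x); exacts [rfl, rfl, x.elim]

theorem both_cap (X : FramedPointGraph T) : Both B (FramedCospan.cap X) := by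
  refine reframing_induction (P := fun X => Both B (FramedCospan.cap X)) ?_ ?_ ?_ ?_ X
  · refine Both.iso (K := FramedCospan.perm (X := unit)
      (Y := unit.dual.tensor unit) ⟨(Equiv.sumEmpty Empty Empty).symm, fun x => x.elim,
      fun x => x.elim⟩) (.perm _) ⟨.refl _, .refl _, fun x => x.elim, fun x => x.elim, ?_,
        fun x => x.elim, fun x => x.elim, fun _ => rfl⟩
    rintro (x | x | x) <;> exact x.elim
  · rintro ⟨Z, _ | _⟩
    · refine ((both_cap_point Z).reindex (Perm.refl _)
        (Y' := (point Z).dual.dual.tensor (point Z).dual)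
        ⟨Equiv.sumComm _ _, by rintro (x | x) <;> rfl, by rintro (x | x) <;> rfl⟩).iso
        ⟨(Equiv.refl _).sumCongr (Equiv.sumComm _ _), .refl _, fun _ => rfl, fun _ => rfl, ?_,
          fun _ => rfl, fun x => x.elim, ?_⟩
      · rintro (x | x | x); exacts [x.elim, rfl, rfl]
      · rintro (x | x) <;> rfl
    · exact both_cap_point Z
  · intro X Y hX hY
    let eV : (Empty ⊕ (X.V ⊕ X.V)) ⊕ (Empty ⊕ (Y.V ⊕ Y.V)) ≃
        Empty ⊕ ((X.V ⊕ Y.V) ⊕ (X.V ⊕ Y.V)) :=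
      ⟨Sum.elim (Sum.map _root_.id (Sum.map Sum.inl Sum.inl))
        (Sum.map _root_.id (Sum.map Sum.inr Sum.inr)),
        Sum.elim Empty.elim (Sum.elim (Sum.elim (fun x => .inl (.inr (.inl x)))
          (fun x => .inr (.inr (.inl x)))) (Sum.elim (fun x => .inl (.inr (.inr x)))
          (fun x => .inr (.inr (.inr x))))),
        by rintro ((x | x | x) | (x | x | x)) <;> first | exact x.elim | rfl,
        by rintro (x | (x | x) | (x | x)) <;> first | exact x.elim | rfl⟩
    refine ((hX.tensor hY).reindex (Perm.leftUnit _).symm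
      (Y' := (X.tensor Y).dual.tensor (X.tensor Y)) ⟨Equiv.sumSumSumComm _ _ _ _,
        by rintro ((x | x) | (x | x)) <;> rfl, by rintro ((x | x) | (x | x)) <;> rfl⟩).iso
      ⟨eV, .refl _, ?_, ?_, ?_, ?_, fun x => x.elim, ?_⟩
    · rintro (x | x)
      · change eV (Sum.inl (Sum.inr (if X.sgn x then Sum.inl x else Sum.inr x))) =
          Sum.inr (if X.sgn x then Sum.inl (Sum.inl x) else Sum.inr (Sum.inl x))
        cases X.sgn x <;> rfl
      · change eV (Sum.inr (Sum.inr (if Y.sgn x then Sum.inl x else Sum.inr x))) =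
          Sum.inr (if Y.sgn x then Sum.inl (Sum.inr x) else Sum.inr (Sum.inr x))
        cases Y.sgn x <;> rfl
    · rintro (x | x)
      · change eV (Sum.inl (Sum.inr (if X.sgn x then Sum.inr x else Sum.inl x))) =
          Sum.inr (if X.sgn x then Sum.inr (Sum.inl x) else Sum.inl (Sum.inl x))
        cases X.sgn x <;> rfl
      · change eV (Sum.inr (Sum.inr (if Y.sgn x then Sum.inr x else Sum.inl x))) =
          Sum.inr (if Y.sgn x then Sum.inr (Sum.inr x) else Sum.inl (Sum.inr x))
        cases Y.sgn x <;> rfl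
    · rintro ((x | x | x) | (x | x | x)) <;> first | exact x.elim | rfl
    · rintro (x | x)
      · change MonoidalSignature.TypeEdge.mid (Sum.elim _ _ (if X.sgn x then _ else _)) =
          MonoidalSignature.TypeEdge.mid (Sum.elim _ _ (if X.sgn x then _ else _))
        cases X.sgn x <;> rfl
      · change MonoidalSignature.TypeEdge.mid (Sum.elim _ _ (if Y.sgn x then _ else _)) =
          MonoidalSignature.TypeEdge.mid (Sum.elim _ _ (if Y.sgn x then _ else _))
        cases Y.sgn x <;> rfl
    · rintro ((x | x) | (x | x)) <;> rfl
  · intro X Y φ _ hX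
    let φ' : Perm X.dual Y.dual := ⟨φ.equiv, φ.ty_comm, fun x => congrArg (!·) (φ.sgn_comm x)⟩
    have hsrc : ∀ x, Sum.map φ.equiv φ.equiv (bendStart X x) = bendStart Y (φ.equiv x) := fun x => by
      unfold bendStart
      rw [φ.sgn_comm]
      cases X.sgn x <;> rfl
    have htgt : ∀ x, Sum.map φ.equiv φ.equiv (bendEnd X x) = bendEnd Y (φ.equiv x) := fun x => by
      unfold bendEnd
      rw [φ.sgn_comm]
      cases X.sgn x <;> rfl
    refine (hX.reindex (Perm.refl _) (φ'.tensor φ)).iso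
      ⟨(Equiv.refl _).sumCongr (φ.equiv.sumCongr φ.equiv), φ.equiv, fun x => ?_, fun x => ?_, ?_,
        fun x => ?_, fun x => x.elim, ?_⟩
    · exact congrArg Sum.inr (hsrc x)
    · exact congrArg Sum.inr (htgt x)
    · rintro (x | x | x)
      exacts [x.elim, congrArg Sum.inl (φ.ty_comm x), congrArg Sum.inl (φ.ty_comm x)]
    · change MonoidalSignature.TypeEdge.mid (Sum.elim Y.ty Y.ty (bendStart Y (φ.equiv x))) =
        MonoidalSignature.TypeEdge.mid (Sum.elim X.ty X.ty (bendStart X x))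
      rw [← hsrc]
      rcases bendStart X x with y | y <;> exact congrArg _ (φ.ty_comm y)
    · rintro (x | x)
      · exact congrArg (fun y => Sum.inr (Sum.inl y)) (φ.equiv.apply_symm_apply x)
      · exact congrArg (fun y => Sum.inr (Sum.inr y)) (φ.equiv.apply_symm_apply x)

theorem cap_all (X : FCsp T) : Gen B (FCsp.cap X) := (both_cap X).1

theorem cup_all (X : FCsp T) : Gen B (FCsp.cup X) := by
  refine of_iso (of_reindex (both_cap (B := B) X).2
    (X' := FramedPointGraph.tensor X (FramedPointGraph.dual X)) (Y' := FramedPointGraph.unit)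
    ⟨.refl _, by rintro (x | x) <;> rfl, by
      rintro (x | x)
      exacts [Bool.not_not _, rfl]⟩
    ⟨.refl _, fun x => x.elim, fun x => x.elim⟩)
    ⟨Equiv.sumComm _ _, .refl _, fun _ => rfl, fun _ => rfl, ?_, fun _ => rfl, fun _ => rfl,
      fun x => x.elim⟩
  rintro (x | (x | x)); exacts [x.elim, rfl, rfl]

end Gen

end FCsp

/-! ## All framed cospans are generated -/

namespace FCsp

open FramedPointGraph FramedCospan TypedGraph

variable {T : MonoidalSignature.{u, v}} {B : T.M → Prop}

theorem mk_bend {X Y : FCsp T} (K : FramedCospan X Y) :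
    (mk K.bend : 𝟙_ (FCsp T) ⟶ dual X ⊗ Y) = FCsp.cap X ≫ (dual X ◁ (mk K : X ⟶ Y)) := by
  let _ := exactPairing X
  refine (tensorLeftHomEquiv (𝟙_ (FCsp T)) (dual X) X Y).symm.injective ?_
  have h := unbend_eq (X := X) (Y := Y) K.bend
  have h2 : (mk K.bend.unbend : X ⟶ Y) = mk K := mk_iso (unbendBend K)
  rw [h2] at h
  change X ◁ (mk K.bend : 𝟙_ (FCsp T) ⟶ dual X ⊗ Y) ≫ (α_ X (dual X) Y).inv ≫ FCsp.cup X ▷ Y ≫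
    (λ_ Y).hom = X ◁ (FCsp.cap X ≫ dual X ◁ mk K) ≫ (α_ X (dual X) Y).inv ≫ FCsp.cup X ▷ Y ≫
    (λ_ Y).hom
  have e1 := congrArg (· ≫ (λ_ Y).hom) h
  have e2 := congrArg (· ≫ (𝟙_ (FCsp T) ◁ (mk K : X ⟶ Y)) ≫ (λ_ Y).hom) (snake_right X)
  simp only [Category.assoc, Iso.inv_hom_id, Category.comp_id, leftUnitor_naturality,
    Iso.inv_hom_id_assoc] at e1 e2
  rw [e1, ← e2, MonoidalCategory.whiskerLeft_comp, Category.assoc,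
    associator_inv_naturality_right_assoc, whisker_exchange_assoc]
  exact congrArg (fun t => X ◁ FCsp.cap X ≫ (α_ X (dual X) X).inv ≫ FCsp.cup X ▷ X ≫ t)
    (leftUnitor_naturality (mk K : X ⟶ Y)).symm

theorem bend_gen {X Y : FCsp T} {K : FramedCospan X Y} (h : Gen B (mk (X := X) (Y := Y) K)) :
    Gen B (mk (X := FramedPointGraph.unit) (Y := FramedPointGraph.dual X |>.tensor Y) K.bend) :=
  mk_bend K ▸ .comp _ _ (.cap_all X) (.whiskerLeft _ h)

/-- A generated framed cospan without inner vertices that maps to the parts of a typed graph with a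
given property. -/
structure Piece (B : T.M → Prop) (G : TypedGraph T) (p : G.E ⊕ G.V → Prop) where of ::
  Y : FramedPointGraph T
  S : FramedCospan FramedPointGraph.unit Y
  gen : Gen B (mk (X := FramedPointGraph.unit) (Y := Y) S)
  onV : S.G.V → G.V
  onE : S.G.E → G.E
  src_comm : ∀ e, onV (S.G.src e) = G.src (onE e)
  tgt_comm : ∀ e, onV (S.G.tgt e) = G.tgt (onE e)
  tyV_comm : ∀ x, G.τ.onV (onV x) = S.G.τ.onV x
  tyE_comm : ∀ e, G.τ.onE (onE e) = S.G.τ.onE e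
  inj : Function.Injective onE
  mem : ∀ e, p (G.flagOwner (onE e, true))
  surj : ∀ e, p (G.flagOwner (e, true)) → ∃ e', onE e' = e
  boundary : ∀ x, S.G.IsWire x → ∃ y, S.c y = x
  box_mem : ∀ x f, S.G.τ.onV x = .inr f → p (.inr (onV x))
  box_surj : ∀ x f, G.τ.onV x = .inr f → p (.inr x) → ∃ x', onV x' = x
  box_inj : ∀ x x' f, S.G.τ.onV x = .inr f → onV x = onV x' → x = x'

namespace Piece

variable {G : TypedGraph T}

theorem empty {p : G.E ⊕ G.V → Prop} (hp : ∀ i, ¬ p i) : Nonempty (Piece B G p) :=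
  ⟨{ Y := FramedPointGraph.unit
     S := FramedCospan.perm (Perm.refl FramedPointGraph.unit)
     gen := .perm _
     onV := Sum.elim Empty.elim Empty.elim
     onE := Empty.elim
     src_comm := fun e => e.elim
     tgt_comm := fun e => e.elim
     tyV_comm := by rintro (x | x) <;> exact x.elim
     tyE_comm := fun e => e.elim
     inj := fun e => e.elim
     mem := fun e => e.elim
     surj := fun e he => absurd he (hp _)
     boundary := by rintro (x | x) <;> exact x.elim
     box_mem := by rintro (x | x) <;> exact x.elim
     box_surj := fun x f _ h => absurd h (hp _)
     box_inj := by rintro (x | x) <;> exact x.elim }⟩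

theorem mid {e : G.E} {Z : T.O} (h : G.τ.onE e = .mid Z) : Nonempty (Piece B G (· = .inl e)) :=
  ⟨{ Y := _
     S := FramedCospan.cap (FramedPointGraph.point Z)
     gen := .cap Z
     onV := Sum.elim Empty.elim (Sum.elim (fun _ => G.src e) (fun _ => G.tgt e))
     onE := fun _ => e
     src_comm := fun _ => rfl
     tgt_comm := fun _ => rfl
     tyV_comm := by
      rintro (x | x | x)
      exacts [x.elim, mid_src h, mid_tgt h]
     tyE_comm := fun _ => h
     inj := fun _ _ _ => rfl
     mem := fun _ => owner_mid (p := (e, true)) h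
     surj := fun e' he' => by
      refine ⟨(), ?_⟩
      cases h' : G.τ.onE e' with
      | mid Z' => rw [owner_mid (p := (e', true)) h'] at he'; exact (Sum.inl_injective he').symm
      | inp f i => rw [owner_inp (p := (e', true)) h'] at he'; cases he'
      | out f i => rw [owner_out (p := (e', true)) h'] at he'; cases he'
     boundary := by
      rintro (x | x) _
      exacts [x.elim, ⟨x, rfl⟩]
     box_mem := by rintro (x | x) f hf <;> cases hf
     box_surj := fun x f _ h => by cases h
     box_inj := by rintro (x | x) _ f hf <;> cases hf }⟩

theorem box {x : G.V} {f : T.M} (hG : G.IsStringGraph) (h : G.τ.onV x = .inr f) (hf : B f) :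
    Nonempty (Piece B G (· = .inr x)) := by
  obtain ⟨l, hl⟩ := exists_boxLab hG h
  have inj := (hG.local_iso x ⟨f, h⟩).injOn
  exact
  ⟨{ Y := _
     S := (FramedCospan.box f).bend
     gen := bend_gen (.box f hf)
     onV := Sum.elim (fun _ => x) (fun y => G.flagEnd (l y))
     onE := fun y => (l y).1
     src_comm := by
      rintro (y | y)
      · refine Eq.trans ?_ (congrArg (fun b => G.flagEnd ((l (.inl y)).1, b)) (hl.inp y).1)
        rfl
      · exact (hl.out y).2.1.symm
     tgt_comm := by
      rintro (y | y)
      · exact (hl.inp y).2.1.symm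
      · refine Eq.trans ?_ (congrArg (fun b => G.flagEnd ((l (.inr y)).1, b)) (hl.out y).1)
        rfl
     tyV_comm := by
      rintro (y | y | y)
      · exact h
      · change G.τ.onV (G.flagEnd ((l (.inl y)).1, (l (.inl y)).2)) = _
        rw [(hl.inp y).1]
        refine (G.τ.src_comm _).trans ?_
        rw [(hl.inp y).2.2]
        exact congrArg Sum.inl (word_ty _ y).symm
      · change G.τ.onV (G.flagEnd ((l (.inr y)).1, (l (.inr y)).2)) = _
        rw [(hl.out y).1]
        refine (G.τ.tgt_comm _).trans ?_
        rw [(hl.out y).2.2]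
        exact congrArg Sum.inl (word_ty _ y).symm
     tyE_comm := by
      rintro (y | y)
      exacts [(hl.inp y).2.2, (hl.out y).2.2]
     inj := by
      rintro (y | y) (z | z) hyz
      · have := (hl.inp y).2.2.symm.trans ((congrArg G.τ.onE hyz).trans (hl.inp z).2.2)
        injection this with _ e
        exact congrArg _ ((wordIdx_bijective _).1 e)
      · have := (hl.inp y).2.2.symm.trans ((congrArg G.τ.onE hyz).trans (hl.out z).2.2)
        cases this
      · have := (hl.out y).2.2.symm.trans ((congrArg G.τ.onE hyz).trans (hl.inp z).2.2)
        cases this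
      · have := (hl.out y).2.2.symm.trans ((congrArg G.τ.onE hyz).trans (hl.out z).2.2)
        injection this with _ e
        exact congrArg _ ((wordIdx_bijective _).1 e)
     mem := by
      rintro (y | y)
      · exact (owner_inp (p := ((l (.inl y)).1, true)) (hl.inp y).2.2).trans
          (congrArg _ (hl.inp y).2.1)
      · exact (owner_out (p := ((l (.inr y)).1, true)) (hl.out y).2.2).trans
          (congrArg _ (hl.out y).2.1)
     surj := fun e he => by
      cases h' : G.τ.onE e with
      | mid Z => rw [owner_mid (p := (e, true)) h'] at he; cases he
      | inp g i =>
        rw [owner_inp (p := (e, true)) h'] at he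
        have he := Sum.inr_injective he
        have hg := (ty_tgt h').symm.trans ((congrArg _ he).trans h)
        obtain rfl := Sum.inr_injective hg
        obtain ⟨y, rfl⟩ := (wordIdx_bijective _).2 i
        exact ⟨.inl y, inj (.inr (hl.inp y).2.1) (.inr he) ((hl.inp y).2.2.trans h'.symm)⟩
      | out g i =>
        rw [owner_out (p := (e, true)) h'] at he
        have he := Sum.inr_injective he
        have hg := (ty_src h').symm.trans ((congrArg _ he).trans h)
        obtain rfl := Sum.inr_injective hg
        obtain ⟨y, rfl⟩ := (wordIdx_bijective _).2 i
        exact ⟨.inr y, inj (.inl (hl.out y).2.1) (.inl he) ((hl.out y).2.2.trans h'.symm)⟩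
     boundary := by
      rintro (y | y) ⟨Z, hy⟩
      · cases hy
      · refine ⟨y, ?_⟩
        rcases y with y | y <;> rfl
     box_mem := by
      rintro (y | y) g hg
      · rfl
      · cases hg
     box_surj := fun x' g _ hx => ⟨.inl (), (Sum.inr_injective hx).symm⟩
     box_inj := by
      rintro (y | y) (y' | y') g hg hy
      · rfl
      · have : G.τ.onV (G.flagEnd (l y')) = .inr f := (congrArg _ hy.symm).trans h
        have h2 : G.IsWire (G.flagEnd (l y')) := by
          rcases y' with y | y
          · rw [show l (.inl y) = ((l (.inl y)).1, false) from Prod.ext rfl (hl.inp y).1]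
            exact isWire_src (hl.inp y).2.2
          · rw [show l (.inr y) = ((l (.inr y)).1, true) from Prod.ext rfl (hl.out y).1]
            exact isWire_tgt (hl.out y).2.2
        exact absurd h2 (not_isWire this)
      all_goals cases hg }⟩

theorem union {p p' : G.E ⊕ G.V → Prop} (P : Piece B G p) (P' : Piece B G p')
    (hp : ∀ i, p i → ¬ p' i) : Nonempty (Piece B G fun i => p i ∨ p' i) :=
  ⟨{ Y := P.Y.tensor P'.Y
     S := (P.S.tensor P'.S).reindex (Perm.leftUnit FramedPointGraph.unit).symm (Perm.refl _)
     gen := .of_reindex (.of_tensor P.gen P'.gen) _ _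
     onV := Sum.elim P.onV P'.onV
     onE := Sum.elim P.onE P'.onE
     src_comm := by rintro (e | e); exacts [P.src_comm e, P'.src_comm e]
     tgt_comm := by rintro (e | e); exacts [P.tgt_comm e, P'.tgt_comm e]
     tyV_comm := by rintro (e | e); exacts [P.tyV_comm e, P'.tyV_comm e]
     tyE_comm := by rintro (e | e); exacts [P.tyE_comm e, P'.tyE_comm e]
     inj := by
      rintro (e | e) (e' | e') h
      · exact congrArg _ (P.inj h)
      · have h1 := P'.mem e'
        rw [← show P.onE e = P'.onE e' from h] at h1
        exact absurd h1 (hp _ (P.mem e))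
      · have h1 := P'.mem e
        rw [show P'.onE e = P.onE e' from h] at h1
        exact absurd h1 (hp _ (P.mem e'))
      · exact congrArg _ (P'.inj h)
     mem := by rintro (e | e); exacts [.inl (P.mem e), .inr (P'.mem e)]
     surj := fun e he => he.elim (fun he => (P.surj e he).imp' Sum.inl fun _ => _root_.id)
      fun he => (P'.surj e he).imp' Sum.inr fun _ => _root_.id
     boundary := by
      rintro (x | x) hx
      · exact (P.boundary x hx).imp' Sum.inl fun _ => congrArg Sum.inl
      · exact (P'.boundary x hx).imp' Sum.inr fun _ => congrArg Sum.inr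
     box_mem := by
      rintro (x | x) f hx
      exacts [.inl (P.box_mem x f hx), .inr (P'.box_mem x f hx)]
     box_surj := fun x f hx h => h.elim
      (fun h => (P.box_surj x f hx h).imp' Sum.inl fun _ => _root_.id)
      fun h => (P'.box_surj x f hx h).imp' Sum.inr fun _ => _root_.id
     box_inj := by
      rintro (x | x) (x' | x') f hx h
      · exact congrArg _ (P.box_inj x x' f hx h)
      · have h1 := P'.box_mem x' f ((P'.tyV_comm x').symm.trans
          ((congrArg _ h.symm).trans ((P.tyV_comm x).trans hx)))
        rw [← show P.onV x = P'.onV x' from h] at h1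
        exact absurd h1 (hp _ (P.box_mem x f hx))
      · have h1 := P.box_mem x' f ((P.tyV_comm x').symm.trans
          ((congrArg _ h.symm).trans ((P'.tyV_comm x).trans hx)))
        rw [← show P'.onV x = P.onV x' from h] at h1
        exact absurd (P'.box_mem x f hx) (hp _ h1)
      · exact congrArg _ (P'.box_inj x x' f hx h) }⟩

theorem exists_list (hG : G.IsStringGraph) (hB : ∀ f, B f) : ∀ N : List (G.E ⊕ G.V), N.Nodup →
    (∀ i ∈ N, G.IsElem i) → Nonempty (Piece B G (· ∈ N))
  | [], _, _ => empty fun _ => List.not_mem_nil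
  | i :: N, hN, hi => by
    obtain ⟨P⟩ := exists_list hG hB N (List.nodup_cons.1 hN).2
      fun j hj => hi j (List.mem_cons_of_mem _ hj)
    have : Nonempty (Piece B G (· = i)) := by
      have := hi i List.mem_cons_self
      rcases i with e | x
      · obtain ⟨Z, hZ⟩ := this
        exact mid hZ
      · obtain ⟨f, hf⟩ := this
        exact box hG hf (hB f)
    obtain ⟨P'⟩ := this
    have e : (fun j => j ∈ i :: N) = fun j => j = i ∨ j ∈ N := funext fun j => by simp
    rw [e]
    exact union P' P fun j hj => hj ▸ (List.nodup_cons.1 hN).1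

end Piece

theorem gen_state {Y : FramedPointGraph T} (K : FramedCospan FramedPointGraph.unit Y)
    (hB : ∀ f, B f) : Gen B (mk (X := FramedPointGraph.unit) (Y := Y) K) := by
  obtain ⟨N, hN⟩ := K.exists_elems
  obtain ⟨A⟩ := Piece.exists_list (B := B) K.string hB N hN.nodup fun i => (hN.mem_iff i).1
  obtain ⟨o, ho⟩ := A.S.exists_outLab
  obtain ⟨k, hk⟩ := K.exists_outLab
  have surjE : Function.Surjective A.onE := fun e =>
    A.surj e ((hN.mem_iff _).2 (isElem_owner (e, true)))
  -- the ends of the edges at wire-vertices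
  let q : A.Y.V → K.G.E × Bool := fun y => (A.onE (o y).1, (o y).2)
  have q_end : ∀ y, K.G.flagEnd (q y) = A.onV (A.S.c y) := fun y => by
    rw [← ho.flagEnd_eq y]
    change K.G.flagEnd (A.onE (o y).1, (o y).2) = A.onV (A.S.G.flagEnd ((o y).1, (o y).2))
    cases (o y).2
    exacts [(A.src_comm _).symm, (A.tgt_comm _).symm]
  have q_letter : ∀ y, K.G.flagLetter (q y) = A.Y.letter y := fun y =>
    Eq.trans (congrArg (fun t : T.TypeEdge => (t.letter, (o y).2)) (A.tyE_comm _)) (ho.letter y)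
  have q_inj : Function.Injective q := fun y y' h =>
    ho.injective (Prod.ext (A.inj (Prod.ext_iff.1 h).1) (Prod.ext_iff.1 h).2)
  have wire : ∀ x, K.G.IsWire (A.onV x) ↔ A.S.G.IsWire x := fun x => isWire_congr (A.tyV_comm x)
  have q_surj : ∀ p, K.G.IsWire (K.G.flagEnd p) → ∃ y, q y = p := by
    rintro ⟨e, b⟩ hp
    obtain ⟨e, rfl⟩ := surjE e
    have he : K.G.flagEnd (A.onE e, b) = A.onV (A.S.G.flagEnd (e, b)) := by
      cases b
      exacts [(A.src_comm _).symm, (A.tgt_comm _).symm]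
    obtain ⟨y, hy⟩ := A.boundary _ ((wire _).1 (he ▸ hp))
    refine ⟨y, ?_⟩
    have : o y = (e, b) := by
      have h1 := ho.flagEnd_eq y
      by_cases hb : (o y).2 = b
      · exact flag_unique A.S.string (by rw [h1]; exact A.S.c_wire y) (h1.trans hy) hb
      · exfalso
        have hw : A.S.G.IsWire (A.S.c y) := A.S.c_wire y
        refine A.S.c_not_inner y ⟨hw, ?_⟩
        rcases ho' : o y with ⟨e', b'⟩
        rw [ho'] at h1 hb
        cases b <;> cases b'
        · exact absurd rfl hb
        · exact ⟨⟨e', h1⟩, ⟨e, hy.symm⟩⟩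
        · exact ⟨⟨e, hy.symm⟩, ⟨e', h1⟩⟩
        · exact absurd rfl hb
    change (A.onE (o y).1, (o y).2) = _
    rw [this]
  have := K.string.finite_V
  obtain ⟨n, ⟨enc⟩⟩ := Finite.exists_equiv_fin {x // K.G.IsInner x}
  choose ty hty using fun x : {x // K.G.IsInner x} => x.2.1
  choose ein hin using fun x : {x // K.G.IsInner x} => x.2.2.1
  choose eout hout using fun x : {x // K.G.IsInner x} => x.2.2.2
  let P : FramedPointGraph T := ⟨{x // K.G.IsInner x}, inferInstance,
    LinearOrder.lift' enc enc.injective, ty, fun _ => true⟩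
  let g : Y.V ⊕ (P.V ⊕ P.V) → K.G.E × Bool :=
    Sum.elim k (Sum.elim (fun x => (ein x, true)) (fun x => (eout x, false)))
  have g_end : ∀ z, K.G.flagEnd (g z) = Sum.elim K.c (Sum.elim Subtype.val Subtype.val) z := by
    rintro (y | x | x)
    exacts [hk.flagEnd_eq y, hin x, hout x]
  have g_wire : ∀ z, K.G.IsWire (K.G.flagEnd (g z)) := fun z => by
    rw [g_end]
    rcases z with y | x | x
    exacts [K.c_wire y, x.2.1, x.2.1]
  have g_letter : ∀ z, K.G.flagLetter (g z) = (Y.tensor (P.tensor P.dual)).letter z := by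
    rintro (y | x | x)
    · exact hk.letter y
    · exact letter_flag (p := (ein x, true)) ((congrArg _ (hin x)).trans (hty x))
    · exact letter_flag (p := (eout x, false)) ((congrArg _ (hout x)).trans (hty x))
  have g_inj : Function.Injective g := by
    intro z z' h
    have h1 := (g_end z).symm.trans ((congrArg _ h).trans (g_end z'))
    rcases z with y | x | x <;> rcases z' with y' | x' | x'
    · exact congrArg _ (K.c_injective h1)
    · exact absurd (show K.G.IsInner (K.c y) from (show K.c y = x'.1 from h1) ▸ x'.2) (K.c_not_inner y)
    · exact absurd (show K.G.IsInner (K.c y) from (show K.c y = x'.1 from h1) ▸ x'.2) (K.c_not_inner y)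
    · exact absurd (show K.G.IsInner (K.c y') from (show x.1 = K.c y' from h1) ▸ x.2) (K.c_not_inner y')
    · exact congrArg (fun x => Sum.inr (Sum.inl x)) (Subtype.ext h1)
    · exact absurd (congrArg Prod.snd h) (by simp [g])
    · exact absurd (show K.G.IsInner (K.c y') from (show x.1 = K.c y' from h1) ▸ x.2) (K.c_not_inner y')
    · exact absurd (congrArg Prod.snd h) (by simp [g])
    · exact congrArg (fun x => Sum.inr (Sum.inr x)) (Subtype.ext h1)
  have g_surj : ∀ p, K.G.IsWire (K.G.flagEnd p) → ∃ z, g z = p := by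
    intro p hp
    rcases K.inner_or_boundary hp with h | ⟨y, hy⟩
    · rcases p with ⟨e, _ | _⟩
      · exact ⟨.inr (.inr ⟨_, h⟩), flag_unique K.string (g_wire (.inr (.inr ⟨_, h⟩)))
          (g_end (.inr (.inr ⟨_, h⟩))) rfl⟩
      · exact ⟨.inr (.inl ⟨_, h⟩), flag_unique K.string (g_wire (.inr (.inl ⟨_, h⟩)))
          (g_end (.inr (.inl ⟨_, h⟩))) rfl⟩
    · refine ⟨.inl y, ?_⟩
      by_contra hne
      have h1 : K.G.flagEnd (k y) = K.G.flagEnd p := (hk.flagEnd_eq y).trans hy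
      have h2 : (k y).2 ≠ p.2 := fun h => hne (flag_unique K.string (g_wire (.inl y)) h1 h)
      refine K.c_not_inner y ⟨K.c_wire y, ?_⟩
      have h3 := hk.flagEnd_eq y
      rcases hky : k y with ⟨e', b'⟩
      rcases p with ⟨e, b⟩
      rw [hky] at h2 h3
      cases b <;> cases b'
      · exact absurd rfl h2
      · exact ⟨⟨e', h3⟩, ⟨e, hy.symm⟩⟩
      · exact ⟨⟨e, hy.symm⟩, ⟨e', h3⟩⟩
      · exact absurd rfl h2
  choose s hs using fun z => q_surj (g z) (g_wire z)
  have s_bij : Function.Bijective s := by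
    refine ⟨fun z z' h => g_inj ((hs z).symm.trans ((congrArg q h).trans (hs z'))), fun y => ?_⟩
    obtain ⟨z, hz⟩ := g_surj (q y) (by rw [q_end]; exact (wire _).2 (A.S.c_wire y))
    exact ⟨z, q_inj ((hs z).trans hz)⟩
  have s_letter : ∀ z, A.Y.letter (s z) = (Y.tensor (P.tensor P.dual)).letter z := fun z => by
    rw [← q_letter, hs, g_letter]
  let Φ : Perm (Y.tensor (P.tensor P.dual)) A.Y :=
    ⟨Equiv.ofBijective s s_bij, fun z => congrArg Prod.fst (s_letter z),
      fun z => congrArg Prod.snd (s_letter z)⟩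
  let K₁ := A.S.reindex (Perm.refl _) Φ.symm
  have c_eq : ∀ z, A.onV (K₁.c z) = Sum.elim K.c (Sum.elim Subtype.val Subtype.val) z := fun z => by
    rw [← g_end, ← hs z, q_end]
    rfl
  have col := cupCollapse K₁ K A.onV
    (fun x => by
      by_cases hx : K.G.IsWire x
      · obtain ⟨z, hz⟩ : ∃ z, K.G.flagEnd (g z) = x := by
          rcases K.inner_or_boundary hx with h | ⟨y, hy⟩
          · exact ⟨.inr (.inl ⟨x, h⟩), g_end _⟩
          · exact ⟨.inl y, (g_end _).trans hy⟩
        exact ⟨A.S.c (s z), by rw [← q_end, hs, hz]⟩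
      · cases h : K.G.τ.onV x with
        | inl Z => exact absurd ⟨Z, h⟩ hx
        | inr f => exact A.box_surj x f h ((hN.mem_iff _).2 ⟨f, h⟩))
    (Equiv.ofBijective A.onE ⟨A.inj, surjE⟩).symm
    (fun e => by
      obtain ⟨e, rfl⟩ := surjE e
      exact (congrArg (fun e => A.onV (A.S.G.src e)) (Equiv.ofBijective_symm_apply_apply _ _ e)).trans
        (A.src_comm e))
    (fun e => by
      obtain ⟨e, rfl⟩ := surjE e
      exact (congrArg (fun e => A.onV (A.S.G.tgt e)) (Equiv.ofBijective_symm_apply_apply _ _ e)).trans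
        (A.tgt_comm e))
    A.tyV_comm
    (fun e => by
      obtain ⟨e, rfl⟩ := surjE e
      exact (A.tyE_comm e).trans
        (congrArg A.S.G.τ.onE (Equiv.ofBijective_symm_apply_apply _ _ e)).symm)
    (fun x => x.elim) (fun y => c_eq (.inl y))
    (fun p => (c_eq (.inr (.inl p))).trans (c_eq (.inr (.inr p))).symm)
    (fun x x' h => by
      cases hx : A.S.G.τ.onV x with
      | inr f => exact .inl (A.box_inj x x' f hx h)
      | inl Z =>
        have hx' : A.S.G.τ.onV x' = .inl Z := by rw [← A.tyV_comm, ← h, A.tyV_comm, hx]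
        obtain ⟨y, rfl⟩ := A.boundary x ⟨Z, hx⟩
        obtain ⟨y', rfl⟩ := A.boundary x' ⟨Z, hx'⟩
        obtain ⟨z, rfl⟩ := s_bij.2 y
        obtain ⟨z', rfl⟩ := s_bij.2 y'
        have h1 := (c_eq z).symm.trans (h.trans (c_eq z'))
        have hc := K.c_not_inner
        rcases z with y | p | p <;> rcases z' with y' | p' | p'
        · exact .inl (congrArg (fun y => A.S.c (s (.inl y))) (K.c_injective h1))
        · exact absurd (show K.G.IsInner (K.c y) from (show K.c y = p'.1 from h1) ▸ p'.2) (hc y)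
        · exact absurd (show K.G.IsInner (K.c y) from (show K.c y = p'.1 from h1) ▸ p'.2) (hc y)
        · exact absurd (show K.G.IsInner (K.c y') from (show p.1 = K.c y' from h1) ▸ p.2) (hc y')
        · exact .inl (congrArg (fun p => A.S.c (s (.inr (.inl p)))) (Subtype.ext h1))
        · obtain rfl : p = p' := Subtype.ext h1
          exact .inr ⟨p, .inl ⟨rfl, rfl⟩⟩
        · exact absurd (show K.G.IsInner (K.c y') from (show p.1 = K.c y' from h1) ▸ p.2) (hc y')
        · obtain rfl : p = p' := Subtype.ext h1
          exact .inr ⟨p, .inr ⟨rfl, rfl⟩⟩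
        · exact .inl (congrArg (fun p => A.S.c (s (.inr (.inr p)))) (Subtype.ext h1)))
  have e := mk_eq (X := FramedPointGraph.unit) col.homeo
  have h1 : Gen B (mk (X := FramedPointGraph.unit) (Y := Y.tensor FramedPointGraph.unit)
      (K.reindex (Perm.refl _) (Perm.rightUnit Y).symm)) := by
    rw [← e]
    refine mk_comp_mk (X := FramedPointGraph.unit) (Y := Y.tensor (P.tensor P.dual))
      (Z := Y.tensor FramedPointGraph.unit) _ _ ▸ .comp _ _ (.of_reindex A.gen _ _) ?_
    exact .of_tensor (.perm _) (.cup_all P)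
  exact .of_iso (.of_reindex h1 (Perm.refl _) (Perm.rightUnit Y))
    ⟨.refl _, .refl _, fun _ => rfl, fun _ => rfl, fun _ => rfl, fun _ => rfl, fun x => x.elim,
      fun _ => rfl⟩

theorem gen_all {X Y : FCsp T} (f : X ⟶ Y) (hB : ∀ f, B f) : Gen B f := by
  obtain ⟨K, rfl⟩ := mk_surj f
  have h := unbend_eq (X := X) (Y := Y) K.bend
  have h1 : Gen B ((ρ_ X).hom ≫ (mk K.bend.unbend : X ⟶ Y) ≫ (λ_ Y).inv) := by
    rw [← h]
    exact .comp _ _ (.whiskerLeft _ (gen_state _ hB)) (.comp _ _ (.ofPerm_assoc_inv _ _ _)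
      (.whiskerRight (.cup_all X) _))
  have h2 : (mk K : X ⟶ Y) = (ρ_ X).inv ≫ ((ρ_ X).hom ≫ (mk K.bend.unbend : X ⟶ Y) ≫ (λ_ Y).inv) ≫
      (λ_ Y).hom := by
    simp only [Category.assoc, Iso.inv_hom_id_assoc, Iso.inv_hom_id, Category.comp_id]
    exact (mk_iso (unbendBend K)).symm
  rw [h2]
  exact .comp _ _ (.perm (Perm.rightUnit X).symm) (.comp _ _ h1 (.perm (Perm.leftUnit Y)))

end FCsp

namespace FramedCospan

open FramedPointGraph TypedGraph

variable {T : MonoidalSignature.{u, v}} {V : Type w₁} [Category.{w₂} V] [MonoidalCategory V]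
  [SymmetricCategory V]
  (D : DualLetters T V) (hat : ∀ f : T.M, 𝟙_ V ⟶ (boxBoundary f).ob D.obj)
  {W Y Y' : FramedPointGraph T} {Z : T.O}

/-- Two opposite boundary vertices can be merged. -/
theorem fusable_boundary (K : FramedCospan unit (((point Z).tensor (point Z).dual).tensor W)) :
    K.G.Fusable (K.c (.inl (.inl ()))) (K.c (.inl (.inr ()))) where
  ne h := by cases K.c_injective h
  ty := (K.c_ty (.inl (.inl ()))).trans (K.c_ty (.inl (.inr ()))).symm
  wire := K.c_wire _
  out e he := absurd he (((K.c_sgn (.inl (.inl ()))).2 rfl).2 e)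
  inn e he := absurd he (((K.c_in (.inl (.inr ()))).2 rfl).2 e)

/-- The framed cospan in which two opposite boundary vertices are merged. -/
noncomputable def merge (K : FramedCospan unit (((point Z).tensor (point Z).dual).tensor W)) :
    FramedCospan unit W :=
  have h := K.fusable_boundary
  have hq : ¬ K.G.IsOutput (K.c (.inl (.inr ()))) := fun h' =>
    K.no_isolated _ ⟨(K.c_in (.inl (.inr ()))).2 rfl, h'⟩
  have hp : ¬ K.G.IsInput (K.c (.inl (.inl ()))) := fun h' =>
    K.no_isolated _ ⟨h', (K.c_sgn (.inl (.inl ()))).2 rfl⟩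
  have ne : ∀ y, K.c (.inr y) ≠ K.c (.inl (.inr ())) := fun y h' => by cases K.c_injective h'
  have ne' : ∀ y, K.c (.inr y) ≠ K.c (.inl (.inl ())) := fun y h' => by cases K.c_injective h'
  have out : ∀ x : (fuse h).V, (fuse h).IsOutput x ↔ x.1 ≠ K.c (.inl (.inl ())) ∧ K.G.IsOutput x.1 :=
    fun x => (fuse_isOutput h x).trans (or_iff_left fun h' => hq h'.2)
  { G := fuse h
    string := fuse_isString h K.string
    d := Empty.elim
    c := fun y => ⟨K.c (.inr y), ne y⟩
    d_ty := fun x => x.elim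
    c_ty := fun y => K.c_ty (.inr y)
    no_isolated := fun x ⟨h1, h2⟩ =>
      K.no_isolated _ ⟨(fuse_isInput h x).1 h1, ((out x).1 h2).2⟩
    injective := by
      rintro (x | x) (y | y) h'
      exacts [x.elim, x.elim, y.elim, congrArg _ (Sum.inr_injective (K.c_injective
        (congrArg Subtype.val h')))]
    range := by
      ext x
      constructor
      · rintro ⟨y | y, rfl⟩
        · exact y.elim
        · exact (K.c_bound (.inr y)).imp (fuse_isInput h _).2 fun h' => (out _).2 ⟨ne' y, h'⟩
      · intro hx
        have : K.G.IsInput x.1 ∨ K.G.IsOutput x.1 :=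
          hx.imp (fuse_isInput h x).1 fun h' => ((out x).1 h').2
        rcases K.bound_cases this with ⟨y, _⟩ | ⟨(_ | _) | y, hy⟩
        · exact y.elim
        · exact absurd hx (not_or.2 ⟨fun h' => hp (by rw [hy]; exact (fuse_isInput h x).1 h'),
            fun h' => ((out x).1 h').1 hy.symm⟩)
        · exact absurd hy.symm x.2
        · exact ⟨.inr y, Subtype.ext hy⟩
    d_sgn := fun x => x.elim
    c_sgn := fun y => ((out _).trans (and_iff_right (ne' y))).trans (K.c_sgn (.inr y)) }

section merge

variable (K : FramedCospan unit (((point Z).tensor (point Z).dual).tensor W))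

/-- The vertex of the merged framed cospan. -/
noncomputable def mergeMap (x : K.G.V) : K.merge.G.V := fuseMap K.fusable_boundary x

/-- The edges of the merged framed cospan. -/
def mergeEdge : K.merge.G.E ≃ K.G.E :=
  Equiv.subtypeUnivEquiv fun e h => ((K.c_sgn (.inl (.inl ()))).2 rfl).2 e h.1

theorem mergeMap_surj : Function.Surjective K.mergeMap := fun x =>
  ⟨x.1, fuseMap_of_ne K.fusable_boundary x.2⟩

theorem mergeMap_c (y : W.V) : K.mergeMap (K.c (.inr y)) = K.merge.c y :=
  fuseMap_of_ne K.fusable_boundary fun h' => by cases K.c_injective h'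

theorem mergeMap_glue : K.mergeMap (K.c (.inl (.inl ()))) = K.mergeMap (K.c (.inl (.inr ()))) :=
  (fuseMap_of_ne K.fusable_boundary K.fusable_boundary.ne).trans
    (fuseMap_self K.fusable_boundary).symm

theorem mergeMap_eq {x x' : K.G.V} (h : K.mergeMap x = K.mergeMap x') : x = x' ∨
    (x = K.c (.inl (.inl ())) ∧ x' = K.c (.inl (.inr ()))) ∨
      (x = K.c (.inl (.inr ())) ∧ x' = K.c (.inl (.inl ()))) := by
  have hf := K.fusable_boundary
  by_cases hx : x = K.c (.inl (.inr ())) <;> by_cases hx' : x' = K.c (.inl (.inr ()))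
  · exact .inl (hx.trans hx'.symm)
  · subst hx
    exact .inr (.inr ⟨rfl, (congrArg Subtype.val ((fuseMap_self hf).symm.trans
      (h.trans (fuseMap_of_ne hf hx')))).symm⟩)
  · subst hx'
    exact .inr (.inl ⟨congrArg Subtype.val ((fuseMap_of_ne hf hx).symm.trans
      (h.trans (fuseMap_self hf))), rfl⟩)
  · exact .inl (congrArg Subtype.val ((fuseMap_of_ne hf hx).symm.trans
      (h.trans (fuseMap_of_ne hf hx'))))

theorem mergeMap_ty (x : K.G.V) : K.merge.G.τ.onV (K.mergeMap x) = K.G.τ.onV x :=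
  fuseMap_lift K.fusable_boundary K.G.τ.onV K.fusable_boundary.ty x

theorem value_merge' : K.merge.value D hat = K.value D hat ≫
    (obTensor D.obj _ W).inv ≫ D.obCup Z ▷ W.ob D.obj ≫ (λ_ _).hom :=
  value_merge D hat K K.merge K.mergeMap K.mergeMap_surj K.mergeEdge.symm (fun _ => rfl)
    (fun _ => rfl) K.mergeMap_ty (fun _ => rfl) K.mergeMap_c K.mergeMap_glue
    fun _ _ => K.mergeMap_eq

end merge

/-- The comparison of units. -/
noncomputable def _root_.FramedPointGraph.obUnit (D : T.O × Bool → V) :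
    𝟙_ V ≅ (unit : FramedPointGraph T).ob D :=
  eqToIso (congrArg (labelTensor D) letters_unit.symm)

theorem _root_.FramedPointGraph.obPerm_leftUnit (D : T.O × Bool → V) (X : FramedPointGraph T) :
    (obTensor D unit X).hom ≫ obPerm D (Perm.leftUnit X) =
      (obUnit D).inv ▷ X.ob D ≫ (λ_ _).hom := by
  have key : ∀ (l : List (T.O × Bool)) (h : l = []) (c : (l ++ X.letters).map D = X.letters.map D),
      (labelApp D l X.letters).hom ≫ labelCast c =
        eqToHom (congrArg (labelTensor D) h) ▷ _ ≫ (λ_ _).hom := by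
    rintro _ rfl c
    change (λ_ _).hom ≫ 𝟙 _ = 𝟙 _ ▷ _ ≫ _
    rw [id_whiskerRight, Category.comp_id, Category.id_comp]
    rfl
  rw [obTensor_hom, obPerm_reframing D (leftUnit_isReframing X), Category.assoc, labelCast_trans]
  exact key _ letters_unit _

theorem value_id_unit : (perm (Perm.refl (unit : FramedPointGraph T))).value D hat =
    (obUnit D.obj).hom := by
  let K := perm (Perm.refl (unit : FramedPointGraph T))
  have hV : K.G.V → False := by rintro (x | x) <;> exact x.elim
  have hE : K.G.E → False := fun e => Empty.elim e
  have hN : Enumerates ([] : List (K.G.E ⊕ K.G.V)) K.G.IsElem :=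
    ⟨List.nodup_nil, fun i => i.elim (fun e => (hE e).elim) fun x => (hV x).elim⟩
  have hM : Enumerates ([] : List K.G.V) K.G.IsInner := ⟨List.nodup_nil, fun x => (hV x).elim⟩
  have ho : K.IsOutLab Empty.elim := ⟨fun y => y.elim, fun y => y.elim⟩
  refine (value_eq D hat hN hM ho).trans ?_
  have key : ∀ (r : List (K.G.E × Bool)) (hr : r = []) (h : (joins []).Perm (fullList [] r))
      (c : r.map (D.lab K.G.flagLetter) = unit.letters.map D.obj),
      netValue (D := D.lab K.G.flagLetter) [] [] r h ≫ labelCast c = (obUnit D.obj).hom := by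
    rintro _ rfl h c
    rw [netValue, labelPerm_refl _ _ List.nodup_nil]
    change (𝟙 _ ≫ 𝟙 _ ≫ 𝟙 _) ≫ _ = _
    simp only [Category.id_comp]
    rfl
  exact key _ (by rw [lst_unit]; rfl) _ _

end FramedCospan

/-! ## The values of morphisms -/

namespace DualLetters

open FramedPointGraph FramedCospan FCsp

variable {T : MonoidalSignature.{u, v}} {V : Type w₁} [Category.{w₂} V] [MonoidalCategory V]
  [SymmetricCategory V] (D : DualLetters T V)

/-- The object of a framed point graph. -/
noncomputable def app (X : FCsp T) : V := FramedPointGraph.ob D.obj X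

/-- The comparison of tensor products. -/
noncomputable def mu (X Y : FCsp T) : D.app X ⊗ D.app Y ≅ D.app (X ⊗ Y) := obTensor D.obj X Y

/-- The comparison of units. -/
noncomputable def eps : 𝟙_ V ≅ D.app (𝟙_ (FCsp T)) := obUnit D.obj

/-- The morphism of a permutation. -/
noncomputable def perm {X Y : FCsp T} (φ : Perm X Y) : D.app X ⟶ D.app Y := obPerm D.obj φ

theorem perm_refl (X : FCsp T) : D.perm (Perm.refl X) = 𝟙 _ := obPerm_refl D.obj X

theorem perm_trans {X Y Z : FCsp T} (φ : Perm X Y) (ψ : Perm Y Z) :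
    D.perm (X := X) (Y := Z) (φ.trans ψ) = D.perm φ ≫ D.perm ψ := obPerm_trans D.obj φ ψ

theorem perm_symm {X Y : FCsp T} (φ : Perm X Y) : D.perm φ ≫ D.perm (X := Y) (Y := X) φ.symm = 𝟙 _ := by
  rw [← perm_trans, ← perm_refl]
  exact congrArg D.perm (Perm.ext fun x => φ.equiv.symm_apply_apply x)

theorem mu_tensor {X Y X' Y' : FCsp T} (φ : Perm X Y) (ψ : Perm X' Y') :
    (D.mu X X').hom ≫ D.perm (X := X ⊗ X') (Y := Y ⊗ Y') (φ.tensor ψ) =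
      (D.perm φ ⊗ₘ D.perm ψ) ≫ (D.mu Y Y').hom := obPerm_tensor D.obj φ ψ

theorem mu_assoc (X Y Z : FCsp T) : (D.mu X Y).hom ▷ D.app Z ≫ (D.mu (X ⊗ Y) Z).hom ≫
    D.perm (X := (X ⊗ Y) ⊗ Z) (Y := X ⊗ (Y ⊗ Z)) (Perm.assoc X Y Z) =
      (α_ _ _ _).hom ≫ D.app X ◁ (D.mu Y Z).hom ≫ (D.mu X (Y ⊗ Z)).hom := obPerm_assoc D.obj X Y Z

theorem mu_swap (X Y : FCsp T) : (D.mu X Y).hom ≫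
    D.perm (X := X ⊗ Y) (Y := Y ⊗ X) (Perm.swap X Y) = (β_ _ _).hom ≫ (D.mu Y X).hom :=
  obPerm_swap D.obj X Y

theorem mu_leftUnit (X : FCsp T) : (D.mu (𝟙_ (FCsp T)) X).hom ≫
    D.perm (X := 𝟙_ (FCsp T) ⊗ X) (Perm.leftUnit X) = D.eps.inv ▷ D.app X ≫ (λ_ _).hom :=
  obPerm_leftUnit D.obj X

/-- A choice of states for the boxes. -/
abbrev Hat : Type (max v w₂) := ∀ f : T.M, 𝟙_ V ⟶ (boxBoundary f).ob D.obj

variable {D} (hat : D.Hat)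

/-- The value of a morphism from the unit. -/
noncomputable def ev {Y : FCsp T} (f : 𝟙_ (FCsp T) ⟶ Y) : 𝟙_ V ⟶ D.app Y :=
  Quotient.liftOn f (fun K => K.value D hat) fun K L h => by
    induction h with
    | rel K L h => exact h.elim (fun ⟨i⟩ => value_iso D hat i) fun ⟨C⟩ => value_contraction D hat C
    | refl => rfl
    | symm _ _ _ h => exact h.symm
    | trans _ _ _ _ _ h h' => exact h.trans h'

variable {X Y Z W : FCsp T}

theorem ev_perm (f : 𝟙_ (FCsp T) ⟶ X) (φ : Perm X Y) :
    ev hat (f ≫ ofPerm φ) = ev hat f ≫ D.perm φ := by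
  obtain ⟨K, rfl⟩ := mk_surj f
  exact (congrArg (ev hat) (mk_comp_ofPerm K φ)).trans (value_reindex D hat (Perm.refl _) φ)

theorem ev_iso {i : X ≅ Y} {p : D.app X ≅ D.app Y} (h : ∀ J, ev hat (J ≫ i.hom) = ev hat J ≫ p.hom)
    (J : 𝟙_ (FCsp T) ⟶ Y) : ev hat (J ≫ i.inv) = ev hat J ≫ p.inv := by
  rw [← cancel_mono p.hom, ← h]
  simp

theorem ev_assoc (J : 𝟙_ (FCsp T) ⟶ (X ⊗ Y) ⊗ Z) : ev hat (J ≫ (α_ X Y Z).hom) =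
    ev hat J ≫ (((D.mu (X ⊗ Y) Z).symm ≪≫ whiskerRightIso (D.mu X Y).symm (D.app Z)) ≪≫ α_ _ _ _ ≪≫
      whiskerLeftIso (D.app X) (D.mu Y Z) ≪≫ D.mu X (Y ⊗ Z)).hom := by
  refine (ev_perm hat J (Perm.assoc X Y Z)).trans (congrArg (ev hat J ≫ ·) ?_)
  have h := congrArg (fun t => (D.mu (X ⊗ Y) Z).inv ≫ (D.mu X Y).inv ▷ D.app Z ≫ t) (D.mu_assoc X Y Z)
  simp only [inv_hom_whiskerRight_assoc, Iso.inv_hom_id_assoc] at h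
  refine h.trans ?_
  simp

theorem ev_assoc_inv (J : 𝟙_ (FCsp T) ⟶ X ⊗ (Y ⊗ Z)) : ev hat (J ≫ (α_ X Y Z).inv) =
    ev hat J ≫ (((D.mu (X ⊗ Y) Z).symm ≪≫ whiskerRightIso (D.mu X Y).symm (D.app Z)) ≪≫ α_ _ _ _ ≪≫
      whiskerLeftIso (D.app X) (D.mu Y Z) ≪≫ D.mu X (Y ⊗ Z)).inv := ev_iso hat (ev_assoc hat) J

theorem ev_leftUnit (J : 𝟙_ (FCsp T) ⟶ 𝟙_ (FCsp T) ⊗ X) : ev hat (J ≫ (λ_ X).hom) =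
    ev hat J ≫ ((D.mu (𝟙_ (FCsp T)) X).symm ≪≫ whiskerRightIso D.eps.symm (D.app X) ≪≫ λ_ _).hom := by
  refine (ev_perm hat J (Perm.leftUnit X)).trans (congrArg (ev hat J ≫ ·) ?_)
  have h := congrArg (fun t => (D.mu (𝟙_ (FCsp T)) X).inv ≫ t) (D.mu_leftUnit X)
  simp only [Iso.inv_hom_id_assoc] at h
  exact h

theorem ev_leftUnit_inv (J : 𝟙_ (FCsp T) ⟶ X) : ev hat (J ≫ (λ_ X).inv) =
    ev hat J ≫ ((D.mu (𝟙_ (FCsp T)) X).symm ≪≫ whiskerRightIso D.eps.symm (D.app X) ≪≫ λ_ _).inv :=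
  ev_iso hat (ev_leftUnit hat) J

theorem ev_id : ev hat (𝟙 (𝟙_ (FCsp T))) = D.eps.hom := value_id_unit D hat

/-- The morphism `v` represents `f` in the category of values. -/
def IsValue (f : X ⟶ Y) (v : D.app X ⟶ D.app Y) : Prop :=
  ∀ (W : FCsp T) (J : 𝟙_ (FCsp T) ⟶ X ⊗ W),
    ev hat (J ≫ f ▷ W) = ev hat J ≫ (D.mu X W).inv ≫ v ▷ D.app W ≫ (D.mu Y W).hom

namespace IsValue

variable {hat}

theorem perm (φ : Perm X Y) : IsValue hat (ofPerm φ) (D.perm φ) := fun W J => by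
  refine (congrArg (fun f => ev hat (J ≫ f)) (ofPerm_tensor φ (Perm.refl W))).trans
    ((ev_perm hat J _).trans (congrArg (ev hat J ≫ ·) ?_))
  refine ((Iso.eq_inv_comp _).2 (D.mu_tensor φ (Perm.refl W))).trans ?_
  rw [perm_refl, tensorHom_id]

theorem id (X : FCsp T) : IsValue hat (𝟙 X) (𝟙 (D.app X)) := D.perm_refl X ▸ perm (Perm.refl X)

theorem comp {f : X ⟶ Y} {g : Y ⟶ Z} {v : D.app X ⟶ D.app Y} {w : D.app Y ⟶ D.app Z}
    (hf : IsValue hat f v) (hg : IsValue hat g w) : IsValue hat (f ≫ g) (v ≫ w) := fun W J => by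
  rw [comp_whiskerRight, ← Category.assoc, hg, hf]
  simp

theorem whiskerRight {f : X ⟶ Y} {v : D.app X ⟶ D.app Y} (hf : IsValue hat f v) (Z : FCsp T) :
    IsValue hat (f ▷ Z) ((D.mu X Z).inv ≫ v ▷ D.app Z ≫ (D.mu Y Z).hom) := fun W J => by
  have e : J ≫ (f ▷ Z) ▷ W = ((J ≫ (α_ X Z W).hom) ≫ f ▷ (Z ⊗ W)) ≫ (α_ Y Z W).inv := by simp
  rw [e, ev_assoc_inv, hf, ev_assoc]
  simp only [Iso.trans_hom, Iso.trans_inv, Iso.symm_hom, Iso.symm_inv, whiskerRightIso_hom,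
    whiskerRightIso_inv, whiskerLeftIso_hom, whiskerLeftIso_inv, Category.assoc,
    Iso.hom_inv_id_assoc, comp_whiskerRight]
  rw [whisker_exchange_assoc, whiskerLeft_hom_inv_assoc, associator_inv_naturality_left_assoc,
    Iso.hom_inv_id_assoc]

theorem braiding (X Y : FCsp T) : IsValue hat (β_ X Y).hom
    ((D.mu X Y).inv ≫ (β_ _ _).hom ≫ (D.mu Y X).hom) :=
  (Iso.inv_comp_eq _).2 (D.mu_swap X Y).symm ▸ perm (Perm.swap X Y)

theorem whiskerLeft (Z : FCsp T) {f : X ⟶ Y} {v : D.app X ⟶ D.app Y} (hf : IsValue hat f v) :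
    IsValue hat (Z ◁ f) ((D.mu Z X).inv ≫ D.app Z ◁ v ≫ (D.mu Z Y).hom) := by
  have h := ((braiding Z X).comp (hf.whiskerRight Z)).comp (braiding Y Z)
  have e : ((β_ Z X).hom ≫ f ▷ Z) ≫ (β_ Y Z).hom = Z ◁ f := by simp
  rw [e] at h
  convert h using 1
  simp

theorem tensor {X' Y' : FCsp T} {f : X ⟶ Y} {g : X' ⟶ Y'} {v : D.app X ⟶ D.app Y}
    {w : D.app X' ⟶ D.app Y'} (hf : IsValue hat f v) (hg : IsValue hat g w) :
    IsValue hat (f ⊗ₘ g) ((D.mu X X').inv ≫ (v ⊗ₘ w) ≫ (D.mu Y Y').hom) := by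
  have h := (hf.whiskerRight X').comp (hg.whiskerLeft Y)
  rw [← MonoidalCategory.tensorHom_def] at h
  convert h using 1
  simp [MonoidalCategory.tensorHom_def]

theorem state {S : FramedCospan FramedPointGraph.unit X} {i₀ : S.G.E ⊕ S.G.V}
    (hi : Enumerates [i₀] S.G.IsElem) (hS : ∀ x, ¬ S.G.IsInner x)
    {oS : FramedPointGraph.V X → S.G.E × Bool}
    (hoS : S.IsOutLab oS) (s : 𝟙_ V ⟶ D.app X)
    (hs : S.G.elemState D hat i₀ = D.boxState S.G.flagLetter s oS hoS.letter) :
    IsValue hat (FCsp.mk S : 𝟙_ (FCsp T) ⟶ X) (D.eps.inv ≫ s) := fun W J => by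
  have e : J ≫ (FCsp.mk S : 𝟙_ (FCsp T) ⟶ X) ▷ W =
      (J ≫ (λ_ W).hom) ≫ (λ_ W).inv ≫ (FCsp.mk S : 𝟙_ (FCsp T) ⟶ X) ▷ W := by simp
  rw [e]
  have h1 := ev_leftUnit hat J
  obtain ⟨L, hL⟩ := mk_surj (J ≫ (λ_ W).hom)
  rw [← hL] at h1 ⊢
  have e' : (FCsp.mk L : 𝟙_ (FCsp T) ⟶ W) ≫ (λ_ W).inv ≫ (FCsp.mk S : 𝟙_ (FCsp T) ⟶ X) ▷ W =
      FCsp.mk ((S.tensor L).reindex (Perm.leftUnit FramedPointGraph.unit).symm (Perm.refl _)) := by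
    have h2 : (FCsp.mk L : 𝟙_ (FCsp T) ⟶ W) ≫ (λ_ W).inv ≫ (FCsp.mk S : 𝟙_ (FCsp T) ⟶ X) ▷ W =
        (λ_ (𝟙_ (FCsp T))).inv ≫ ((FCsp.mk S : 𝟙_ (FCsp T) ⟶ X) ⊗ₘ FCsp.mk L) := by
      rw [tensorHom_def', leftUnitor_inv_naturality_assoc]
    refine h2.trans ((congrArg (_ ≫ ·) (tensorHom_mk (X := FCsp.unit) (X' := FCsp.unit) S L)).trans ?_)
    exact ofPerm_comp_mk (X := FCsp.unit) (X' := FCsp.tensorObj FCsp.unit FCsp.unit) _ _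
  rw [e']
  refine (value_tensor D hat S L hi hS hoS s hs _).trans ?_
  refine (congrArg (· ≫ (λ_ _).inv ≫ s ▷ D.app W ≫ (D.mu X W).hom) h1).trans ?_
  simp

theorem cap (Z : T.O) : IsValue hat (FCsp.cap (FramedPointGraph.point Z)) (D.eps.inv ≫ D.obCap Z) := by
  refine state (i₀ := .inl ()) (oS := Sum.elim (fun _ => ((), false)) fun _ => ((), true))
    ⟨List.nodup_singleton _, ?_⟩ ?_ ⟨?_, ?_⟩ _ ?_
  · rintro (_ | x | x | x)
    · exact iff_of_true (List.mem_singleton.2 rfl) ⟨Z, rfl⟩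
    · exact x.elim
    all_goals exact iff_of_false (fun h => by cases List.mem_singleton.1 h) fun ⟨f, hf⟩ => by cases hf
  · rintro (x | x | x)
    · exact x.elim
    · exact fun ⟨_, ⟨e, he⟩, _⟩ => by cases he
    · exact fun ⟨_, _, ⟨e, he⟩⟩ => by cases he
  · rintro (x | x) <;> rfl
  · rintro (x | x) <;> rfl
  · refine (TypedGraph.elemState_mid D hat rfl).trans ?_
    have key : ∀ (l) (_ : l = [((), false), ((), true)]) (c), D.capState
        (FramedCospan.cap (FramedPointGraph.point Z)).G.flagLetter Z ((), false) ((), true) rfl rfl =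
          ⟨l, D.obCap Z ≫ labelCast c⟩ := by
      rintro _ rfl c
      exact Sigma.ext rfl (heq_of_eq (D.capState_eq rfl rfl c))
    have h1 : (FramedPointGraph.point Z).dual.lst = [()] := lst_single (Z, false)
    exact key _ (by rw [lst_tensor, h1, lst_point]; rfl) _

theorem cup (Z : T.O) : IsValue hat (FCsp.cup (FramedPointGraph.point Z)) (D.obCup Z ≫ D.eps.hom) :=
    fun W J => by
  obtain ⟨K, rfl⟩ := mk_surj J
  let P := FramedPointGraph.point Z
  have h : (FCsp.mk K : 𝟙_ (FCsp T) ⟶ (P ⊗ FCsp.dual P) ⊗ W) ≫ (β_ _ W).hom ≫ W ◁ FCsp.cup P =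
      FCsp.mk K.merge ≫ (ρ_ W).inv := by
    let K₁ := K.reindex (Perm.refl _) (Perm.swap (P.tensor P.dual) W)
    have col := cupCollapse K₁ K.merge K.mergeMap K.mergeMap_surj K.mergeEdge (fun _ => rfl)
      (fun _ => rfl) K.mergeMap_ty (fun _ => rfl) (fun x => x.elim) K.mergeMap_c
      (fun _ => K.mergeMap_glue) fun x x' hx => (K.mergeMap_eq hx).imp_right fun hx => ⟨(), hx⟩
    refine (Category.assoc _ _ _).symm.trans
      ((congrArg (· ≫ W ◁ FCsp.cup P) (mk_comp_ofPerm K (Perm.swap (P.tensor P.dual) W))).trans ?_)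
    refine (congrArg (FCsp.mk K₁ ≫ ·) (tensorHom_mk (X := W) (Y := W) (FramedCospan.perm (Perm.refl W))
      (FramedCospan.cup P))).trans ?_
    exact (mk_comp_mk (X := FCsp.unit) _ _).trans ((mk_eq (X := FCsp.unit) col.homeo).trans
      (mk_comp_ofPerm (X := FCsp.unit) K.merge (Perm.rightUnit W).symm).symm)
  have h' : (FCsp.mk K : 𝟙_ (FCsp T) ⟶ (P ⊗ FCsp.dual P) ⊗ W) ≫ FCsp.cup P ▷ W =
      FCsp.mk K.merge ≫ (λ_ W).inv := by
    have h2 := congrArg (· ≫ (β_ W (𝟙_ (FCsp T))).hom) h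
    simp only [Category.assoc] at h2
    refine Eq.trans ?_ (h2.trans ?_)
    · refine congrArg (FCsp.mk K ≫ ·) ?_
      rw [← BraidedCategory.braiding_naturality_left_assoc]
      exact ((congrArg (FCsp.cup P ▷ W ≫ ·) (SymmetricCategory.symmetry _ _)).trans
        (Category.comp_id _)).symm
    · rw [rightUnitor_inv_braiding]
  refine (congrArg (ev hat) h').trans ((ev_leftUnit_inv hat _).trans ?_)
  have key : ∀ (P : FCsp T) (j : 𝟙_ V ⟶ D.app (P ⊗ W)) (k : D.app P ⟶ 𝟙_ V),
      (j ≫ (D.mu P W).inv ≫ k ▷ D.app W ≫ (λ_ _).hom) ≫ ((D.mu (𝟙_ (FCsp T)) W).symm ≪≫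
        whiskerRightIso D.eps.symm (D.app W) ≪≫ λ_ _).inv =
      j ≫ (D.mu P W).inv ≫ (k ≫ D.eps.hom) ▷ D.app W ≫ (D.mu (𝟙_ (FCsp T)) W).hom := by
    intro P j k
    simp
  exact (congrArg (· ≫ _) (value_merge' D hat K)).trans (key _ _ _)

end IsValue

end DualLetters

theorem eq_of_coevaluation {C : Type c} [Category.{d} C] [MonoidalCategory C] {A B Z : C}
    (p : ExactPairing A B) {v v' : A ⟶ Z}
    (h : p.coevaluation' ≫ v ▷ B = p.coevaluation' ≫ v' ▷ B) : v = v' := by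
  have key : ∀ v : A ⟶ Z, tensorRightHomEquiv (𝟙_ C) A B Z ((λ_ A).hom ≫ v) =
      p.coevaluation' ≫ v ▷ B := fun v => by
    change (ρ_ _).inv ≫ _ ◁ p.coevaluation' ≫ (α_ _ _ _).inv ≫ _ ▷ _ = _
    simp [unitors_equal]
  have := (tensorRightHomEquiv (𝟙_ C) A B Z).injective ((key v).trans (h.trans (key v').symm))
  exact (cancel_epi _).1 this

namespace DualLetters

open FramedPointGraph FramedCospan FCsp

variable {T : MonoidalSignature.{u, v}} {V : Type w₁} [Category.{w₂} V] [MonoidalCategory V]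
  [SymmetricCategory V] {D : DualLetters T V} {X Y Z W : FCsp T}

/-- The exact pairings of the signed types. -/
@[reducible] def pairing (D : DualLetters T V) (Z : T.O) :
    ExactPairing (D.obj (Z, false)) (D.obj (Z, true)) where
  coevaluation' := D.cap Z
  evaluation' := D.cup Z
  coevaluation_evaluation' := D.triangle_pos Z
  evaluation_coevaluation' := D.triangle_neg Z

variable (D) in
/-- The object of a single vertex. -/
noncomputable def one (p : T.O × Bool) : D.obj p ≅ D.app (single p) :=
  (ρ_ (D.obj p)).symm ≪≫ eqToIso (congrArg (labelTensor D.obj) (letters_single p).symm)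

theorem one_tensor (p q : T.O × Bool)
    (c : [p, q].map D.obj = ((single p).tensor (single q)).letters.map D.obj) :
    ((D.one p).hom ⊗ₘ (D.one q).hom) ≫ (D.mu (single p) (single q)).hom =
      D.obj p ◁ (ρ_ (D.obj q)).inv ≫ labelCast c := by
  have key : ∀ (l m : List (T.O × Bool)) (hl : l = [p]) (hm : m = [q])
      (c' : [p, q].map D.obj = (l ++ m).map D.obj),
      (((ρ_ (D.obj p)).inv ≫ eqToHom (congrArg (labelTensor D.obj) hl.symm)) ⊗ₘ
        ((ρ_ (D.obj q)).inv ≫ eqToHom (congrArg (labelTensor D.obj) hm.symm))) ≫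
        (labelApp D.obj l m).hom = D.obj p ◁ (ρ_ (D.obj q)).inv ≫ labelCast c' := by
    rintro _ _ rfl rfl c'
    change (((ρ_ _).inv ≫ 𝟙 _) ⊗ₘ ((ρ_ _).inv ≫ 𝟙 _)) ≫ (α_ _ _ _).hom ≫
      D.obj p ◁ (λ_ (D.obj q ⊗ 𝟙_ V)).hom = D.obj p ◁ (ρ_ _).inv ≫ 𝟙 _
    simp only [Category.comp_id]
    monoidal
  have e := key _ _ (letters_single p) (letters_single q)
    (by rw [letters_single, letters_single]; rfl)
  refine (Category.assoc _ _ _).symm.trans ((congrArg (· ≫ labelCast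
    (congrArg (List.map D.obj) (letters_tensor (single p) (single q)).symm)) e).trans ?_)
  rw [Category.assoc, labelCast_trans]

theorem cap_one (Z : T.O) : D.cap Z ≫ ((D.one (Z, false)).hom ⊗ₘ (D.one (Z, true)).hom) ≫
    (D.mu (single (Z, false)) (single (Z, true))).hom = D.obCap Z := by
  rw [one_tensor _ _ (congrArg (List.map D.obj) (letters_cap Z).symm)]
  exact (Category.assoc _ _ _).symm

theorem one_cup (Z : T.O) : ((D.one (Z, true)).hom ⊗ₘ (D.one (Z, false)).hom) ≫
    (D.mu (single (Z, true)) (single (Z, false))).hom ≫ D.obCup Z = D.cup Z := by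
  have h := one_tensor (D := D) (Z, true) (Z, false) (congrArg (List.map D.obj) (letters_cup Z).symm)
  refine (Category.assoc _ _ _).symm.trans ((congrArg (· ≫ D.obCup Z) h).trans ?_)
  rw [Category.assoc, obCup, labelCast_trans_assoc]
  change _ ≫ 𝟙 _ ≫ _ = _
  simp

theorem perm_assoc (X Y Z : FCsp T) : D.perm (X := (X ⊗ Y) ⊗ Z) (Y := X ⊗ (Y ⊗ Z)) (Perm.assoc X Y Z) =
    (((D.mu (X ⊗ Y) Z).symm ≪≫ whiskerRightIso (D.mu X Y).symm (D.app Z)) ≪≫ α_ _ _ _ ≪≫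
      whiskerLeftIso (D.app X) (D.mu Y Z) ≪≫ D.mu X (Y ⊗ Z)).hom := by
  have h := congrArg (fun t => (D.mu (X ⊗ Y) Z).inv ≫ (D.mu X Y).inv ▷ D.app Z ≫ t) (D.mu_assoc X Y Z)
  simp only [inv_hom_whiskerRight_assoc, Iso.inv_hom_id_assoc] at h
  refine h.trans ?_
  simp

/-- The isomorphism of a permutation. -/
@[simps] noncomputable def permIso (φ : Perm X Y) : D.app X ≅ D.app Y where
  hom := D.perm φ
  inv := D.perm (X := Y) (Y := X) φ.symm
  hom_inv_id := D.perm_symm φ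
  inv_hom_id := D.perm_symm (X := Y) (Y := X) φ.symm

namespace IsValue

variable {hat : D.Hat}

theorem of_eq {f : X ⟶ Y} {v v' : D.app X ⟶ D.app Y} (h : IsValue hat f v) (e : v = v') :
    IsValue hat f v' := e ▸ h

theorem iso {i : X ≅ Y} {p : D.app X ≅ D.app Y} (h : IsValue hat i.hom p.hom) :
    IsValue hat i.inv p.inv := fun W J => by
  have e := h W (J ≫ i.inv ▷ W)
  rw [Category.assoc, inv_hom_whiskerRight, Category.comp_id] at e
  rw [e]
  simp

theorem assoc (X Y Z : FCsp T) : IsValue hat (α_ X Y Z).hom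
    (((D.mu (X ⊗ Y) Z).symm ≪≫ whiskerRightIso (D.mu X Y).symm (D.app Z)) ≪≫ α_ _ _ _ ≪≫
      whiskerLeftIso (D.app X) (D.mu Y Z) ≪≫ D.mu X (Y ⊗ Z)).hom :=
  (perm (Perm.assoc X Y Z)).of_eq (perm_assoc X Y Z)

theorem leftUnit (X : FCsp T) : IsValue hat (λ_ X).hom
    ((D.mu (𝟙_ (FCsp T)) X).symm ≪≫ whiskerRightIso D.eps.symm (D.app X) ≪≫ λ_ _).hom :=
  (perm (Perm.leftUnit X)).of_eq ((Iso.eq_inv_comp _).2 (D.mu_leftUnit X))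

theorem rightUnit (X : FCsp T) : IsValue hat (ρ_ X).hom
    ((D.mu X (𝟙_ (FCsp T))).symm ≪≫ whiskerLeftIso (D.app X) D.eps.symm ≪≫ ρ_ _).hom := by
  have h := (braiding (hat := hat) X (𝟙_ (FCsp T))).comp (leftUnit X)
  rw [braiding_leftUnitor] at h
  refine h.of_eq ?_
  simp only [Iso.trans_hom, Iso.symm_hom, whiskerRightIso_hom, whiskerLeftIso_hom, Category.assoc,
    Iso.hom_inv_id_assoc]
  rw [← BraidedCategory.braiding_naturality_right_assoc, braiding_leftUnitor]

end IsValue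

variable (D) in
/-- There is a morphism whose value is the coevaluation of an exact pairing. -/
def HasPairing (X : FCsp T) : Prop :=
  ∃ (W : FCsp T) (J : 𝟙_ (FCsp T) ⟶ X ⊗ W) (p : ExactPairing (D.app X) (D.app W)),
    ∀ hat, IsValue hat J (D.eps.inv ≫ p.coevaluation' ≫ (D.mu X W).hom)

theorem hasPairing (X : FCsp T) : D.HasPairing X := by
  refine reframing_induction (P := D.HasPairing) ?_ ?_ ?_ ?_ X
  · refine ⟨𝟙_ _, (λ_ (𝟙_ (FCsp T))).inv, exactPairingCongr D.eps.symm D.eps.symm, fun hat => ?_⟩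
    refine (IsValue.leftUnit (hat := hat) (𝟙_ (FCsp T))).iso.of_eq (Eq.symm ?_)
    change _ ≫ (((ρ_ (𝟙_ V)).inv ≫ _ ◁ D.eps.hom) ≫ D.eps.hom ▷ _) ≫ _ = _
    simp [unitors_equal]
    rfl
  · rintro ⟨Z, _ | _⟩
    · let _ := D.pairing Z
      refine ⟨single (Z, true), FCsp.cap (FramedPointGraph.point Z),
        exactPairingCongr (D.one (Z, false)).symm (D.one (Z, true)).symm, fun hat => ?_⟩
      refine (IsValue.cap (hat := hat) Z).of_eq (Eq.symm ?_)
      refine congrArg (D.eps.inv ≫ ·) (Eq.trans ?_ (cap_one Z))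
      change ((D.cap Z ≫ _ ◁ (D.one (Z, true)).hom) ≫ (D.one (Z, false)).hom ▷ _) ≫ _ = _
      rw [tensorHom_def']
      simp only [Category.assoc]
    · let _ := D.pairing Z
      let _ := BraidedCategory.exactPairing_swap (D.obj (Z, false)) (D.obj (Z, true))
      refine ⟨single (Z, false), FCsp.cap (FramedPointGraph.point Z) ≫ (β_ _ _).hom,
        exactPairingCongr (D.one (Z, true)).symm (D.one (Z, false)).symm, fun hat => ?_⟩
      refine ((IsValue.cap (hat := hat) Z).comp (IsValue.braiding _ _)).of_eq (Eq.symm ?_)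
      refine Eq.trans (congrArg (D.eps.inv ≫ ·) ?_) (Category.assoc _ _ _).symm
      refine Eq.trans ?_ (congrArg (· ≫ _) (cap_one Z))
      change (((D.cap Z ≫ (β_ _ _).inv) ≫ _ ◁ (D.one (Z, false)).hom) ≫ (D.one (Z, true)).hom ▷ _) ≫ _ =
        (_ ≫ _ ≫ (D.mu (single (Z, false)) (single (Z, true))).hom) ≫
          (D.mu (single (Z, false)) (single (Z, true))).inv ≫ _
      rw [MonoidalCategory.tensorHom_def]
      simp only [Category.assoc, Iso.hom_inv_id_assoc, ← SymmetricCategory.braiding_swap_eq_inv_braiding]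
      have e : ∀ {A B A' B' Z : V} (c : 𝟙_ V ⟶ A ⊗ B) (a : A ⟶ A') (b : B ⟶ B') (m : B' ⊗ A' ⟶ Z),
          c ≫ (β_ A B).hom ≫ B ◁ a ≫ b ▷ A' ≫ m = c ≫ a ▷ B ≫ A' ◁ b ≫ (β_ A' B').hom ≫ m := by
        intros
        simp
      exact e _ _ _ _
  · rintro (X : FCsp T) (Y : FCsp T) ⟨W, J, p, h⟩ ⟨W', J', p', h'⟩
    refine ⟨W' ⊗ W, J ≫ (ρ_ X).inv ▷ W ≫ (X ◁ J') ▷ W ≫ (α_ X Y W').inv ▷ W ≫ (α_ (X ⊗ Y) W' W).hom,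
      @exactPairingCongr _ _ _ _ _ _ _ (@ExactPairing.tensor _ _ _ _ _ _ _ p p') (D.mu X Y).symm
        (D.mu W' W).symm, fun hat => ?_⟩
    refine ((h hat).comp (((IsValue.rightUnit X).iso.whiskerRight W).comp
      ((((h' hat).whiskerLeft X).whiskerRight W).comp (((IsValue.assoc X Y W').iso.whiskerRight W).comp
        (IsValue.assoc (X ⊗ Y) W' W))))).of_eq (Eq.symm ?_)
    change _ ≫ (((p.coevaluation' ⊗≫ (D.app X ◁ p'.coevaluation') ▷ D.app W ⊗≫ 𝟙 _) ≫
      _ ◁ (D.mu W' W).hom) ≫ (D.mu X Y).hom ▷ _) ≫ _ = _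
    have e : ∀ {A B C E P Q Z : V} (c : 𝟙_ V ⟶ A ⊗ B) (c' : 𝟙_ V ⟶ C ⊗ E) (m : E ⊗ B ⟶ P)
        (n : A ⊗ C ⟶ Q) (k : Q ⊗ P ⟶ Z),
        (((c ⊗≫ (A ◁ c') ▷ B ⊗≫ 𝟙 ((A ⊗ C) ⊗ E ⊗ B)) ≫ _ ◁ m) ≫ n ▷ _) ≫ k =
        c ≫ (ρ_ A).inv ▷ B ≫ (A ◁ c') ▷ B ≫ (α_ A C E).inv ▷ B ≫ n ▷ E ▷ B ≫ (α_ _ _ _).hom ≫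
          Q ◁ m ≫ k := by
      intros
      rw [Category.assoc, Category.assoc, whisker_exchange_assoc]
      monoidal
    refine (congrArg (D.eps.inv ≫ ·) (e _ _ _ _ _)).trans ?_
    simp
    rfl
  · rintro (X : FCsp T) (Y : FCsp T) φ - ⟨W, J, p, h⟩
    refine ⟨W, J ≫ ofPerm φ ▷ W, exactPairingCongr (permIso φ).symm (Iso.refl _), fun hat => ?_⟩
    refine ((h hat).comp ((IsValue.perm φ).whiskerRight W)).of_eq (Eq.symm ?_)
    change _ ≫ ((p.coevaluation' ≫ _ ◁ 𝟙 _) ≫ D.perm φ ▷ _) ≫ _ = _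
    simp

theorem IsValue.ev_eq {hat : D.Hat} {J : 𝟙_ (FCsp T) ⟶ X} {v : D.app (𝟙_ (FCsp T)) ⟶ D.app X}
    (h : IsValue hat J v) : ev hat J = D.eps.hom ≫ v := by
  have e := h (𝟙_ _) (λ_ _).inv
  have k : (λ_ (𝟙_ (FCsp T))).inv ≫ J ▷ 𝟙_ (FCsp T) = (J ≫ (λ_ X).inv) ≫ (β_ (𝟙_ (FCsp T)) X).hom := by
    rw [Category.assoc, leftUnitor_inv_braiding, unitors_inv_equal, rightUnitor_inv_naturality]
  have k' : ev hat (λ_ (𝟙_ (FCsp T))).inv = _ :=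
    (congrArg (ev hat) (Category.id_comp _).symm).trans (ev_leftUnit_inv hat (𝟙 _))
  have p : ev hat ((J ≫ (λ_ X).inv) ≫ (β_ (𝟙_ (FCsp T)) X).hom) = _ :=
    ev_perm hat (J ≫ (λ_ X).inv) (Perm.swap (𝟙_ (FCsp T)) X)
  have m : D.perm (X := 𝟙_ (FCsp T) ⊗ X) (Y := X ⊗ 𝟙_ (FCsp T)) (Perm.swap (𝟙_ (FCsp T)) X) =
      (D.mu (𝟙_ (FCsp T)) X).inv ≫ (β_ _ _).hom ≫ (D.mu X (𝟙_ (FCsp T))).hom :=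
    (Iso.eq_inv_comp _).2 (D.mu_swap (𝟙_ (FCsp T)) X)
  rw [k, p, m, k', ev_id, ev_leftUnit_inv, ← cancel_mono (D.mu X (𝟙_ (FCsp T))).inv] at e
  simp only [Iso.trans_inv, Iso.symm_inv, whiskerRightIso_inv, Category.assoc, Iso.hom_inv_id,
    Iso.hom_inv_id_assoc, Category.comp_id, BraidedCategory.braiding_naturality_left,
    leftUnitor_inv_braiding_assoc, rightUnitor_inv_naturality_assoc] at e
  have q : ∀ {A B : V} (i : 𝟙_ V ⟶ A) (w : A ⟶ B), i ≫ (λ_ A).inv ≫ i ▷ A ≫ w ▷ A =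
      (i ≫ w) ≫ (ρ_ B).inv ≫ B ◁ i := by
    intro A B i w
    rw [leftUnitor_inv_naturality_assoc, ← comp_whiskerRight, whisker_exchange, unitors_inv_equal,
      ← rightUnitor_inv_naturality_assoc]
  rw [q, ← rightUnitor_inv_naturality_assoc] at e
  simpa only [← Category.assoc, cancel_mono] using e

theorem IsValue.unique {hat : D.Hat} {f : X ⟶ Y} {v v' : D.app X ⟶ D.app Y} (h : IsValue hat f v)
    (h' : IsValue hat f v') : v = v' := by
  obtain ⟨W, J, p, hJ⟩ := hasPairing (D := D) X
  have e := (h W J).symm.trans (h' W J)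
  rw [(hJ hat).ev_eq] at e
  simp only [Category.assoc, Iso.hom_inv_id_assoc] at e
  simp only [← Category.assoc, cancel_mono] at e
  exact eq_of_coevaluation p e

theorem exists_value {B : T.M → Prop} {H : D.Hat → Prop} (hB : ∀ f, B f →
    ∃ v, ∀ hat, H hat → IsValue hat ((generators T).map f) v) {f : X ⟶ Y} (hf : Gen B f) :
    ∃ v, ∀ hat, H hat → IsValue hat f v := by
  induction hf with
  | reframe φ _ => exact ⟨_, fun hat _ => .perm φ⟩
  | braid X Y => exact ⟨_, fun hat _ => .braiding X Y⟩
  | comp f g _ _ hf hg =>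
    obtain ⟨v, hv⟩ := hf
    obtain ⟨w, hw⟩ := hg
    exact ⟨_, fun hat h => (hv hat h).comp (hw hat h)⟩
  | tensor f g _ _ hf hg =>
    obtain ⟨v, hv⟩ := hf
    obtain ⟨w, hw⟩ := hg
    exact ⟨_, fun hat h => (hv hat h).tensor (hw hat h)⟩
  | cap Z => exact ⟨_, fun hat _ => .cap Z⟩
  | cup Z => exact ⟨_, fun hat _ => .cup Z⟩
  | box f hf => exact hB f hf

end DualLetters

open FramedPointGraph in
theorem FCsp.mk_eq_closure {T : MonoidalSignature.{u, v}} {X Y : FCsp T} (K : FramedCospan X Y) : (FCsp.mk K : X ⟶ Y) = (ρ_ X).inv ≫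
    X ◁ (FCsp.mk K.bend : 𝟙_ (FCsp T) ⟶ FCsp.dual X ⊗ Y) ≫ (α_ X (FCsp.dual X) Y).inv ≫ FCsp.cup X ▷ Y ≫ (λ_ Y).hom := by
  have h := FCsp.unbend_eq (X := X) (Y := Y) K.bend
  have h2 : (FCsp.mk K.bend.unbend : X ⟶ Y) = FCsp.mk K := FCsp.mk_iso (FramedCospan.unbendBend K)
  rw [h2] at h
  have := congrArg (fun t => (ρ_ X).inv ≫ t ≫ (λ_ Y).hom) h
  simp only [Category.assoc, Iso.inv_hom_id, Iso.inv_hom_id_assoc, Category.comp_id] at this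
  exact this.symm

namespace DualLetters

open FramedPointGraph FramedCospan FCsp

variable {T : MonoidalSignature.{u, v}} {V : Type w₁} [Category.{w₂} V] [MonoidalCategory V]
  [SymmetricCategory V] {D : DualLetters T V} {X Y Z W : FCsp T}

theorem IsValue.box_bend (hat : D.Hat) (f : T.M) :
    IsValue hat (FCsp.mk (X := FCsp.unit) (Y := boxBoundary f) (FramedCospan.box f).bend)
      (D.eps.inv ≫ hat f) := by
  have hb : TypedGraph.IsBoxLab (G := (FramedCospan.box f).G) (.inl ()) f
      (Sum.elim (fun x => (.inl x, false)) fun y => (.inr y, true)) :=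
    ⟨rfl, fun _ => ⟨rfl, rfl, rfl⟩, fun _ => ⟨rfl, rfl, rfl⟩⟩
  refine state (S := (FramedCospan.box f).bend) (i₀ := .inr (.inl ()))
    (oS := Sum.elim (fun x => (.inl x, false)) fun y => (.inr y, true))
    ⟨List.nodup_singleton _, ?_⟩ ?_ ⟨?_, ?_⟩ _ (TypedGraph.elemState_box D hat (FramedCospan.box f).string hb)
  · rintro ((x | x) | (x | x | x))
    · exact iff_of_false (fun h => by cases List.mem_singleton.1 h) fun ⟨Z, h⟩ => by cases h
    · exact iff_of_false (fun h => by cases List.mem_singleton.1 h) fun ⟨Z, h⟩ => by cases h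
    · exact iff_of_true (List.mem_singleton.2 rfl) ⟨f, rfl⟩
    all_goals exact iff_of_false (fun h => by cases List.mem_singleton.1 h) fun ⟨f, hf⟩ => by cases hf
  · rintro (x | x | x)
    · exact fun ⟨⟨_, h⟩, _⟩ => by cases h
    · exact fun ⟨_, ⟨e, he⟩, _⟩ => by rcases e with _ | _ <;> cases he
    · exact fun ⟨_, _, ⟨e, he⟩⟩ => by rcases e with _ | _ <;> cases he
  · rintro (x | x) <;> rfl
  · rintro (x | x)
    · change false = !(word (T.dom f)).sgn x
      rw [word_sgn]
      rfl
    · exact (word_sgn _ x).symm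

theorem exists_hat (m : ∀ f : T.M, D.app (word (T.dom f)) ⟶ D.app (word (T.cod f))) :
    ∃ hat : D.Hat, ∀ f, IsValue hat ((generators T).map f) (m f) := by
  have hc (X : FCsp T) : ∃ v : D.app (𝟙_ (FCsp T)) ⟶ D.app (FCsp.dual X ⊗ X), ∀ hat : D.Hat, True →
      IsValue hat (FCsp.cap X) v := exists_value (B := fun _ => False) (fun _ h => h.elim) (.cap_all X)
  have hu (X : FCsp T) : ∃ v : D.app (X ⊗ FCsp.dual X) ⟶ D.app (𝟙_ (FCsp T)), ∀ hat : D.Hat, True →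
      IsValue hat (FCsp.cup X) v := exists_value (B := fun _ => False) (fun _ h => h.elim) (.cup_all X)
  choose j hj using hc
  choose u hu using hu
  let H (f : T.M) : D.app (𝟙_ (FCsp T)) ⟶ D.app (FCsp.dual (word (T.dom f)) ⊗ word (T.cod f)) :=
    j (word (T.dom f)) ≫ (D.mu _ _).inv ≫ D.app (FCsp.dual (word (T.dom f))) ◁ m f ≫ (D.mu _ _).hom
  refine ⟨fun f => D.eps.hom ≫ H f, fun f => ?_⟩
  set hat : D.Hat := fun f => D.eps.hom ≫ H f
  have hb : IsValue hat (FCsp.mk (X := FCsp.unit) (Y := boxBoundary f) (FramedCospan.box f).bend) (H f) :=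
    (IsValue.box_bend hat f).of_eq (Iso.inv_hom_id_assoc _ _)
  have key : ∀ {X Y : FCsp T} {S : FramedCospan X Y} (v : D.app X ⟶ D.app Y), IsValue hat
      (FCsp.mk S.bend : 𝟙_ (FCsp T) ⟶ FCsp.dual X ⊗ Y) (j X ≫ (D.mu _ _).inv ≫
        D.app (FCsp.dual X) ◁ v ≫ (D.mu _ _).hom) → IsValue hat (FCsp.mk S : X ⟶ Y) v := by
    intro X Y S v h
    have c : ∀ {X Y : FCsp T} {S : FramedCospan X Y} (v), IsValue hat
      (FCsp.mk S.bend : 𝟙_ (FCsp T) ⟶ FCsp.dual X ⊗ Y) v →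
        IsValue hat (FCsp.mk S : X ⟶ Y) _ :=
      fun {X Y S} v h => FCsp.mk_eq_closure (X := X) (Y := Y) S ▸ ((IsValue.rightUnit X).iso.comp
      ((h.whiskerLeft X).comp ((IsValue.assoc _ _ _).iso.comp
        ((IsValue.whiskerRight (X := X ⊗ FCsp.dual X) (Y := 𝟙_ (FCsp T)) (hu X hat trivial) Y).comp
          (.leftUnit Y)))))
    obtain ⟨K, hK⟩ := mk_surj (𝟙 X)
    have k : (FCsp.mk K.bend : 𝟙_ (FCsp T) ⟶ FCsp.dual X ⊗ X) = FCsp.cap X :=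
      (mk_bend K).trans ((congrArg (fun t => FCsp.cap X ≫ FCsp.dual X ◁ t) hK).trans
        ((congrArg (FCsp.cap X ≫ ·) (whiskerLeft_id _ _)).trans (Category.comp_id _)))
    have h1 := (c (S := K) _ (k ▸ hj X hat trivial))
    rw [hK] at h1
    refine (c _ h).of_eq (Eq.trans ?_ ((congrArg (· ≫ v) (h1.unique (.id X))).trans (Category.id_comp v)))
    simp only [Iso.trans_inv, Iso.symm_inv, whiskerLeftIso_inv, Category.assoc, Iso.hom_inv_id_assoc,
      whiskerRightIso_inv, Iso.trans_hom, Iso.symm_hom, whiskerRightIso_hom, whiskerLeft_comp,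
      whiskerLeft_hom_inv_assoc]
    rw [associator_inv_naturality_right_assoc, whisker_exchange_assoc, whisker_exchange_assoc,
      whisker_exchange_assoc, leftUnitor_naturality]
  exact key _ hb

variable {hat : D.Hat} (h : ∀ {X Y : FCsp T} (f : X ⟶ Y), ∃ v, IsValue hat f v)

/-- The functor of values. -/
@[reducible] noncomputable def extend : FCsp T ⥤ V where
  obj := D.app
  map f := (h f).choose
  map_id X := (h (𝟙 X)).choose_spec.unique (.id X)
  map_comp f g := (h (f ≫ g)).choose_spec.unique ((h f).choose_spec.comp (h g).choose_spec)

theorem extend_map {f : X ⟶ Y} {v} (hv : IsValue hat f v) : (extend h).map f = v :=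
  (h f).choose_spec.unique hv

/-- The monoidal structure of the functor of values. -/
noncomputable def coreMonoidal : (extend h).CoreMonoidal where
  εIso := D.eps
  μIso := D.mu
  μIso_hom_natural_left f Z := by
    rw [extend_map h ((h f).choose_spec.whiskerRight Z)]
    simp
  μIso_hom_natural_right Z f := by
    rw [extend_map h ((h f).choose_spec.whiskerLeft Z)]
    simp
  associativity X Y Z := by
    rw [extend_map h (IsValue.assoc X Y Z)]
    simp
  left_unitality X := by
    rw [extend_map h (IsValue.leftUnit X)]
    simp
  right_unitality X := by
    rw [extend_map h (IsValue.rightUnit X)]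
    simp

noncomputable instance : (extend h).Monoidal := (coreMonoidal h).toMonoidal

noncomputable instance : (extend h).Braided where
  braided X Y := by
    have e := extend_map h (IsValue.braiding X Y)
    exact (congrArg ((D.mu X Y).hom ≫ ·) e).trans (Iso.hom_inv_id_assoc _ _)

end DualLetters

namespace DualLetters

open FramedPointGraph FramedCospan FCsp

variable {T : MonoidalSignature.{u, v}} {V : Type w₁} [Category.{w₂} V] [MonoidalCategory V]
  [SymmetricCategory V]

theorem exists_isValue {D : DualLetters T V} {hat : D.Hat}
    {m : ∀ f : T.M, D.app (word (T.dom f)) ⟶ D.app (word (T.cod f))}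
    (hm : ∀ f, IsValue hat ((generators T).map f) (m f)) {X Y : FCsp T} (f : X ⟶ Y) :
    ∃ v, IsValue hat f v := by
  obtain ⟨v, hv⟩ := exists_value (B := fun _ => True) (H := (· = hat))
    (fun f _ => ⟨m f, fun _ h => h ▸ hm f⟩) (gen_all f fun _ => trivial)
  exact ⟨v, hv hat rfl⟩

variable [LeftRigidCategory V] (x : SigValuation T V)

/-- The chosen duals of the values of the object symbols. -/
@[reducible] def ofValuation : DualLetters T V where
  obj
    | (Z, true) => x.obj Z
    | (Z, false) => ᘁ(x.obj Z)
  cap Z := η_ (ᘁ(x.obj Z)) (x.obj Z)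
  cup Z := ε_ (ᘁ(x.obj Z)) (x.obj Z)
  triangle_pos Z := ExactPairing.coevaluation_evaluation (ᘁ(x.obj Z)) (x.obj Z)
  triangle_neg Z := ExactPairing.evaluation_coevaluation (ᘁ(x.obj Z)) (x.obj Z)

/-- The values of words. -/
noncomputable def wordIso : ∀ l : List T.O, tensorList (l.map x.obj) ≅ (ofValuation x).app (word l)
  | [] => (ofValuation x).eps
  | Z :: l => ((ofValuation x).one (Z, true) ⊗ᵢ wordIso l) ≪≫ (ofValuation x).mu (point Z) (word l)

/-- The value of a morphism symbol. -/
noncomputable def symbol (f : T.M) :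
    (ofValuation x).app (word (T.dom f)) ⟶ (ofValuation x).app (word (T.cod f)) :=
  (wordIso x (T.dom f)).inv ≫ x.map f ≫ (wordIso x (T.cod f)).hom

theorem exists_extension : ∃ (F : FCsp T ⥤ V) (_ : F.Braided),
    Nonempty (SigValuation.Iso ((generators T).along F) x) := by
  obtain ⟨hat, hm⟩ := exists_hat (symbol x)
  refine ⟨extend (exists_isValue hm), inferInstance, ⟨⟨fun Z => ((ofValuation x).one (Z, true)).symm, fun f => ?_⟩⟩⟩
  have key : ∀ l, (tensorListComparison (extend (exists_isValue hm)) (generators T).obj l).hom =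
      tensorListMap (fun Z => ((ofValuation x).one (Z, true)).inv) l ≫ (wordIso x l).hom := by
    intro l
    induction l with
    | nil => exact (Category.id_comp _).symm
    | cons Z l ih =>
      change _ ◁ (tensorListComparison (extend (exists_isValue hm)) (generators T).obj l).hom ≫
        ((ofValuation x).mu (point Z) (word l)).hom = _
      rw [ih]
      change _ = (((ofValuation x).one (Z, true)).inv ⊗ₘ tensorListMap _ l) ≫
        (((ofValuation x).one (Z, true)).hom ⊗ₘ (wordIso x l).hom) ≫ ((ofValuation x).mu (point Z) (word l)).hom
      rw [tensorHom_comp_tensorHom_assoc, Iso.inv_hom_id, id_tensorHom]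
      rfl
  have abs : ∀ {A B A' B' P Q : V} (c : A ≅ P) (c' : B ≅ Q) (t : A ⟶ A') (t' : B ⟶ B') (w : A' ≅ P)
      (w' : B' ≅ Q) (k : A' ⟶ B') (g : P ⟶ Q), c.hom = t ≫ w.hom → c'.hom = t' ≫ w'.hom →
      g = w.inv ≫ k ≫ w'.hom → (c.hom ≫ g ≫ c'.inv) ≫ t' = t ≫ k := by
    intro A B A' B' P Q c c' t t' w w' k g hc hc' hg
    have : t' = c'.hom ≫ w'.inv := by simp [hc']
    simp [hc, hg, this]
  exact abs _ _ _ _ _ _ _ _ (key _) (key _) (extend_map (exists_isValue hm) (hm f))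

end DualLetters

/-! ## Strict categories -/

section Strict

variable {V : Type c} [Category.{d} V]

/-- The identities between equal objects. -/
def IsEqHom {A B : V} (f : A ⟶ B) : Prop := ∃ h : A = B, f = CategoryTheory.eqToHom h

namespace IsEqHom

variable {A B A' B' : V}

theorem id (A : V) : IsEqHom (𝟙 A) := ⟨rfl, rfl⟩

theorem eqToHom (h : A = B) : IsEqHom (eqToHom h) := ⟨h, rfl⟩

theorem comp {C : V} {f : A ⟶ B} {g : B ⟶ C} : IsEqHom f → IsEqHom g → IsEqHom (f ≫ g) := by
  rintro ⟨rfl, rfl⟩ ⟨rfl, rfl⟩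
  exact ⟨rfl, Category.comp_id _⟩

theorem inv {i : A ≅ B} : IsEqHom i.hom → IsEqHom i.inv := by
  rintro ⟨rfl, h⟩
  refine ⟨rfl, ?_⟩
  rw [← cancel_epi i.hom, Iso.hom_inv_id, h]
  exact (Category.comp_id _).symm

theorem of_mk {f : A ⟶ B} {C : V} (h : Arrow.mk f = Arrow.mk (𝟙 C)) : IsEqHom f := by
  obtain ⟨rfl, rfl, h⟩ := (Arrow.mk_eq_mk_iff _ _).1 h
  exact ⟨rfl, h.trans (by simp)⟩

theorem mk_eq {i : A' ⟶ A} {f : A ⟶ B} {j : B ⟶ B'} (hi : IsEqHom i) (hj : IsEqHom j) :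
    Arrow.mk (i ≫ f ≫ j) = Arrow.mk f := by
  obtain ⟨rfl, rfl⟩ := hi
  obtain ⟨rfl, rfl⟩ := hj
  simp

theorem mk_id {f : A ⟶ B} (h : IsEqHom f) : Arrow.mk f = Arrow.mk (𝟙 A) := by
  obtain ⟨rfl, rfl⟩ := h
  rfl

theorem eq {f : A ⟶ B} (h : IsEqHom f) : A = B := h.1

variable [MonoidalCategory V]

theorem tensor {f : A ⟶ B} {g : A' ⟶ B'} : IsEqHom f → IsEqHom g → IsEqHom (f ⊗ₘ g) := by
  rintro ⟨rfl, rfl⟩ ⟨rfl, rfl⟩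
  exact ⟨rfl, by simp⟩

variable (hV : IsStrictMonoidal V)
include hV

theorem labelApp {ι : Type*} (D : ι → V) : ∀ l m, IsEqHom (labelApp D l m).hom
  | [], m => of_mk (hV.leftUnitor _)
  | x :: l, m => (of_mk (hV.associator _ _ _)).comp (by
      have h := (id (D x)).tensor (labelApp D l m)
      rwa [id_tensorHom] at h)

end IsEqHom

end Strict

namespace DualLetters

open FramedPointGraph FramedCospan FCsp

variable {T : MonoidalSignature.{u, v}} {V : Type w₁} [Category.{w₂} V] [MonoidalCategory V]
  [SymmetricCategory V] (hV : IsStrictMonoidal V)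
include hV

theorem isEqHom_mu (D : DualLetters T V) (X Y : FCsp T) : IsEqHom (D.mu X Y).hom :=
  (IsEqHom.labelApp hV _ _ _).comp
    (.eqToHom (congrArg (labelTensor D.obj) (letters_tensor X Y).symm))

theorem isEqHom_one (D : DualLetters T V) (p : T.O × Bool) : IsEqHom (D.one p).hom :=
  IsEqHom.comp (IsEqHom.of_mk (hV.rightUnitor _)).inv
    (.eqToHom (congrArg (labelTensor D.obj) (letters_single p).symm))

omit hV in
theorem isEqHom_eps (D : DualLetters T V) : IsEqHom D.eps.hom :=
  .eqToHom (congrArg (labelTensor D.obj) letters_unit.symm)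

theorem isEqHom_wordIso [LeftRigidCategory V] (x : SigValuation T V) : ∀ l, IsEqHom (wordIso x l).hom
  | [] => isEqHom_eps _
  | Z :: l => ((isEqHom_one hV _ (Z, true)).tensor (isEqHom_wordIso x l)).comp (isEqHom_mu hV _ _ _)

theorem exists_strict [LeftRigidCategory V] (x : SigValuation T V) : ∃ F : FCsp T ⥤ V,
    IsStrictFunctor F ∧ (∀ Z, F.obj ((generators T).obj Z) = x.obj Z) ∧
      (∀ f, Arrow.mk (F.map ((generators T).map f)) = Arrow.mk (x.map f)) ∧
      ∀ Z, F.obj (FCsp.dual ((generators T).obj Z)) = (ᘁ(x.obj Z) : V) ∧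
        Arrow.mk (F.map (FCsp.cup ((generators T).obj Z))) = Arrow.mk (ε_ (ᘁ(x.obj Z)) (x.obj Z)) ∧
        Arrow.mk (F.map (FCsp.cap ((generators T).obj Z))) = Arrow.mk (η_ (ᘁ(x.obj Z)) (x.obj Z)) := by
  obtain ⟨hat, hm⟩ := exists_hat (symbol x)
  have mu (X Y : FCsp T) := isEqHom_mu hV (ofValuation x) X Y
  have one (p : T.O × Bool) := isEqHom_one hV (ofValuation x) p
  have eps := isEqHom_eps (ofValuation x)
  have ap {X Y : FCsp T} {f : X ⟶ Y} {v} (hv : IsValue hat f v) {A B : V} {g : A ⟶ B}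
      (h : Arrow.mk v = Arrow.mk g) : Arrow.mk ((extend (exists_isValue hm)).map f) = Arrow.mk g :=
    (congrArg Arrow.mk (extend_map (exists_isValue hm) hv)).trans h
  refine ⟨extend (exists_isValue hm), ⟨eps.eq.symm, fun X Y => (mu X Y).eq.symm, fun f g => ?_, fun X Y => ?_,
    fun {X Y} φ h => ?_⟩, fun Z => (one (Z, true)).eq.symm, fun f => ?_,
    fun Z => ⟨(one (Z, false)).eq.symm, ?_, ?_⟩⟩
  · exact ap ((exists_isValue hm f).choose_spec.tensor (exists_isValue hm g).choose_spec)
      (IsEqHom.mk_eq (mu _ _).inv (mu _ _))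
  · exact ap (.braiding X Y) (IsEqHom.mk_eq (mu _ _).inv (mu _ _))
  · refine ap (.perm φ) (IsEqHom.mk_id ?_)
    rw [perm, obPerm_reframing _ h]
    exact .eqToHom _
  · exact ap (hm f) (IsEqHom.mk_eq (isEqHom_wordIso hV x _).inv (isEqHom_wordIso hV x _))
  · refine ap (.cup Z) ?_
    have k := IsEqHom.mk_eq (f := (ofValuation x).obCup Z) (((one (Z, true)).tensor (one (Z, false))).comp
      (mu (single (Z, true)) (single (Z, false)))) (.id _)
    have k' := IsEqHom.mk_eq (f := (ofValuation x).obCup Z) (.id _) eps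
    rw [Category.comp_id] at k
    rw [Category.id_comp] at k'
    exact k'.trans (k.symm.trans (congrArg Arrow.mk ((Category.assoc _ _ _).trans (one_cup Z))))
  · refine ap (.cap Z) ?_
    have k := IsEqHom.mk_eq (f := (ofValuation x).cap Z) eps.inv
      (((one (Z, false)).tensor (one (Z, true))).comp (mu (single (Z, false)) (single (Z, true))))
    rw [cap_one] at k
    exact k

end DualLetters

/-! ## Uniqueness of strict functors -/

namespace FCsp

open FramedPointGraph FramedCospan

variable {T : MonoidalSignature.{u, v}} {V : Type w₁} [Category.{w₂} V] [MonoidalCategory V]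
  [SymmetricCategory V]

theorem IsStrictFunctor.ext {F G : FCsp T ⥤ V} (hF : IsStrictFunctor F) (hG : IsStrictFunctor G)
    (hd : ∀ Z, F.obj (dual (point Z)) = G.obj (dual (point Z)))
    (h : ∀ f, Arrow.mk (F.map ((generators T).map f)) = Arrow.mk (G.map ((generators T).map f)))
    (hp : ∀ Z, F.obj (point Z) = G.obj (point Z))
    (hu : ∀ Z, Arrow.mk (F.map (cup (point Z))) = Arrow.mk (G.map (cup (point Z))))
    (hc : ∀ Z, Arrow.mk (F.map (cap (point Z))) = Arrow.mk (G.map (cap (point Z)))) : F = G := by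
  have ho : ∀ X : FCsp T, F.obj X = G.obj X := by
    refine fun X => reframing_induction (P := fun X => F.obj X = G.obj X) (hF.obj_unit.trans hG.obj_unit.symm) ?_ ?_ ?_ X
    · rintro ⟨Z, _ | _⟩
      · exact hd Z
      · exact hp Z
    · intro X Y hX hY
      exact (hF.obj_tensor X Y).trans ((congrArg₂ (· ⊗ ·) hX hY).trans (hG.obj_tensor X Y).symm)
    · intro X Y φ h e
      exact ((IsEqHom.of_mk (hF.map_reframing φ h)).eq.symm.trans e).trans
        (IsEqHom.of_mk (hG.map_reframing φ h)).eq
  refine CategoryTheory.Functor.ext ho fun X Y f => ?_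
  suffices e : Arrow.mk (F.map f) = Arrow.mk (G.map f) from ((Arrow.mk_eq_mk_iff _ _).1 e).choose_spec.choose_spec
  have k : ∀ {A B A' B' : V} {f : A ⟶ B} {f' : A' ⟶ B'}, Arrow.mk f = Arrow.mk f' → ∀ {P Q P' Q' : V}
      {g : P ⟶ Q} {g' : P' ⟶ Q'}, Arrow.mk g = Arrow.mk g' → Arrow.mk (f ⊗ₘ g) = Arrow.mk (f' ⊗ₘ g') := by
    intro A B A' B' f f' hf P Q P' Q' g g' hg
    cases hf
    cases hg
    rfl
  have kc : ∀ {A B C A' B' C' : V} {f : A ⟶ B} {f' : A' ⟶ B'} {g : B ⟶ C} {g' : B' ⟶ C'},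
      Arrow.mk f = Arrow.mk f' → Arrow.mk g = Arrow.mk g' → Arrow.mk (f ≫ g) = Arrow.mk (f' ≫ g') := by
    intro A B C A' B' C' f f' g g' hf hg
    cases hf
    cases hg
    rfl
  induction gen_all f (B := fun _ => True) fun _ => trivial with
  | reframe φ hφ =>
    exact (hF.map_reframing φ hφ).trans ((congrArg (fun A => Arrow.mk (𝟙 A)) (ho _)).trans
      (hG.map_reframing φ hφ).symm)
  | braid X Y => rw [hF.map_braiding, hG.map_braiding, ho, ho]
  | comp f g _ _ hf hg =>
    rw [F.map_comp, G.map_comp]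
    exact kc hf hg
  | tensor f g _ _ hf hg =>
    rw [hF.map_tensor, hG.map_tensor]
    exact k hf hg
  | cap Z => exact hc Z
  | cup Z => exact hu Z
  | box f hf => exact h f

theorem isStrictlyFree (T : MonoidalSignature.{u, v}) : IsStrictlyFree.{u, v, w₁, w₂} T := by
  intro V _ _ _ _ hV x
  obtain ⟨F, hF⟩ := DualLetters.exists_strict hV x
  refine ⟨F, hF, fun G hG => ?_⟩
  exact hG.1.ext hF.1 (fun Z => (hG.2.2.2 Z).1.trans (hF.2.2.2 Z).1.symm)
    (fun f => (hG.2.2.1 f).trans (hF.2.2.1 f).symm) (fun Z => (hG.2.1 Z).trans (hF.2.1 Z).symm)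
    (fun Z => (hG.2.2.2 Z).2.1.trans (hF.2.2.2 Z).2.1.symm)
    fun Z => (hG.2.2.2 Z).2.2.trans (hF.2.2.2 Z).2.2.symm

end FCsp

/-! ## Uniqueness of monoidal functors -/

section Pairings

variable {C : Type a} [Category.{b} C] [MonoidalCategory C] {V : Type c} [Category.{d} V]
  [MonoidalCategory V]

open Functor.LaxMonoidal Functor.OplaxMonoidal Functor.Monoidal

/-- Strong monoidal functors preserve exact pairings. -/
@[reducible] def mapExactPairing (F : C ⥤ V) [F.Monoidal] {X Y : C} (p : ExactPairing X Y) :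
    ExactPairing (F.obj X) (F.obj Y) where
  coevaluation' := ε F ≫ F.map p.coevaluation' ≫ δ F X Y
  evaluation' := μ F Y X ≫ F.map p.evaluation' ≫ η F
  coevaluation_evaluation' := by
    have h := congrArg (fun t => μ F Y (𝟙_ C) ≫ F.map t ≫ δ F (𝟙_ C) Y) p.coevaluation_evaluation'
    simp only [Functor.map_comp, map_whiskerLeft, map_whiskerRight, map_associator_inv, map_rightUnitor,
      map_leftUnitor_inv, Category.assoc, μ_δ_assoc, μ_δ, Category.comp_id] at h
    simp only [whiskerLeft_comp, comp_whiskerRight, Category.assoc]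
    rw [reassoc_of% h, whiskerLeft_ε_η_assoc, whiskerRight_ε_η, Category.comp_id]
  evaluation_coevaluation' := by
    have h := congrArg (fun t => μ F (𝟙_ C) X ≫ F.map t ≫ δ F X (𝟙_ C)) p.evaluation_coevaluation'
    simp only [Functor.map_comp, map_whiskerLeft, map_whiskerRight, map_associator, map_leftUnitor,
      map_rightUnitor_inv, Category.assoc, μ_δ_assoc, μ_δ, Category.comp_id] at h
    simp only [whiskerLeft_comp, comp_whiskerRight, Category.assoc]
    rw [reassoc_of% h, whiskerRight_ε_η_assoc, whiskerLeft_ε_η, Category.comp_id]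

theorem exists_mate {P P' Q Q' : V} (p : ExactPairing P' P) (q : ExactPairing Q' Q) (i : P ≅ Q) :
    ∃ j : P' ≅ Q', p.coevaluation' ≫ (j.hom ⊗ₘ i.hom) = q.coevaluation' ∧
      (i.hom ⊗ₘ j.hom) ≫ q.evaluation' = p.evaluation' := by
  let q' : ExactPairing Q' P := exactPairingCongrRight i
  refine ⟨leftDualIso p q', ?_, ?_⟩
  · have h : p.coevaluation' ≫ (leftDualIso p q').hom ▷ P = (q.coevaluation' ≫ Q' ◁ i.inv) ≫ Q' ◁ 𝟙 P :=
      @coevaluation_comp_leftAdjointMate V _ _ P P ⟨Q'⟩ ⟨P'⟩ (𝟙 P)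
    rw [MonoidalCategory.tensorHom_def, reassoc_of% h]
    simp
  · have h : P ◁ (leftDualIso p q').hom ≫ i.hom ▷ Q' ≫ q.evaluation' = 𝟙 P ▷ P' ≫ p.evaluation' :=
      @leftAdjointMate_comp_evaluation V _ _ P P ⟨Q'⟩ ⟨P'⟩ (𝟙 P)
    rw [tensorHom_def', Category.assoc, h]
    simp

end Pairings

namespace FCsp

open FramedPointGraph FramedCospan Functor.LaxMonoidal Functor.OplaxMonoidal Functor.Monoidal

variable {T : MonoidalSignature.{u, v}} {V : Type w₁} [Category.{w₂} V] [MonoidalCategory V]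
  [SymmetricCategory V] {F G : FCsp T ⥤ V} [F.Braided] [G.Braided] {X Y Z X' Y' : FCsp T}

variable (F G) in
/-- The comparison of units. -/
noncomputable def unitCompare : F.obj (𝟙_ (FCsp T)) ≅ G.obj (𝟙_ (FCsp T)) := (εIso F).symm ≪≫ εIso G

/-- The comparison of tensor products. -/
noncomputable def tensorCompare (s : F.obj X ≅ G.obj X) (t : F.obj Y ≅ G.obj Y) : F.obj (X ⊗ Y) ≅ G.obj (X ⊗ Y) :=
  (μIso F X Y).symm ≪≫ (s ⊗ᵢ t) ≪≫ μIso G X Y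

/-- Naturality with respect to a single morphism. -/
def Sq (f : X ⟶ Y) (s : F.obj X ≅ G.obj X) (t : F.obj Y ≅ G.obj Y) : Prop :=
  F.map f ≫ t.hom = s.hom ≫ G.map f

namespace Sq

variable {s : F.obj X ≅ G.obj X} {t t' : F.obj Y ≅ G.obj Y} {r : F.obj Z ≅ G.obj Z}
  {s' : F.obj X' ≅ G.obj X'} {r' : F.obj Y' ≅ G.obj Y'}

theorem comp {f : X ⟶ Y} {g : Y ⟶ Z} (h : Sq f s t) (h' : Sq g t r) : Sq (f ≫ g) s r := by
  unfold Sq at *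
  simp [h', reassoc_of% h]

theorem of_eq {f g : X ⟶ Y} (h : Sq f s t) (e : f = g) : Sq g s t := e ▸ h

theorem id : Sq (𝟙 X) s s := by
  unfold Sq
  simp

theorem conj (i : X ≅ Y) : Sq i.hom s ((F.mapIso i).symm ≪≫ s ≪≫ G.mapIso i) := by
  unfold Sq
  simp

theorem cancel (i : X ≅ Y) {g : Y ⟶ Z} (h : Sq (i.hom ≫ g) s r) (h' : Sq i.hom s t) : Sq g t r := by
  unfold Sq at *
  rw [← cancel_epi (F.map i.hom), reassoc_of% h', ← G.map_comp, ← h, F.map_comp, Category.assoc]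

theorem unique (i : X ≅ Y) (h : Sq i.hom s t) (h' : Sq i.hom s t') : t = t' :=
  Iso.ext ((cancel_epi (F.map i.hom)).1 (h.trans h'.symm))

theorem tensor {f : X ⟶ Y} {g : X' ⟶ Y'} (h : Sq f s t) (h' : Sq g s' r') :
    Sq (f ⊗ₘ g) (tensorCompare s s') (tensorCompare t r') := by
  unfold Sq at *
  simp only [tensorCompare, map_tensor, Iso.trans_hom, Iso.symm_hom, μIso_inv, μIso_hom, Category.assoc,
    μ_δ_assoc, tensorIso_hom, tensorHom_comp_tensorHom_assoc, h, h']

theorem assoc : Sq (α_ X Y Z).hom (tensorCompare (tensorCompare s t) r)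
    (tensorCompare s (tensorCompare t r)) := by
  unfold Sq
  simp only [tensorCompare, map_associator, Iso.trans_hom, Iso.symm_hom, μIso_inv, μIso_hom,
    Category.assoc, μ_δ_assoc, tensorIso_hom, MonoidalCategory.tensorHom_def, comp_whiskerRight, whiskerLeft_comp]
  rw [whisker_exchange_assoc, whiskerLeft_μ_δ_assoc, whisker_exchange_assoc, whiskerRight_μ_δ_assoc]
  refine congrArg (_ ≫ ·) (congrArg (_ ≫ ·) ?_)
  simp

theorem leftUnit : Sq (λ_ X).hom (tensorCompare (unitCompare F G) s) s := by
  unfold Sq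
  simp only [tensorCompare, unitCompare, map_leftUnitor, Iso.trans_hom, Iso.symm_hom, μIso_inv, μIso_hom,
    Category.assoc, μ_δ_assoc, tensorIso_hom, MonoidalCategory.tensorHom_def, comp_whiskerRight, εIso_hom, εIso_inv]
  rw [whisker_exchange_assoc, whiskerRight_ε_η_assoc, leftUnitor_naturality]

theorem rightUnit : Sq (ρ_ X).hom (tensorCompare s (unitCompare F G)) s := by
  unfold Sq
  simp only [tensorCompare, unitCompare, map_rightUnitor, Iso.trans_hom, Iso.symm_hom, μIso_inv, μIso_hom,
    Category.assoc, μ_δ_assoc, tensorIso_hom, tensorHom_def', whiskerLeft_comp, εIso_hom, εIso_inv]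
  rw [← whisker_exchange_assoc, whiskerLeft_ε_η_assoc, rightUnitor_naturality]

theorem braiding : Sq (β_ X Y).hom (tensorCompare s t) (tensorCompare t s) := by
  unfold Sq
  simp [tensorCompare, Functor.map_braiding]

end Sq

/-- The isomorphism of framed point graphs of a permutation. -/
@[simps] noncomputable def ofPermIso {X Y : FCsp T} (φ : Perm X Y) : X ≅ Y where
  hom := ofPerm φ
  inv := ofPerm (X := Y) (Y := X) φ.symm
  hom_inv_id := (ofPerm_comp _ _).trans (congrArg ofPerm (Perm.ext fun x => φ.equiv.symm_apply_apply x))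
  inv_hom_id := (ofPerm_comp _ _).trans (congrArg ofPerm (Perm.ext fun x => φ.equiv.apply_symm_apply x))

variable (β : ∀ p : T.O × Bool, F.obj (single p) ≅ G.obj (single p))

/-- The comparison of words. -/
noncomputable def wordCompare : ∀ l, F.obj (ofLetters l : FCsp T) ≅ G.obj (ofLetters l : FCsp T)
  | [] => unitCompare F G
  | p :: l => tensorCompare (β p) (wordCompare l)

/-- The comparison of framed point graphs. -/
noncomputable def compare (X : FCsp T) : F.obj X ≅ G.obj X :=
  (F.mapIso (ofPermIso (reframe (letters_ofLetters (letters X))))).symm ≪≫ wordCompare β (letters X) ≪≫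
    G.mapIso (ofPermIso (reframe (letters_ofLetters (letters X))))

theorem sq_wordCompare {l : List (T.O × Bool)} {r : Perm (ofLetters l) X} (h : r.IsReframing) :
    Sq (X := ofLetters l) (ofPerm r) (wordCompare β l) (compare β X) := by
  obtain rfl : letters X = l := (letters_reframing h).trans (letters_ofLetters l)
  obtain rfl := IsReframing.unique h (reframe_isReframing (letters_ofLetters (letters X)))
  exact Sq.conj (ofPermIso (reframe (letters_ofLetters (letters X))))

theorem compare_reframing {φ : Perm X Y} (h : φ.IsReframing) :
    Sq (ofPerm φ) (compare β X) (compare β Y) := by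
  have hr := reframe_isReframing (letters_ofLetters (letters X))
  have e := sq_wordCompare β (IsReframing.trans hr h)
  have k := ofPerm_comp (X := ofLetters (letters X)) (reframe (letters_ofLetters (letters X))) φ
  exact Sq.cancel (ofPermIso (X := ofLetters (letters X)) (Y := X) _) (e.of_eq k.symm)
    (sq_wordCompare β hr)

theorem compare_unit : compare β (𝟙_ (FCsp T)) = unitCompare F G := by
  have e := sq_wordCompare (X := 𝟙_ (FCsp T)) (l := []) β (IsReframing.refl unit)
  exact Sq.unique (Iso.refl (𝟙_ (FCsp T))) e Sq.id

theorem compare_single (p : T.O × Bool) : compare β (single p) = β p :=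
  let P : FCsp T := single p
  Sq.unique (ρ_ P) (sq_wordCompare (X := single p) (l := [p]) β (rightUnit_isReframing (single p)))
    (Sq.rightUnit (X := single p) (s := β p))

theorem sq_append : ∀ (l m : List (T.O × Bool)) (r : Perm ((ofLetters l).tensor (ofLetters m)) (ofLetters (l ++ m))),
    r.IsReframing → Sq (X := (ofLetters l : FCsp T) ⊗ ofLetters m) (ofPerm r)
      (tensorCompare (wordCompare β l) (wordCompare β m)) (wordCompare β (l ++ m))
  | [], m, r, h => by
    obtain rfl := IsReframing.unique h (leftUnit_isReframing (ofLetters m))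
    exact Sq.leftUnit
  | p :: l, m, r, h => by
    have hl : ((ofLetters l).tensor (ofLetters m) : FramedPointGraph T).letters =
        (ofLetters (l ++ m)).letters := by
      rw [letters_tensor, letters_ofLetters, letters_ofLetters, letters_ofLetters]
    obtain rfl := IsReframing.unique h (IsReframing.trans (assoc_isReframing (single p) (ofLetters l) (ofLetters m))
      (IsReframing.tensor (IsReframing.refl (single p)) (reframe_isReframing hl)))
    have h2 := Sq.tensor (X := single p) (Y := single p) (Sq.id (s := β p)) (sq_append l m _ (reframe_isReframing hl))
    refine ((Sq.assoc (X := single p) (Y := ofLetters l) (Z := ofLetters m)).comp h2).of_eq ?_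
    exact (congrArg (assocHom _ _ _ ≫ ·) ((congrArg (tensorHom · _) (id_eq _)).trans (ofPerm_tensor _ _))).trans
      (ofPerm_comp _ _)

theorem compare_tensor (X Y : FCsp T) : compare β (X ⊗ Y) = tensorCompare (compare β X) (compare β Y) := by
  have hX := reframe_isReframing (letters_ofLetters (letters X))
  have hY := reframe_isReframing (letters_ofLetters (letters Y))
  have hl : ((ofLetters (letters X)).tensor (ofLetters (letters Y))).letters =
      (ofLetters (letters X ++ letters Y)).letters := by
    rw [letters_tensor, letters_ofLetters, letters_ofLetters, letters_ofLetters]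
  have hr := reframe_isReframing hl
  have hs := IsReframing.tensor hX hY
  have ht := IsReframing.trans (IsReframing.symm hr) hs
  have h2 := (sq_append β _ _ _ hr).comp (sq_wordCompare (X := X ⊗ Y) β ht)
  exact Sq.unique (ofPermIso (X := (ofLetters (letters X) : FCsp T) ⊗ ofLetters (letters Y)) (Y := X ⊗ Y) _)
    (h2.of_eq ((ofPerm_comp _ _).trans (congrArg ofPerm (IsReframing.unique (IsReframing.trans hr ht) hs))))
    ((Sq.tensor (sq_wordCompare β hX) (sq_wordCompare β hY)).of_eq (ofPerm_tensor _ _))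

theorem compare_word (x : SigValuation T V) (φ : SigValuation.Iso ((generators T).along F) x)
    (ψ : SigValuation.Iso ((generators T).along G) x)
    (hβ : ∀ Z, (β (Z, true)).hom ≫ (ψ.app Z).hom = (φ.app Z).hom) : ∀ l : List T.O,
    (tensorListComparison F (generators T).obj l).hom ≫ (compare β (word l)).hom ≫
      (tensorListComparison G (generators T).obj l).inv ≫ tensorListMap (fun Z => (ψ.app Z).hom) l =
    tensorListMap (fun Z => (φ.app Z).hom) l
  | [] => by
    change ε F ≫ (compare β (𝟙_ (FCsp T))).hom ≫ η G ≫ 𝟙 _ = 𝟙 _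
    rw [compare_unit]
    simp [unitCompare]
  | Z :: l => by
    have ih := compare_word x φ ψ hβ l
    have abs : ∀ {A B P Q W W' M R PW QW : V} (m : P ⊗ W ≅ PW) (n : Q ⊗ W' ≅ QW) (f : A ⟶ W) (g : W' ⟶ B)
        (b : P ⟶ Q) (w : W ⟶ W') (p : Q ⟶ M) (r : B ⟶ R), (P ◁ f ≫ m.hom) ≫
          (m.inv ≫ (b ⊗ₘ w) ≫ n.hom) ≫ (n.inv ≫ Q ◁ g) ≫ (p ⊗ₘ r) = (b ≫ p) ⊗ₘ (f ≫ w ≫ g ≫ r) := by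
      intros
      simp [tensorHom_def', ← whisker_exchange_assoc]
    have k := congrArg Iso.hom (compare_tensor β (point Z) (word l))
    rw [show compare β (point Z) = β (Z, true) from compare_single β (Z, true)] at k
    refine (congrArg (fun t => _ ≫ t ≫ _) k).trans ((abs (μIso F (point Z) (word l)) (μIso G (point Z) (word l))
      _ _ _ _ _ _).trans (congrArg₂ (· ⊗ₘ ·) (hβ Z) ih))

theorem sq_box (x : SigValuation T V) (φ : SigValuation.Iso ((generators T).along F) x)
    (ψ : SigValuation.Iso ((generators T).along G) x)
    (hβ : ∀ Z, (β (Z, true)).hom ≫ (ψ.app Z).hom = (φ.app Z).hom) (f : T.M) :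
    Sq ((generators T).map f) (compare β _) (compare β _) := by
  have hφ := φ.comm f
  have hψ := ψ.comm f
  have hd := compare_word β x φ ψ hβ (T.dom f)
  have hc := compare_word β x φ ψ hβ (T.cod f)
  have hi : IsIso (tensorListMap (fun Z => (ψ.app Z).hom) (T.cod f)) := by
    have key : ∀ l, IsIso (tensorListMap (fun Z => (ψ.app Z).hom) l) := fun l => by
      induction l with
      | nil => exact inferInstanceAs (IsIso (𝟙 (𝟙_ V)))
      | cons Z l ih => exact inferInstanceAs (IsIso ((ψ.app Z).hom ⊗ₘ tensorListMap _ l))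
    exact key _
  have abs : ∀ {A B A' B' P Q P' Q' D C : V} (cF : A ≅ P) (dF : B ≅ Q) (cG : A' ≅ P') (dG : B' ≅ Q')
      (g : P ⟶ Q) (g' : P' ⟶ Q') (s : P ⟶ P') (t : Q ⟶ Q') (mA : A ⟶ D) (mB : B ⟶ C) (nA : A' ⟶ D)
      (nB : B' ⟶ C) [IsIso nB] (k : D ⟶ C), (cF.hom ≫ g ≫ dF.inv) ≫ mB = mA ≫ k →
      (cG.hom ≫ g' ≫ dG.inv) ≫ nB = nA ≫ k → cF.hom ≫ s ≫ cG.inv ≫ nA = mA →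
      dF.hom ≫ t ≫ dG.inv ≫ nB = mB → g ≫ t = s ≫ g' := by
    intro A B A' B' P Q P' Q' D C cF dF cG dG g g' s t mA mB nA nB _ k h1 h2 h3 h4
    subst h3 h4
    simp only [Category.assoc, Iso.inv_hom_id_assoc] at h1 h2
    rw [← h2] at h1
    simp only [← Category.assoc, cancel_mono] at h1
    simpa only [Category.assoc, Iso.inv_hom_id_assoc, cancel_epi] using h1
  exact abs _ _ _ _ _ _ _ _ _ _ _ _ _ hφ hψ hd hc

theorem sq_all
    (hc : ∀ Z, Sq (cap (point Z)) (unitCompare F G) (tensorCompare (X := dual (point Z)) (Y := point Z)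
      (β (Z, false)) (β (Z, true))))
    (hu : ∀ Z, Sq (cup (point Z)) (tensorCompare (X := point Z) (Y := dual (point Z))
      (β (Z, true)) (β (Z, false))) (unitCompare F G))
    (hb : ∀ f : T.M, Sq ((generators T).map f) (compare β _) (compare β _)) (f : X ⟶ Y) :
    Sq f (compare β X) (compare β Y) := by
  induction gen_all f (B := fun _ => True) fun _ => trivial with
  | reframe φ hφ => exact compare_reframing β hφ
  | braid X Y =>
    rw [compare_tensor, compare_tensor]
    exact Sq.braiding
  | comp f g _ _ hf hg => exact hf.comp hg
  | tensor f g _ _ hf hg =>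
    rw [compare_tensor, compare_tensor]
    exact hf.tensor hg
  | cap Z =>
    have h := hc Z
    rw [← compare_unit β, ← compare_single β, ← compare_single β] at h
    exact (compare_tensor β (dual (point Z)) (point Z)).symm ▸ h
  | cup Z =>
    have h := hu Z
    rw [← compare_unit β, ← compare_single β, ← compare_single β] at h
    exact (compare_tensor β (point Z) (dual (point Z))).symm ▸ h
  | box f _ => exact hb f

end FCsp

namespace FCsp

open FramedPointGraph FramedCospan Functor.LaxMonoidal Functor.OplaxMonoidal Functor.Monoidal

variable {T : MonoidalSignature.{u, v}} {V : Type w₁} [Category.{w₂} V] [MonoidalCategory V]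
  [SymmetricCategory V] {F G : FCsp T ⥤ V} [F.Braided] [G.Braided] {X Y Z X' Y' : FCsp T}

theorem isMonoidal_ext {x : SigValuation T V} {φ : SigValuation.Iso ((generators T).along F) x}
    {ψ : SigValuation.Iso ((generators T).along G) x} {θ θ' : F ≅ G} (h : NatTrans.IsMonoidal θ.hom)
    (h' : NatTrans.IsMonoidal θ'.hom)
    (e : ∀ Z, θ.hom.app ((generators T).obj Z) ≫ (ψ.app Z).hom = (φ.app Z).hom)
    (e' : ∀ Z, θ'.hom.app ((generators T).obj Z) ≫ (ψ.app Z).hom = (φ.app Z).hom) : θ = θ' := by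
  have hp (Z : T.O) : θ.hom.app (point Z) = θ'.hom.app (point Z) :=
    (cancel_mono (ψ.app Z).hom).1 ((e Z).trans (e' Z).symm)
  have ht : ∀ {X Y : FCsp T} (f : 𝟙_ (FCsp T) ⟶ X ⊗ Y) (θ : F ≅ G), NatTrans.IsMonoidal θ.hom →
      (ε F ≫ F.map f ≫ δ F X Y) ≫ (θ.hom.app X ⊗ₘ θ.hom.app Y) = ε G ≫ G.map f ≫ δ G X Y := by
    intro X Y f θ h
    have ht : (θ.hom.app X ⊗ₘ θ.hom.app Y) = μ F X Y ≫ θ.hom.app (X ⊗ Y) ≫ δ G X Y :=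
      ((Iso.eq_comp_inv (μIso G _ _)).2 (h.tensor X Y).symm).trans (Category.assoc _ _ _)
    rw [ht, ← h.unit]
    simp only [Category.assoc, δ_μ_assoc, θ.hom.naturality_assoc]
  have key : ∀ {X Y : FCsp T} (f : 𝟙_ (FCsp T) ⟶ X ⊗ Y), θ.hom.app Y = θ'.hom.app Y →
      (ε F ≫ F.map f ≫ δ F X Y) ≫ θ.hom.app X ▷ F.obj Y = (ε F ≫ F.map f ≫ δ F X Y) ≫ θ'.hom.app X ▷ F.obj Y := by
    intro X Y f hf
    have e := (ht f θ h).trans (ht f θ' h').symm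
    rw [hf, MonoidalCategory.tensorHom_def, MonoidalCategory.tensorHom_def] at e
    simpa only [← Category.assoc, cancel_mono] using e
  refine Iso.ext (NatTrans.ext (funext fun X => ?_))
  refine reframing_induction (P := fun X => θ.hom.app X = θ'.hom.app X) ?_ ?_ ?_ ?_ X
  · exact (cancel_epi (ε F)).1 (h.unit.trans h'.unit.symm)
  · rintro ⟨Z, _ | _⟩
    · exact eq_of_coevaluation (mapExactPairing F (exactPairing (point Z)))
        (key (X := dual (point Z)) (Y := point Z) (cap (point Z)) (hp Z))
    · exact hp Z
  · rintro (X : FCsp T) (Y : FCsp T) hX hY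
    refine (cancel_epi (μ F X Y)).1 ((h.tensor X Y).trans (Eq.trans ?_ (h'.tensor X Y).symm))
    rw [hX, hY]
  · rintro (X : FCsp T) (Y : FCsp T) r _ hX
    refine (cancel_epi (F.map (ofPermIso r).hom)).1 ?_
    rw [θ.hom.naturality, θ'.hom.naturality, hX]

theorem Sq.of_coevaluation {f : 𝟙_ (FCsp T) ⟶ X ⊗ Y} {s : F.obj X ≅ G.obj X} {t : F.obj Y ≅ G.obj Y}
    (h : (ε F ≫ F.map f ≫ δ F X Y) ≫ (s.hom ⊗ₘ t.hom) = ε G ≫ G.map f ≫ δ G X Y) :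
    Sq f (unitCompare F G) (tensorCompare s t) := by
  have h := congrArg (fun t => η F ≫ t ≫ μ G X Y) h
  simp only [Category.assoc, η_ε_assoc, δ_μ, Category.comp_id] at h
  unfold Sq
  simpa only [unitCompare, tensorCompare, Iso.trans_hom, Iso.symm_hom, εIso_hom, εIso_inv, μIso_hom, μIso_inv,
    tensorIso_hom, Category.assoc] using h

theorem Sq.of_evaluation {f : X ⊗ Y ⟶ 𝟙_ (FCsp T)} {s : F.obj X ≅ G.obj X} {t : F.obj Y ≅ G.obj Y}
    (h : (s.hom ⊗ₘ t.hom) ≫ μ G X Y ≫ G.map f ≫ η G = μ F X Y ≫ F.map f ≫ η F) :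
    Sq f (tensorCompare s t) (unitCompare F G) := by
  have h := congrArg (fun t => δ F X Y ≫ t ≫ ε G) h
  simp only [Category.assoc, η_ε, δ_μ_assoc, Category.comp_id] at h
  unfold Sq
  simpa only [unitCompare, tensorCompare, Iso.trans_hom, Iso.symm_hom, εIso_hom, εIso_inv, μIso_hom, μIso_inv,
    tensorIso_hom, Category.assoc] using h.symm

theorem isFreeCompactClosed (T : MonoidalSignature.{u, v}) :
    SigValuation.IsFreeCompactClosed.{u, v, w₁, w₂} (generators T) := by
  intro V _ _ _ _ x
  refine ⟨DualLetters.exists_extension x, fun F G _ _ φ ψ => ?_⟩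
  let pF (Z : T.O) := mapExactPairing F (exactPairing (point Z))
  let pG (Z : T.O) := mapExactPairing G (exactPairing (point Z))
  choose j hj hj' using fun Z => exists_mate (pF Z) (pG Z) (φ.app Z ≪≫ (ψ.app Z).symm)
  let β : ∀ p : T.O × Bool, F.obj (single p) ≅ G.obj (single p)
    | (Z, true) => φ.app Z ≪≫ (ψ.app Z).symm
    | (Z, false) => j Z
  have hβ (Z : T.O) : (β (Z, true)).hom ≫ (ψ.app Z).hom = (φ.app Z).hom := by
    change ((φ.app Z).hom ≫ (ψ.app Z).inv) ≫ _ = _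
    simp
  have hs {X Y : FCsp T} (f : X ⟶ Y) : Sq f (compare β X) (compare β Y) := by
    refine sq_all β (fun Z => ?_) (fun Z => ?_) (sq_box β x φ ψ hβ) f
    · exact Sq.of_coevaluation (X := dual (point Z)) (Y := point Z) (hj Z)
    · exact Sq.of_evaluation (X := point Z) (Y := dual (point Z)) (hj' Z)
  let Θ : F ≅ G := NatIso.ofComponents (compare β) hs
  have hm : NatTrans.IsMonoidal Θ.hom := by
    refine ⟨?_, fun X Y => ?_⟩
    · change ε F ≫ (compare β _).hom = _
      rw [compare_unit]
      simp [unitCompare]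
    · change μ F X Y ≫ (compare β (X ⊗ Y)).hom = ((compare β X).hom ⊗ₘ (compare β Y).hom) ≫ _
      rw [compare_tensor]
      simp [tensorCompare]
  have hg (Z : T.O) : Θ.hom.app ((generators T).obj Z) ≫ (ψ.app Z).hom = (φ.app Z).hom :=
    (congrArg (fun t => Iso.hom t ≫ _) (compare_single β (Z, true))).trans (hβ Z)
  exact ⟨Θ, ⟨hm, hg⟩, fun θ hθ => isMonoidal_ext hθ.1 hm hθ.2 hg⟩

end FCsp

theorem mainTheorem2 (T : MonoidalSignature.{u, v}) :
    ∃ _ : FCsp.SymmetricMonoidalLaws T,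
      (∀ X : FCsp T, ∃ p : ExactPairing (FCsp.dual X) X,
        p.evaluation' = FCsp.cup X ∧ p.coevaluation' = FCsp.cap X) ∧
      SigValuation.IsFreeCompactClosed.{u, v, w₁, w₂} (FCsp.generators T) ∧
      FCsp.IsStrictlyFree.{u, v, w₁, w₂} T :=
  ⟨inferInstance, fun X => ⟨FCsp.exactPairing X, rfl, rfl⟩, FCsp.isFreeCompactClosed T,
    FCsp.isStrictlyFree T⟩
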